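/- Machine model. All algorithms are programs of a randomized real RAM with $w$-bit words: registers and arrays of words (integers modulo $2^w$, with the usual arithmetic and bitwise operations, used for addressing) and registers and arrays of real numbers (exact $+,-,\times,\div,\sqrt{\cdot}$ and comparisons, no rounding), integer program constants, an instruction that draws a uniform random element of $\{0,\dots,n-1\}$, and control flow by sequencing, branching and loops; every instruction and every test costs one step. $k$-center. For finite $P,C\subset\mathbb R^d$ let $\mathbf u_C(P)=\max_{p\in P}\min_{c\in C}\|p-c\|_2$ and let $\mathrm{OPT}_k(P)=\min\{\mathbf u_C(P): C\subseteq P,\ |C|\le k\}$. Let $\gamma\ge 1$ and let $T:\mathbb N\to\mathbb N$ be nondecreasing. A $\gamma$-approximation algorithm with running time $T$ for $k$-center in $\mathbb R^d$ is a program that, given a list of $n$ distinct points forming a set $P\subset\mathbb R^d$ and an integer $1\le k\le n$, on words of at least a constant times $\log(n+2)$ bits, always halts within $T(n)$ steps and outputs $C\subseteq P$ with $|C|\le k$ and $\mathbf u_C(P)\le\gamma\,\mathrm{OPT}_k(P)$. Join queries. A join query $q=R_1\Join\dots\Join R_m$ over attributes $A_1,\dots,A_d$ assigns to each relation $R_j$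 a set $\mathbf A_j$ of attributes, every attribute occurring in some $\mathbf A_j$. It is acyclic if there is a tree on the relations such that for every attribute the relations containing it induce a connected subgraph. A database instance $D$ of size $N$ gives each $R_j$ a set of $N$ real tuples over $\mathbf A_j$, and $q(D)=\{t\in\mathbb R^d: \pi_{\mathbf A_j}(t)\in R_j\text{ for all }j\}$. Theorem. Let $q$ be an acyclic join query over $d$ attributes and let $\varepsilon\in(0,1)$. There is a constant $C$, depending only on $q$ and $\varepsilon$, such that for every $\gamma\ge1$, every nondecreasing $T$ and every $\gamma$-approximation algorithm $B$ with running time $T$ for $k$-center in $\mathbb R^d$ there are a program $A$ and a constant $c$ with the following properties. For every database instance $D$ of size $N\ge1$, every integer $k\ge1$ and every word length $w\ge c\log_2(N+k+2)$, the program $A$, given the relations of $D$ and $k$, always halts and always outputs a set $\mathcal S\subseteq q(D)$ of exactly $\min(k,|q(D)|)$ points with $$\mathbf u_{\mathcal S}(q(D))\le(1+\varepsilon)\,\gamma\,\mathrm{OPT}_k(q(D)),$$ and with probability at least $1-\frac1N$ it halts within $$C\left(kN\log^2N+k\log^4N+T(Ck)\right)$$ steps. In particular, if $T(2n)=O(T(n))$,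 then $A$ runs in $O(kN\log^2N+k\log^4N+T(k))$ time with probability at least $1-\frac1N$. -/

import Mathlib

open scoped ENNReal

noncomputable section

/-! ### The machine model: a randomized real RAM with `w`-bit words -/

namespace RealRAM

/-- Unit-cost operations on `w`-bit words. -/
inductive WordOp
  | add | sub | mul | div | mod | land | lor | lxor | shl | shr

/-- Words are natural numbers below `2 ^ w`; arithmetic is modulo `2 ^ w`
(division by zero returns zero). -/
def WordOp.eval (w : ℕ) : WordOp → ℕ → ℕ → ℕ
  | add, x, y => (x + y) % 2 ^ w
  | sub, x, y => (x + (2 ^ w - y % 2 ^ w)) % 2 ^ w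
  | mul, x, y => (x * y) % 2 ^ w
  | div, x, y => (x / y) % 2 ^ w
  | mod, x, y => (x % y) % 2 ^ w
  | land, x, y => (x &&& y) % 2 ^ w
  | lor, x, y => (x ||| y) % 2 ^ w
  | lxor, x, y => (x ^^^ y) % 2 ^ w
  | shl, x, y => (x * 2 ^ y) % 2 ^ w
  | shr, x, y => (x / 2 ^ y) % 2 ^ w

/-- Unit-cost exact operations on real numbers. There is no rounding operation and no
conversion from reals to words. -/
inductive RealOp
  | add | sub | mul | div

def RealOp.eval : RealOp → ℝ → ℝ → ℝ
  | add, x, y => x + y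
  | sub, x, y => x - y
  | mul, x, y => x * y
  | div, x, y => x / y

/-- Elementary instructions. Word registers, real registers, word arrays and real arrays are
named by natural numbers; array cells are addressed by the contents of word registers. -/
inductive Instr
  /-- word register `dst` := the constant `c` -/
  | wconst (dst c : ℕ)
  /-- word register `dst` := `op` of the word registers `a`, `b` -/
  | wop (op : WordOp) (dst a b : ℕ)
  /-- word register `dst` := cell of word array `arr` at the address in word register `idx` -/
  | wload (dst arr idx : ℕ)
  /-- cell of word array `arr` at the address in word register `idx` := word register `src` -/
  | wstore (arr idx src : ℕ)
  /-- real register `dst` := the value of word register `src` -/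
  | rofword (dst src : ℕ)
  /-- real register `dst` := `op` of the real registers `a`, `b` -/
  | rop (op : RealOp) (dst a b : ℕ)
  /-- real register `dst` := square root of real register `src` -/
  | rsqrt (dst src : ℕ)
  /-- real register `dst` := cell of real array `arr` at the address in word register `idx` -/
  | rload (dst arr idx : ℕ)
  /-- cell of real array `arr` at the address in word register `idx` := real register `src` -/
  | rstore (arr idx src : ℕ)
  /-- word register `dst` := a fresh uniformly random element of `{0, …, n - 1}`, where `n` is
  the content of word register `src` (and `0` if `n = 0`) -/
  | rand (dst src : ℕ)

/-- Tests. -/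
inductive Cond
  | weq (a b : ℕ)
  | wlt (a b : ℕ)
  | rlt (a b : ℕ)
  | not (c : Cond)

/-- Programs. -/
inductive Prog
  | skip
  | instr (i : Instr)
  | seq (p q : Prog)
  | ite (c : Cond) (p q : Prog)
  | loop (c : Cond) (p : Prog)

/-- Memory contents. -/
structure State where
  wreg : ℕ → ℕ
  rreg : ℕ → ℝ
  warr : ℕ → ℕ → ℕ
  rarr : ℕ → ℕ → ℝ

def State.setW (s : State) (dst v : ℕ) : State :=
  { s with wreg := Function.update s.wreg dst v }

def State.setR (s : State) (dst : ℕ) (v : ℝ) : State :=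
  { s with rreg := Function.update s.rreg dst v }

def Cond.Holds (s : State) : Cond → Prop
  | weq a b => s.wreg a = s.wreg b
  | wlt a b => s.wreg a < s.wreg b
  | rlt a b => s.rreg a < s.rreg b
  | not c => ¬ c.Holds s

/-- The (random) effect of one elementary instruction. -/
def Instr.exec (w : ℕ) (s : State) : Instr → PMF State
  | wconst dst c => PMF.pure (s.setW dst (c % 2 ^ w))
  | wop op dst a b => PMF.pure (s.setW dst (op.eval w (s.wreg a) (s.wreg b)))
  | wload dst arr idx => PMF.pure (s.setW dst (s.warr arr (s.wreg idx)))
  | wstore arr idx src => PMF.pure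
      { s with warr := Function.update s.warr arr
                (Function.update (s.warr arr) (s.wreg idx) (s.wreg src)) }
  | rofword dst src => PMF.pure (s.setR dst (s.wreg src : ℝ))
  | rop op dst a b => PMF.pure (s.setR dst (op.eval (s.rreg a) (s.rreg b)))
  | rsqrt dst src => PMF.pure (s.setR dst (Real.sqrt (s.rreg src)))
  | rload dst arr idx => PMF.pure (s.setR dst (s.rarr arr (s.wreg idx)))
  | rstore arr idx src => PMF.pure
      { s with rarr := Function.update s.rarr arr
                (Function.update (s.rarr arr) (s.wreg idx) (s.rreg src)) }
  | rand dst src =>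
      (PMF.uniformOfFinset (Finset.range (max (s.wreg src) 1))
        (Finset.nonempty_range_iff.mpr (by omega))).map (fun v => s.setW dst v)

/-- A configuration: the stack of programs that remain to be executed, and the memory.
The machine has halted when the stack is empty. -/
abbrev Config := List Prog × State

open Classical in
/-- One step of the machine; each step has unit cost. -/
def step (w : ℕ) : Config → PMF Config
  | ([], s) => PMF.pure ([], s)
  | (Prog.skip :: K, s) => PMF.pure (K, s)
  | (Prog.instr i :: K, s) => (i.exec w s).map (fun s' => (K, s'))
  | (Prog.seq p q :: K, s) => PMF.pure (p :: q :: K, s)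
  | (Prog.ite c p q :: K, s) => PMF.pure (if c.Holds s then (p :: K, s) else (q :: K, s))
  | (Prog.loop c p :: K, s) =>
      PMF.pure (if c.Holds s then (p :: Prog.loop c p :: K, s) else (K, s))

/-- The distribution of the configuration after `t` steps of program `p` started in memory `s`,
on a machine with `w`-bit words. -/
def run (w : ℕ) (p : Prog) (s : State) : ℕ → PMF Config
  | 0 => PMF.pure ([p], s)
  | t + 1 => (run w p s t).bind (step w)

/-- The probability that the machine halts within `t` steps. -/
def haltProb (w : ℕ) (p : Prog) (s : State) (t : ℕ) : ℝ≥0∞ :=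
  (run w p s t).toOuterMeasure {c | c.1 = []}

/-- The machine halts within `t` steps, whatever the random choices. -/
def HaltsWithin (w : ℕ) (p : Prog) (s : State) (t : ℕ) : Prop :=
  ∀ c ∈ (run w p s t).support, c.1 = []

/-- Whatever the random choices, if the machine halts then the final memory satisfies `Q`. -/
def Yields (w : ℕ) (p : Prog) (s : State) (Q : State → Prop) : Prop :=
  ∀ t, ∀ c ∈ (run w p s t).support, c.1 = [] → Q c.2

/-- The output convention: word register `0` holds the number of points, and the points are the
first rows of real array `0`, written row by row and without repetition. -/
def Outputs {d : ℕ} (s : State) (S : Finset (EuclideanSpace ℝ (Fin d))) : Prop :=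
  S.card = s.wreg 0 ∧
  ∀ x, x ∈ S ↔ ∃ i < s.wreg 0, ∀ a : Fin d, x a = s.rarr 0 (i * d + a)

end RealRAM

/-! ### `k`-center clustering -/

/-- The cost `max_{p ∈ P} min_{c ∈ C} ‖p - c‖₂`. -/
def centerCost {d : ℕ} (C P : Set (EuclideanSpace ℝ (Fin d))) : ℝ≥0∞ :=
  ⨆ p ∈ P, ⨅ c ∈ C, edist p c

/-- The optimum cost with at most `k` centers chosen among the points of `P`. -/
def optCenterCost {d : ℕ} (k : ℕ) (P : Set (EuclideanSpace ℝ (Fin d))) : ℝ≥0∞ :=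
  ⨅ (C : Finset (EuclideanSpace ℝ (Fin d))) (_ : (C : Set _) ⊆ P) (_ : C.card ≤ k),
    centerCost (C : Set _) P

/-- The memory that holds the points `P 0, …, P (n-1)` of a flat table, row by row, in real
array `1`, and the numbers `n` and `k` in word registers `0` and `1`. -/
def pointInput {d n : ℕ} (P : Fin n → EuclideanSpace ℝ (Fin d)) (k : ℕ) : RealRAM.State where
  wreg := fun r => if r = 0 then n else if r = 1 then k else 0
  rreg := fun _ => 0
  warr := fun _ _ => 0
  rarr := fun b x =>
    if b = 1 then
      if h : x < n * d then P (Fin.divNat ⟨x, h⟩) (Fin.modNat ⟨x, h⟩) else 0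
    else 0

/-- `B` is a `γ`-approximation algorithm for `k`-center clustering in `ℝ^d`, in the standard
computational setting, with running time at most `T n` on every set of `n` points; it needs
words of `O(log n)` bits. -/
def IsKCenterAlg (d : ℕ) (γ : ℝ) (T : ℕ → ℕ) (B : RealRAM.Prog) : Prop :=
  ∃ c : ℕ, ∀ (n k w : ℕ) (P : Fin n → EuclideanSpace ℝ (Fin d)),
    Function.Injective P → 1 ≤ k → k ≤ n → (n + 2) ^ c ≤ 2 ^ w →
      RealRAM.HaltsWithin w B (pointInput P k) (T n) ∧
      RealRAM.Yields w B (pointInput P k) fun s =>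
        ∃ C : Finset (EuclideanSpace ℝ (Fin d)), RealRAM.Outputs s C ∧
          (C : Set _) ⊆ Set.range P ∧ C.card ≤ k ∧
          centerCost (C : Set _) (Set.range P) ≤
            ENNReal.ofReal γ * optCenterCost k (Set.range P)

/-! ### Join queries -/

/-- A join query `R_1 ⋈ … ⋈ R_m` over `d` attributes: relation `j` has the attributes `attrs j`,
and every attribute occurs in some relation. -/
structure JoinQuery (d m : ℕ) where
  attrs : Fin m → Finset (Fin d)
  cover : ∀ a, ∃ j, a ∈ attrs j

/-- There is a join tree: a tree on the relations in which, for every attribute, the relations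
that contain it are connected. -/
def JoinQuery.Acyclic {d m : ℕ} (q : JoinQuery d m) : Prop :=
  ∃ G : SimpleGraph (Fin m), G.IsTree ∧ ∀ a, (G.induce {j | a ∈ q.attrs j}).Connected

/-- A database instance with `N` (distinct, real) tuples in each relation, listed in an arbitrary
order. -/
structure Database {d m : ℕ} (q : JoinQuery d m) (N : ℕ) where
  tup : (j : Fin m) → Fin N → (q.attrs j → ℝ)
  inj : ∀ j, Function.Injective (tup j)

namespace Database

variable {d m N : ℕ} {q : JoinQuery d m}

/-- The set of join results. -/
def results (D : Database q N) : Set (EuclideanSpace ℝ (Fin d)) :=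
  {t | ∀ j, (fun a : q.attrs j => t a) ∈ Set.range (D.tup j)}

/-- The memory that holds relation `j` (for `j = 0, …, m-1`), row by row, in real array `j + 1`,
with rows of length `d` padded by zeros at the attributes that are not in the relation, and the
numbers `N` and `k` in word registers `0` and `1`. -/
def input (D : Database q N) (k : ℕ) : RealRAM.State where
  wreg := fun r => if r = 0 then N else if r = 1 then k else 0
  rreg := fun _ => 0
  warr := fun _ _ => 0
  rarr := fun b x =>
    if hb : 1 ≤ b ∧ b - 1 < m then
      if hx : x < N * d then
        if ha : Fin.modNat ⟨x, hx⟩ ∈ q.attrs ⟨b - 1, hb.2⟩ then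
          D.tup ⟨b - 1, hb.2⟩ (Fin.divNat ⟨x, hx⟩) ⟨Fin.modNat ⟨x, hx⟩, ha⟩
        else 0
      else 0
    else 0

end Database

/-- Program `A`, on words of `w ≥ c log₂ (N + k + 2)` bits, always halts, and it always outputs a
set `S` of `k` join results (of all join results, if there are fewer than `k`) whose `k`-center
cost is at most `α` times the optimum. -/
def SolvesRelKCenter {d m : ℕ} (q : JoinQuery d m) (A : RealRAM.Prog) (c : ℕ) (α : ℝ) : Prop :=
  ∀ (N k w : ℕ) (D : Database q N), 1 ≤ N → 1 ≤ k → (N + k + 2) ^ c ≤ 2 ^ w →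
    (∃ t, RealRAM.HaltsWithin w A (D.input k) t) ∧
    RealRAM.Yields w A (D.input k) fun s =>
      ∃ S : Finset (EuclideanSpace ℝ (Fin d)), RealRAM.Outputs s S ∧
        (S : Set _) ⊆ D.results ∧ (S.card : ℕ∞) = min (k : ℕ∞) D.results.encard ∧
        centerCost (S : Set _) D.results ≤ ENNReal.ofReal α * optCenterCost k D.results

/-- On words of `w ≥ c log₂ (N + k + 2)` bits, program `A` runs in time at most `f N k` with
probability at least `1 - 1 / N`. -/
def RunsInTimeWHP {d m : ℕ} (q : JoinQuery d m) (A : RealRAM.Prog) (c : ℕ) (f : ℕ → ℕ → ℝ) :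
    Prop :=
  ∀ (N k w : ℕ) (D : Database q N), 1 ≤ N → 1 ≤ k → (N + k + 2) ^ c ≤ 2 ^ w →
    ENNReal.ofReal (1 - 1 / (N : ℝ)) ≤ RealRAM.haltProb w A (D.input k) ⌊f N k⌋₊

end

/-! The set `q(D)` may have up to `N ^ m` points and is never listed. It is replaced by a small net:
a set `P ⊆ q(D)` of `O(k)` points such that every join result lies within `(ε/2) r` of `P`, for
every radius `r` at which some `k` join results cover `q(D)`. Running `B` on `P` is then enough.
Centers for `q(D)` can be moved into `P` at an extra cost of `δ ≤ (ε/2) r`, so the centers that `B`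
finds have cost at most `δ + γ (r + δ) ≤ (1 + ε) γ r` on all of `q(D)` (`approx_of_net`).

The net comes from a partition of `q(D)` by half-open boxes. Start with one cube and repeatedly take
the box whose results have the bounding box with the longest side, and cut it at the midpoint of
that side. Each half still contains a result. Longest sides never grow, and a cut leaves half of the
currently longest side in both parts, so every box stays, in every direction, at least half as wide
as the longest tight side `ℓ` of any box (`Part.split`). Now pack: each box contains a point of the
lattice `(ℓ/2) ℤ^d` close to one of its results, disjoint boxes contain different lattice points,
and only `b ^ d` of these points are near a given center (`Part.card_le`). Hence after `b ^ d * k`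
cuts `d ℓ ≤ (ε/2) r` (`Part.key_le`), and one result from each box gives the net. If the cuts run
out earlier, every box holds a single result and the net is all of `q(D)`.

A cut needs the bounding box of the results inside a box. The box constrains each attribute
separately, so it filters the tuples of the relations; for an acyclic query, semijoins up and down
the join tree then leave exactly the tuples that take part in a result inside the box
(`Built.exists_fits`, `reduced_iff`), and the bounding box is read off the surviving entries. A
semijoin takes linear time by direct addressing: the real entries are sorted once and replaced by
rank codes, a join key is the number whose digits are the codes at the common attributes, and keys
address a word array. A result in a box is found by `d` such reductions, each of which fixes one
coordinate at its minimum. A tournament tree serves both for the sorting and for finding the longest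
side.

Programs are written in a small structured language, whose triple `HT` asserts correctness and a
time bound together, and are compiled to the machine; `B` runs unchanged in a renamed part of the
memory. The number `k` is first replaced by `min k (N ^ m)`, which loses nothing because `q(D)` has
at most `N ^ m` points and which makes all logarithms `O(log N)`. Outside `B` the time is `O(k N log
N)`, and `log N ≤ 2 log² N` for `N ≥ 2`. No random numbers are drawn outside `B`, and the bound for
`B` holds for all random choices; so for `N ≥ 2` the time bound holds with probability one, and for
`N = 1` the required probability is zero. -/

namespace RealRAM

/-! ### Total correctness with a time bound -/

/-- Whatever the random choices, the machine started with the stack of programs `L` in memory `s`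
halts within `t` steps in a memory that satisfies `Q`. -/
def Ends (w : ℕ) (Q : State → Prop) : ℕ → List Prog → State → Prop
  | _, [], s => Q s
  | 0, _ :: _, _ => False
  | t + 1, p :: L, s => ∀ c ∈ (step w (p :: L, s)).support, Ends w Q t c.1 c.2

variable {w : ℕ} {Q Q' : State → Prop}

theorem ends_nil {t : ℕ} {s : State} : Ends w Q t [] s ↔ Q s := by
  cases t <;> simp [Ends]

theorem Ends.mono {t t' : ℕ} {L : List Prog} {s : State} (h : Ends w Q t L s) (ht : t ≤ t')
    (hQ : ∀ s, Q s → Q' s) : Ends w Q' t' L s := by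
  induction t generalizing t' L s with
  | zero =>
    cases L with
    | nil => exact ends_nil.2 (hQ _ (ends_nil.1 h))
    | cons p L => exact absurd h (by simp [Ends])
  | succ t ih =>
    cases L with
    | nil => exact ends_nil.2 (hQ _ (ends_nil.1 h))
    | cons p L =>
      obtain ⟨t', rfl⟩ : ∃ u, t' = u + 1 := ⟨t' - 1, by omega⟩
      exact fun c hc => ih (h c hc) (by omega)

/-- A step looks only at the top of the stack, so programs beneath it are carried along. Sequential
composition of time bounds rests on this. -/
theorem step_append (p : Prog) (L K : List Prog) (s : State) :
    step w (p :: (L ++ K), s) = (step w (p :: L, s)).map (fun c => (c.1 ++ K, c.2)) := by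
  cases p <;> simp only [step, PMF.pure_map, PMF.map_comp] <;> first | rfl | skip
  all_goals split_ifs <;> rfl

theorem Ends.append {t t' : ℕ} {L K : List Prog} {s : State} (h : Ends w Q t L s)
    (hK : ∀ s', Q s' → Ends w Q' t' K s') : Ends w Q' (t + t') (L ++ K) s := by
  induction t generalizing L s with
  | zero =>
    cases L with
    | nil => exact (hK _ (ends_nil.1 h)).mono (by omega) (fun _ h => h)
    | cons p L => exact absurd h (by simp [Ends])
  | succ t ih =>
    cases L with
    | nil => exact (hK _ (ends_nil.1 h)).mono (by omega) (fun _ h => h)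
    | cons p L =>
      rw [show t + 1 + t' = (t + t') + 1 by omega]
      intro c hc
      change c ∈ (step w (p :: (L ++ K), s)).support at hc
      rw [step_append, PMF.support_map] at hc
      obtain ⟨c, hc, rfl⟩ := hc
      exact ih (h c hc)

/-- From the recursive `Ends` to the distributions `run`: after `t` steps the remaining budget is `T
- t`, and a budget of zero forces an empty stack. -/
theorem Ends.of_mem_run {T t : ℕ} {p : Prog} {s : State} (h : Ends w Q T [p] s) :
    ∀ c ∈ (run w p s t).support, Ends w Q (T - t) c.1 c.2 := by
  induction t with
  | zero => intro c hc; simp [run] at hc; subst hc; simpa using h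
  | succ t ih =>
    intro c hc
    simp only [run, PMF.mem_support_bind_iff] at hc
    obtain ⟨⟨L, s'⟩, hc', hc⟩ := hc
    have h' := ih _ hc'
    cases L with
    | nil =>
      simp [step] at hc
      subst hc
      exact ends_nil.2 (ends_nil.1 h')
    | cons p L =>
      rcases hT : T - t with _ | u
      · simp [hT, Ends] at h'
      · rw [hT] at h'
        rw [show T - (t + 1) = u by omega]
        exact h' _ hc

theorem Ends.haltsWithin {t t' : ℕ} {p : Prog} {s : State} (h : Ends w Q t [p] s) (ht : t ≤ t') :
    HaltsWithin w p s t' := by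
  intro c hc
  have := h.of_mem_run c hc
  rw [show t - t' = 0 by omega] at this
  rcases c with ⟨_ | _, s⟩
  · rfl
  · simp [Ends] at this

theorem Ends.yields {t : ℕ} {p : Prog} {s : State} (h : Ends w Q t [p] s) : Yields w p s Q := by
  rintro u ⟨L, s'⟩ hc (rfl : L = [])
  exact ends_nil.1 (h.of_mem_run _ hc)

theorem HaltsWithin.haltProb_eq_one {t : ℕ} {p : Prog} {s : State} (h : HaltsWithin w p s t) :
    haltProb w p s t = 1 :=
  (PMF.toOuterMeasure_apply_eq_one_iff _ _).2 h

/-- The converse passage, needed because the `k`-center program is known only through `HaltsWithin`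
and `Yields`. The induction is on the number of steps left before time `T`, when every reachable
stack is empty. -/
theorem HaltsWithin.ends {T : ℕ} {p : Prog} {s : State} (h : HaltsWithin w p s T)
    (hY : Yields w p s Q) : Ends w Q T [p] s := by
  have key : ∀ r t, t + r = T → ∀ c ∈ (run w p s t).support, Ends w Q r c.1 c.2 := by
    intro r
    induction r with
    | zero =>
      rintro t rfl ⟨L, s'⟩ hc
      obtain rfl : L = [] := h _ hc
      exact ends_nil.2 (hY _ _ hc rfl)
    | succ r ih =>
      rintro t ht ⟨L, s'⟩ hc
      cases L with
      | nil => exact ends_nil.2 (hY _ _ hc rfl)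
      | cons p L =>
        intro c' hc'
        exact ih (t + 1) (by omega) c' (by
          simp only [run, PMF.mem_support_bind_iff]; exact ⟨_, hc, hc'⟩)
  exact key T 0 (by simp) ([p], s) (by simp [run])

/-- Program `p` started in `s` halts within `t` steps in a memory that satisfies `Q`. -/
def Runs (w : ℕ) (p : Prog) (s : State) (t : ℕ) (Q : State → Prop) : Prop :=
  Ends w Q t [p] s

theorem Runs.mono {p : Prog} {s : State} {t t' : ℕ} (h : Runs w p s t Q) (ht : t ≤ t')
    (hQ : ∀ s, Q s → Q' s) : Runs w p s t' Q' :=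
  Ends.mono h ht hQ

theorem Runs.skip {s : State} (h : Q s) : Runs w .skip s 1 Q := by
  intro c hc
  simp [step] at hc
  subst hc
  exact ends_nil.2 h

theorem Runs.instr {i : Instr} {s : State} (h : ∀ s' ∈ (i.exec w s).support, Q s') :
    Runs w (.instr i) s 1 Q := by
  intro c hc
  simp only [step, PMF.support_map, Set.mem_image] at hc
  obtain ⟨s', hs', rfl⟩ := hc
  exact ends_nil.2 (h _ hs')

theorem Runs.instr_pure {i : Instr} {s s' : State} (hi : i.exec w s = PMF.pure s') (h : Q s') :
    Runs w (.instr i) s 1 Q := by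
  refine Runs.instr fun s'' hs => ?_
  rw [hi] at hs
  simp at hs
  subst hs
  exact h

theorem Runs.seq {p q : Prog} {s : State} {t t' : ℕ}
    (h : Runs w p s t (fun s' => Runs w q s' t' Q)) : Runs w (.seq p q) s (t + t' + 1) Q := by
  intro c hc
  simp [step] at hc
  subst hc
  exact Ends.append (L := [p]) (K := [q]) h fun _ h => h

theorem Runs.ite {c : Cond} {p q : Prog} {s : State} {t : ℕ}
    (hp : c.Holds s → Runs w p s t Q) (hq : ¬ c.Holds s → Runs w q s t Q) :
    Runs w (.ite c p q) s (t + 1) Q := by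
  intro c' hc
  simp only [step, PMF.support_pure, Set.mem_singleton_iff] at hc
  subst hc
  split_ifs with h
  · exact hp h
  · exact hq h

theorem Runs.loop_done {c : Cond} {p : Prog} {s : State} (h : ¬ c.Holds s) (hQ : Q s) :
    Runs w (.loop c p) s 1 Q := by
  intro c' hc
  simp only [step, PMF.support_pure, Set.mem_singleton_iff, if_neg h] at hc
  subst hc
  exact ends_nil.2 hQ

theorem Runs.loop_step {c : Cond} {p : Prog} {s : State} {t t' : ℕ} (h : c.Holds s)
    (hp : Runs w p s t (fun s' => Runs w (.loop c p) s' t' Q)) :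
    Runs w (.loop c p) s (t + t' + 1) Q := by
  intro c' hc
  simp only [step, PMF.support_pure, Set.mem_singleton_iff, if_pos h] at hc
  subst hc
  exact Ends.append (L := [p]) (K := [.loop c p]) hp fun _ h => h

/-! ### Memory locations that a program does not write -/

/-- A register or an array. -/
inductive Loc
  | w (r : ℕ)
  | r (r : ℕ)
  | wa (a : ℕ)
  | ra (a : ℕ)

/-- The location `l` has the same contents in both memories. -/
def SameAt (s s' : State) : Loc → Prop
  | .w r => s'.wreg r = s.wreg r
  | .r r => s'.rreg r = s.rreg r
  | .wa a => s'.warr a = s.warr a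
  | .ra a => s'.rarr a = s.rarr a

theorem SameAt.refl (s : State) (l : Loc) : SameAt s s l := by cases l <;> rfl

theorem SameAt.trans {s s' s'' : State} {l : Loc} (h : SameAt s s' l) (hs : SameAt s' s'' l) :
    SameAt s s'' l := by
  cases l <;> exact Eq.trans hs h

/-- The location that an instruction writes. -/
def Instr.target : Instr → Loc
  | wconst dst _ => .w dst
  | wop _ dst _ _ => .w dst
  | wload dst _ _ => .w dst
  | wstore arr _ _ => .wa arr
  | rofword dst _ => .r dst
  | rop _ dst _ _ => .r dst
  | rsqrt dst _ => .r dst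
  | rload dst _ _ => .r dst
  | rstore arr _ _ => .ra arr
  | rand dst _ => .w dst

/-- The locations that a program may write. -/
def Prog.Writes : Prog → Loc → Prop
  | skip, _ => False
  | instr i, l => i.target = l
  | seq p q, l => p.Writes l ∨ q.Writes l
  | ite _ p q, l => p.Writes l ∨ q.Writes l
  | loop _ p, l => p.Writes l

theorem Instr.exec_sameAt {i : Instr} {s s' : State} {l : Loc} (h : s' ∈ (i.exec w s).support)
    (hl : i.target ≠ l) : SameAt s s' l := by
  cases i <;> cases l <;>
    simp only [exec, PMF.support_pure, Set.mem_singleton_iff, PMF.support_map, Set.mem_image] at h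
  all_goals
    first | subst h | obtain ⟨v, -, rfl⟩ := h
    simp_all [SameAt, target, State.setW, State.setR, eq_comm]

/-- The reference memory `s₀` stays fixed during the induction, so the final memory is compared with
the initial one. -/
theorem Ends.frame {t : ℕ} {L : List Prog} {s s₀ : State} {X : Loc → Prop} (h : Ends w Q t L s)
    (hs : ∀ l, X l → SameAt s₀ s l) (hL : ∀ p ∈ L, ∀ l, X l → ¬ p.Writes l) :
    Ends w (fun s' => Q s' ∧ ∀ l, X l → SameAt s₀ s' l) t L s := by
  induction t generalizing L s with
  | zero =>
    cases L with
    | nil => exact ends_nil.2 ⟨ends_nil.1 h, hs⟩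
    | cons p L => exact absurd h (by simp [Ends])
  | succ t ih =>
    cases L with
    | nil => exact ends_nil.2 ⟨ends_nil.1 h, hs⟩
    | cons p L =>
      intro c hc
      have h' := h c hc
      have hp := hL p (by simp)
      have hL' : ∀ q ∈ L, ∀ l, X l → ¬ q.Writes l := fun q hq => hL q (by simp [hq])
      cases p with
      | skip =>
        simp only [step, PMF.support_pure, Set.mem_singleton_iff] at hc
        subst hc
        exact ih h' hs hL'
      | instr i =>
        simp only [step, PMF.support_map, Set.mem_image] at hc
        obtain ⟨s', hs', rfl⟩ := hc
        exact ih h' (fun l hl => (hs l hl).trans (Instr.exec_sameAt hs' (hp l hl))) hL'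
      | seq p q =>
        simp only [step, PMF.support_pure, Set.mem_singleton_iff] at hc
        subst hc
        refine ih h' hs ?_
        simp only [List.mem_cons]
        rintro r (rfl | rfl | hr) l hl hw
        · exact hp l hl (Or.inl hw)
        · exact hp l hl (Or.inr hw)
        · exact hL' r hr l hl hw
      | ite c p q =>
        simp only [step, PMF.support_pure, Set.mem_singleton_iff] at hc
        subst hc
        split_ifs at h' ⊢
        all_goals
          refine ih h' hs ?_
          simp only [List.mem_cons]
          rintro r (rfl | hr) l hl hw
          · first | exact hp l hl (Or.inl hw) | exact hp l hl (Or.inr hw)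
          · exact hL' r hr l hl hw
      | loop c p =>
        simp only [step, PMF.support_pure, Set.mem_singleton_iff] at hc
        subst hc
        split_ifs at h' ⊢
        · refine ih h' hs ?_
          simp only [List.mem_cons]
          rintro r (rfl | rfl | hr) l hl hw
          · exact hp l hl hw
          · exact hp l hl hw
          · exact hL' r hr l hl hw
        · exact ih h' hs hL'

theorem Runs.frame {p : Prog} {s : State} {t : ℕ} (h : Runs w p s t Q) :
    Runs w p s t (fun s' => Q s' ∧ ∀ l, ¬ p.Writes l → SameAt s s' l) :=
  Ends.frame h (fun l _ => SameAt.refl s l) (by simp)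

/-! ### Renaming registers and arrays -/

/-- Rename registers and word arrays by `f`, real arrays by `g`. -/
def Instr.rename (f g : ℕ → ℕ) : Instr → Instr
  | wconst dst c => wconst (f dst) c
  | wop op dst a b => wop op (f dst) (f a) (f b)
  | wload dst arr idx => wload (f dst) (f arr) (f idx)
  | wstore arr idx src => wstore (f arr) (f idx) (f src)
  | rofword dst src => rofword (f dst) (f src)
  | rop op dst a b => rop op (f dst) (f a) (f b)
  | rsqrt dst src => rsqrt (f dst) (f src)
  | rload dst arr idx => rload (f dst) (g arr) (f idx)
  | rstore arr idx src => rstore (g arr) (f idx) (f src)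
  | rand dst src => rand (f dst) (f src)

def Cond.rename (f : ℕ → ℕ) : Cond → Cond
  | weq a b => weq (f a) (f b)
  | wlt a b => wlt (f a) (f b)
  | rlt a b => rlt (f a) (f b)
  | not c => not (c.rename f)

def Prog.rename (f g : ℕ → ℕ) : Prog → Prog
  | skip => skip
  | instr i => instr (i.rename f g)
  | seq p q => seq (p.rename f g) (q.rename f g)
  | ite c p q => ite (c.rename f) (p.rename f g) (q.rename f g)
  | loop c p => loop (c.rename f) (p.rename f g)

/-- The memory seen through a renaming. -/
def State.pull (f g : ℕ → ℕ) (s : State) : State where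
  wreg r := s.wreg (f r)
  rreg r := s.rreg (f r)
  warr a := s.warr (f a)
  rarr a := s.rarr (g a)

theorem Cond.holds_rename (f g : ℕ → ℕ) (c : Cond) (s : State) :
    (c.rename f).Holds s ↔ c.Holds (s.pull f g) := by
  induction c <;> simp_all [rename, Holds, State.pull]

theorem update_pull {α : Type*} {f : ℕ → ℕ} (hf : Function.Injective f) (u : ℕ → α) (i : ℕ)
    (v : α) : (fun r => Function.update u (f i) v (f r)) =
      Function.update (fun r => u (f r)) i v := by
  funext r
  simp [Function.update_apply, hf.eq_iff]

theorem Instr.exec_rename {f g : ℕ → ℕ} (hf : Function.Injective f) (hg : Function.Injective g)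
    (i : Instr) (s s' : State) (h : s' ∈ ((i.rename f g).exec w s).support) :
    s'.pull f g ∈ (i.exec w (s.pull f g)).support := by
  cases i <;>
    simp only [exec, rename, PMF.support_pure, Set.mem_singleton_iff, PMF.support_map,
      Set.mem_image] at h ⊢
  all_goals
    first
    | (obtain ⟨v, hv, rfl⟩ := h
       refine ⟨v, hv, ?_⟩
       simp [State.pull, State.setW, update_pull hf])
    | (subst h
       simp [State.pull, State.setW, State.setR, update_pull hf, update_pull hg])

/-- The renamed program simulates the original on the pulled-back memory. Injectivity makes a write
to `f i` visible as a write to `i` alone (`update_pull`). Real arrays have a renaming of their own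
because the input fills as many real arrays as there are relations. -/
theorem Ends.rename {f g : ℕ → ℕ} (hf : Function.Injective f) (hg : Function.Injective g)
    {t : ℕ} {L : List Prog} {s : State} (h : Ends w Q t L (s.pull f g)) :
    Ends w (fun s' => Q (s'.pull f g)) t (L.map (Prog.rename f g)) s := by
  induction t generalizing L s with
  | zero =>
    cases L with
    | nil => exact ends_nil.2 (ends_nil.1 h)
    | cons p L => exact absurd h (by simp [Ends])
  | succ t ih =>
    cases L with
    | nil => exact ends_nil.2 (ends_nil.1 h)
    | cons p L =>
      intro c hc
      cases p with
      | skip =>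
        simp only [step, Prog.rename, PMF.support_pure, Set.mem_singleton_iff] at hc
        subst hc
        exact ih (h (L, s.pull f g) (by simp [step]))
      | instr i =>
        simp only [step, Prog.rename, PMF.support_map, Set.mem_image] at hc
        obtain ⟨s', hs', rfl⟩ := hc
        refine ih (h (L, s'.pull f g) ?_)
        simp only [step, PMF.support_map, Set.mem_image]
        exact ⟨_, Instr.exec_rename hf hg i s s' hs', rfl⟩
      | seq p q =>
        simp only [step, Prog.rename, PMF.support_pure, Set.mem_singleton_iff] at hc
        subst hc
        exact ih (L := p :: q :: L) (h (p :: q :: L, s.pull f g) (by simp [step]))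
      | ite c p q =>
        simp only [step, Prog.rename, PMF.support_pure, Set.mem_singleton_iff] at hc
        subst hc
        split_ifs with hc <;> rw [Cond.holds_rename f g] at hc
        · exact ih (L := p :: L) (h (p :: L, s.pull f g) (by simp [step, hc]))
        · exact ih (L := q :: L) (h (q :: L, s.pull f g) (by simp [step, hc]))
      | loop c p =>
        simp only [step, Prog.rename, PMF.support_pure, Set.mem_singleton_iff] at hc
        subst hc
        split_ifs with hc <;> rw [Cond.holds_rename f g] at hc
        · exact ih (L := p :: .loop c p :: L)
            (h (p :: .loop c p :: L, s.pull f g) (by simp [step, hc]))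
        · exact ih (L := L) (h (L, s.pull f g) (by simp [step, hc]))

theorem Runs.rename {f g : ℕ → ℕ} (hf : Function.Injective f) (hg : Function.Injective g)
    {t : ℕ} {p : Prog} {s : State} (h : Runs w p (s.pull f g) t Q) :
    Runs w (p.rename f g) s t (fun s' => Q (s'.pull f g)) :=
  Ends.rename (L := [p]) hf hg h

theorem Prog.writes_rename {f g : ℕ → ℕ} {p : Prog} {l : Loc} (h : (p.rename f g).Writes l) :
    ∃ r, l = .w (f r) ∨ l = .r (f r) ∨ l = .wa (f r) ∨ l = .ra (g r) := by
  induction p with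
  | skip => exact h.elim
  | instr i =>
    subst h
    cases i <;> simp [Instr.rename, Instr.target]
  | seq p q hp hq => exact h.elim hp hq
  | ite c p q hp hq => exact h.elim hp hq
  | loop c p hp => exact hp h

end RealRAM

namespace RealRAM

/-! ### A structured language with expressions and bounded loops -/

def State.setWA (s : State) (arr i v : ℕ) : State :=
  { s with warr := Function.update s.warr arr (Function.update (s.warr arr) i v) }

noncomputable def State.setRA (s : State) (arr i : ℕ) (v : ℝ) : State :=
  { s with rarr := Function.update s.rarr arr (Function.update (s.rarr arr) i v) }

section StateLemmas

variable (s : State) (r r' a a' i v : ℕ) (x : ℝ)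

@[simp] theorem State.setW_wreg : (s.setW r v).wreg r' = if r' = r then v else s.wreg r' := by
  simp [State.setW, Function.update_apply]
@[simp] theorem State.setW_rreg : (s.setW r v).rreg = s.rreg := rfl
@[simp] theorem State.setW_warr : (s.setW r v).warr = s.warr := rfl
@[simp] theorem State.setW_rarr : (s.setW r v).rarr = s.rarr := rfl
@[simp] theorem State.setR_rreg : (s.setR r x).rreg r' = if r' = r then x else s.rreg r' := by
  simp [State.setR, Function.update_apply]
@[simp] theorem State.setR_wreg : (s.setR r x).wreg = s.wreg := rfl
@[simp] theorem State.setR_warr : (s.setR r x).warr = s.warr := rfl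
@[simp] theorem State.setR_rarr : (s.setR r x).rarr = s.rarr := rfl
@[simp] theorem State.setWA_warr : (s.setWA a i v).warr a' =
    if a' = a then Function.update (s.warr a) i v else s.warr a' := by
  simp [State.setWA, Function.update_apply]
@[simp] theorem State.setWA_wreg : (s.setWA a i v).wreg = s.wreg := rfl
@[simp] theorem State.setWA_rreg : (s.setWA a i v).rreg = s.rreg := rfl
@[simp] theorem State.setWA_rarr : (s.setWA a i v).rarr = s.rarr := rfl
@[simp] theorem State.setRA_rarr : (s.setRA a i x).rarr a' =
    if a' = a then Function.update (s.rarr a) i x else s.rarr a' := by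
  simp [State.setRA, Function.update_apply]
@[simp] theorem State.setRA_wreg : (s.setRA a i x).wreg = s.wreg := rfl
@[simp] theorem State.setRA_rreg : (s.setRA a i x).rreg = s.rreg := rfl
@[simp] theorem State.setRA_warr : (s.setRA a i x).warr = s.warr := rfl

end StateLemmas

/-- Word expressions. -/
inductive WE
  | reg (r : ℕ)
  | const (c : ℕ)
  | add (a b : WE)
  | mul (a b : WE)
  | div (a b : WE)
  | load (arr : ℕ) (e : WE)

/-- The exact value of a word expression. -/
def WE.eval (s : State) : WE → ℕ
  | reg r => s.wreg r
  | const c => c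
  | add a b => a.eval s + b.eval s
  | mul a b => a.eval s * b.eval s
  | div a b => a.eval s / b.eval s
  | load arr e => s.warr arr (e.eval s)

/-- No operation in the expression overflows. -/
def WE.Ok (w : ℕ) (s : State) : WE → Prop
  | reg _ => True
  | const c => c < 2 ^ w
  | add a b => a.Ok w s ∧ b.Ok w s ∧ a.eval s + b.eval s < 2 ^ w
  | mul a b => a.Ok w s ∧ b.Ok w s ∧ a.eval s * b.eval s < 2 ^ w
  | div a b => a.Ok w s ∧ b.Ok w s ∧ a.eval s < 2 ^ w
  | load _ e => e.Ok w s

/-- Real expressions. -/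
inductive RE
  | reg (r : ℕ)
  | load (arr : ℕ) (e : WE)
  | ofW (e : WE)
  | op (o : RealOp) (a b : RE)

noncomputable def RE.eval (s : State) : RE → ℝ
  | reg r => s.rreg r
  | load arr e => s.rarr arr (e.eval s)
  | ofW e => (e.eval s : ℝ)
  | op o a b => o.eval (a.eval s) (b.eval s)

def RE.Ok (w : ℕ) (s : State) : RE → Prop
  | reg _ => True
  | load _ e => e.Ok w s
  | ofW e => e.Ok w s
  | op _ a b => a.Ok w s ∧ b.Ok w s

/-- Tests between expressions. -/
inductive HC
  | wlt (a b : WE)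
  | weq (a b : WE)
  | rlt (a b : RE)

def HC.Ok (w : ℕ) (s : State) : HC → Prop
  | wlt a b => a.Ok w s ∧ b.Ok w s
  | weq a b => a.Ok w s ∧ b.Ok w s
  | rlt a b => a.Ok w s ∧ b.Ok w s

def HC.Holds (s : State) : HC → Prop
  | wlt a b => a.eval s < b.eval s
  | weq a b => a.eval s = b.eval s
  | rlt a b => a.eval s < b.eval s

/-- Structured programs. `loopTo i n p` runs `p` with word register `i` counting from `0` up to
the content of word register `n`; `loopWhile z i p` runs `p` while the content of register `z` is
below that of register `i`. -/
inductive HL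
  | skip
  | wset (r : ℕ) (e : WE)
  | wsto (arr : ℕ) (e v : WE)
  | rset (r : ℕ) (e : RE)
  | rsto (arr : ℕ) (e : WE) (v : RE)
  | seq (p q : HL)
  | ite (c : HC) (p q : HL)
  | loopTo (i n : ℕ) (p : HL)
  | loopWhile (z i : ℕ) (p : HL)

/-! ### Compilation -/

/-- The register (or word array) that implements a named one. -/
def phys (r : ℕ) : ℕ := if r ≤ 1 then r else 2 * r

/-- Temporary registers. -/
def tmp (T : ℕ) : ℕ := 2 * T + 3

theorem phys_injective : Function.Injective phys := by
  intro a b h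
  unfold phys at h
  split_ifs at h <;> omega

/-- Named registers `0` and `1` stay where the input and output conventions put them; the others get
even numbers from `4` on, and temporaries get odd numbers from `3` on. -/
theorem phys_ne_tmp (r T : ℕ) : phys r ≠ tmp T := by
  unfold phys tmp
  split_ifs <;> omega

@[simp] theorem tmp_inj {T T' : ℕ} : tmp T = tmp T' ↔ T = T' := by unfold tmp; omega

/-- The memory as the structured program sees it. -/
def view (s : State) : State := s.pull phys id

/-- The value is left in `tmp T`, and temporaries below `T` survive. A register is copied through
cell `0` of a scratch array: adding zero instead would reduce the value modulo `2 ^ w` and call for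
an overflow condition. -/
def WE.code (T : ℕ) : WE → Prog
  | reg r => .seq (.instr (.wconst (tmp T) 0))
      (.seq (.instr (.wstore (tmp 0) (tmp T) (phys r))) (.instr (.wload (tmp T) (tmp 0) (tmp T))))
  | const c => .instr (.wconst (tmp T) c)
  | add a b => .seq (a.code T) (.seq (b.code (T + 1)) (.instr (.wop .add (tmp T) (tmp T) (tmp (T + 1)))))
  | mul a b => .seq (a.code T) (.seq (b.code (T + 1)) (.instr (.wop .mul (tmp T) (tmp T) (tmp (T + 1)))))
  | div a b => .seq (a.code T) (.seq (b.code (T + 1)) (.instr (.wop .div (tmp T) (tmp T) (tmp (T + 1)))))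
  | load arr e => .seq (e.code T) (.instr (.wload (tmp T) (phys arr) (tmp T)))

def WE.cost : WE → ℕ
  | reg _ => 5
  | const _ => 1
  | add a b | mul a b | div a b => a.cost + (b.cost + 1 + 1) + 1
  | load _ e => e.cost + 1 + 1

def RE.code (T : ℕ) : RE → Prog
  | reg r => .seq (.instr (.wconst (tmp 0) 0)) (.seq (.instr (.rofword (tmp T) (tmp 0)))
      (.instr (.rop .add (tmp T) (phys r) (tmp T))))
  | load arr e => .seq (e.code 0) (.instr (.rload (tmp T) arr (tmp 0)))
  | ofW e => .seq (e.code 0) (.instr (.rofword (tmp T) (tmp 0)))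
  | op o a b => .seq (a.code T) (.seq (b.code (T + 1)) (.instr (.rop o (tmp T) (tmp T) (tmp (T + 1)))))

def RE.cost : RE → ℕ
  | reg _ => 5
  | load _ e => e.cost + 1 + 1
  | ofW e => e.cost + 1 + 1
  | op _ a b => a.cost + (b.cost + 1 + 1) + 1

def HC.code (p q : Prog) : HC → Prog
  | wlt a b => .seq (a.code 0) (.seq (b.code 1) (.ite (.wlt (tmp 0) (tmp 1)) p q))
  | weq a b => .seq (a.code 0) (.seq (b.code 1) (.ite (.weq (tmp 0) (tmp 1)) p q))
  | rlt a b => .seq (a.code 0) (.seq (b.code 1) (.ite (.rlt (tmp 0) (tmp 1)) p q))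

def HC.cost : HC → ℕ
  | wlt a b | weq a b => a.cost + b.cost + 3
  | rlt a b => a.cost + b.cost + 3

def wsetCode (r : ℕ) (e : WE) : Prog :=
  .seq (e.code 0) (.seq (.instr (.wconst (tmp 1) 0))
    (.seq (.instr (.wstore (tmp 0) (tmp 1) (tmp 0))) (.instr (.wload (phys r) (tmp 0) (tmp 1)))))

def HL.toProg : HL → Prog
  | skip => .skip
  | wset r e => wsetCode r e
  | wsto arr e v => .seq (e.code 0) (.seq (v.code 1) (.instr (.wstore (phys arr) (tmp 0) (tmp 1))))
  | rset r e => .seq (e.code 0) (.seq (.instr (.wconst (tmp 0) 0))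
      (.seq (.instr (.rofword (tmp 1) (tmp 0))) (.instr (.rop .add (phys r) (tmp 0) (tmp 1)))))
  | rsto arr e v => .seq (v.code 0) (.seq (e.code 0) (.instr (.rstore arr (tmp 0) (tmp 0))))
  | seq p q => .seq p.toProg q.toProg
  | ite c p q => c.code p.toProg q.toProg
  | loopTo i n p => .seq (wsetCode i (.const 0)) (.loop (.wlt (phys i) (phys n))
      (.seq p.toProg (wsetCode i (.add (.reg i) (.const 1)))))
  | loopWhile z i p => .loop (.wlt (phys z) (phys i)) p.toProg

/-- A bound for the running time of a structured program in which the loops bounded by register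
`n` make at most `β n` iterations. -/
def HL.cost (β : ℕ → ℕ) : HL → ℕ
  | skip => 1
  | wset _ e => e.cost + 6
  | wsto _ e v => e.cost + v.cost + 3
  | rset _ e => e.cost + 6
  | rsto _ e v => e.cost + v.cost + 3
  | seq p q => p.cost β + q.cost β + 1
  | ite c p q => c.cost + (p.cost β + q.cost β)
  | loopTo _ n p => β n * (p.cost β + 17) + 9
  | loopWhile _ i p => β i * (p.cost β + 1) + 1

/-! ### The triple -/

/-- The compiled program `p`, run in a memory seen as `s`, ends within its time bound in a memory
seen as one that satisfies `Q`. -/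
def HT (β : ℕ → ℕ) (w : ℕ) (p : HL) (s : State) (Q : State → Prop) : Prop :=
  ∀ s₁, view s₁ = s → Runs w p.toProg s₁ (p.cost β) (fun s' => Q (view s'))

variable {w : ℕ} {β : ℕ → ℕ} {Q Q' : State → Prop}

@[simp] theorem view_setW_tmp (s : State) (T v : ℕ) : view (s.setW (tmp T) v) = view s := by
  simp [view, State.pull, State.setW, phys_ne_tmp]

@[simp] theorem view_setR_tmp (s : State) (T : ℕ) (v : ℝ) :
    view (s.setR (tmp T) v) = view s := by
  simp [view, State.pull, State.setR, phys_ne_tmp]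

@[simp] theorem view_setWA_tmp (s : State) (T i v : ℕ) :
    view (s.setWA (tmp T) i v) = view s := by
  simp [view, State.pull, State.setWA, phys_ne_tmp]

@[simp] theorem view_setW (s : State) (r v : ℕ) :
    view (s.setW (phys r) v) = (view s).setW r v := by
  simp [view, State.pull, State.setW, update_pull phys_injective]

@[simp] theorem view_setR (s : State) (r : ℕ) (v : ℝ) :
    view (s.setR (phys r) v) = (view s).setR r v := by
  simp [view, State.pull, State.setR, update_pull phys_injective]

@[simp] theorem view_setWA (s : State) (a i v : ℕ) :
    view (s.setWA (phys a) i v) = (view s).setWA a i v := by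
  simp [view, State.pull, State.setWA, update_pull phys_injective]

@[simp] theorem view_setRA (s : State) (a i : ℕ) (v : ℝ) :
    view (s.setRA a i v) = (view s).setRA a i v := by
  simp [view, State.pull, State.setRA]

/-- The contract of compiled word expressions. -/
def WE.Sound (w : ℕ) (v : State → ℕ) (ok : State → Prop) (code : ℕ → Prog) (cost : ℕ) : Prop :=
  ∀ T s, ok (view s) → Runs w (code T) s cost (fun s' =>
    s'.wreg (tmp T) = v (view s) ∧ view s' = view s ∧
    (∀ T' < T, s'.wreg (tmp T') = s.wreg (tmp T')) ∧ s'.rreg = s.rreg)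

theorem WE.sound_op {va vb : State → ℕ} {oka okb : State → Prop} {ca cb : ℕ → Prog} {ta tb : ℕ}
    (ha : WE.Sound w va oka ca ta) (hb : WE.Sound w vb okb cb tb) (o : WordOp) {v : State → ℕ}
    {ok : State → Prop}
    (h : ∀ s, ok s → oka s ∧ okb s ∧ o.eval w (va s) (vb s) = v s) :
    WE.Sound w v ok (fun T => .seq (ca T) (.seq (cb (T + 1))
      (.instr (.wop o (tmp T) (tmp T) (tmp (T + 1)))))) (ta + (tb + 1 + 1) + 1) := by
  intro T s hok
  obtain ⟨h1, h2, h3⟩ := h _ hok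
  refine Runs.seq ((ha T s h1).mono le_rfl ?_)
  rintro s1 ⟨e1, e2, e3, e4⟩
  refine Runs.seq ((hb (T + 1) s1 (by rwa [e2])).mono le_rfl ?_)
  rintro s2 ⟨e5, e6, e7, e8⟩
  refine Runs.instr_pure rfl ?_
  rw [e7 T (by omega), e5, e1, e2]
  refine ⟨by simpa using h3, by simp [e6, e2], fun T' hT => ?_, by simp [e8, e4]⟩
  rw [← e3 T' hT, ← e7 T' (by omega)]
  simp [hT.ne]

theorem WE.code_sound (e : WE) :
    WE.Sound w (fun s => e.eval s) (fun s => e.Ok w s) (fun T => e.code T) e.cost := by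
  induction e with
  | reg r =>
    intro T s h
    refine Runs.seq (t := 1) (t' := 3) (Runs.instr_pure rfl ?_)
    refine Runs.seq (t := 1) (t' := 1) (Runs.instr_pure rfl ?_)
    refine Runs.instr_pure rfl ?_
    refine ⟨?_, ?_, ?_, ?_⟩
    · simp [WE.eval, view, State.pull, phys_ne_tmp]
    · exact (view_setW_tmp _ _ _).trans ((view_setWA_tmp _ _ _ _).trans (view_setW_tmp _ _ _))
    · intro T' hT
      simp [hT.ne]
    · simp
  | const c =>
    intro T s h
    refine Runs.instr_pure rfl ?_
    refine ⟨by simpa [WE.eval] using Nat.mod_eq_of_lt h, by simp, fun T' hT => by simp [hT.ne],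
      by simp⟩
  | add a b iha ihb =>
    exact WE.sound_op iha ihb .add fun s h => ⟨h.1, h.2.1, Nat.mod_eq_of_lt h.2.2⟩
  | mul a b iha ihb =>
    exact WE.sound_op iha ihb .mul fun s h => ⟨h.1, h.2.1, Nat.mod_eq_of_lt h.2.2⟩
  | div a b iha ihb =>
    exact WE.sound_op iha ihb .div fun s h => ⟨h.1, h.2.1,
      Nat.mod_eq_of_lt ((Nat.div_le_self _ _).trans_lt h.2.2)⟩
  | load arr e ih =>
    intro T s h
    refine Runs.seq ((ih T s h).mono le_rfl ?_)
    rintro s1 ⟨h1, h2, h3, h4⟩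
    refine Runs.instr_pure rfl ?_
    refine ⟨?_, by simp [h2], fun T' hT => ?_, by simp [h4]⟩
    · simp only [State.setW_wreg, if_true, h1, WE.eval]
      rw [← h2]
      rfl
    · rw [← h3 T' hT]
      simp [hT.ne]

theorem RE.code_runs (e : RE) (T : ℕ) (s : State) (h : e.Ok w (view s)) :
    Runs w (e.code T) s e.cost (fun s' => s'.rreg (tmp T) = e.eval (view s) ∧ view s' = view s ∧
      ∀ T' < T, s'.rreg (tmp T') = s.rreg (tmp T')) := by
  induction e generalizing T s with
  | reg r =>
    refine Runs.seq (t := 1) (t' := 3) (Runs.instr_pure rfl ?_)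
    refine Runs.seq (t := 1) (t' := 1) (Runs.instr_pure rfl ?_)
    refine Runs.instr_pure rfl ?_
    refine ⟨by simp [RE.eval, RealOp.eval, view, State.pull, phys_ne_tmp], by simp, ?_⟩
    intro T' hT
    simp [hT.ne]
  | load arr e =>
    refine Runs.seq ((WE.code_sound e 0 s h).mono le_rfl ?_)
    rintro s1 ⟨h1, h2, -, h4⟩
    refine Runs.instr_pure rfl ⟨?_, by simp [h2], fun T' hT => by simp [hT.ne, h4]⟩
    simp only [State.setR_rreg, if_true, h1, RE.eval]
    rw [← h2]
    rfl
  | ofW e =>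
    refine Runs.seq ((WE.code_sound e 0 s h).mono le_rfl ?_)
    rintro s1 ⟨h1, h2, -, h4⟩
    exact Runs.instr_pure rfl ⟨by simp [h1, RE.eval], by simp [h2],
      fun T' hT => by simp [hT.ne, h4]⟩
  | op o a b iha ihb =>
    refine Runs.seq ((iha T s h.1).mono le_rfl ?_)
    rintro s1 ⟨h1, h2, h3⟩
    refine Runs.seq ((ihb (T + 1) s1 (by rw [h2]; exact h.2)).mono le_rfl ?_)
    rintro s2 ⟨h5, h6, h7⟩
    refine Runs.instr_pure rfl ?_
    rw [h7 T (by omega), h5, h1, h2]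
    refine ⟨by simp [RE.eval], by simp [h6, h2], fun T' hT => ?_⟩
    rw [← h3 T' hT, ← h7 T' (by omega)]
    simp [hT.ne]

theorem wsetCode_runs (r : ℕ) (e : WE) (s : State) (h : e.Ok w (view s)) :
    Runs w (wsetCode r e) s (e.cost + 6) (fun s' => view s' = (view s).setW r (e.eval (view s))) := by
  refine Runs.seq (t' := 5) ((WE.code_sound e 0 s h).mono le_rfl ?_)
  rintro s1 ⟨h1, h2, -, -⟩
  refine Runs.seq (t := 1) (t' := 3) (Runs.instr_pure rfl ?_)
  refine Runs.seq (t := 1) (t' := 1) (Runs.instr_pure rfl ?_)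
  refine Runs.instr_pure rfl ?_
  refine (view_setW _ _ _).trans ?_
  have : ∀ a i v, view (State.setWA (s1.setW (tmp 1) (0 % 2 ^ w)) (tmp a) i v) = view s1 := by
    intros
    simp
  refine (congrArg₂ (fun a b => State.setW a r b) (this 0 _ _) ?_).trans (by rw [h2])
  simp [h1]

theorem HT.skip {s : State} (h : Q s) : HT β w .skip s Q := by
  rintro s₁ rfl
  exact Runs.skip h

theorem HT.wset {r : ℕ} {e : WE} {s : State} (h : e.Ok w s) (hQ : Q (s.setW r (e.eval s))) :
    HT β w (.wset r e) s Q := by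
  rintro s₁ rfl
  exact (wsetCode_runs r e s₁ h).mono le_rfl fun s' hs => by rwa [hs]

theorem HT.wsto {arr : ℕ} {e v : WE} {s : State} (he : e.Ok w s) (hv : v.Ok w s)
    (hQ : Q (s.setWA arr (e.eval s) (v.eval s))) : HT β w (.wsto arr e v) s Q := by
  rintro s₁ rfl
  refine Runs.mono (t := e.cost + (v.cost + 1 + 1) + 1) ?_ (by simp only [HL.cost]; omega)
    (fun _ h => h)
  refine Runs.seq ((WE.code_sound e 0 s₁ he).mono le_rfl ?_)
  rintro s1 ⟨h1, h2, -, -⟩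
  refine Runs.seq ((WE.code_sound v 1 s1 (by rwa [h2])).mono le_rfl ?_)
  rintro s2 ⟨h3, h4, h5, -⟩
  refine Runs.instr_pure rfl ?_
  rw [h3, h5 0 (by omega), h1, h2]
  have := view_setWA s2 arr (e.eval (view s₁)) (v.eval (view s₁))
  rw [State.setWA] at this
  rw [this, h4, h2]
  exact hQ

theorem HT.rset {r : ℕ} {e : RE} {s : State} (h : e.Ok w s) (hQ : Q (s.setR r (e.eval s))) :
    HT β w (.rset r e) s Q := by
  rintro s₁ rfl
  refine Runs.seq (t' := 5) ((RE.code_runs e 0 s₁ h).mono le_rfl ?_)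
  rintro s1 ⟨h1, h2, -⟩
  refine Runs.seq (t := 1) (t' := 3) (Runs.instr_pure rfl ?_)
  refine Runs.seq (t := 1) (t' := 1) (Runs.instr_pure rfl ?_)
  refine Runs.instr_pure rfl ?_
  simpa [RealOp.eval, h1, h2] using hQ

theorem HT.rsto {arr : ℕ} {e : WE} {v : RE} {s : State} (he : e.Ok w s) (hv : v.Ok w s)
    (hQ : Q (s.setRA arr (e.eval s) (v.eval s))) : HT β w (.rsto arr e v) s Q := by
  rintro s₁ rfl
  refine Runs.mono (t := v.cost + (e.cost + 1 + 1) + 1) ?_ (by simp only [HL.cost]; omega)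
    (fun _ h => h)
  refine Runs.seq ((RE.code_runs v 0 s₁ hv).mono le_rfl ?_)
  rintro s1 ⟨h1, h2, -⟩
  refine Runs.seq ((WE.code_sound e 0 s1 (by rwa [h2])).mono le_rfl ?_)
  rintro s2 ⟨h3, h4, -, h5⟩
  refine Runs.instr_pure rfl ?_
  rw [h3, congrFun h5 (tmp 0), h1, h2]
  have := view_setRA s2 arr (e.eval (view s₁)) (v.eval (view s₁))
  rw [State.setRA] at this
  rw [this, h4, h2]
  exact hQ

theorem HT.seq {p q : HL} {s : State} (h : HT β w p s (fun s' => HT β w q s' Q)) :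
    HT β w (.seq p q) s Q := by
  rintro s₁ rfl
  exact Runs.seq ((h s₁ rfl).mono le_rfl fun s' hs => hs s' rfl)

theorem HT.mono {p : HL} {s : State} (h : HT β w p s Q) (hQ : ∀ s, Q s → Q' s) :
    HT β w p s Q' :=
  fun s₁ hs => (h s₁ hs).mono le_rfl fun _ h => hQ _ h

theorem HT.ite {c : HC} {p q : HL} {s : State} (hc : c.Ok w s) (hp : c.Holds s → HT β w p s Q)
    (hq : ¬ c.Holds s → HT β w q s Q) : HT β w (.ite c p q) s Q := by
  rintro s₁ rfl
  have key : ∀ (cd : Cond) (s' : State), view s' = view s₁ →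
      (cd.Holds s' ↔ c.Holds (view s₁)) →
      Runs w (.ite cd p.toProg q.toProg) s' (p.cost β + q.cost β + 1) fun s' => Q (view s') := by
    intro cd s' hv h
    refine Runs.ite (fun h' => ?_) (fun h' => ?_)
    · exact (hp (h.1 h') s' hv).mono (by omega) (fun _ h => h)
    · exact (hq (fun hh => h' (h.2 hh)) s' hv).mono (by omega) (fun _ h => h)
  cases c with
  | rlt a b =>
    refine Runs.mono (t := a.cost + (b.cost + (p.cost β + q.cost β + 1) + 1) + 1) ?_
      (by simp only [HL.cost, HC.cost]; omega) (fun _ h => h)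
    refine Runs.seq ((RE.code_runs a 0 s₁ hc.1).mono le_rfl ?_)
    rintro s1 ⟨h1, h2, -⟩
    refine Runs.seq ((RE.code_runs b 1 s1 (by rw [h2]; exact hc.2)).mono le_rfl ?_)
    rintro s2 ⟨h3, h4, h5⟩
    refine key _ s2 (h4.trans h2) ?_
    simp only [Cond.Holds, HC.Holds]
    rw [h3, h5 0 (by omega), h1, h2]
  | _ a b =>
    refine Runs.mono (t := a.cost + (b.cost + (p.cost β + q.cost β + 1) + 1) + 1) ?_
      (by simp only [HL.cost, HC.cost]; omega) (fun _ h => h)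
    refine Runs.seq ((WE.code_sound a 0 s₁ hc.1).mono le_rfl ?_)
    rintro s1 ⟨h1, h2, -⟩
    refine Runs.seq ((WE.code_sound b 1 s1 (by rw [h2]; exact hc.2)).mono le_rfl ?_)
    rintro s2 ⟨h3, h4, h5, -⟩
    refine key _ s2 (h4.trans h2) ?_
    simp only [Cond.Holds, HC.Holds]
    rw [h3, h5 0 (by omega), h1, h2]

/-- Weakest preconditions of loop-free programs. -/
def HL.wp (w : ℕ) : HL → (State → Prop) → State → Prop
  | skip, Q, s => Q s
  | wset r e, Q, s => e.Ok w s ∧ Q (s.setW r (e.eval s))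
  | wsto arr e v, Q, s => e.Ok w s ∧ v.Ok w s ∧ Q (s.setWA arr (e.eval s) (v.eval s))
  | rset r e, Q, s => e.Ok w s ∧ Q (s.setR r (e.eval s))
  | rsto arr e v, Q, s => e.Ok w s ∧ v.Ok w s ∧ Q (s.setRA arr (e.eval s) (v.eval s))
  | seq p q, Q, s => p.wp w (q.wp w Q) s
  | ite c p q, Q, s => c.Ok w s ∧ (c.Holds s → p.wp w Q s) ∧ (¬ c.Holds s → q.wp w Q s)
  | loopTo _ _ _, _, _ => False
  | loopWhile _ _ _, _, _ => False

theorem HT.of_wp {p : HL} {s : State} (h : p.wp w Q s) : HT β w p s Q := by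
  induction p generalizing s Q with
  | skip => exact HT.skip h
  | wset r e => exact HT.wset h.1 h.2
  | wsto arr e v => exact HT.wsto h.1 h.2.1 h.2.2
  | rset r e => exact HT.rset h.1 h.2
  | rsto arr e v => exact HT.rsto h.1 h.2.1 h.2.2
  | seq p q hp hq => exact HT.seq ((hp h).mono fun s' hs => hq hs)
  | ite c p q hp hq => exact HT.ite h.1 (fun hc => hp (h.2.1 hc)) (fun hc => hq (h.2.2 hc))
  | loopTo => exact h.elim
  | loopWhile => exact h.elim

/-! ### Frames -/

/-- The locations that a structured program may write. -/
def HL.wr : HL → Loc → Bool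
  | wset r _, .w r' => r == r'
  | wsto a _ _, .wa a' => a == a'
  | rset r _, .r r' => r == r'
  | rsto a _ _, .ra a' => a == a'
  | seq p q, l => p.wr l || q.wr l
  | ite _ p q, l => p.wr l || q.wr l
  | loopTo i _ p, .w r => i == r || p.wr (.w r)
  | loopTo _ _ p, l => p.wr l
  | loopWhile _ _ p, l => p.wr l
  | _, _ => false

/-- `s'` agrees with `s` at the locations that `p` does not write. -/
def Keeps (p : HL) (s s' : State) : Prop := ∀ l, p.wr l = false → SameAt s s' l

def Loc.phys : Loc → Loc
  | .w x => .w (RealRAM.phys x)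
  | .r x => .r (RealRAM.phys x)
  | .wa x => .wa (RealRAM.phys x)
  | .ra x => .ra x

theorem sameAt_view {s s' : State} {l : Loc} (h : SameAt s s' l.phys) :
    SameAt (view s) (view s') l := by
  cases l <;> exact h

theorem WE.not_writes (e : WE) (T : ℕ) (l : Loc) : ¬ (e.code T).Writes l.phys := by
  induction e generalizing T <;> cases l <;>
    simp_all [code, Prog.Writes, Instr.target, Loc.phys, (phys_ne_tmp _ _).symm]

theorem RE.not_writes (e : RE) (T : ℕ) (l : Loc) : ¬ (e.code T).Writes l.phys := by
  induction e generalizing T with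
  | op o a b iha ihb =>
    cases l <;>
    simp_all [code, Prog.Writes, Instr.target, Loc.phys, (phys_ne_tmp _ _).symm]
  | _ =>
    rintro h
    simp only [code, Prog.Writes, WE.not_writes, false_or] at h
    cases l <;> simp [Instr.target, Loc.phys, (phys_ne_tmp _ _).symm] at h

theorem HL.wr_of_writes (p : HL) (l : Loc) (h : p.toProg.Writes l.phys) : p.wr l = true := by
  have hset : ∀ (r : ℕ) (e : WE), (wsetCode r e).Writes l.phys → l = .w r := by
    intro r e h
    simp only [wsetCode, Prog.Writes, WE.not_writes, false_or] at h
    cases l <;>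
      simp_all [Instr.target, Loc.phys, (phys_ne_tmp _ _).symm, phys_injective.eq_iff]
  induction p with
  | skip => exact h.elim
  | wset r e => simp [hset r e h, wr]
  | wsto arr e v =>
    simp only [toProg, Prog.Writes, WE.not_writes, false_or] at h
    cases l <;> simp_all [Instr.target, Loc.phys, phys_injective.eq_iff, wr]
  | rset r e =>
    simp only [toProg, Prog.Writes, RE.not_writes, false_or] at h
    cases l <;> simp_all [Instr.target, Loc.phys, phys_injective.eq_iff, wr,
      (phys_ne_tmp _ _).symm]
  | rsto arr e v =>
    simp only [toProg, Prog.Writes, WE.not_writes, RE.not_writes, false_or] at h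
    cases l <;> simp_all [Instr.target, Loc.phys, wr]
  | seq p q hp hq =>
    rcases h with h | h
    · simp [wr, hp h]
    · simp [wr, hq h]
  | ite c p q hp hq =>
    have h' : p.toProg.Writes l.phys ∨ q.toProg.Writes l.phys := by
      cases c <;> simpa only [toProg, HC.code, Prog.Writes, WE.not_writes, RE.not_writes,
        false_or] using h
    rcases h' with h | h
    · simp [wr, hp h]
    · simp [wr, hq h]
  | loopTo i n p hp =>
    rcases h with h | h | h
    · simp [hset _ _ h, wr]
    · have := hp h
      cases l <;> simp [wr, this]
    · simp [hset _ _ h, wr]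
  | loopWhile z i p hp => simpa [wr] using hp h

theorem HT.keeps {p : HL} {s : State} (h : HT β w p s Q) :
    HT β w p s (fun s' => Q s' ∧ Keeps p s s') := by
  rintro s₁ rfl
  refine (h s₁ rfl).frame.mono le_rfl fun s' hs => ⟨hs.1, fun l hl => sameAt_view (hs.2 _ ?_)⟩
  intro hw
  simp [p.wr_of_writes l hw] at hl

theorem Keeps.refl (p : HL) (s : State) : Keeps p s s := fun l _ => SameAt.refl s l

theorem Keeps.trans {p : HL} {s s' s'' : State} (h : Keeps p s s') (h' : Keeps p s' s'') :
    Keeps p s s'' := fun l hl => (h l hl).trans (h' l hl)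

theorem Keeps.loop_body {i n : ℕ} {p : HL} {s s' : State} (h : Keeps p s s') :
    Keeps (.loopTo i n p) s s' := by
  intro l hl
  refine h l ?_
  cases l <;> simp_all [HL.wr]

theorem keeps_setW_counter (i n : ℕ) (p : HL) (s : State) (v : ℕ) :
    Keeps (.loopTo i n p) s (s.setW i v) := by
  intro l hl
  cases l with
  | w r =>
    have : i ≠ r := by rintro rfl; simp [HL.wr] at hl
    simp [SameAt, this.symm]
  | _ => rfl

/-- The invariant is indexed by the counter. The compiled loop advances the counter after the body,
which is why the body must establish the invariant for the memory with the counter already set to `x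
+ 1`. `Keeps` relates each iteration to the memory before the loop; all facts about untouched
registers and arrays are recovered from it. -/
theorem HT.loopTo {i n : ℕ} {p : HL} {s : State} (Inv : ℕ → State → Prop)
    (hwr : p.wr (.w i) = false ∧ p.wr (.w n) = false ∧ i ≠ n) (hβ : s.wreg n ≤ β n)
    (hw : s.wreg n < 2 ^ w) (h0 : Inv 0 (s.setW i 0))
    (hs : ∀ x s', x < s.wreg n → s'.wreg i = x → Keeps (.loopTo i n p) s s' → Inv x s' →
      HT β w p s' (fun s'' => Inv (x + 1) (s''.setW i (x + 1))))
    (hQ : ∀ s', s'.wreg i = s.wreg n → Keeps (.loopTo i n p) s s' → Inv (s.wreg n) s' → Q s') :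
    HT β w (.loopTo i n p) s Q := by
  obtain ⟨hi, hn, hin⟩ := hwr
  have key : ∀ r x s₁, x + r = s.wreg n → (view s₁).wreg i = x →
      Keeps (.loopTo i n p) s (view s₁) → Inv x (view s₁) →
      Runs w (.loop (.wlt (phys i) (phys n)) (.seq p.toProg
        (wsetCode i (.add (.reg i) (.const 1))))) s₁ (r * (p.cost β + 17) + 1)
        (fun s' => Q (view s')) := by
    intro r
    induction r with
    | zero =>
      intro x s₁ hx hxi hk hI
      have hn' : (view s₁).wreg n = s.wreg n := hk (.w n) (by simp [HL.wr, hn, hin])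
      have hx' : x = s.wreg n := by omega
      refine Runs.mono (Q := fun s' => Q (view s')) (Runs.loop_done ?_
        (hQ (view s₁) (by omega) hk (hx' ▸ hI))) (by omega) fun _ h => h
      intro hlt
      change (view s₁).wreg i < (view s₁).wreg n at hlt
      omega
    | succ r ih =>
      intro x s₁ hx hxi hk hI
      have hn' : (view s₁).wreg n = s.wreg n := hk (.w n) (by simp [HL.wr, hn, hin])
      -- Evaluating the counter plus one costs `9` and assigning it `6`; one step for the sequencing
      -- and one for the test complete the `17` in `HL.cost`.
      refine Runs.mono (t := (p.cost β + (9 + 6) + 1) + (r * (p.cost β + 17) + 1) + 1) ?_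
        (by rw [Nat.succ_mul]; omega) fun _ h => h
      have hone : 1 < 2 ^ w := by omega
      refine Runs.loop_step (show (view s₁).wreg i < (view s₁).wreg n by omega) ?_
      refine Runs.seq (Runs.mono ((hs x _ (by omega) hxi hk hI).keeps s₁ rfl) le_rfl ?_)
      rintro s2 ⟨hI2, hk2⟩
      have hi2 : (view s2).wreg i = x := Eq.trans (hk2 (.w i) hi) hxi
      refine Runs.mono (wsetCode_runs i _ s2 ⟨trivial, hone, ?_⟩) le_rfl ?_
      · simp only [WE.eval]
        omega
      · intro s3 h3
        simp only [WE.eval, hi2] at h3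
        refine ih (x + 1) s3 (by omega) (by simp [h3]) ?_ (by rw [h3]; exact hI2)
        rw [h3]
        exact (hk.trans hk2.loop_body).trans (keeps_setW_counter _ _ _ _ _)
  rintro s₁ rfl
  refine Runs.mono (t := (1 + 6) + ((view s₁).wreg n * (p.cost β + 17) + 1) + 1) ?_ ?_ fun _ h => h
  · refine Runs.seq (Runs.mono (wsetCode_runs i _ s₁ (Nat.two_pow_pos w)) le_rfl ?_)
    intro s2 h2
    simp only [WE.eval] at h2
    refine key _ 0 s2 (by omega) (by simp [h2]) ?_ (by rw [h2]; exact h0)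
    rw [h2]
    exact keeps_setW_counter _ _ _ _ _
  · have := Nat.mul_le_mul_right (p.cost β + 17) hβ
    simp only [HL.cost]
    omega

/-- The index of the invariant is a budget of iterations: it starts at `β i` and must drop by one
whenever the test succeeds. -/
theorem HT.loopWhile {z i : ℕ} {p : HL} {s : State} (Inv : ℕ → State → Prop) (h0 : Inv (β i) s)
    (hs : ∀ r s', Keeps (.loopWhile z i p) s s' → Inv r s' → s'.wreg z < s'.wreg i →
      ∃ r', r = r' + 1 ∧ HT β w p s' (Inv r'))
    (hQ : ∀ r s', Keeps (.loopWhile z i p) s s' → Inv r s' → ¬ s'.wreg z < s'.wreg i → Q s') :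
    HT β w (.loopWhile z i p) s Q := by
  have key : ∀ r s₁, Keeps (.loopWhile z i p) s (view s₁) → Inv r (view s₁) →
      Runs w (.loop (.wlt (phys z) (phys i)) p.toProg) s₁ (r * (p.cost β + 1) + 1)
        (fun s' => Q (view s')) := by
    intro r
    induction r with
    | zero =>
      intro s₁ hk hI
      have hlt : ¬ (view s₁).wreg z < (view s₁).wreg i := by
        intro hlt
        obtain ⟨r', h, -⟩ := hs 0 _ hk hI hlt
        omega
      exact Runs.mono (Q := fun s' => Q (view s')) (Runs.loop_done hlt (hQ 0 (view s₁) hk hI hlt))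
        (by omega) fun _ h => h
    | succ r ih =>
      intro s₁ hk hI
      by_cases hlt : (view s₁).wreg z < (view s₁).wreg i
      · obtain ⟨r', h, hp⟩ := hs _ _ hk hI hlt
        obtain rfl : r' = r := by omega
        refine Runs.mono (t := p.cost β + (r' * (p.cost β + 1) + 1) + 1) ?_
          (by rw [Nat.succ_mul]; omega) fun _ h => h
        refine Runs.loop_step hlt (Runs.mono (hp.keeps s₁ rfl) le_rfl ?_)
        rintro s2 ⟨hI2, hk2⟩
        exact ih s2 (hk.trans fun l hl => hk2 l hl) hI2
      · exact Runs.mono (Q := fun s' => Q (view s'))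
          (Runs.loop_done hlt (hQ _ (view s₁) hk hI hlt)) (by omega) fun _ h => h
  rintro s₁ rfl
  exact key _ s₁ (Keeps.refl _ _) h0

end RealRAM

/-! ### Notation and evaluation rules for expressions; the memory layout; join keys. -/

namespace RealRAM

instance : Add WE := ⟨WE.add⟩
instance : Mul WE := ⟨WE.mul⟩
instance : Div WE := ⟨WE.div⟩
instance : Add RE := ⟨RE.op .add⟩
instance : Sub RE := ⟨RE.op .sub⟩
instance : Div RE := ⟨RE.op .div⟩

notation:60 p:61 "⨟" q:60 => HL.seq p q

section Eval

variable (w : ℕ) (s : State)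

@[simp] theorem WE.eval_add (a b : WE) : (a + b).eval s = a.eval s + b.eval s := rfl
@[simp] theorem WE.eval_mul (a b : WE) : (a * b).eval s = a.eval s * b.eval s := rfl
@[simp] theorem WE.eval_div (a b : WE) : (a / b).eval s = a.eval s / b.eval s := rfl
@[simp] theorem WE.eval_reg (r : ℕ) : (WE.reg r).eval s = s.wreg r := rfl
@[simp] theorem WE.eval_const (k : ℕ) : (WE.const k).eval s = k := rfl
@[simp] theorem WE.eval_load (a : ℕ) (e : WE) : (WE.load a e).eval s = s.warr a (e.eval s) := rfl
@[simp] theorem WE.ok_add (a b : WE) :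
    (a + b).Ok w s ↔ a.Ok w s ∧ b.Ok w s ∧ a.eval s + b.eval s < 2 ^ w := Iff.rfl
@[simp] theorem WE.ok_mul (a b : WE) :
    (a * b).Ok w s ↔ a.Ok w s ∧ b.Ok w s ∧ a.eval s * b.eval s < 2 ^ w := Iff.rfl
@[simp] theorem WE.ok_div (a b : WE) :
    (a / b).Ok w s ↔ a.Ok w s ∧ b.Ok w s ∧ a.eval s < 2 ^ w := Iff.rfl
@[simp] theorem WE.ok_reg (r : ℕ) : (WE.reg r).Ok w s ↔ True := Iff.rfl
@[simp] theorem WE.ok_const (k : ℕ) : (WE.const k).Ok w s ↔ k < 2 ^ w := Iff.rfl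
@[simp] theorem WE.ok_load (a : ℕ) (e : WE) : (WE.load a e).Ok w s ↔ e.Ok w s := Iff.rfl
@[simp] theorem RE.eval_reg (r : ℕ) : (RE.reg r).eval s = s.rreg r := rfl
@[simp] theorem RE.eval_load (a : ℕ) (e : WE) : (RE.load a e).eval s = s.rarr a (e.eval s) := rfl
@[simp] theorem RE.eval_ofW (e : WE) : (RE.ofW e).eval s = (e.eval s : ℝ) := rfl
@[simp] theorem RE.eval_add (a b : RE) : (a + b).eval s = a.eval s + b.eval s := rfl
@[simp] theorem RE.eval_sub (a b : RE) : (a - b).eval s = a.eval s - b.eval s := rfl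
@[simp] theorem RE.eval_div (a b : RE) : (a / b).eval s = a.eval s / b.eval s := rfl
@[simp] theorem RE.ok_reg (r : ℕ) : (RE.reg r).Ok w s ↔ True := Iff.rfl
@[simp] theorem RE.ok_load (a : ℕ) (e : WE) : (RE.load a e).Ok w s ↔ e.Ok w s := Iff.rfl
@[simp] theorem RE.ok_ofW (e : WE) : (RE.ofW e).Ok w s ↔ e.Ok w s := Iff.rfl
@[simp] theorem RE.ok_add (a b : RE) : (a + b).Ok w s ↔ a.Ok w s ∧ b.Ok w s := Iff.rfl
@[simp] theorem RE.ok_sub (a b : RE) : (a - b).Ok w s ↔ a.Ok w s ∧ b.Ok w s := Iff.rfl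
@[simp] theorem RE.ok_div (a b : RE) : (a / b).Ok w s ↔ a.Ok w s ∧ b.Ok w s := Iff.rfl
@[simp] theorem HC.ok_wlt (a b : WE) : (HC.wlt a b).Ok w s ↔ a.Ok w s ∧ b.Ok w s := Iff.rfl
@[simp] theorem HC.ok_weq (a b : WE) : (HC.weq a b).Ok w s ↔ a.Ok w s ∧ b.Ok w s := Iff.rfl
@[simp] theorem HC.ok_rlt (a b : RE) : (HC.rlt a b).Ok w s ↔ a.Ok w s ∧ b.Ok w s := Iff.rfl
@[simp] theorem HC.holds_wlt (a b : WE) : (HC.wlt a b).Holds s ↔ a.eval s < b.eval s := Iff.rfl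
@[simp] theorem HC.holds_weq (a b : WE) : (HC.weq a b).Holds s ↔ a.eval s = b.eval s := Iff.rfl
@[simp] theorem HC.holds_rlt (a b : RE) : (HC.rlt a b).Holds s ↔ a.eval s < b.eval s := Iff.rfl

end Eval

/-! ### Numbers written in a base -/

def horner (b : ℕ) (f : ℕ → ℕ) : ℕ → ℕ
  | 0 => 0
  | n + 1 => horner b f n * b + f n

theorem horner_lt {b : ℕ} {f : ℕ → ℕ} {n : ℕ} (h : ∀ a < n, f a < b) : horner b f n < b ^ n := by
  induction n with
  | zero => simp [horner]
  | succ n ih =>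
    have h1 := ih fun a ha => h a (by omega)
    have h2 := h n (by omega)
    calc horner b f n * b + f n < horner b f n * b + b := by omega
      _ = (horner b f n + 1) * b := by ring
      _ ≤ b ^ n * b := Nat.mul_le_mul_right _ h1
      _ = b ^ (n + 1) := (pow_succ b n).symm

theorem horner_congr {b : ℕ} {f g : ℕ → ℕ} {n : ℕ} (h : ∀ a < n, f a = g a) :
    horner b f n = horner b g n := by
  induction n with
  | zero => rfl
  | succ n ih =>
    simp only [horner]
    rw [ih fun a ha => h a (by omega), h n (by omega)]

theorem horner_inj {b : ℕ} {f g : ℕ → ℕ} {n : ℕ} (hf : ∀ a < n, f a < b) (hg : ∀ a < n, g a < b)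
    (h : horner b f n = horner b g n) : ∀ a < n, f a = g a := by
  induction n with
  | zero => intro a ha; omega
  | succ n ih =>
    simp only [horner] at h
    have h1 := hf n (by omega)
    have h2 := hg n (by omega)
    have hmod := congrArg (· % b) h
    have hdiv := congrArg (· / b) h
    simp only [Nat.mul_add_mod_of_lt, h1, h2] at hmod
    have hb : 0 < b := by omega
    simp only [Nat.add_comm _ (f n), Nat.add_comm _ (g n), Nat.add_mul_div_right _ _ hb,
      Nat.div_eq_of_lt h1, Nat.div_eq_of_lt h2, zero_add] at hdiv
    intro a ha
    rcases Nat.lt_succ_iff_lt_or_eq.1 ha with ha | rfl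
    · exact ih (fun a ha => hf a (by omega)) (fun a ha => hg a (by omega)) hdiv a ha
    · exact hmod

/-! ### The memory layout of the join algorithm -/

/-- The data the join algorithm works on: `m` relations of `N` tuples over `d` attributes. The
entry of tuple `i` of relation `j` at attribute `a` is `V ((j * N + i) * d + a)` and its rank code
`ids ((j * N + i) * d + a + 1)`; `mask (j * d + a) = 1` if relation `j` has attribute `a`; `sched`
lists the semijoins that reduce the relations; `k` is the number of centers, `K` the number of
splits; `β` bounds the number of iterations of loops. -/
structure Cx where
  (d m N w k K : ℕ)
  V : ℕ → ℝ
  (mask ids : ℕ → ℕ)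
  sched : List (ℕ × ℕ)
  β : ℕ → ℕ

namespace Cx

variable (c : Cx)

/-- The number of table entries. -/
def nv : ℕ := c.m * c.N * c.d

/-- The size conditions. -/
structure Good : Prop where
  N_pos : 1 ≤ c.N
  β0 : c.N ≤ c.β 0
  β2 : c.d ≤ c.β 2
  β4 : c.m * c.N ≤ c.β 4
  β5 : c.nv ≤ c.β 5
  β7 : c.sched.length ≤ c.β 7
  β8 : c.K ≤ c.β 8
  β9 : c.K + 1 ≤ c.β 9
  β11 : c.N * c.d ≤ c.β 11
  β12 : c.K + 1 ≤ c.β 12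
  -- Climbing from a leaf to the root takes at most `β 43` rounds. The tree for sorting has `nv + 1`
  -- leaves, the tree of cells has `K + 2`.
  β43 : 2 * (c.nv + 1) ≤ 2 ^ c.β 43 ∧ 2 * (c.K + 2) ≤ 2 ^ c.β 43
  β57 : (c.K + 1) * c.d ≤ c.β 57
  -- A join key, or the code of a row, has `d` digits in base `nv + 1` and has to fit into a word.
  big_key : (c.nv + 2) ^ (c.d + 2) ≤ 2 ^ c.w
  big_cells : 2 * (c.K + 3) * (c.d + 2) ≤ 2 ^ c.w
  big_tuples : (c.m + 1) * (c.N + 1) ≤ 2 ^ c.w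
  big_mask : (c.m + 1) * (c.d + 1) ≤ 2 ^ c.w
  big_sched : c.sched.length < 2 ^ c.w
  mask_le : ∀ x, c.mask x ≤ 1
  sched_lt : ∀ e ∈ c.sched, e.1 < c.m ∧ e.2 < c.m

/-- The part of the memory that stays fixed before the rank codes are known. -/
structure Base (s : State) : Prop where
  r0 : s.wreg 0 = c.N
  r1 : s.wreg 1 = c.k
  r2 : s.wreg 2 = c.d
  r3 : s.wreg 3 = c.m
  r4 : s.wreg 4 = c.m * c.N
  r5 : s.wreg 5 = c.nv
  r6 : s.wreg 6 = c.nv + 1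
  r7 : s.wreg 7 = c.sched.length
  r8 : s.wreg 8 = c.K
  mask : s.warr 1 = c.mask
  src : ∀ e (h : e < c.sched.length), s.warr 2 e = c.sched[e].1
  dst : ∀ e (h : e < c.sched.length), s.warr 3 e = c.sched[e].2
  V : s.rarr 1 = c.V

/-- The part of the memory that stays fixed. -/
structure Env (s : State) : Prop extends c.Base s where
  ids : s.warr 4 = c.ids

/-- Rank codes are positive, bounded, and equal exactly for equal entries. -/
structure Ranked : Prop where
  pos : ∀ x < c.nv, 1 ≤ c.ids (x + 1)
  le : ∀ x < c.nv, c.ids (x + 1) ≤ c.nv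
  eq_iff : ∀ x < c.nv, ∀ y < c.nv, c.ids (x + 1) = c.ids (y + 1) ↔ c.V x = c.V y

def baseLocs : List Loc :=
  [.w 0, .w 1, .w 2, .w 3, .w 4, .w 5, .w 6, .w 7, .w 8, .wa 1, .wa 2, .wa 3, .ra 1]

variable {c} {s s' : State} {p : HL}

theorem Base.keep (h : c.Base s) (hk : Keeps p s s')
    (hp : baseLocs.all (fun l => !p.wr l) = true) : c.Base s' := by
  simp only [baseLocs, List.all_cons, List.all_nil, Bool.and_true, Bool.and_eq_true,
    Bool.not_eq_true'] at hp
  obtain ⟨h0, h1, h2, h3, h4, h5, h6, h7, h8, a1, a2, a3, b1⟩ := hp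
  have e2 : s'.warr 2 = s.warr 2 := hk _ a2
  have e3 : s'.warr 3 = s.warr 3 := hk _ a3
  exact ⟨Eq.trans (hk _ h0) h.r0, Eq.trans (hk _ h1) h.r1, Eq.trans (hk _ h2) h.r2,
    Eq.trans (hk _ h3) h.r3,
    Eq.trans (hk _ h4) h.r4, Eq.trans (hk _ h5) h.r5, Eq.trans (hk _ h6) h.r6,
    Eq.trans (hk _ h7) h.r7, Eq.trans (hk _ h8) h.r8, Eq.trans (hk _ a1) h.mask,
    fun e he => by rw [e2]; exact h.src e he, fun e he => by rw [e3]; exact h.dst e he,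
    Eq.trans (hk _ b1) h.V⟩

theorem Env.keep (h : c.Env s) (hk : Keeps p s s')
    (hp : (.wa 4 :: baseLocs).all (fun l => !p.wr l) = true) : c.Env s' := by
  rw [List.all_cons, Bool.and_eq_true, Bool.not_eq_true'] at hp
  exact ⟨h.toBase.keep hk hp.2, Eq.trans (hk _ hp.1) h.ids⟩

theorem Base.setW (h : c.Base s) {r v : ℕ} (hr : 8 < r) : c.Base (s.setW r v) := by
  have e : ∀ x, x ≤ 8 → (s.setW r v).wreg x = s.wreg x := by
    intro x hx
    simp [show x ≠ r by omega]
  exact ⟨by rw [e 0 (by omega), h.r0], by rw [e 1 (by omega), h.r1], by rw [e 2 (by omega), h.r2],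
    by rw [e 3 (by omega), h.r3], by rw [e 4 (by omega), h.r4], by rw [e 5 (by omega), h.r5],
    by rw [e 6 (by omega), h.r6], by rw [e 7 (by omega), h.r7], by rw [e 8 (by omega), h.r8],
    h.mask, h.src, h.dst, h.V⟩

theorem Base.setR (h : c.Base s) {r : ℕ} {v : ℝ} : c.Base (s.setR r v) := { h with }

theorem Base.setWA (h : c.Base s) {a i v : ℕ} (ha : 3 < a) : c.Base (s.setWA a i v) := by
  have e : ∀ x, x ≤ 3 → (s.setWA a i v).warr x = s.warr x := by
    intro x hx
    simp [show x ≠ a by omega]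
  exact { h with
    mask := by rw [e 1 (by omega), h.mask]
    src := by rw [e 2 (by omega)]; exact h.src
    dst := by rw [e 3 (by omega)]; exact h.dst }

theorem Base.setRA (h : c.Base s) {a i : ℕ} {v : ℝ} (ha : 1 ≠ a) : c.Base (s.setRA a i v) :=
  { h with V := by simp [ha, h.V] }

theorem Env.setW (h : c.Env s) {r v : ℕ} (hr : 8 < r) : c.Env (s.setW r v) :=
  ⟨h.toBase.setW hr, h.ids⟩

theorem Env.setR (h : c.Env s) {r : ℕ} {v : ℝ} : c.Env (s.setR r v) := ⟨h.toBase.setR, h.ids⟩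

theorem Env.setWA (h : c.Env s) {a i v : ℕ} (ha : 4 < a) : c.Env (s.setWA a i v) :=
  ⟨h.toBase.setWA (by omega), by simp [show 4 ≠ a by omega, h.ids]⟩

theorem Env.setRA (h : c.Env s) {a i : ℕ} {v : ℝ} (ha : 1 ≠ a) : c.Env (s.setRA a i v) :=
  ⟨h.toBase.setRA ha, h.ids⟩

/-- The entry index of tuple `t` (counted through all relations) at attribute `a`. -/
theorem entry_lt {t a : ℕ} (ht : t < c.m * c.N) (ha : a < c.d) : t * c.d + a < c.nv := by
  calc t * c.d + a < t * c.d + c.d := by omega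
    _ = (t + 1) * c.d := by ring
    _ ≤ c.m * c.N * c.d := Nat.mul_le_mul_right _ ht

theorem mask_index_lt {j a : ℕ} (hj : j < c.m) (ha : a < c.d) : j * c.d + a < c.m * c.d := by
  calc j * c.d + a < j * c.d + c.d := by omega
    _ = (j + 1) * c.d := by ring
    _ ≤ c.m * c.d := Nat.mul_le_mul_right _ hj

theorem tuple_lt {j i : ℕ} (hj : j < c.m) (hi : i < c.N) : j * c.N + i < c.m * c.N := by
  calc j * c.N + i < j * c.N + c.N := by omega
    _ = (j + 1) * c.N := by ring
    _ ≤ c.m * c.N := Nat.mul_le_mul_right _ hj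

theorem Good.nv_lt (h : c.Good) : c.nv + 2 ≤ 2 ^ c.w ∧ (c.nv + 1) ^ (c.d + 1) < 2 ^ c.w := by
  constructor
  · exact (Nat.le_self_pow (by omega) _).trans h.big_key
  · calc (c.nv + 1) ^ (c.d + 1) < (c.nv + 2) ^ (c.d + 1) :=
        Nat.pow_lt_pow_left (by omega) (by omega)
      _ ≤ (c.nv + 2) ^ (c.d + 2) := Nat.pow_le_pow_right (by omega) (by omega)
      _ ≤ _ := h.big_key

theorem Good.w_ne (h : c.Good) : c.w ≠ 0 := by
  intro hw
  have := h.nv_lt.1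
  rw [hw] at this
  omega

theorem Good.tuples_lt (h : c.Good) : c.m * c.N + c.m + c.N + 1 ≤ 2 ^ c.w :=
  le_trans (le_of_eq (by ring)) h.big_tuples

theorem Good.mask_lt (h : c.Good) : c.m * c.d + c.m + c.d + 1 ≤ 2 ^ c.w :=
  le_trans (le_of_eq (by ring)) h.big_mask

end Cx

/-! ### Join keys and semijoins -/

/-- Word register 23 := the join key of tuple (register 20) for the relations in registers 21
and 22. -/
def keyOf : HL :=
  .wset 23 (.const 0) ⨟
  .loopTo 24 2 (.wset 23 (.reg 23 * .reg 6 + .load 4 (.reg 20 * .reg 2 + .reg 24 + .const 1) *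
    (.load 1 (.reg 21 * .reg 2 + .reg 24) * .load 1 (.reg 22 * .reg 2 + .reg 24))))

namespace Cx

variable {s s' : State} {c : Cx}

/-- The code of attribute `a` in the join key of tuple `t` for relations `j` and `p`. -/
def digit (c : Cx) (j p t a : ℕ) : ℕ :=
  c.ids (t * c.d + a + 1) * (c.mask (j * c.d + a) * c.mask (p * c.d + a))

/-- Attributes that are not common to `j` and `p` contribute the digit `0`, so equality of keys is
agreement at the common attributes (`key_eq_iff`). -/
def key (c : Cx) (j p t : ℕ) : ℕ := horner (c.nv + 1) (c.digit j p t) c.d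

theorem digit_lt (hg : c.Good) (hr : c.Ranked) {j p t a : ℕ} (ht : t < c.m * c.N) (ha : a < c.d) :
    c.digit j p t a < c.nv + 1 := by
  have h1 := hr.le _ (entry_lt ht ha)
  have h2 := Nat.mul_le_mul (hg.mask_le (j * c.d + a)) (hg.mask_le (p * c.d + a))
  have := Nat.mul_le_mul h1 h2
  simp only [digit]
  omega

theorem keyOf_spec (hg : c.Good) (hr : c.Ranked) (hE : c.Env s) {j p t : ℕ}
    (h20 : s.wreg 20 = t) (h21 : s.wreg 21 = j) (h22 : s.wreg 22 = p)
    (ht : t < c.m * c.N) (hj : j < c.m) (hp : p < c.m) :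
    HT c.β c.w keyOf s (fun s' => s'.wreg 23 = c.key j p t) := by
  refine HT.seq (HT.of_wp ?_)
  have hpos := hg.nv_lt.1
  simp only [HL.wp, WE.ok_const, WE.eval_const]
  refine ⟨by omega, ?_⟩
  refine HT.loopTo (fun x s' => s'.wreg 23 = horner (c.nv + 1) (c.digit j p t) x) ⟨rfl, rfl, by decide⟩
    (by simpa [hE.r2] using hg.β2) (by simp [hE.r2]; have := hg.mask_lt; omega) (by simp [horner]) ?_ ?_
  · intro x s' hx hx' hk hI
    simp only [State.setW_wreg, hE.r2] at hx
    norm_num at hx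
    have h6 : s'.wreg 6 = c.nv + 1 := Eq.trans (hk (.w 6) rfl) (by simp [hE.r6])
    have h2 : s'.wreg 2 = c.d := Eq.trans (hk (.w 2) rfl) (by simp [hE.r2])
    have e20 : s'.wreg 20 = t := Eq.trans (hk (.w 20) rfl) (by simp [h20])
    have e21 : s'.wreg 21 = j := Eq.trans (hk (.w 21) rfl) (by simp [h21])
    have e22 : s'.wreg 22 = p := Eq.trans (hk (.w 22) rfl) (by simp [h22])
    have a1 : s'.warr 1 = c.mask := Eq.trans (hk (.wa 1) rfl) (by simp [hE.mask])
    have a4 : s'.warr 4 = c.ids := Eq.trans (hk (.wa 4) rfl) (by simp [hE.ids])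
    have b1 := entry_lt ht hx
    have b2 := mask_index_lt hj hx
    have b3 := mask_index_lt hp hx
    have b4 := hg.mask_lt
    have hd := digit_lt hg hr (j := j) (p := p) ht hx
    have b5 : horner (c.nv + 1) (c.digit j p t) x < (c.nv + 1) ^ x :=
      horner_lt fun a ha => digit_lt hg hr ht (by omega)
    have b6 : horner (c.nv + 1) (c.digit j p t) x * (c.nv + 1) + c.digit j p t x < 2 ^ c.w := by
      have : horner (c.nv + 1) (c.digit j p t) (x + 1) < (c.nv + 1) ^ (x + 1) :=
        horner_lt fun a ha => digit_lt hg hr ht (by omega)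
      have := this.trans_le (Nat.pow_le_pow_right (by omega) (show x + 1 ≤ c.d + 1 by omega))
      exact this.trans hg.nv_lt.2
    have b7 := Nat.mul_le_mul (hg.mask_le (j * c.d + x)) (hg.mask_le (p * c.d + x))
    refine HT.of_wp ?_
    simp [HL.wp, h6, h2, e20, e21, e22, a1, a4, hx', hI, horner]
    have := hg.w_ne
    have : c.digit j p t x = c.ids (t * c.d + x + 1) *
      (c.mask (j * c.d + x) * c.mask (p * c.d + x)) := rfl
    omega
  · intro s' _ _ hI
    simpa [hE.r2, key] using hI

end Cx

end RealRAM

namespace RealRAM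

theorem HT.seq' {β : ℕ → ℕ} {w : ℕ} {p q : HL} {s : State} {R Q : State → Prop}
    (hp : HT β w p s R) (hq : ∀ s', R s' → Keeps p s s' → HT β w q s' Q) :
    HT β w (p ⨟ q) s Q :=
  HT.seq (hp.keeps.mono fun t h => hq t h.1 h.2)

/-- Keep the tuples of relation (register 31) that match a tuple of relation (register 30). -/
def semijoin : HL :=
  .wset 21 (.reg 30) ⨟ .wset 22 (.reg 31) ⨟
  .loopTo 32 0 (.wset 20 (.reg 30 * .reg 0 + .reg 32) ⨟
    .ite (.weq (.load 6 (.reg 20)) (.const 1)) (keyOf ⨟ .wsto 7 (.reg 23) (.const 1)) .skip) ⨟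
  .loopTo 32 0 (.wset 20 (.reg 31 * .reg 0 + .reg 32) ⨟ keyOf ⨟
    .wsto 6 (.reg 20) (.load 6 (.reg 20) * .load 7 (.reg 23))) ⨟
  .loopTo 32 0 (.wset 20 (.reg 30 * .reg 0 + .reg 32) ⨟ keyOf ⨟ .wsto 7 (.reg 23) (.const 0))

namespace Cx

variable {s s' : State} {c : Cx}

/-- Direct addressing: the keys of the surviving source tuples are stamped in word array 7, each
target mark is multiplied by the stamp of its key, and the stamps are erased again. Because array 7
is zero before and after, all semijoins share it, and no time is spent on the polynomially many
other addresses. -/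
theorem semijoin_spec (hg : c.Good) (hr : c.Ranked) (hE : c.Env s) {j p : ℕ}
    (h30 : s.wreg 30 = j) (h31 : s.wreg 31 = p) (hj : j < c.m) (hp : p < c.m)
    (hst : ∀ y, s.warr 7 y = 0) (hal : ∀ t < c.m * c.N, s.warr 6 t ≤ 1) :
    HT c.β c.w semijoin s (fun s' => (∀ y, s'.warr 7 y = 0) ∧
      (∀ t < c.m * c.N, s'.warr 6 t ≤ 1) ∧
      ∀ l < c.m, ∀ i < c.N, (s'.warr 6 (l * c.N + i) = 1 ↔ s.warr 6 (l * c.N + i) = 1 ∧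
        (l = p → ∃ i' < c.N, s.warr 6 (j * c.N + i') = 1 ∧
          c.key j p (j * c.N + i') = c.key j p (p * c.N + i)))) := by
  have hw := hg.w_ne
  have hT := hg.tuples_lt
  refine HT.seq (HT.of_wp ?_)
  simp only [HL.wp, WE.ok_reg, WE.eval_reg, true_and]
  refine HT.seq (HT.of_wp ?_)
  simp only [HL.wp, WE.ok_reg, WE.eval_reg, true_and]
  set s0 := (s.setW 21 (s.wreg 30)).setW 22 ((s.setW 21 (s.wreg 30)).wreg 31) with hs0
  have hE0 : c.Env s0 := (hE.setW (by decide)).setW (by decide)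
  have e21 : s0.wreg 21 = j := by simp [hs0, h30]
  have e22 : s0.wreg 22 = p := by simp [hs0, h31]
  have e30 : s0.wreg 30 = j := by simp [hs0, h30]
  have e31 : s0.wreg 31 = p := by simp [hs0, h31]
  have a7 : s0.warr 7 = s.warr 7 := rfl
  have a6 : s0.warr 6 = s.warr 6 := rfl
  clear_value s0
  refine HT.seq' (HT.loopTo (Q := fun s' => ∀ y, s'.warr 7 y ≤ 1 ∧
      (s'.warr 7 y = 1 ↔ ∃ i < c.N, s.warr 6 (j * c.N + i) = 1 ∧ c.key j p (j * c.N + i) = y))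
    (fun x s' => ∀ y, s'.warr 7 y ≤ 1 ∧ (s'.warr 7 y = 1 ↔
      ∃ i < x, s.warr 6 (j * c.N + i) = 1 ∧ c.key j p (j * c.N + i) = y))
    ⟨rfl, rfl, by decide⟩ (by simpa [hE0.r0] using hg.β0) (by rw [hE0.r0]; omega)
    (by simp [a7, hst]) ?_ ?_) ?_
  · intro x s1 hx hx1 hk hI
    rw [hE0.r0] at hx
    have hE1 := hE0.keep hk rfl
    have f30 : s1.wreg 30 = j := Eq.trans (hk (.w 30) rfl) e30
    have f21 : s1.wreg 21 = j := Eq.trans (hk (.w 21) rfl) e21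
    have f22 : s1.wreg 22 = p := Eq.trans (hk (.w 22) rfl) e22
    have g6 : s1.warr 6 = s.warr 6 := Eq.trans (hk (.wa 6) rfl) a6
    have ht := tuple_lt hj hx
    refine HT.seq (HT.of_wp ?_)
    simp only [HL.wp, WE.ok_reg, WE.eval_reg, true_and, WE.ok_add, WE.ok_mul, WE.eval_add,
      WE.eval_mul, f30, hE1.r0, hx1]
    refine ⟨by omega, ?_⟩
    have hE2 : c.Env (s1.setW 20 (j * c.N + x)) := hE1.setW (by decide)
    refine HT.ite (by simp [hw]) ?_ ?_
    · intro hc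
      simp [g6] at hc
      refine HT.seq' (keyOf_spec hg hr hE2 (t := j * c.N + x) (j := j) (p := p) (by simp)
        (by simpa using f21) (by simpa using f22) ht hj hp) ?_
      intro s3 h23 hk3
      have g7 : s3.warr 7 = s1.warr 7 := hk3 (.wa 7) rfl
      refine HT.of_wp ?_
      simp [HL.wp, h23, g7, hw]
      intro y
      rw [Function.update_apply]
      split_ifs with hy
      · subst hy
        simp only [le_refl, true_iff, true_and]
        exact ⟨x, by omega, hc, rfl⟩
      · refine ⟨(hI y).1, (hI y).2.trans ⟨?_, ?_⟩⟩
        · rintro ⟨i, hi, h⟩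
          exact ⟨i, by omega, h⟩
        · rintro ⟨i, hi, h1, h2⟩
          refine ⟨i, ?_, h1, h2⟩
          rcases Nat.lt_or_eq_of_le hi with hi | rfl
          · exact hi
          · exact absurd h2.symm hy
    · intro hc
      simp [g6] at hc
      refine HT.skip ?_
      simp only [State.setW_warr]
      intro y
      refine ⟨(hI y).1, (hI y).2.trans ⟨?_, ?_⟩⟩
      · rintro ⟨i, hi, h⟩
        exact ⟨i, by omega, h⟩
      · rintro ⟨i, hi, h1, h2⟩
        refine ⟨i, ?_, h1, h2⟩
        rcases Nat.lt_succ_iff_lt_or_eq.1 hi with hi | rfl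
        · exact hi
        · exact absurd h1 hc
  · intro s1 _ _ hI
    simpa [hE0.r0] using hI
  intro s1 hI1 hk1
  have hE1 := hE0.keep hk1 rfl
  have f21 : s1.wreg 21 = j := Eq.trans (hk1 (.w 21) rfl) e21
  have f22 : s1.wreg 22 = p := Eq.trans (hk1 (.w 22) rfl) e22
  have f30 : s1.wreg 30 = j := Eq.trans (hk1 (.w 30) rfl) e30
  have f31 : s1.wreg 31 = p := Eq.trans (hk1 (.w 31) rfl) e31
  have g6 : s1.warr 6 = s.warr 6 := Eq.trans (hk1 (.wa 6) rfl) a6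
  refine HT.seq' (HT.loopTo (Q := fun s' => ∀ t, s'.warr 6 t = if ∃ i < c.N, t = p * c.N + i then
      s.warr 6 t * s1.warr 7 (c.key j p t) else s.warr 6 t)
    (fun x s' => ∀ t, s'.warr 6 t = if ∃ i < x, t = p * c.N + i then
      s.warr 6 t * s1.warr 7 (c.key j p t) else s.warr 6 t)
    ⟨rfl, rfl, by decide⟩ (by simpa [hE1.r0] using hg.β0) (by rw [hE1.r0]; omega)
    (by simp [g6]) ?_ ?_) ?_
  · intro x s2 hx hx2 hk hI
    rw [hE1.r0] at hx
    have hE2 := hE1.keep hk rfl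
    have i31 : s2.wreg 31 = p := Eq.trans (hk (.w 31) rfl) f31
    have i21 : s2.wreg 21 = j := Eq.trans (hk (.w 21) rfl) f21
    have i22 : s2.wreg 22 = p := Eq.trans (hk (.w 22) rfl) f22
    have g7 : s2.warr 7 = s1.warr 7 := hk (.wa 7) rfl
    have ht := tuple_lt hp hx
    refine HT.seq (HT.of_wp ?_)
    simp only [HL.wp, WE.ok_reg, WE.eval_reg, true_and, WE.ok_add, WE.ok_mul, WE.eval_add,
      WE.eval_mul, i31, hE2.r0, hx2]
    refine ⟨by omega, ?_⟩
    have hE3 : c.Env (s2.setW 20 (p * c.N + x)) := hE2.setW (by decide)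
    refine HT.seq' (keyOf_spec hg hr hE3 (t := p * c.N + x) (j := j) (p := p) (by simp)
      (by simpa using i21) (by simpa using i22) ht hj hp) ?_
    intro s3 h23 hk3
    have k7 : s3.warr 7 = s1.warr 7 := Eq.trans (hk3 (.wa 7) rfl) (by simp [g7])
    have k6 : s3.warr 6 = s2.warr 6 := hk3 (.wa 6) rfl
    have k20 : s3.wreg 20 = p * c.N + x := Eq.trans (hk3 (.w 20) rfl) (by simp)
    have hnot : ¬ ∃ i < x, p * c.N + x = p * c.N + i := by
      rintro ⟨i, hi, h⟩
      omega
    have hb := Nat.mul_le_mul (hal _ ht) (hI1 (c.key j p (p * c.N + x))).1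
    refine HT.of_wp ?_
    simp only [HL.wp, WE.ok_reg, WE.eval_reg, true_and, WE.ok_load, WE.eval_load, WE.ok_mul,
      WE.eval_mul, h23, k7, k20, k6, hI (p * c.N + x), if_neg hnot]
    refine ⟨by omega, ?_⟩
    intro t
    simp only [State.setW_warr, State.setWA_warr, if_true, k6, Function.update_apply]
    split_ifs with h1 h2 h2
    · rw [h1]
    · exact absurd ⟨x, by omega, h1⟩ h2
    · obtain ⟨i, hi, rfl⟩ := h2
      rw [hI, if_pos ⟨i, by omega, rfl⟩]
    · rw [hI, if_neg]
      rintro ⟨i, hi, rfl⟩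
      exact h2 ⟨i, by omega, rfl⟩
  · intro s2 _ _ hI
    simpa [hE1.r0] using hI
  intro s2 hI2 hk2
  have hE2 := hE1.keep hk2 rfl
  have i21 : s2.wreg 21 = j := Eq.trans (hk2 (.w 21) rfl) f21
  have i22 : s2.wreg 22 = p := Eq.trans (hk2 (.w 22) rfl) f22
  have i30 : s2.wreg 30 = j := Eq.trans (hk2 (.w 30) rfl) f30
  have g7 : s2.warr 7 = s1.warr 7 := hk2 (.wa 7) rfl
  -- All source tuples are visited, surviving or not; this covers every stamped key.
  refine HT.loopTo (fun x s' => s'.warr 6 = s2.warr 6 ∧ ∀ y, s'.warr 7 y =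
      if ∃ i < x, c.key j p (j * c.N + i) = y then 0 else s1.warr 7 y)
    ⟨rfl, rfl, by decide⟩ (by simpa [hE2.r0] using hg.β0) (by rw [hE2.r0]; omega)
    (by simp [g7]) ?_ ?_
  · intro x s3 hx hx3 hk hI
    rw [hE2.r0] at hx
    have hE3 := hE2.keep hk rfl
    have l30 : s3.wreg 30 = j := Eq.trans (hk (.w 30) rfl) i30
    have l21 : s3.wreg 21 = j := Eq.trans (hk (.w 21) rfl) i21
    have l22 : s3.wreg 22 = p := Eq.trans (hk (.w 22) rfl) i22
    have ht := tuple_lt hj hx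
    refine HT.seq (HT.of_wp ?_)
    simp only [HL.wp, WE.ok_reg, WE.eval_reg, true_and, WE.ok_add, WE.ok_mul, WE.eval_add,
      WE.eval_mul, l30, hE3.r0, hx3]
    refine ⟨by omega, ?_⟩
    have hE4 : c.Env (s3.setW 20 (j * c.N + x)) := hE3.setW (by decide)
    refine HT.seq' (keyOf_spec hg hr hE4 (t := j * c.N + x) (j := j) (p := p) (by simp)
      (by simpa using l21) (by simpa using l22) ht hj hp) ?_
    intro s4 h23 hk4
    have k7 : s4.warr 7 = s3.warr 7 := hk4 (.wa 7) rfl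
    have k6 : s4.warr 6 = s3.warr 6 := hk4 (.wa 6) rfl
    refine HT.of_wp ?_
    simp only [HL.wp, WE.ok_reg, WE.eval_reg, true_and, WE.ok_const, WE.eval_const, h23,
      State.setW_warr, State.setWA_warr, if_true, k7]
    refine ⟨by omega, by simp [k6, hI.1], fun y => ?_⟩
    rw [Function.update_apply]
    split_ifs with h1 h2 h2
    · rfl
    · exact absurd ⟨x, by omega, h1.symm⟩ h2
    · obtain ⟨i, hi, rfl⟩ := h2
      rcases Nat.lt_succ_iff_lt_or_eq.1 hi with hi | rfl
      · rw [hI.2, if_pos ⟨i, hi, rfl⟩]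
      · exact absurd rfl h1
    · rw [hI.2, if_neg]
      rintro ⟨i, hi, rfl⟩
      exact h2 ⟨i, by omega, rfl⟩
  · intro s3 _ _ hI
    rw [hE2.r0] at hI
    refine ⟨fun y => ?_, fun t ht => ?_, fun l hl i hi => ?_⟩
    · rw [hI.2]
      split_ifs with h
      · rfl
      · have h1 := (hI1 y).1
        have h2 := (hI1 y).2
        by_contra h0
        obtain ⟨i, hi, -, h3⟩ := h2.1 (by omega)
        exact h ⟨i, hi, h3⟩
    · rw [hI.1, hI2]
      have h1 := hal t ht
      split_ifs
      · exact Nat.mul_le_mul h1 (hI1 _).1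
      · exact h1
    · rw [hI.1, hI2]
      have h1 := hal _ (tuple_lt hl hi)
      by_cases hlp : l = p
      · subst hlp
        rw [if_pos ⟨i, hi, rfl⟩]
        simp [(hI1 _).2]
      · rw [if_neg]
        · simp [hlp]
        · rintro ⟨i', hi', h⟩
          apply hlp
          have h3 := congrArg (· / c.N) h
          simpa [Nat.add_div_of_dvd_right, Nat.mul_div_cancel, hg.N_pos, Nat.div_eq_of_lt,
            hi, hi', Nat.mul_add_div, Nat.mul_comm _ c.N, show 0 < c.N from hg.N_pos] using h3

end Cx

end RealRAM

/-! ### The bounding box of the join results inside a box. -/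

namespace RealRAM

/-- Mark the tuples inside the half-open box given by real arrays 3 and 4. -/
def boxFilter : HL :=
  .loopTo 33 4 (.wset 34 (.reg 33 / .reg 0) ⨟ .wsto 6 (.reg 33) (.const 1) ⨟
    .loopTo 35 2 (.ite (.weq (.load 1 (.reg 34 * .reg 2 + .reg 35)) (.const 1))
      (.ite (.rlt (.load 3 (.reg 35)) (.load 1 (.reg 33 * .reg 2 + .reg 35)))
        (.ite (.rlt (.load 4 (.reg 35)) (.load 1 (.reg 33 * .reg 2 + .reg 35)))
          (.wsto 6 (.reg 33) (.const 0)) .skip)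
        (.wsto 6 (.reg 33) (.const 0)))
      .skip))

/-- Carry out the scheduled semijoins. -/
def semijoins : HL :=
  .loopTo 37 7 (.wset 30 (.load 2 (.reg 37)) ⨟ .wset 31 (.load 3 (.reg 37)) ⨟ semijoin)

/-- Lower bounds (real array 5) and upper bounds (real array 6) of the marked tuples; word
register 36 tells whether there is a marked tuple. -/
def tightBounds : HL :=
  .loopTo 35 2 (.rsto 5 (.reg 35) (.load 4 (.reg 35)) ⨟ .rsto 6 (.reg 35) (.load 3 (.reg 35))) ⨟
  .wset 36 (.const 0) ⨟
  .loopTo 33 4 (.ite (.weq (.load 6 (.reg 33)) (.const 1))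
    (.wset 36 (.const 1) ⨟ .wset 34 (.reg 33 / .reg 0) ⨟
      .loopTo 35 2 (.ite (.weq (.load 1 (.reg 34 * .reg 2 + .reg 35)) (.const 1))
        (.ite (.rlt (.load 1 (.reg 33 * .reg 2 + .reg 35)) (.load 5 (.reg 35)))
          (.rsto 5 (.reg 35) (.load 1 (.reg 33 * .reg 2 + .reg 35))) .skip ⨟
        .ite (.rlt (.load 6 (.reg 35)) (.load 1 (.reg 33 * .reg 2 + .reg 35)))
          (.rsto 6 (.reg 35) (.load 1 (.reg 33 * .reg 2 + .reg 35))) .skip)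
        .skip))
    .skip)

/-- The tight bounding box of the join results in the box given by real arrays 3 and 4. -/
def reduce : HL := boxFilter ⨟ semijoins ⨟ tightBounds

namespace Cx

variable {s s' : State} {c : Cx}

/-- Entry of tuple `i` of relation `l` at attribute `a`. -/
def ent (c : Cx) (l i a : ℕ) : ℝ := c.V ((l * c.N + i) * c.d + a)

/-- Relation `l` has attribute `a`. -/
def Has (c : Cx) (l a : ℕ) : Prop := c.mask (l * c.d + a) = 1

/-- Tuple `i` of relation `l` and tuple `t` of relation `p` agree on common attributes. -/
def Agree (c : Cx) (l i p t : ℕ) : Prop :=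
  ∀ a < c.d, c.Has l a → c.Has p a → c.ent l i a = c.ent p t a

/-- The effect of a semijoin on the sets of remaining tuples. -/
def sj (c : Cx) (U : ℕ → ℕ → Prop) (e : ℕ × ℕ) (l i : ℕ) : Prop :=
  U l i ∧ (l = e.2 → ∃ i' < c.N, U e.1 i' ∧ c.Agree e.1 i' e.2 i)

theorem key_eq_iff (hg : c.Good) (hr : c.Ranked) {l p i i' : ℕ} (hl : l < c.m) (hp : p < c.m)
    (hi : i < c.N) (hi' : i' < c.N) :
    c.key l p (l * c.N + i) = c.key l p (p * c.N + i') ↔ c.Agree l i p i' := by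
  have ht := tuple_lt hl hi
  have ht' := tuple_lt hp hi'
  constructor
  · intro h a ha h1 h2
    have := horner_inj (fun a ha => digit_lt hg hr ht ha) (fun a ha => digit_lt hg hr ht' ha) h a ha
    simp only [Has] at h1 h2
    simp only [digit, h1, h2, mul_one] at this
    exact (hr.eq_iff _ (entry_lt ht ha) _ (entry_lt ht' ha)).1 this
  · intro h
    refine horner_congr fun a ha => ?_
    simp only [digit]
    have m1 := hg.mask_le (l * c.d + a)
    have m2 := hg.mask_le (p * c.d + a)
    by_cases h1 : c.mask (l * c.d + a) = 1
    · by_cases h2 : c.mask (p * c.d + a) = 1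
      · rw [(hr.eq_iff _ (entry_lt ht ha) _ (entry_lt ht' ha)).2 (h a ha h1 h2)]
      · simp [show c.mask (p * c.d + a) = 0 by omega]
    · simp [show c.mask (l * c.d + a) = 0 by omega]

theorem boxFilter_spec (hg : c.Good) (hE : c.Env s) :
    HT c.β c.w boxFilter s (fun s' => ∀ t < c.m * c.N, s'.warr 6 t ≤ 1 ∧ (s'.warr 6 t = 1 ↔
      ∀ a < c.d, c.Has (t / c.N) a → s.rarr 3 a < c.V (t * c.d + a) ∧
        c.V (t * c.d + a) ≤ s.rarr 4 a)) := by
  have hw := hg.w_ne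
  have hT := hg.tuples_lt
  have hM := hg.mask_lt
  have hnv := hg.nv_lt.1
  refine HT.loopTo (fun x s' => ∀ t < x, s'.warr 6 t ≤ 1 ∧ (s'.warr 6 t = 1 ↔
      ∀ a < c.d, c.Has (t / c.N) a → s.rarr 3 a < c.V (t * c.d + a) ∧
        c.V (t * c.d + a) ≤ s.rarr 4 a))
    ⟨rfl, rfl, by decide⟩ (by simpa [hE.r4] using hg.β4) (by rw [hE.r4]; omega)
    (by simp) ?_ ?_
  · intro x s1 hx hx1 hk hI
    rw [hE.r4] at hx
    have hE1 := hE.keep hk rfl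
    have k3 : s1.rarr 3 = s.rarr 3 := hk (.ra 3) rfl
    have k4 : s1.rarr 4 = s.rarr 4 := hk (.ra 4) rfl
    have hj : x / c.N < c.m := (Nat.div_lt_iff_lt_mul hg.N_pos).2 hx
    refine HT.seq (HT.of_wp ?_)
    simp only [HL.wp, WE.ok_div, WE.ok_reg, WE.eval_reg, true_and, WE.eval_div, hx1, hE1.r0]
    refine ⟨by omega, ?_⟩
    refine HT.seq (HT.of_wp ?_)
    simp only [HL.wp, WE.ok_const, WE.ok_reg, WE.eval_reg, true_and, WE.eval_const,
      State.setW_wreg]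
    norm_num [hx1]
    refine ⟨hw, ?_⟩
    set s2 := (s1.setW 34 (x / c.N)).setWA 6 x 1 with hs2
    have hE2 : c.Env s2 := (hE1.setW (by decide)).setWA (by decide)
    have m33 : s2.wreg 33 = x := by simp [hs2, hx1]
    have m34 : s2.wreg 34 = x / c.N := by simp [hs2]
    have n3 : s2.rarr 3 = s.rarr 3 := by simp [hs2, k3]
    have n4 : s2.rarr 4 = s.rarr 4 := by simp [hs2, k4]
    have n6 : ∀ t, s2.warr 6 t = if t = x then 1 else s1.warr 6 t := by
      intro t
      simp [hs2, Function.update_apply]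
    clear_value s2
    refine HT.loopTo (fun y s' => (∀ t ≠ x, s'.warr 6 t = s1.warr 6 t) ∧ s'.warr 6 x ≤ 1 ∧
        (s'.warr 6 x = 1 ↔ ∀ a < y, c.Has (x / c.N) a → s.rarr 3 a < c.V (x * c.d + a) ∧
        c.V (x * c.d + a) ≤ s.rarr 4 a))
      ⟨rfl, rfl, by decide⟩ (by simpa [hE2.r2] using hg.β2) (by rw [hE2.r2]; omega) ?_ ?_ ?_
    · refine ⟨fun t ht => by simp [n6, ht], by simp [n6], by simp [n6]⟩
    · intro y s3 hy hy3 hk3 ⟨hI1, hI2, hI3⟩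
      rw [hE2.r2] at hy
      have hE3 := hE2.keep hk3 rfl
      have o33 : s3.wreg 33 = x := Eq.trans (hk3 (.w 33) rfl) m33
      have o34 : s3.wreg 34 = x / c.N := Eq.trans (hk3 (.w 34) rfl) m34
      have q3 : s3.rarr 3 = s.rarr 3 := Eq.trans (hk3 (.ra 3) rfl) n3
      have q4 : s3.rarr 4 = s.rarr 4 := Eq.trans (hk3 (.ra 4) rfl) n4
      have b1 := mask_index_lt hj hy
      have b2 := entry_lt hx hy
      have hsucc : ∀ P : ℕ → Prop, (∀ a < y + 1, P a) ↔ (∀ a < y, P a) ∧ P y := by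
        intro P
        constructor
        · exact fun h => ⟨fun a ha => h a (by omega), h y (by omega)⟩
        · rintro ⟨h1, h2⟩ a ha
          rcases Nat.lt_succ_iff_lt_or_eq.1 ha with ha | rfl
          · exact h1 a ha
          · exact h2
      -- Every branch of the body amounts to overwriting the mark of tuple `x` by some `v`; the
      -- branches differ only in the reason why `v = 1` has the right meaning.
      have done : ∀ v, v ≤ 1 → (v = 1 ↔ s3.warr 6 x = 1 ∧ (c.Has (x / c.N) y →
          s.rarr 3 y < c.V (x * c.d + y) ∧ c.V (x * c.d + y) ≤ s.rarr 4 y)) →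
          ∀ f : ℕ → ℕ, f = Function.update (s3.warr 6) x v →
          (∀ t ≠ x, f t = s1.warr 6 t) ∧ f x ≤ 1 ∧
          (f x = 1 ↔ ∀ a < y + 1, c.Has (x / c.N) a → s.rarr 3 a < c.V (x * c.d + a) ∧
          c.V (x * c.d + a) ≤ s.rarr 4 a) := by
        rintro v hv hv1 f rfl
        refine ⟨fun t ht => by simp [ht, hI1 t ht], by simpa using hv, ?_⟩
        rw [hsucc, ← hI3]
        simpa using hv1
      refine HT.of_wp ?_
      simp only [HL.wp, HC.ok_weq, HC.ok_rlt, RE.ok_load, WE.ok_load, WE.ok_add, WE.ok_mul, WE.ok_reg,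
        WE.ok_const, WE.eval_add, WE.eval_mul, WE.eval_reg, WE.eval_load, WE.eval_const,
        HC.holds_weq, HC.holds_rlt, RE.eval_load, true_and, o33, o34, q3, q4, hy3, hE3.r2, hE3.mask,
        hE3.V, State.setW_warr, State.setWA_warr, if_true]
      refine ⟨by omega, fun hm => ⟨by omega, fun h1 => ⟨by omega, fun h2 => ⟨by omega, ?_⟩,
        fun h2 => ?_⟩, fun h1 => ⟨by omega, ?_⟩⟩, fun hm => ?_⟩
      · refine done 0 (by omega) ?_ _ rfl
        simp only [Has, hm, true_imp_iff]
        constructor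
        · omega
        · rintro ⟨-, -, h⟩
          exact absurd h (not_le.2 h2)
      · refine done (s3.warr 6 x) hI2 ?_ _ (by simp)
        simp only [Has, hm, true_imp_iff]
        simp [h1, not_lt.1 h2]
      · refine done 0 (by omega) ?_ _ rfl
        simp only [Has, hm, true_imp_iff]
        simp [h1]
      · refine done (s3.warr 6 x) hI2 ?_ _ (by simp)
        simp [Has, hm]
    · intro s3 _ _ ⟨hI1, hI2, hI3⟩
      rw [hE2.r2] at hI3
      intro t ht
      rcases Nat.lt_or_eq_of_le ht with ht | rfl
      · rw [hI1 t (by omega)]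
        exact hI t ht
      · exact ⟨hI2, hI3⟩
  · intro s1 _ _ hI
    rwa [hE.r4] at hI

theorem semijoins_spec (hg : c.Good) (hr : c.Ranked) (hE : c.Env s)
    (hst : ∀ y, s.warr 7 y = 0) (hal : ∀ t < c.m * c.N, s.warr 6 t ≤ 1) {U : ℕ → ℕ → Prop}
    (hU : ∀ l < c.m, ∀ i < c.N, (s.warr 6 (l * c.N + i) = 1 ↔ U l i)) :
    HT c.β c.w semijoins s (fun s' => (∀ y, s'.warr 7 y = 0) ∧
      (∀ t < c.m * c.N, s'.warr 6 t ≤ 1) ∧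
      ∀ l < c.m, ∀ i < c.N, (s'.warr 6 (l * c.N + i) = 1 ↔ c.sched.foldl c.sj U l i)) := by
  refine HT.loopTo (fun x s' => (∀ y, s'.warr 7 y = 0) ∧ (∀ t < c.m * c.N, s'.warr 6 t ≤ 1) ∧
      ∀ l < c.m, ∀ i < c.N,
        (s'.warr 6 (l * c.N + i) = 1 ↔ (c.sched.take x).foldl c.sj U l i))
    ⟨rfl, rfl, by decide⟩ (by simpa [hE.r7] using hg.β7) (by rw [hE.r7]; exact hg.big_sched)
    (by simpa using ⟨hst, hal, hU⟩) ?_ ?_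
  · intro x s1 hx hx1 hk ⟨hI1, hI2, hI3⟩
    rw [hE.r7] at hx
    have hE1 := hE.keep hk rfl
    obtain ⟨hlt1, hlt2⟩ := hg.sched_lt _ (List.getElem_mem hx)
    refine HT.seq (HT.of_wp ?_)
    simp only [HL.wp, WE.ok_load, WE.ok_reg, WE.eval_reg, WE.eval_load, true_and, hx1]
    refine HT.seq (HT.of_wp ?_)
    simp only [HL.wp, WE.ok_load, WE.ok_reg, WE.eval_reg, WE.eval_load, true_and]
    norm_num [hx1]
    have hE2 : c.Env ((s1.setW 30 (s1.warr 2 x)).setW 31 (s1.warr 3 x)) :=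
      (hE1.setW (by decide)).setW (by decide)
    refine (semijoin_spec hg hr hE2 (j := c.sched[x].1) (p := c.sched[x].2)
      (by simp [hE1.src x hx]) (by simp [hE1.dst x hx]) hlt1 hlt2 hI1 hI2).mono ?_
    rintro s2 ⟨h1, h2, h3⟩
    refine ⟨h1, h2, fun l hl i hi => ?_⟩
    refine (h3 l hl i hi).trans ?_
    simp only [State.setW_warr]
    rw [hI3 l hl i hi, List.take_add_one, List.foldl_append, List.getElem?_eq_getElem hx]
    simp only [Option.toList_some, List.foldl_cons, List.foldl_nil, sj]
    refine and_congr_right fun _ => imp_congr_right fun hlp => exists_congr fun i' =>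
      and_congr_right fun hi' => ?_
    rw [hI3 _ hlt1 _ hi', key_eq_iff hg hr hlt1 hlt2 hi' hi]
  · intro s1 _ _ hI
    rw [hE.r7, List.take_length] at hI
    exact hI

/-- `lo` and `hi` are the coordinatewise extrema of the entries in `S` and of the corners of the
box. -/
def Bd (c : Cx) (g h lo hi : ℕ → ℝ) (S : ℕ → ℕ → Prop) : Prop :=
  ∀ a < c.d, (lo a ≤ h a ∧ (∀ t, S t a → lo a ≤ c.V (t * c.d + a)) ∧
      (lo a = h a ∨ ∃ t, S t a ∧ lo a = c.V (t * c.d + a))) ∧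
    (g a ≤ hi a ∧ (∀ t, S t a → c.V (t * c.d + a) ≤ hi a) ∧
      (hi a = g a ∨ ∃ t, S t a ∧ hi a = c.V (t * c.d + a)))

theorem Bd.congr {g h lo hi : ℕ → ℝ} {S S' : ℕ → ℕ → Prop} (hB : c.Bd g h lo hi S)
    (hS : ∀ t, ∀ a < c.d, S t a ↔ S' t a) : c.Bd g h lo hi S' := by
  intro a ha
  simpa only [hS _ a ha] using hB a ha

open Classical in
-- The set of inspected entries grows by the entry of tuple `x` at attribute `y`, so only coordinate
-- `y` of the two vectors can change.
theorem Bd.insert {g h lo hi : ℕ → ℝ} {S S' : ℕ → ℕ → Prop} (hB : c.Bd g h lo hi S) {x y : ℕ}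
    (hS : ∀ t, ∀ a < c.d, S' t a ↔ S t a ∨ (t = x ∧ a = y)) {lo' hi' : ℕ → ℝ}
    (hlo : lo' = if c.V (x * c.d + y) < lo y then Function.update lo y (c.V (x * c.d + y)) else lo)
    (hhi : hi' = if hi y < c.V (x * c.d + y) then Function.update hi y (c.V (x * c.d + y)) else hi) :
    c.Bd g h lo' hi' S' := by
  intro a ha
  obtain ⟨⟨l1, l2, l3⟩, ⟨h1, h2, h3⟩⟩ := hB a ha
  by_cases hay : a = y
  · subst hay
    constructor
    · subst hlo
      split_ifs with hv
      · simp only [Function.update_self]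
        refine ⟨hv.le.trans l1, fun t ht => ?_, Or.inr ⟨x, (hS _ _ ha).2 (Or.inr ⟨rfl, rfl⟩), rfl⟩⟩
        rcases (hS t a ha).1 ht with ht | ⟨rfl, -⟩
        · exact hv.le.trans (l2 t ht)
        · exact le_rfl
      · refine ⟨l1, fun t ht => ?_, l3.imp_right fun ⟨t, ht, e⟩ => ⟨t, (hS _ _ ha).2 (Or.inl ht), e⟩⟩
        rcases (hS t a ha).1 ht with ht | ⟨rfl, -⟩
        · exact l2 t ht
        · exact not_lt.1 hv
    · subst hhi
      split_ifs with hv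
      · simp only [Function.update_self]
        refine ⟨h1.trans hv.le, fun t ht => ?_, Or.inr ⟨x, (hS _ _ ha).2 (Or.inr ⟨rfl, rfl⟩), rfl⟩⟩
        rcases (hS t a ha).1 ht with ht | ⟨rfl, -⟩
        · exact (h2 t ht).trans hv.le
        · exact le_rfl
      · refine ⟨h1, fun t ht => ?_, h3.imp_right fun ⟨t, ht, e⟩ => ⟨t, (hS _ _ ha).2 (Or.inl ht), e⟩⟩
        rcases (hS t a ha).1 ht with ht | ⟨rfl, -⟩
        · exact h2 t ht
        · exact not_lt.1 hv
  · have e1 : lo' a = lo a := by subst hlo; split_ifs <;> simp [hay]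
    have e2 : hi' a = hi a := by subst hhi; split_ifs <;> simp [hay]
    have hS' : ∀ t, S' t a ↔ S t a := fun t => by simp [hS t a ha, hay]
    simp only [e1, e2, hS']
    exact ⟨⟨l1, l2, l3⟩, ⟨h1, h2, h3⟩⟩

/-- In place of infinite initial values, the lower bounds start at the upper corner `s.rarr 4` of
the box and the upper bounds at the lower corner `s.rarr 3`. This is the origin of the corner
alternatives in `Bd`. -/
theorem tightBounds_spec (hg : c.Good) (hE : c.Env s) :
    HT c.β c.w tightBounds s (fun s' => s'.wreg 36 ≤ 1 ∧
      (s'.wreg 36 = 1 ↔ ∃ t < c.m * c.N, s.warr 6 t = 1) ∧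
      c.Bd (s.rarr 3) (s.rarr 4) (s'.rarr 5) (s'.rarr 6)
        (fun t a => t < c.m * c.N ∧ s.warr 6 t = 1 ∧ c.Has (t / c.N) a)) := by
  have hw := hg.w_ne
  have hT := hg.tuples_lt
  have hM := hg.mask_lt
  have hnv := hg.nv_lt.1
  refine HT.seq' (HT.loopTo (Q := fun s' => ∀ a < c.d, s'.rarr 5 a = s.rarr 4 a ∧
      s'.rarr 6 a = s.rarr 3 a) (fun x s' => ∀ a < x, s'.rarr 5 a = s.rarr 4 a ∧
      s'.rarr 6 a = s.rarr 3 a) ⟨rfl, rfl, by decide⟩ (by simpa [hE.r2] using hg.β2)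
      (by rw [hE.r2]; omega) (by simp) ?_ ?_) ?_
  · intro x s1 hx hx1 hk hI
    have k3 : s1.rarr 3 = s.rarr 3 := hk (.ra 3) rfl
    have k4 : s1.rarr 4 = s.rarr 4 := hk (.ra 4) rfl
    refine HT.of_wp ?_
    simp [HL.wp, hx1, k3, k4]
    intro a ha
    rcases Nat.lt_or_eq_of_le ha with ha | rfl
    · simp [ha.ne, hI a ha]
    · simp
  · intro s1 _ _ hI
    rwa [hE.r2] at hI
  intro s1 hI1 hk1
  have hE1 := hE.keep hk1 rfl
  have a3 : s1.rarr 3 = s.rarr 3 := hk1 (.ra 3) rfl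
  have a4 : s1.rarr 4 = s.rarr 4 := hk1 (.ra 4) rfl
  have a6 : s1.warr 6 = s.warr 6 := hk1 (.wa 6) rfl
  refine HT.seq (HT.of_wp ?_)
  simp only [HL.wp, WE.ok_const, WE.eval_const]
  refine ⟨by omega, ?_⟩
  have hE2 : c.Env (s1.setW 36 0) := hE1.setW (by decide)
  refine HT.loopTo (fun x s' => s'.wreg 36 ≤ 1 ∧ (s'.wreg 36 = 1 ↔ ∃ t < x, s.warr 6 t = 1) ∧
      c.Bd (s.rarr 3) (s.rarr 4) (s'.rarr 5) (s'.rarr 6)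
        (fun t a => t < x ∧ s.warr 6 t = 1 ∧ c.Has (t / c.N) a))
      ⟨rfl, rfl, by decide⟩ (by rw [hE2.r4]; exact hg.β4) (by rw [hE2.r4]; omega) ?_ ?_ ?_
  · refine ⟨by simp, by simp, fun a ha => ?_⟩
    simp [hI1 a ha]
  · intro x s2 hx hx2 hk ⟨i1, i2, i3⟩
    rw [hE2.r4] at hx
    have hE3 := hE2.keep hk rfl
    have b3 : s2.rarr 3 = s.rarr 3 := Eq.trans (hk (.ra 3) rfl) a3
    have b4 : s2.rarr 4 = s.rarr 4 := Eq.trans (hk (.ra 4) rfl) a4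
    have b6 : s2.warr 6 = s.warr 6 := Eq.trans (hk (.wa 6) rfl) a6
    have hj : x / c.N < c.m := (Nat.div_lt_iff_lt_mul hg.N_pos).2 hx
    refine HT.ite (by simp [hw]) ?_ ?_
    · intro hal
      simp [b6, hx2] at hal
      refine HT.seq (HT.of_wp ?_)
      simp only [HL.wp, WE.ok_const, WE.eval_const]
      refine ⟨by omega, ?_⟩
      refine HT.seq (HT.of_wp ?_)
      simp only [HL.wp, WE.ok_div, WE.ok_reg, WE.eval_div, WE.eval_reg, State.setW_wreg]
      norm_num [hx2, hE3.r0]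
      refine ⟨by omega, ?_⟩
      set s3 := (s2.setW 36 1).setW 34 (x / c.N) with hs3
      have hE4 : c.Env s3 := (hE3.setW (by decide)).setW (by decide)
      have m33 : s3.wreg 33 = x := by simp [hs3, hx2]
      have m34 : s3.wreg 34 = x / c.N := by simp [hs3]
      have m36 : s3.wreg 36 = 1 := by simp [hs3]
      have n5 : s3.rarr 5 = s2.rarr 5 := rfl
      have n6 : s3.rarr 6 = s2.rarr 6 := rfl
      clear_value s3
      refine HT.loopTo (fun y s' => c.Bd (s.rarr 3) (s.rarr 4) (s'.rarr 5) (s'.rarr 6)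
        (fun t a => (t < x ∨ (t = x ∧ a < y)) ∧ s.warr 6 t = 1 ∧ c.Has (t / c.N) a))
        ⟨rfl, rfl, by decide⟩ (by simpa [hE4.r2] using hg.β2) (by rw [hE4.r2]; omega) ?_ ?_ ?_
      · simp only [State.setW_rarr, n5, n6]
        exact i3.congr fun t a _ => by simp
      · intro y s4 hy hy4 hk4 hI
        rw [hE4.r2] at hy
        have hE5 := hE4.keep hk4 rfl
        have o33 : s4.wreg 33 = x := Eq.trans (hk4 (.w 33) rfl) m33
        have o34 : s4.wreg 34 = x / c.N := Eq.trans (hk4 (.w 34) rfl) m34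
        have b1 := mask_index_lt hj hy
        have b2 := entry_lt hx hy
        have hS : c.Has (x / c.N) y → ∀ t, ∀ a < c.d,
            ((t < x ∨ (t = x ∧ a < y + 1)) ∧ s.warr 6 t = 1 ∧ c.Has (t / c.N) a) ↔
            ((t < x ∨ (t = x ∧ a < y)) ∧ s.warr 6 t = 1 ∧ c.Has (t / c.N) a) ∨
              (t = x ∧ a = y) := by
          intro hh t a _
          constructor
          · rintro ⟨h | ⟨rfl, h⟩, h1, h2⟩
            · exact Or.inl ⟨Or.inl h, h1, h2⟩
            · rcases Nat.lt_succ_iff_lt_or_eq.1 h with h | rfl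
              · exact Or.inl ⟨Or.inr ⟨rfl, h⟩, h1, h2⟩
              · exact Or.inr ⟨rfl, rfl⟩
          · rintro (⟨h | ⟨rfl, h⟩, h1, h2⟩ | ⟨rfl, rfl⟩)
            · exact ⟨Or.inl h, h1, h2⟩
            · exact ⟨Or.inr ⟨rfl, by omega⟩, h1, h2⟩
            · exact ⟨Or.inr ⟨rfl, by omega⟩, hal, hh⟩
        refine HT.of_wp ?_
        simp only [HL.wp, HC.ok_weq, HC.ok_rlt, RE.ok_load, WE.ok_load, WE.ok_add, WE.ok_mul,
          WE.ok_reg, WE.ok_const, WE.eval_add, WE.eval_mul, WE.eval_reg, WE.eval_load,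
          WE.eval_const, HC.holds_weq, HC.holds_rlt, RE.eval_load, true_and, o33, o34, hy4,
          hE5.r2, hE5.mask, hE5.V, State.setW_rarr, State.setRA_rarr, State.setRA_wreg]
        norm_num [-Order.lt_add_one_iff]
        refine ⟨by omega, fun hm => ?_, fun hm => ?_⟩
        · simp only [show x * c.d < 2 ^ c.w by omega, show x * c.d + y < 2 ^ c.w by omega,
            true_and]
          refine ⟨fun h1 => ⟨fun h2 => ?_, fun h2 => ?_⟩, fun h1 => ⟨fun h2 => ?_, fun h2 => ?_⟩⟩
          · exact hI.insert (hS hm) (by rw [if_pos h1]) (by rw [if_pos h2])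
          · exact hI.insert (hS hm) (by rw [if_pos h1]) (by rw [if_neg (not_lt.2 h2)])
          · exact hI.insert (hS hm) (by rw [if_neg (not_lt.2 h1)]) (by rw [if_pos h2])
          · exact hI.insert (hS hm) (by rw [if_neg (not_lt.2 h1)]) (by rw [if_neg (not_lt.2 h2)])
        · refine hI.congr fun t a _ => ?_
          constructor
          · rintro ⟨h | ⟨rfl, h⟩, h1, h2⟩
            · exact ⟨Or.inl h, h1, h2⟩
            · exact ⟨Or.inr ⟨rfl, by omega⟩, h1, h2⟩
          · rintro ⟨h | ⟨rfl, h⟩, h1, h2⟩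
            · exact ⟨Or.inl h, h1, h2⟩
            · refine ⟨Or.inr ⟨rfl, ?_⟩, h1, h2⟩
              rcases Nat.lt_succ_iff_lt_or_eq.1 h with h | rfl
              · exact h
              · exact absurd h2 hm
      · intro s4 _ hk4 hI
        rw [hE4.r2] at hI
        have o36 : s4.wreg 36 = 1 := Eq.trans (hk4 (.w 36) rfl) m36
        refine ⟨by simp [o36], by simpa [o36] using ⟨x, by omega, hal⟩, ?_⟩
        refine hI.congr fun t a ha => ?_
        constructor
        · rintro ⟨h | ⟨rfl, h⟩, h1, h2⟩
          · exact ⟨by omega, h1, h2⟩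
          · exact ⟨by omega, h1, h2⟩
        · rintro ⟨h, h1, h2⟩
          exact ⟨by omega, h1, h2⟩
    · intro hal
      simp [b6, hx2] at hal
      refine HT.skip ⟨by simpa using i1, ?_, ?_⟩
      · simp only [State.setW_wreg]
        norm_num
        rw [i2]
        constructor
        · rintro ⟨t, ht, h⟩
          exact ⟨t, by omega, h⟩
        · rintro ⟨t, ht, h⟩
          rcases Nat.lt_or_eq_of_le ht with ht | rfl
          · exact ⟨t, ht, h⟩
          · exact absurd h hal
      · refine i3.congr fun t a _ => ?_
        constructor
        · rintro ⟨h, h1, h2⟩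
          exact ⟨by omega, h1, h2⟩
        · rintro ⟨h, h1, h2⟩
          rcases Nat.lt_succ_iff_lt_or_eq.1 h with h | rfl
          · exact ⟨h, h1, h2⟩
          · exact absurd h1 hal
  · intro s2 _ _ hI
    rwa [hE2.r4] at hI

end Cx

end RealRAM

namespace RealRAM

namespace Cx

variable {s s' : State} {c : Cx}

/-! ### Full reduction along a join tree -/

/-- `Built c S l`: the schedule `l` fully reduces the set `S` of relations. A relation `v` can be
attached to a member `p` of `S` if `p` has all attributes that `v` shares with members of `S`. -/
inductive Built (c : Cx) : Finset ℕ → List (ℕ × ℕ) → Prop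
  | root (r : ℕ) : Built c {r} []
  | attach {S : Finset ℕ} {l : List (ℕ × ℕ)} {v p : ℕ} (h : Built c S l) (hv : v ∉ S) (hp : p ∈ S)
      (hrip : ∀ a < c.d, c.Has v a → ∀ r ∈ S, c.Has r a → c.Has p a) :
      Built c (insert v S) ((v, p) :: l ++ [(p, v)])

/-- The point `x` has the entries of tuple `i` of relation `l`. -/
def Fits (c : Cx) (x : ℕ → ℝ) (l i : ℕ) : Prop := ∀ a < c.d, c.Has l a → x a = c.ent l i a

theorem foldl_sj_imp {l : List (ℕ × ℕ)} {U : ℕ → ℕ → Prop} {j i : ℕ}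
    (h : l.foldl c.sj U j i) : U j i := by
  induction l generalizing U with
  | nil => exact h
  | cons e l ih => exact (ih h).1

/-- The core of full reduction: a surviving tuple of any relation extends to a join result made of
tuples from `U`. The relation `v` attached last is a leaf. Each relevant tuple of `p` has a partner
in `v` and conversely, and a point over `S` that fits the tuple of `p` can be overwritten on the
attributes of `v`: by `hrip`, attributes of `v` that occur in `S` occur in `p`, where the two tuples
agree. -/
theorem Built.exists_fits {S : Finset ℕ} {l : List (ℕ × ℕ)} (hb : c.Built S l)
    {U : ℕ → ℕ → Prop} {j i : ℕ} (hj : j ∈ S) (hi : i < c.N) (hU : l.foldl c.sj U j i) :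
    ∃ x : ℕ → ℝ, (∀ j' ∈ S, ∃ i' < c.N, U j' i' ∧ c.Fits x j' i') ∧ c.Fits x j i := by
  classical
  induction hb generalizing U j i with
  | root r =>
    obtain rfl : j = r := by simpa using hj
    refine ⟨fun a => c.ent j i a, ?_, fun a _ _ => rfl⟩
    intro j' hj'
    obtain rfl : j' = j := by simpa using hj'
    exact ⟨i, hi, hU, fun a _ _ => rfl⟩
  | @attach S l v p h hv hp hrip ih =>
    have extend : ∀ x : ℕ → ℝ, ∀ iv < c.N, ∀ ip,
        (∀ j' ∈ S, ∃ i' < c.N, U j' i' ∧ c.Fits x j' i') → c.Fits x p ip → U v iv →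
        c.Agree v iv p ip → ∃ y : ℕ → ℝ,
          (∀ j' ∈ insert v S, ∃ i' < c.N, U j' i' ∧ c.Fits y j' i') ∧ c.Fits y v iv ∧
          ∀ j' ∈ S, ∀ i', c.Fits x j' i' → c.Fits y j' i' := by
      intro x iv hiv ip hx hxp hUv hag
      have hfit : ∀ j' ∈ S, ∀ i', c.Fits x j' i' →
          c.Fits (fun a => if c.Has v a then c.ent v iv a else x a) j' i' := by
        intro j' hj' i' hf a ha hh
        by_cases hva : c.Has v a
        · simp only [hva, if_true]
          have hpa := hrip a ha hva j' hj' hh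
          rw [hag a ha hva hpa, ← hxp a ha hpa, hf a ha hh]
        · simp only [hva, if_false]
          exact hf a ha hh
      have hfv : c.Fits (fun a => if c.Has v a then c.ent v iv a else x a) v iv := by
        intro a ha hh
        simp [hh]
      refine ⟨_, ?_, hfv, hfit⟩
      intro j' hj'
      rcases Finset.mem_insert.1 hj' with rfl | hj'
      · exact ⟨iv, hiv, hUv, hfv⟩
      · obtain ⟨i', hi', hU', hf⟩ := hx j' hj'
        exact ⟨i', hi', hU', hfit j' hj' i' hf⟩
    -- The first semijoin `(v, p)` filters `p` by `v`, the induction hypothesis applies to what it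
    -- leaves, and the last one `(p, v)` filters `v` by `p`.
    simp only [List.cons_append, List.foldl_cons, List.foldl_append, List.foldl_nil] at hU
    have hweak : ∀ x : ℕ → ℝ, (∀ j' ∈ S, ∃ i' < c.N, c.sj U (v, p) j' i' ∧ c.Fits x j' i') →
        ∀ j' ∈ S, ∃ i' < c.N, U j' i' ∧ c.Fits x j' i' := by
      intro x hx j' hj'
      obtain ⟨i', hi', h1, h2⟩ := hx j' hj'
      exact ⟨i', hi', h1.1, h2⟩
    -- For a tuple of `v` the last semijoin supplies a partner in `p`, from which a point over `S`
    -- is built. For a tuple of a relation in `S` the point comes first, and its tuple in `p` has a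
    -- partner in `v` by the first semijoin.
    rcases Finset.mem_insert.1 hj with rfl | hjS
    · obtain ⟨ip, hip, hUp, hag⟩ := hU.2 rfl
      obtain ⟨x, hx, hxp⟩ := ih hp hip hUp
      have hUv : U j i := (foldl_sj_imp hU.1).1
      obtain ⟨y, hy1, hy2, -⟩ := extend x i hi ip (hweak x hx) hxp hUv
        (fun a ha h1 h2 => (hag a ha h2 h1).symm)
      exact ⟨y, hy1, hy2⟩
    · obtain ⟨x, hx, hxj⟩ := ih hjS hi hU.1
      obtain ⟨ip, hip, hUp, hxp⟩ := hx p hp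
      obtain ⟨iv, hiv, hUv, hag⟩ := hUp.2 rfl
      obtain ⟨y, hy1, -, hy3⟩ := extend x iv hiv ip (hweak x hx) hxp hUv hag
      exact ⟨y, hy1, hy3 j hjS i hxj⟩

/-- Soundness of any schedule: the tuples of one join result agree pairwise, so they keep each other
alive in every semijoin. -/
theorem foldl_sj_of_fits {l : List (ℕ × ℕ)} (hl : ∀ e ∈ l, e.1 < c.m) {U : ℕ → ℕ → Prop}
    {x : ℕ → ℝ} (hx : ∀ j < c.m, ∃ i < c.N, c.Fits x j i)
    (hU : ∀ j i, c.Fits x j i → U j i) {j i : ℕ} (hf : c.Fits x j i) : l.foldl c.sj U j i := by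
  induction l generalizing U with
  | nil => exact hU j i hf
  | cons e l ih =>
    refine ih (fun e' he' => hl e' (by simp [he'])) ?_
    intro j' i' hf'
    refine ⟨hU j' i' hf', ?_⟩
    rintro rfl
    obtain ⟨i₁, hi₁, hf₁⟩ := hx e.1 (hl e (by simp))
    exact ⟨i₁, hi₁, hU _ _ hf₁, fun a ha h1 h2 => by rw [← hf₁ a ha h1, hf' a ha h2]⟩

/-! ### Join results -/

/-- The join results. -/
def res (c : Cx) : Set (EuclideanSpace ℝ (Fin c.d)) :=
  {x | ∀ l < c.m, ∃ i < c.N, ∀ a : Fin c.d, c.Has l a → x a = c.ent l i a}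

/-- The join results in the half-open box with corners `g` and `h`. -/
def cell (c : Cx) (g h : ℕ → ℝ) : Set (EuclideanSpace ℝ (Fin c.d)) :=
  {x | x ∈ c.res ∧ ∀ a : Fin c.d, g a < x a ∧ x a ≤ h a}

/-- `lo` and `hi` are the corners of the bounding box of the join results in a box. -/
def Tight (c : Cx) (g h lo hi : ℕ → ℝ) : Prop :=
  ∀ a : Fin c.d, IsLeast ((fun x : EuclideanSpace ℝ (Fin c.d) => x a) '' c.cell g h) (lo a) ∧
    IsGreatest ((fun x : EuclideanSpace ℝ (Fin c.d) => x a) '' c.cell g h) (hi a)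

/-- The query is acyclic, in terms of its schedule, and every attribute occurs. -/
structure Reducible (c : Cx) : Prop where
  built : c.Built (Finset.range c.m) c.sched
  cover : ∀ a < c.d, ∃ l < c.m, c.Has l a

/-- The tuples inside a box. -/
def inBox (c : Cx) (g h : ℕ → ℝ) (l i : ℕ) : Prop :=
  ∀ a < c.d, c.Has l a → g a < c.ent l i a ∧ c.ent l i a ≤ h a

/-- Every attribute occurs in some relation, so a box can be imposed on the tuples instead of the
results; what remains is an instance of the same acyclic query, to which full reduction applies. -/
theorem reduced_iff (hg : c.Good) (hR : c.Reducible) {g h : ℕ → ℝ} {l i : ℕ} (hl : l < c.m)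
    (hi : i < c.N) : c.sched.foldl c.sj (c.inBox g h) l i ↔
      ∃ x ∈ c.cell g h, ∀ a : Fin c.d, c.Has l a → x a = c.ent l i a := by
  constructor
  · intro hU
    obtain ⟨x, hx, hxl⟩ := hR.built.exists_fits (by simpa using hl) hi hU
    refine ⟨WithLp.toLp 2 fun a => x a, ⟨fun j hj => ?_, fun a => ?_⟩, fun a ha => hxl a a.2 ha⟩
    · obtain ⟨i', hi', -, hf⟩ := hx j (by simpa using hj)
      exact ⟨i', hi', fun a ha => hf a a.2 ha⟩
    · obtain ⟨j, hj, hja⟩ := hR.cover a a.2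
      obtain ⟨i', hi', hB, hf⟩ := hx j (by simpa using hj)
      have := hB a a.2 hja
      rw [← hf a a.2 hja] at this
      exact this
  · rintro ⟨x, ⟨hx, hbox⟩, hxl⟩
    set y : ℕ → ℝ := fun a => if ha : a < c.d then x ⟨a, ha⟩ else 0 with hy
    have hya : ∀ a (ha : a < c.d), y a = x ⟨a, ha⟩ := fun a ha => by simp [hy, ha]
    refine foldl_sj_of_fits (x := y) (fun e he => (hg.sched_lt e he).1) ?_ ?_ ?_
    · intro j hj
      obtain ⟨i', hi', hf⟩ := hx j hj
      exact ⟨i', hi', fun a ha hh => by rw [hya a ha]; exact hf ⟨a, ha⟩ hh⟩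
    · intro j i' hf a ha hh
      rw [← hf a ha hh, hya a ha]
      exact hbox ⟨a, ha⟩
    · intro a ha hh
      rw [hya a ha]
      exact hxl ⟨a, ha⟩ hh

theorem Reducible.m_pos (hR : c.Reducible) : 0 < c.m := by
  have : ∀ S l, c.Built S l → S.Nonempty := by
    intro S l h
    induction h with
    | root r => exact ⟨r, by simp⟩
    | attach => exact ⟨_, Finset.mem_insert_self _ _⟩
  exact Nat.pos_of_ne_zero (by simpa using this _ _ hR.built)

/-- The outcome of `reduce`. -/
def Reduced (c : Cx) (g h : ℕ → ℝ) (s' : State) : Prop :=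
  (s'.wreg 36 = 1 ∧ (c.cell g h).Nonempty ∧ c.Tight g h (s'.rarr 5) (s'.rarr 6)) ∨
    (s'.wreg 36 = 0 ∧ c.cell g h = ∅)

theorem reduce_spec (hg : c.Good) (hr : c.Ranked) (hR : c.Reducible) (hE : c.Env s)
    (hst : ∀ y, s.warr 7 y = 0) :
    HT c.β c.w reduce s (fun s' => (∀ y, s'.warr 7 y = 0) ∧
      c.Reduced (s.rarr 3) (s.rarr 4) s') := by
  refine HT.seq' (boxFilter_spec hg hE) ?_
  intro s1 h1 hk1
  have hE1 := hE.keep hk1 rfl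
  have g3 : s1.rarr 3 = s.rarr 3 := hk1 (.ra 3) rfl
  have g4 : s1.rarr 4 = s.rarr 4 := hk1 (.ra 4) rfl
  have g7 : s1.warr 7 = s.warr 7 := hk1 (.wa 7) rfl
  have hdiv : ∀ l i, i < c.N → (l * c.N + i) / c.N = l := by
    intro l i hi
    rw [Nat.mul_comm, Nat.mul_add_div hg.N_pos, Nat.div_eq_of_lt hi, add_zero]
  refine HT.seq' (semijoins_spec hg hr hE1 (by simpa [g7] using hst) (fun t ht => (h1 t ht).1)
    (U := c.inBox (s.rarr 3) (s.rarr 4)) ?_) ?_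
  · intro l hl i hi
    rw [(h1 _ (tuple_lt hl hi)).2, hdiv l i hi]
    rfl
  rintro s2 ⟨h2, -, h3⟩ hk2
  have hE2 := hE1.keep hk2 rfl
  have i3 : s2.rarr 3 = s.rarr 3 := Eq.trans (hk2 (.ra 3) rfl) g3
  have i4 : s2.rarr 4 = s.rarr 4 := Eq.trans (hk2 (.ra 4) rfl) g4
  refine (tightBounds_spec hg hE2).keeps.mono ?_
  rintro s3 ⟨⟨f1, f2, f3⟩, hk3⟩
  have i7 : s3.warr 7 = s2.warr 7 := hk3 (.wa 7) rfl
  refine ⟨by rwa [i7], ?_⟩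
  rw [i3, i4] at f3
  have alive_iff : ∀ l < c.m, ∀ i < c.N, s2.warr 6 (l * c.N + i) = 1 ↔
      ∃ x ∈ c.cell (s.rarr 3) (s.rarr 4), ∀ a : Fin c.d, c.Has l a → x a = c.ent l i a :=
    fun l hl i hi => (h3 l hl i hi).trans (reduced_iff hg hR hl hi)
  have split : ∀ t < c.m * c.N, t / c.N < c.m ∧ t % c.N < c.N ∧ t = t / c.N * c.N + t % c.N :=
    fun t ht => ⟨(Nat.div_lt_iff_lt_mul hg.N_pos).2 ht, Nat.mod_lt _ hg.N_pos,
      by rw [Nat.mul_comm]; exact (Nat.div_add_mod t c.N).symm⟩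
  have ne_iff : s3.wreg 36 = 1 ↔ (c.cell (s.rarr 3) (s.rarr 4)).Nonempty := by
    rw [f2]
    constructor
    · rintro ⟨t, ht, h⟩
      obtain ⟨e1, e2, e3⟩ := split t ht
      rw [e3] at h
      obtain ⟨x, hx, -⟩ := (alive_iff _ e1 _ e2).1 h
      exact ⟨x, hx⟩
    · rintro ⟨x, hx⟩
      obtain ⟨i, hi, hf⟩ := hx.1 0 hR.m_pos
      exact ⟨0 * c.N + i, tuple_lt hR.m_pos hi, (alive_iff 0 hR.m_pos i hi).2 ⟨x, hx, hf⟩⟩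
  rcases Set.eq_empty_or_nonempty (c.cell (s.rarr 3) (s.rarr 4)) with he | hne
  · right
    refine ⟨?_, he⟩
    by_contra h0
    have := ne_iff.1 (by omega)
    rw [he] at this
    exact Set.not_nonempty_empty this
  · left
    refine ⟨ne_iff.2 hne, hne, fun a => ?_⟩
    obtain ⟨⟨l1, l2, l3⟩, ⟨u1, u2, u3⟩⟩ := f3 a a.2
    have val : ∀ t, (t < c.m * c.N ∧ s2.warr 6 t = 1 ∧ c.Has (t / c.N) a) →
        ∃ x ∈ c.cell (s.rarr 3) (s.rarr 4), x a = c.V (t * c.d + a) := by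
      rintro t ⟨ht, hal, hh⟩
      obtain ⟨e1, e2, e3⟩ := split t ht
      rw [e3] at hal
      obtain ⟨x, hx, hf⟩ := (alive_iff _ e1 _ e2).1 hal
      refine ⟨x, hx, (hf a hh).trans ?_⟩
      rw [ent, ← e3]
    have rep : ∀ x ∈ c.cell (s.rarr 3) (s.rarr 4), ∃ t,
        (t < c.m * c.N ∧ s2.warr 6 t = 1 ∧ c.Has (t / c.N) a) ∧ x a = c.V (t * c.d + a) := by
      intro x hx
      obtain ⟨l, hl, hla⟩ := hR.cover a a.2
      obtain ⟨i, hi, hf⟩ := hx.1 l hl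
      refine ⟨l * c.N + i, ⟨tuple_lt hl hi, (alive_iff l hl i hi).2 ⟨x, hx, hf⟩, ?_⟩, hf a hla⟩
      rwa [hdiv l i hi]
    have hlow : s3.rarr 5 a ∈ lowerBounds
        ((fun x : EuclideanSpace ℝ (Fin c.d) => x a) '' c.cell (s.rarr 3) (s.rarr 4)) := by
      rintro _ ⟨x, hx, rfl⟩
      obtain ⟨t, ht, e⟩ := rep x hx
      exact (l2 t ht).trans e.ge
    have hup : s3.rarr 6 a ∈ upperBounds
        ((fun x : EuclideanSpace ℝ (Fin c.d) => x a) '' c.cell (s.rarr 3) (s.rarr 4)) := by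
      rintro _ ⟨x, hx, rfl⟩
      obtain ⟨t, ht, e⟩ := rep x hx
      exact e.le.trans (u2 t ht)
    obtain ⟨x₀, hx₀⟩ := hne
    refine ⟨⟨?_, hlow⟩, ⟨?_, hup⟩⟩
    -- A lower bound equal to the upper corner is attained, as every result of the box then lies on
    -- that face. Below, an upper bound equal to the lower corner is impossible, as the box is open
    -- there.
    · rcases l3 with l3 | ⟨t, ht, e⟩
      · have h1 := hlow ⟨x₀, hx₀, rfl⟩
        have h2 := (hx₀.2 a).2
        exact ⟨x₀, hx₀, le_antisymm (h2.trans l3.ge) h1⟩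
      · obtain ⟨x, hx, e'⟩ := val t ht
        exact ⟨x, hx, e'.trans e.symm⟩
    · rcases u3 with u3 | ⟨t, ht, e⟩
      · have h1 := hup ⟨x₀, hx₀, rfl⟩
        have h2 := (hx₀.2 a).1
        exact absurd (h2.trans_le (h1.trans u3.le)) (lt_irrefl _)
      · obtain ⟨x, hx, e'⟩ := val t ht
        exact ⟨x, hx, e'.trans e.symm⟩

end Cx

end RealRAM

namespace RealRAM

/-! ### Tournament trees -/

open Classical in
/-- A tournament tree with `n` leaves: node `i` holds the index with the larger key among those
held by its children `2 * i` and `2 * i + 1`; leaf `l` is node `n + l`. -/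
def Tour (n : ℕ) (key : ℕ → ℝ) (node : ℕ → ℕ) : Prop :=
  ∀ i, 1 ≤ i → i < n → node i =
    if key (node (2 * i)) < key (node (2 * i + 1)) then node (2 * i + 1) else node (2 * i)

/-- Repeated halving leads from every index to `1`, whether or not the number of leaves is a power
of two. -/
theorem Tour.le_root {n : ℕ} {key : ℕ → ℝ} {node : ℕ → ℕ} (h : Tour n key node) (i : ℕ)
    (hi : 1 ≤ i) (hn : i < 2 * n) : key (node i) ≤ key (node 1) := by
  induction i using Nat.strong_induction_on with
  | _ i ih =>
    rcases Nat.eq_or_lt_of_le hi with rfl | hi'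
    · exact le_rfl
    · refine le_trans ?_ (ih (i / 2) (by omega) (by omega) (by omega))
      rw [h (i / 2) (by omega) (by omega)]
      rcases Nat.even_or_odd' i with ⟨k, rfl | rfl⟩
      · rw [show 2 * k / 2 = k by omega]
        split_ifs with hk
        · exact hk.le
        · exact le_rfl
      · rw [show (2 * k + 1) / 2 = k by omega]
        split_ifs with hk
        · exact le_rfl
        · exact not_lt.1 hk

theorem Tour.eq_leaf {n : ℕ} {key : ℕ → ℝ} {node : ℕ → ℕ} (h : Tour n key node) (i : ℕ)
    (hi : 1 ≤ i) (hn : i < 2 * n) : ∃ l < n, node i = node (n + l) := by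
  induction hk : 2 * n - i using Nat.strong_induction_on generalizing i with
  | _ k ih =>
    by_cases hin : i < n
    · rw [h i hi hin]
      split_ifs
      · exact ih _ (by omega) (2 * i + 1) (by omega) (by omega) rfl
      · exact ih _ (by omega) (2 * i) (by omega) (by omega) rfl
    · exact ⟨i - n, by omega, by congr 1; omega⟩

/-- The key of an index may be changed freely while no node holds that index. -/
theorem Tour.update_key {n : ℕ} {key : ℕ → ℝ} {node : ℕ → ℕ} (h : Tour n key node) {x : ℕ} {v : ℝ}
    (hx : ∀ i, 1 ≤ i → i < 2 * n → node i ≠ x) : Tour n (Function.update key x v) node := by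
  intro i hi hn
  rw [h i hi hn, Function.update_of_ne (hx _ (by omega) (by omega)),
    Function.update_of_ne (hx _ (by omega) (by omega))]

theorem Tour.zero (n : ℕ) (key : ℕ → ℝ) {node : ℕ → ℕ} (h : ∀ i, node i = 0) : Tour n key node := by
  intro i _ _
  simp [h]

/-- Put the word in register 42 at leaf (register 41) of the tournament tree with as many leaves
as register 10 tells; the nodes are in word array 5, the keys in real array 2. -/
def setLeaf : HL :=
  .wsto 5 (.reg 10 + .reg 41) (.reg 42) ⨟ .wset 43 ((.reg 10 + .reg 41) / .const 2) ⨟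
  .wset 44 (.const 0) ⨟
  .loopWhile 44 43 (.ite (.rlt (.load 2 (.load 5 (.const 2 * .reg 43)))
      (.load 2 (.load 5 (.const 2 * .reg 43 + .const 1))))
    (.wsto 5 (.reg 43) (.load 5 (.const 2 * .reg 43 + .const 1)))
    (.wsto 5 (.reg 43) (.load 5 (.const 2 * .reg 43))) ⨟
    .wset 43 (.reg 43 / .const 2))

/-- Changing a leaf can spoil only the nodes above it; these are recomputed from the bottom up. -/
theorem setLeaf_spec {w : ℕ} {β : ℕ → ℕ} {s : State} {n l v : ℕ} (h10 : s.wreg 10 = n)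
    (h41 : s.wreg 41 = l) (h42 : s.wreg 42 = v) (hl : l < n) (hn : 2 * n + 2 ≤ 2 ^ w)
    (hβ : 2 * n ≤ 2 ^ β 43) (hT : Tour n (s.rarr 2) (s.warr 5)) :
    HT β w setLeaf s (fun s' => Tour n (s'.rarr 2) (s'.warr 5) ∧
      (∀ l' < n, s'.warr 5 (n + l') = if l' = l then v else s.warr 5 (n + l')) ∧
      ∀ i, i = 0 ∨ 2 * n ≤ i → s'.warr 5 i = s.warr 5 i) := by
  classical
  refine HT.seq (HT.of_wp ?_)
  simp only [HL.wp, WE.ok_add, WE.ok_reg, WE.eval_add, WE.eval_reg, true_and, h10, h41, h42]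
  refine ⟨by omega, ?_⟩
  refine HT.seq (HT.of_wp ?_)
  simp only [HL.wp, WE.ok_add, WE.ok_reg, WE.eval_add, WE.eval_reg, true_and, h10, h41,
    WE.ok_div, WE.eval_div, WE.ok_const, WE.eval_const, State.setWA_wreg]
  refine ⟨by omega, ?_⟩
  refine HT.seq (HT.of_wp ?_)
  simp only [HL.wp, WE.ok_const, WE.eval_const]
  refine ⟨by omega, ?_⟩
  set s0 := ((s.setWA 5 (n + l) v).setW 43 ((n + l) / 2)).setW 44 0 with hs0
  have e43 : s0.wreg 43 = (n + l) / 2 := by simp [hs0]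
  have e44 : s0.wreg 44 = 0 := by simp [hs0]
  have a5 : s0.warr 5 = Function.update (s.warr 5) (n + l) v := by simp [hs0]
  have b2 : s0.rarr 2 = s.rarr 2 := rfl
  clear_value s0
  -- The index `r` bounds the number of halvings still possible. The nodes that may be wrong are the
  -- current one and its ancestors, that is `s'.wreg 43 / 2 ^ e` for all `e`.
  refine HT.loopWhile (fun r s' => s'.wreg 43 < 2 ^ r ∧ s'.wreg 43 < n ∧
      (∀ i, 1 ≤ i → i < n → (∀ e, i ≠ s'.wreg 43 / 2 ^ e) → s'.warr 5 i =
        if s.rarr 2 (s'.warr 5 (2 * i)) < s.rarr 2 (s'.warr 5 (2 * i + 1)) then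
          s'.warr 5 (2 * i + 1) else s'.warr 5 (2 * i)) ∧
      (∀ l' < n, s'.warr 5 (n + l') = if l' = l then v else s.warr 5 (n + l')) ∧
      ∀ i, i = 0 ∨ 2 * n ≤ i → s'.warr 5 i = s.warr 5 i) ?_ ?_ ?_
  · refine ⟨by omega, by omega, ?_, ?_, ?_⟩
    · intro i h1 h2 he
      have h3 : i ≠ (n + l) / 2 := by simpa [e43] using he 0
      rw [a5, Function.update_of_ne (by omega), Function.update_of_ne (by omega),
        Function.update_of_ne (by omega)]
      exact hT i h1 h2
    · intro l' hl'
      rw [a5, Function.update_apply]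
      simp
    · intro i hi
      rw [a5, Function.update_of_ne (by omega)]
  · intro r s1 hk ⟨i1, i2, i3, i4, i5⟩ hlt
    have k44 : s1.wreg 44 = 0 := Eq.trans (hk (.w 44) rfl) e44
    have k2 : s1.rarr 2 = s.rarr 2 := Eq.trans (hk (.ra 2) rfl) b2
    rw [k44] at hlt
    obtain ⟨r', rfl⟩ : ∃ r', r = r' + 1 := by
      cases r with
      | zero => simp at i1; omega
      | succ r => exact ⟨r, rfl⟩
    refine ⟨r', rfl, ?_⟩
    generalize hi : s1.wreg 43 = i at *
    have step : ∀ u : ℕ, u = (if s.rarr 2 (s1.warr 5 (2 * i)) < s.rarr 2 (s1.warr 5 (2 * i + 1))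
        then s1.warr 5 (2 * i + 1) else s1.warr 5 (2 * i)) →
        i / 2 < 2 ^ r' ∧ i / 2 < n ∧
        (∀ j, 1 ≤ j → j < n → (∀ e, j ≠ i / 2 / 2 ^ e) → Function.update (s1.warr 5) i u j =
          if s.rarr 2 (Function.update (s1.warr 5) i u (2 * j)) <
            s.rarr 2 (Function.update (s1.warr 5) i u (2 * j + 1)) then
            Function.update (s1.warr 5) i u (2 * j + 1)
          else Function.update (s1.warr 5) i u (2 * j)) ∧
        (∀ l' < n, Function.update (s1.warr 5) i u (n + l') =
          if l' = l then v else s.warr 5 (n + l')) ∧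
        ∀ j, j = 0 ∨ 2 * n ≤ j → Function.update (s1.warr 5) i u j = s.warr 5 j := by
      intro u hu
      refine ⟨by rw [pow_succ] at i1; omega, by omega, ?_, ?_, ?_⟩
      · intro j h1 h2 he
        have h3 : j ≠ i / 2 := by simpa using he 0
        rw [Function.update_of_ne (show 2 * j ≠ i by omega),
          Function.update_of_ne (show 2 * j + 1 ≠ i by omega)]
        by_cases hji : j = i
        · subst hji
          rw [Function.update_self]
          exact hu
        · rw [Function.update_of_ne hji]
          refine i3 j h1 h2 fun e => ?_
          cases e with
          | zero => simpa using hji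
          | succ e =>
            rw [pow_succ', ← Nat.div_div_eq_div_mul]
            exact he e
      · intro l' hl'
        rw [Function.update_of_ne (by omega)]
        exact i4 l' hl'
      · intro j hj
        rw [Function.update_of_ne (by omega)]
        exact i5 j hj
    refine HT.of_wp ?_
    simp only [HL.wp, HC.ok_rlt, RE.ok_load, WE.ok_load, WE.ok_mul, WE.ok_add, WE.ok_div,
      WE.ok_const, WE.ok_reg, WE.eval_mul, WE.eval_add, WE.eval_div, WE.eval_const, WE.eval_reg,
      WE.eval_load, HC.holds_rlt, RE.eval_load, hi, k2, State.setWA_wreg, State.setW_wreg,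
      State.setWA_warr, State.setW_warr, if_true, true_and]
    refine ⟨by omega, fun hc => ⟨by omega, by omega, ?_⟩, fun hc => ⟨by omega, by omega, ?_⟩⟩
    · exact step _ (by rw [if_pos hc])
    · exact step _ (by rw [if_neg hc])
  · intro r s1 hk ⟨i1, i2, i3, i4, i5⟩ hlt
    have k44 : s1.wreg 44 = 0 := Eq.trans (hk (.w 44) rfl) e44
    have k2 : s1.rarr 2 = s.rarr 2 := Eq.trans (hk (.ra 2) rfl) b2
    have k43 : s1.wreg 43 = 0 := by omega
    refine ⟨?_, i4, i5⟩
    intro i h1 h2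
    rw [k2]
    refine i3 i h1 h2 fun e => ?_
    rw [k43, Nat.zero_div]
    omega

/-! ### Rank codes -/

/-- Real registers 2 and 3 := minimum and maximum of the entries in real array 1; the entries become
the keys `1, 2, …` in real array 2, and key `0` is smaller than all of them. -/
def rankKeys : HL :=
  .rset 2 (.load 1 (.const 0)) ⨟ .rset 3 (.load 1 (.const 0)) ⨟
  .loopTo 50 5 (
    .ite (.rlt (.load 1 (.reg 50)) (.reg 2)) (.rset 2 (.load 1 (.reg 50))) .skip ⨟
    .ite (.rlt (.reg 3) (.load 1 (.reg 50))) (.rset 3 (.load 1 (.reg 50))) .skip ⨟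
    .rsto 2 (.reg 50 + .const 1) (.load 1 (.reg 50))) ⨟
  .rsto 2 (.const 0) (.reg 2 - .ofW (.const 1))

/-- Put all entries into the tournament tree. -/
def rankInsert : HL :=
  .wset 10 (.reg 5 + .const 1) ⨟
  .loopTo 50 5 (.wset 41 (.reg 50 + .const 1) ⨟ .wset 42 (.reg 50 + .const 1) ⨟ setLeaf)

/-- Extract the entries in descending order; word array 4 := their rank codes. -/
def rankExtract : HL :=
  .wset 51 (.const 0) ⨟ .rset 4 (.reg 3 + .ofW (.const 1)) ⨟
  .loopTo 50 5 (.wset 41 (.load 5 (.const 1)) ⨟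
    .ite (.rlt (.load 2 (.reg 41)) (.reg 4)) (.wset 51 (.reg 51 + .const 1)) .skip ⨟
    .rset 4 (.load 2 (.reg 41)) ⨟ .wsto 4 (.reg 41) (.reg 51) ⨟ .wset 42 (.const 0) ⨟ setLeaf)

/-- Word array 4 := rank codes of the entries in real array 1. Real registers 2 and 3 hold a lower
and an upper bound of the entries. -/
def rankAll : HL := rankKeys ⨟ rankInsert ⨟ rankExtract

namespace Cx

variable {s s' : State} {c : Cx}

theorem Good.tour_lt (hg : c.Good) : 2 * (c.nv + 1) + 2 ≤ 2 ^ c.w := by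
  refine le_trans ?_ hg.big_key
  calc 2 * (c.nv + 1) + 2 = 2 * (c.nv + 2) := by ring
    _ ≤ (c.nv + 2) * (c.nv + 2) := Nat.mul_le_mul_right _ (by omega)
    _ = (c.nv + 2) ^ 2 := by ring
    _ ≤ _ := Nat.pow_le_pow_right (by omega) (by omega)

/-- The state of the extraction loop of `rankAll`: the entries in `R` are extracted, the last of
them is `prev` and has code `rk`. -/
structure Extracted (n : ℕ) (key : ℕ → ℝ) (node ids : ℕ → ℕ) (prev : ℝ) (rk : ℕ)
    (R : Finset ℕ) : Prop where
  sub : R ⊆ Finset.Icc 1 n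
  tour : Tour (n + 1) key node
  leaf : ∀ l < n + 1, node (n + 1 + l) = if l ∈ R ∨ l = 0 then 0 else l
  out : ∀ i, i = 0 ∨ 2 * (n + 1) ≤ i → node i = 0
  sentinel : ∀ l ∈ Finset.Icc 1 n, key 0 < key l
  rk_le : rk ≤ R.card
  start : 1 ≤ rk ∨ ∀ l ∈ Finset.Icc 1 n, key l < prev
  done : ∀ l ∈ R, prev ≤ key l ∧ 1 ≤ ids l ∧ ids l ≤ rk ∧ (ids l = rk ↔ key l = prev)
  eq_iff : ∀ l ∈ R, ∀ l' ∈ R, ids l = ids l' ↔ key l = key l'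
  todo : ∀ l ∈ Finset.Icc 1 n, l ∉ R → key l ≤ prev

/-- Leaves of extracted indices hold the sentinel `0`, whose key is below all others. As long as an
index remains, the root therefore holds a remaining index of maximal key. -/
theorem Extracted.pop {n : ℕ} {key : ℕ → ℝ} {node ids : ℕ → ℕ} {prev : ℝ} {rk : ℕ}
    {R : Finset ℕ} (h : Extracted n key node ids prev rk R) (hR : R.card < n) :
    node 1 ∈ Finset.Icc 1 n ∧ node 1 ∉ R ∧
      ∀ l ∈ Finset.Icc 1 n, l ∉ R → key l ≤ key (node 1) := by
  have hmax : ∀ l ∈ Finset.Icc 1 n, l ∉ R → key l ≤ key (node 1) := by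
    intro l hl hlR
    rw [Finset.mem_Icc] at hl
    have := h.tour.le_root (n + 1 + l) (by omega) (by omega)
    rwa [h.leaf l (by omega), if_neg (by simp only [hlR, false_or]; omega)] at this
  obtain ⟨l0, hl0, hlR⟩ : ∃ l ∈ Finset.Icc 1 n, l ∉ R := by
    by_contra! hcon
    have := Finset.card_le_card (s := Finset.Icc 1 n) (t := R) hcon
    simp at this
    omega
  have hne : node 1 ≠ 0 := by
    intro h0
    have h1 := hmax l0 hl0 hlR
    rw [h0] at h1
    exact absurd (h.sentinel l0 hl0) (not_lt.2 h1)
  obtain ⟨l, hl, e⟩ := h.tour.eq_leaf 1 le_rfl (by omega)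
  rw [h.leaf l hl] at e
  split_ifs at e with hc
  · exact absurd e hne
  · push Not at hc
    rw [e]
    exact ⟨Finset.mem_Icc.2 (by omega), hc.1, by rw [← e]; exact hmax⟩

open Classical in
-- Keys leave the tree in descending order, so equal keys are consecutive. A new code is issued
-- exactly when the key drops below the previous one.
theorem Extracted.step {n : ℕ} {key : ℕ → ℝ} {node ids : ℕ → ℕ} {prev : ℝ} {rk : ℕ}
    {R : Finset ℕ} (h : Extracted n key node ids prev rk R) (hR : R.card < n) {node' : ℕ → ℕ}
    (hT : Tour (n + 1) key node')
    (hl : ∀ l < n + 1, node' (n + 1 + l) = if l = node 1 then 0 else node (n + 1 + l))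
    (ho : ∀ i, i = 0 ∨ 2 * (n + 1) ≤ i → node' i = node i) {rk' : ℕ}
    (hrk : rk' = if key (node 1) < prev then rk + 1 else rk) :
    Extracted n key node' (Function.update ids (node 1) rk') (key (node 1)) rk'
      (insert (node 1) R) := by
  obtain ⟨p1, p2, p3⟩ := h.pop hR
  have hne : ∀ l ∈ R, l ≠ node 1 := by rintro l hl rfl; exact p2 hl
  -- Equality with `prev` is possible only after a first extraction, since `prev` starts above all
  -- keys; hence `1 ≤ rk` in that case.
  have hcase : (key (node 1) < prev ∧ rk' = rk + 1) ∨ (key (node 1) = prev ∧ rk' = rk ∧ 1 ≤ rk) := by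
    split_ifs at hrk with hc
    · exact Or.inl ⟨hc, hrk⟩
    · have := h.todo _ p1 p2
      refine Or.inr ⟨le_antisymm this (not_lt.1 hc), hrk, ?_⟩
      rcases h.start with h1 | h1
      · exact h1
      · exact absurd (h1 _ p1) hc
  have hnew : ∀ l ∈ R, (ids l = rk' ↔ key l = key (node 1)) ∧ key (node 1) ≤ key l ∧
      1 ≤ ids l ∧ ids l ≤ rk' := by
    intro l hl
    obtain ⟨d1, d2, d3, d4⟩ := h.done l hl
    rcases hcase with ⟨c1, c2⟩ | ⟨c1, c2, c3⟩
    · refine ⟨⟨fun e => ?_, fun e => ?_⟩, by linarith, d2, by omega⟩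
      · omega
      · linarith
    · rw [c1, c2]
      exact ⟨d4, d1, d2, d3⟩
  refine ⟨?_, hT, ?_, ?_, h.sentinel, ?_, ?_, ?_, ?_, ?_⟩
  · exact Finset.insert_subset p1 h.sub
  · intro l hl'
    rw [hl l hl', h.leaf l hl']
    by_cases e : l = node 1
    · simp [e]
    · simp [e]
  · intro i hi
    rw [ho i hi, h.out i hi]
  · rw [Finset.card_insert_of_notMem p2]
    have := h.rk_le
    rcases hcase with ⟨-, c2⟩ | ⟨-, c2, -⟩ <;> omega
  · left
    rcases hcase with ⟨-, c2⟩ | ⟨-, c2, c3⟩ <;> omega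
  · intro l hl'
    rcases Finset.mem_insert.1 hl' with rfl | hl'
    · simp only [Function.update_self, le_refl, true_and, and_true]
      rcases hcase with ⟨-, c2⟩ | ⟨-, c2, c3⟩ <;> omega
    · rw [Function.update_of_ne (hne l hl')]
      obtain ⟨a1, a2, a3, a4⟩ := hnew l hl'
      exact ⟨a2, a3, a4, a1⟩
  · intro l hl' l' hl''
    rcases Finset.mem_insert.1 hl' with rfl | hl' <;> rcases Finset.mem_insert.1 hl'' with rfl | hl''
    · simp
    · rw [Function.update_self, Function.update_of_ne (hne l' hl'')]
      have := (hnew l' hl'').1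
      constructor
      · intro e; exact (this.1 e.symm).symm
      · intro e; exact (this.2 e.symm).symm
    · rw [Function.update_self, Function.update_of_ne (hne l hl')]
      exact (hnew l hl').1
    · rw [Function.update_of_ne (hne l hl'), Function.update_of_ne (hne l' hl'')]
      exact h.eq_iff l hl' l' hl''
  · intro l hl' hl''
    rw [Finset.mem_insert, not_or] at hl''
    exact p3 l hl' hl''.2

end Cx

end RealRAM

namespace RealRAM

namespace Cx

variable {s s' : State} {c : Cx}

theorem rankKeys_spec (hg : c.Good) (hB : c.Base s) :
    HT c.β c.w rankKeys s (fun s' => (∀ x < c.nv, s'.rreg 2 ≤ c.V x ∧ c.V x ≤ s'.rreg 3) ∧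
      (∀ x < c.nv, s'.rarr 2 (x + 1) = c.V x) ∧ s'.rarr 2 0 = s'.rreg 2 - 1) := by
  have hnv := hg.nv_lt.1
  have hw := hg.w_ne
  refine HT.seq (HT.of_wp ?_)
  simp only [HL.wp, RE.ok_load, WE.ok_const]
  refine ⟨by omega, ?_⟩
  refine HT.seq (HT.of_wp ?_)
  simp only [HL.wp, RE.ok_load, WE.ok_const]
  refine ⟨by omega, ?_⟩
  set s0 := (s.setR 2 _).setR 3 _ with hs0
  have hB0 : c.Base s0 := hB.setR.setR
  clear_value s0
  refine HT.seq' (HT.loopTo (Q := fun s' => (∀ x < c.nv, s'.rreg 2 ≤ c.V x ∧ c.V x ≤ s'.rreg 3) ∧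
      (∀ x < c.nv, s'.rarr 2 (x + 1) = c.V x))
    (fun n s' => (∀ x < n, s'.rreg 2 ≤ c.V x ∧ c.V x ≤ s'.rreg 3) ∧
      (∀ x < n, s'.rarr 2 (x + 1) = c.V x)) ⟨rfl, rfl, by decide⟩
    (by rw [hB0.r5]; exact hg.β5) (by rw [hB0.r5]; omega) (by simp) ?_ ?_) ?_
  · intro n s1 hn hn1 hk ⟨i1, i2⟩
    rw [hB0.r5] at hn
    have hB1 := hB0.keep hk rfl
    have i2' : ∀ x < n + 1, Function.update (s1.rarr 2) (n + 1) (c.V n) (x + 1) = c.V x := by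
      intro x hx
      rcases Nat.lt_succ_iff_lt_or_eq.1 hx with hx | rfl
      · rw [Function.update_of_ne (by omega), i2 x hx]
      · simp
    have i1' : ∀ lo hi : ℝ, lo ≤ c.V n → c.V n ≤ hi → lo ≤ s1.rreg 2 → s1.rreg 3 ≤ hi →
        ∀ x < n + 1, lo ≤ c.V x ∧ c.V x ≤ hi := by
      intro lo hi h1 h2 h3 h4 x hx
      rcases Nat.lt_succ_iff_lt_or_eq.1 hx with hx | rfl
      · exact ⟨h3.trans (i1 x hx).1, (i1 x hx).2.trans h4⟩
      · exact ⟨h1, h2⟩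
    refine HT.of_wp ?_
    simp only [HL.wp, HC.ok_rlt, RE.ok_load, WE.ok_reg, RE.ok_reg, HC.holds_rlt, RE.eval_load,
      RE.eval_reg, WE.eval_reg, WE.ok_add, WE.eval_add, WE.ok_const, WE.eval_const, true_and, hn1,
      State.setR_wreg, State.setR_rarr, State.setR_rreg, State.setRA_rreg, State.setRA_rarr,
      State.setW_rreg, State.setW_rarr, hB1.V, not_lt]
    norm_num [-Order.lt_add_one_iff]
    have e1 : n + 1 < 2 ^ c.w := by omega
    simp only [hw, e1, not_false_eq_true, true_and]
    refine ⟨fun h1 => ⟨fun h2 => ⟨?_, i2'⟩, fun h2 => ⟨?_, i2'⟩⟩,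
      fun h1 => ⟨fun h2 => ⟨?_, i2'⟩, fun h2 => ⟨?_, i2'⟩⟩⟩
    · exact i1' _ _ le_rfl le_rfl h1.le h2.le
    · exact i1' _ _ le_rfl h2 h1.le le_rfl
    · exact i1' _ _ h1 le_rfl le_rfl h2.le
    · exact i1' _ _ h1 h2 le_rfl le_rfl
  · intro s1 _ _ hI
    rwa [hB0.r5] at hI
  · rintro s1 ⟨h1, h2⟩ -
    refine HT.of_wp ?_
    simp [HL.wp, hw]
    exact ⟨h1, h2⟩

theorem rankInsert_spec (hg : c.Good) (hB : c.Base s) (h5 : ∀ i, s.warr 5 i = 0) :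
    HT c.β c.w rankInsert s (fun s' => s'.wreg 10 = c.nv + 1 ∧
      Tour (c.nv + 1) (s'.rarr 2) (s'.warr 5) ∧
      (∀ l < c.nv + 1, s'.warr 5 (c.nv + 1 + l) = l) ∧
      ∀ i, i = 0 ∨ 2 * (c.nv + 1) ≤ i → s'.warr 5 i = 0) := by
  have hnv := hg.tour_lt
  have hw := hg.w_ne
  refine HT.seq (HT.of_wp ?_)
  simp only [HL.wp, WE.ok_add, WE.ok_reg, WE.ok_const, WE.eval_add, WE.eval_reg, WE.eval_const,
    hB.r5, true_and]
  refine ⟨by omega, ?_⟩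
  set s0 := s.setW 10 _ with hs0
  have hB0 : c.Base s0 := hB.setW (by decide)
  have e10 : s0.wreg 10 = c.nv + 1 := by simp [hs0]
  have e5 : ∀ i, s0.warr 5 i = 0 := h5
  clear_value s0
  refine HT.loopTo (fun n s' => Tour (c.nv + 1) (s'.rarr 2) (s'.warr 5) ∧
      (∀ l < c.nv + 1, s'.warr 5 (c.nv + 1 + l) = if l ≤ n then l else 0) ∧
      ∀ i, i = 0 ∨ 2 * (c.nv + 1) ≤ i → s'.warr 5 i = 0) ⟨rfl, rfl, by decide⟩
    (by rw [hB0.r5]; exact hg.β5) (by rw [hB0.r5]; omega) ?_ ?_ ?_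
  · refine ⟨Tour.zero _ _ e5, fun l hl => ?_, fun i _ => e5 i⟩
    simp only [State.setW_warr, e5]
    split_ifs <;> omega
  · intro n s1 hn hn1 hk ⟨i1, i2, i3⟩
    rw [hB0.r5] at hn
    have f10 : s1.wreg 10 = c.nv + 1 := Eq.trans (hk (.w 10) rfl) e10
    refine HT.seq (HT.of_wp ?_)
    simp only [HL.wp, WE.ok_add, WE.ok_reg, WE.ok_const, WE.eval_add, WE.eval_reg, WE.eval_const,
      hn1, true_and]
    refine ⟨by omega, ?_⟩
    refine HT.seq (HT.of_wp ?_)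
    simp only [HL.wp, WE.ok_add, WE.ok_reg, WE.ok_const, WE.eval_add, WE.eval_reg, WE.eval_const,
      true_and, State.setW_wreg, hn1]
    refine ⟨by simp; omega, ?_⟩
    set s2 := (s1.setW 41 (n + 1)).setW 42 _ with hs2
    have g10 : s2.wreg 10 = c.nv + 1 := by simp [hs2, f10]
    have g41 : s2.wreg 41 = n + 1 := by simp [hs2]
    have g42 : s2.wreg 42 = n + 1 := by simp [hs2]
    refine (setLeaf_spec g10 g41 g42 (by omega) hnv hg.β43.1 i1).mono ?_
    rintro s3 ⟨j1, j2, j3⟩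
    refine ⟨j1, fun l hl => ?_, fun i hi => (j3 i hi).trans (i3 i hi)⟩
    simp only [State.setW_warr]
    rw [j2 l hl]
    have : s2.warr 5 (c.nv + 1 + l) = if l ≤ n then l else 0 := i2 l hl
    rw [this]
    split_ifs <;> omega
  · intro s1 _ hk ⟨i1, i2, i3⟩
    rw [hB0.r5] at i2
    refine ⟨Eq.trans (hk (.w 10) rfl) e10, i1, fun l hl => ?_, i3⟩
    rw [i2 l hl, if_pos (by omega)]

/-- The first comparison value is the maximum plus one, so codes start at `1`. At the end all
leaves, and with them all nodes, hold `0`; the node array is clean again for the tree of cells. -/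
theorem rankExtract_spec (hg : c.Good) (hB : c.Base s) (h10 : s.wreg 10 = c.nv + 1)
    (hT : Tour (c.nv + 1) (s.rarr 2) (s.warr 5))
    (hl : ∀ l < c.nv + 1, s.warr 5 (c.nv + 1 + l) = l)
    (ho : ∀ i, i = 0 ∨ 2 * (c.nv + 1) ≤ i → s.warr 5 i = 0)
    (hV : ∀ x < c.nv, s.rreg 2 ≤ c.V x ∧ c.V x ≤ s.rreg 3)
    (hkey : ∀ x < c.nv, s.rarr 2 (x + 1) = c.V x) (hkey0 : s.rarr 2 0 = s.rreg 2 - 1) :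
    HT c.β c.w rankExtract s (fun s' => (∀ i, s'.warr 5 i = 0) ∧
      Ranked { c with ids := s'.warr 4 }) := by
  have hnv := hg.tour_lt
  have hw := hg.w_ne
  refine HT.seq (HT.of_wp ?_)
  simp only [HL.wp, WE.ok_const, WE.eval_const]
  refine ⟨by omega, ?_⟩
  refine HT.seq (HT.of_wp ?_)
  simp only [HL.wp, RE.ok_add, RE.ok_reg, RE.ok_ofW, WE.ok_const, true_and, RE.eval_add,
    RE.eval_reg, RE.eval_ofW, WE.eval_const]
  refine ⟨by omega, ?_⟩
  set s0 := (s.setW 51 0).setR 4 _ with hs0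
  have hB0 : c.Base s0 := (hB.setW (by decide)).setR
  have e10 : s0.wreg 10 = c.nv + 1 := by simp [hs0, h10]
  have e51 : s0.wreg 51 = 0 := by simp [hs0]
  have e4 : s0.rreg 4 = s.rreg 3 + 1 := by simp [hs0]
  have e5 : s0.warr 5 = s.warr 5 := rfl
  have b2 : s0.rarr 2 = s.rarr 2 := rfl
  clear_value s0
  have hkey' : ∀ l ∈ Finset.Icc 1 c.nv, s.rarr 2 0 < s.rarr 2 l ∧ s.rarr 2 l < s.rreg 3 + 1 := by
    intro l hl
    rw [Finset.mem_Icc] at hl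
    obtain ⟨x, rfl⟩ : ∃ x, l = x + 1 := ⟨l - 1, by omega⟩
    have := hV x (by omega)
    rw [hkey x (by omega), hkey0]
    constructor <;> linarith
  refine HT.loopTo (fun n s' => ∃ R : Finset ℕ, R.card = n ∧
      Extracted c.nv (s.rarr 2) (s'.warr 5) (s'.warr 4) (s'.rreg 4) (s'.wreg 51) R)
    ⟨rfl, rfl, by decide⟩ (by rw [hB0.r5]; exact hg.β5) (by rw [hB0.r5]; omega) ?_ ?_ ?_
  · refine ⟨∅, rfl, ⟨by simp, ?_, fun l hll => ?_, ?_, fun l hl => (hkey' l hl).1, by simp [e51],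
      Or.inr fun l hl => ?_, by simp, by simp, fun l hl _ => ?_⟩⟩
    · simpa [e5] using hT
    · simp only [State.setW_warr, e5]
      rw [hl l hll]
      simp
    · simpa [e5] using ho
    · simpa [e4] using (hkey' l hl).2
    · simpa [e4] using (hkey' l hl).2.le
  · rintro n s1 hn hn1 hk ⟨R, hRn, hI⟩
    rw [hB0.r5] at hn
    have f10 : s1.wreg 10 = c.nv + 1 := Eq.trans (hk (.w 10) rfl) e10
    have f2 : s1.rarr 2 = s.rarr 2 := Eq.trans (hk (.ra 2) rfl) b2
    obtain ⟨p1, p2, -⟩ := hI.pop (by omega)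
    rw [Finset.mem_Icc] at p1
    have hrk := hI.rk_le
    refine HT.seq (HT.of_wp ?_)
    simp only [HL.wp, WE.ok_load, WE.ok_const, WE.eval_load, WE.eval_const]
    refine ⟨by omega, ?_⟩
    classical
    set rk' := if s.rarr 2 (s1.warr 5 1) < s1.rreg 4 then s1.wreg 51 + 1 else s1.wreg 51 with hrk'
    refine HT.seq' (R := fun s' => s'.wreg 51 = rk') (HT.of_wp ?_) ?_
    · simp only [HL.wp, HC.ok_rlt, RE.ok_load, WE.ok_reg, RE.ok_reg, HC.holds_rlt, RE.eval_load,
        WE.eval_reg, State.setW_wreg, State.setW_rarr, if_true, RE.eval_reg, State.setW_rreg,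
        WE.ok_add, WE.eval_add, WE.ok_const, WE.eval_const, true_and, f2]
      refine ⟨fun h => ⟨by simp [hw]; omega, ?_⟩, fun h => ?_⟩
      · rw [hrk', if_pos h]
        simp
      · rw [hrk', if_neg h]
        simp
    intro s2 h51 hk2
    have g41 : s2.wreg 41 = s1.warr 5 1 := Eq.trans (hk2 (.w 41) rfl) (by simp)
    have g10 : s2.wreg 10 = c.nv + 1 := Eq.trans (hk2 (.w 10) rfl) (by simp [f10])
    have g2 : s2.rarr 2 = s.rarr 2 := Eq.trans (hk2 (.ra 2) rfl) f2
    have g5 : s2.warr 5 = s1.warr 5 := hk2 (.wa 5) rfl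
    have g4 : s2.warr 4 = s1.warr 4 := hk2 (.wa 4) rfl
    refine HT.seq (HT.of_wp ?_)
    simp only [HL.wp, RE.ok_load, WE.ok_reg, RE.eval_load, WE.eval_reg, true_and, g41, g2]
    refine HT.seq (HT.of_wp ?_)
    simp only [HL.wp, WE.ok_reg, WE.eval_reg, true_and, State.setR_wreg, g41, h51]
    refine HT.seq (HT.of_wp ?_)
    simp only [HL.wp, WE.ok_const, WE.eval_const]
    refine ⟨by omega, ?_⟩
    set s3 := State.setW _ 42 0 with hs3
    have m41 : s3.wreg 41 = s1.warr 5 1 := by simp [hs3, g41]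
    have m10 : s3.wreg 10 = c.nv + 1 := by simp [hs3, g10]
    have m42 : s3.wreg 42 = 0 := by simp [hs3]
    have m2 : s3.rarr 2 = s.rarr 2 := g2
    have m5 : s3.warr 5 = s1.warr 5 := by simp [hs3, g5]
    have m4 : s3.warr 4 = Function.update (s1.warr 4) (s1.warr 5 1) rk' := by simp [hs3, g4]
    have mr4 : s3.rreg 4 = s.rarr 2 (s1.warr 5 1) := by simp [hs3]
    have m51 : s3.wreg 51 = rk' := by simp [hs3, h51]
    clear_value s3
    refine (setLeaf_spec m10 m41 m42 (by omega) hnv hg.β43.1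
      (by rw [m2, m5]; exact hI.tour)).keeps.mono ?_
    rintro s4 ⟨⟨j1, j2, j3⟩, hk4⟩
    have n2 : s4.rarr 2 = s.rarr 2 := Eq.trans (hk4 (.ra 2) rfl) m2
    have n4 : s4.warr 4 = s3.warr 4 := hk4 (.wa 4) rfl
    have nr4 : s4.rreg 4 = s3.rreg 4 := hk4 (.r 4) rfl
    have n51 : s4.wreg 51 = s3.wreg 51 := hk4 (.w 51) rfl
    refine ⟨insert (s1.warr 5 1) R, by rw [Finset.card_insert_of_notMem p2, hRn], ?_⟩
    simp only [State.setW_warr, State.setW_rreg, State.setW_wreg]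
    norm_num
    rw [n4, nr4, n51, m4, mr4, m51]
    rw [n2] at j1
    rw [m5] at j2 j3
    exact hI.step (by omega) j1 j2 j3 hrk'
  · rintro s1 _ hk ⟨R, hRn, hI⟩
    rw [hB0.r5] at hRn
    have hR : R = Finset.Icc 1 c.nv := Finset.eq_of_subset_of_card_le hI.sub (by simp [hRn])
    refine ⟨fun i => ?_, fun x hx => ?_, fun x hx => ?_, fun x hx y hy => ?_⟩
    · by_cases hi : i = 0 ∨ 2 * (c.nv + 1) ≤ i
      · exact hI.out i hi
      · obtain ⟨l, hl, e⟩ := hI.tour.eq_leaf i (by omega) (by omega)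
        rw [e, hI.leaf l hl, if_pos]
        rw [hR, Finset.mem_Icc]
        omega
    · exact (hI.done (x + 1) (by rw [hR, Finset.mem_Icc]; change x < c.nv at hx; omega)).2.1
    · have := (hI.done (x + 1) (by rw [hR, Finset.mem_Icc]; change x < c.nv at hx; omega)).2.2.1
      have h2 := hI.rk_le
      change s1.warr 4 (x + 1) ≤ c.nv
      omega
    · change x < c.nv at hx
      change y < c.nv at hy
      have := hI.eq_iff (x + 1) (by rw [hR, Finset.mem_Icc]; omega) (y + 1)
        (by rw [hR, Finset.mem_Icc]; omega)
      rw [hkey x hx, hkey y hy] at this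
      exact this

theorem rankAll_spec (hg : c.Good) (hB : c.Base s) (h5 : ∀ i, s.warr 5 i = 0) :
    HT c.β c.w rankAll s (fun s' => (∀ i, s'.warr 5 i = 0) ∧ Ranked { c with ids := s'.warr 4 } ∧
      ∀ x < c.nv, s'.rreg 2 ≤ c.V x ∧ c.V x ≤ s'.rreg 3) := by
  refine HT.seq' (rankKeys_spec hg hB) ?_
  rintro s1 ⟨h1, h2, h3⟩ hk1
  have hB1 := hB.keep hk1 rfl
  have e5 : s1.warr 5 = s.warr 5 := hk1 (.wa 5) rfl
  refine HT.seq' (rankInsert_spec hg hB1 (by rwa [e5])) ?_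
  rintro s2 ⟨i1, i2, i3, i4⟩ hk2
  have hB2 := hB1.keep hk2 rfl
  have b2 : s2.rarr 2 = s1.rarr 2 := hk2 (.ra 2) rfl
  have r2 : s2.rreg 2 = s1.rreg 2 := hk2 (.r 2) rfl
  have r3 : s2.rreg 3 = s1.rreg 3 := hk2 (.r 3) rfl
  refine (rankExtract_spec hg hB2 i1 i2 i3 i4 (by rwa [r2, r3]) (by rwa [b2])
    (by rwa [b2, r2])).keeps.mono ?_
  rintro s3 ⟨⟨j1, j2⟩, hk3⟩
  have q2 : s3.rreg 2 = s2.rreg 2 := hk3 (.r 2) rfl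
  have q3 : s3.rreg 3 = s2.rreg 3 := hk3 (.r 3) rfl
  exact ⟨j1, j2, by rwa [q2, q3, r2, r3]⟩

end Cx

end RealRAM

namespace RealRAM

/-! ### Cells and their longest tight sides -/

/-- Row `i` of a table with rows of length `d`. -/
def row (d : ℕ) (A : ℕ → ℝ) (i a : ℕ) : ℝ := A (i * d + a)

/-- Real register 0 := the longest side of the box with corners in real arrays 5 and 6; word
register 38 and real register 1 := its direction and its midpoint. -/
def longest : HL :=
  .rset 0 (.ofW (.const 0)) ⨟ .wset 38 (.const 0) ⨟ .rset 1 (.ofW (.const 0)) ⨟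
  .loopTo 35 2 (.ite (.rlt (.reg 0) (.load 6 (.reg 35) - .load 5 (.reg 35)))
    (.rset 0 (.load 6 (.reg 35) - .load 5 (.reg 35)) ⨟ .wset 38 (.reg 35) ⨟
      .rset 1 ((.load 5 (.reg 35) + .load 6 (.reg 35)) / .ofW (.const 2))) .skip)

/-- Real arrays 3 and 4 := the corners of cell (register 39). -/
def loadCell : HL :=
  .loopTo 35 2 (.rsto 3 (.reg 35) (.load 7 (.reg 39 * .reg 2 + .reg 35)) ⨟
    .rsto 4 (.reg 35) (.load 8 (.reg 39 * .reg 2 + .reg 35)))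

/-- Compute the longest tight side of cell (register 39) and put the cell into the tournament
tree. -/
def refresh : HL :=
  loadCell ⨟ reduce ⨟ longest ⨟ .rsto 2 (.reg 39) (.reg 0) ⨟ .wsto 9 (.reg 39) (.reg 38) ⨟
  .rsto 9 (.reg 39) (.reg 1) ⨟ .wset 41 (.reg 39) ⨟ .wset 42 (.reg 39) ⨟ setLeaf

namespace Cx

variable {s s' : State} {c : Cx}

theorem cell_congr {g g' h h' : ℕ → ℝ} (hg : ∀ a < c.d, g a = g' a) (hh : ∀ a < c.d, h a = h' a) :
    c.cell g h = c.cell g' h' := by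
  ext x
  simp only [cell, Set.mem_ofPred_eq]
  refine and_congr_right fun _ => forall_congr' fun a => ?_
  rw [hg a a.2, hh a a.2]

theorem cell_subset {g g' h h' : ℕ → ℝ} (hg : ∀ a < c.d, g' a ≤ g a) (hh : ∀ a < c.d, h a ≤ h' a) :
    c.cell g h ⊆ c.cell g' h' :=
  fun _ hx => ⟨hx.1, fun a => ⟨(hg a a.2).trans_lt (hx.2 a).1, (hx.2 a).2.trans (hh a a.2)⟩⟩

/-- The cell `(g, h]` contains a result, `L` is the longest side of the bounding box of its
results, and `dim` and `mid` are the direction and the midpoint of this side. -/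
structure Info (c : Cx) (g h : ℕ → ℝ) (L : ℝ) (dim : ℕ) (mid : ℝ) : Prop where
  ne : (c.cell g h).Nonempty
  nonneg : 0 ≤ L
  diam : ∀ x ∈ c.cell g h, ∀ y ∈ c.cell g h, ∀ a, x a - y a ≤ L
  side : 0 < L → ∃ hd : dim < c.d, ∃ x ∈ c.cell g h, ∃ y ∈ c.cell g h,
    x ⟨dim, hd⟩ + L / 2 = mid ∧ mid + L / 2 = y ⟨dim, hd⟩

/-- The longest tight side is spanned by two results of the cell, so it cannot be longer for a
smaller cell. -/
theorem Info.le {g h g' h' : ℕ → ℝ} {L L' mid mid' : ℝ} {dim dim' : ℕ}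
    (hi : c.Info g h L dim mid) (hi' : c.Info g' h' L' dim' mid')
    (hs : c.cell g' h' ⊆ c.cell g h) : L' ≤ L := by
  rcases hi'.nonneg.eq_or_lt with h0 | h0
  · rw [← h0]
    exact hi.nonneg
  · obtain ⟨hd, x, hx, y, hy, e1, e2⟩ := hi'.side h0
    have := hi.diam y (hs hy) x (hs hx) ⟨dim', hd⟩
    linarith

theorem Good.cells_lt (hg : c.Good) {i a : ℕ} (hi : i ≤ c.K + 1) (ha : a ≤ c.d) :
    i * c.d + a + 2 < 2 ^ c.w ∧ i + 2 < 2 ^ c.w ∧ 2 * (c.K + 2) + 2 ≤ 2 ^ c.w ∧ c.d + 2 < 2 ^ c.w := by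
  have h1 := hg.big_cells
  have h2 : i * c.d ≤ (c.K + 1) * c.d := Nat.mul_le_mul_right _ hi
  have h3 : 2 * (c.K + 3) * (c.d + 2) = 2 * ((c.K + 1) * c.d) + 4 * c.K + 4 * c.d + 12 := by ring
  omega

theorem longest_spec (hg : c.Good) (hE : c.Env s) :
    HT c.β c.w longest s (fun s' => 0 ≤ s'.rreg 0 ∧
      (∀ a < c.d, s.rarr 6 a - s.rarr 5 a ≤ s'.rreg 0) ∧
      (0 < s'.rreg 0 → s'.wreg 38 < c.d ∧
        s'.rreg 0 = s.rarr 6 (s'.wreg 38) - s.rarr 5 (s'.wreg 38) ∧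
        s'.rreg 1 = (s.rarr 5 (s'.wreg 38) + s.rarr 6 (s'.wreg 38)) / 2)) := by
  have hb := hg.cells_lt (i := 0) (a := 0) (by omega) (by omega)
  refine HT.seq (HT.of_wp ?_)
  simp only [HL.wp, RE.ok_ofW, WE.ok_const]
  refine ⟨by omega, ?_⟩
  refine HT.seq (HT.of_wp ?_)
  simp only [HL.wp, WE.ok_const]
  refine ⟨by omega, ?_⟩
  refine HT.seq (HT.of_wp ?_)
  simp only [HL.wp, RE.ok_ofW, WE.ok_const]
  refine ⟨by omega, ?_⟩
  set s0 := State.setR _ 1 _ with hs0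
  have hE0 : c.Env s0 := (hE.setR.setW (by decide)).setR
  have e0 : s0.rreg 0 = 0 := by simp [hs0]
  have e5 : s0.rarr 5 = s.rarr 5 := rfl
  have e6 : s0.rarr 6 = s.rarr 6 := rfl
  clear_value s0
  refine HT.loopTo (fun n s' => 0 ≤ s'.rreg 0 ∧
      (∀ a < n, s.rarr 6 a - s.rarr 5 a ≤ s'.rreg 0) ∧
      (0 < s'.rreg 0 → s'.wreg 38 < n ∧
        s'.rreg 0 = s.rarr 6 (s'.wreg 38) - s.rarr 5 (s'.wreg 38) ∧
        s'.rreg 1 = (s.rarr 5 (s'.wreg 38) + s.rarr 6 (s'.wreg 38)) / 2)) ⟨rfl, rfl, by decide⟩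
    (by rw [hE0.r2]; exact hg.β2) (by rw [hE0.r2]; omega) (by simp [e0]) ?_ ?_
  · rintro n s1 hn hn1 hk ⟨i1, i2, i3⟩
    have f5 : s1.rarr 5 = s.rarr 5 := Eq.trans (hk (.ra 5) rfl) e5
    have f6 : s1.rarr 6 = s.rarr 6 := Eq.trans (hk (.ra 6) rfl) e6
    refine HT.of_wp ?_
    simp [HL.wp, hn1, f5, f6, -Order.lt_add_one_iff]
    refine ⟨fun h => ⟨by omega, by linarith, fun a ha => ?_⟩, fun h => ⟨i1, fun a ha => ?_, ?_⟩⟩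
    · rcases Nat.lt_succ_iff_lt_or_eq.1 ha with ha | rfl
      · linarith [i2 a ha]
      · linarith
    · rcases Nat.lt_succ_iff_lt_or_eq.1 ha with ha | rfl
      · linarith [i2 a ha]
      · linarith
    · intro h0
      obtain ⟨j1, j2, j3⟩ := i3 h0
      exact ⟨by omega, j2, j3⟩
  · rintro s1 _ hk hI
    rwa [hE0.r2] at hI

theorem loadCell_spec (hg : c.Good) (hE : c.Env s) {i : ℕ} (h39 : s.wreg 39 = i)
    (hi : i ≤ c.K + 1) :
    HT c.β c.w loadCell s (fun s' => ∀ a < c.d, s'.rarr 3 a = row c.d (s.rarr 7) i a ∧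
      s'.rarr 4 a = row c.d (s.rarr 8) i a) := by
  have hb := hg.cells_lt (a := c.d) hi le_rfl
  refine HT.loopTo (fun n s' => ∀ a < n, s'.rarr 3 a = row c.d (s.rarr 7) i a ∧
      s'.rarr 4 a = row c.d (s.rarr 8) i a) ⟨rfl, rfl, by decide⟩
    (by rw [hE.r2]; exact hg.β2) (by rw [hE.r2]; omega) (by simp) ?_ ?_
  · intro n s1 hn hn1 hk hI
    rw [hE.r2] at hn
    have hE1 := hE.keep hk rfl
    have f39 : s1.wreg 39 = i := Eq.trans (hk (.w 39) rfl) h39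
    have f7 : s1.rarr 7 = s.rarr 7 := hk (.ra 7) rfl
    have f8 : s1.rarr 8 = s.rarr 8 := hk (.ra 8) rfl
    refine HT.of_wp ?_
    simp [HL.wp, hn1, f39, f7, f8, hE1.r2, -Order.lt_add_one_iff]
    refine ⟨by omega, fun a ha => ?_⟩
    rcases Nat.lt_succ_iff_lt_or_eq.1 ha with ha | rfl
    · simpa [ha.ne] using hI a ha
    · simp [row]
  · rintro s1 _ hk hI
    rwa [hE.r2] at hI

/-- The key of cell `i` changes before the cell enters the tree. By `hTi` no leaf, hence no node,
holds `i` at that moment, which is what `Tour.update_key` needs. -/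
theorem refresh_spec (hg : c.Good) (hr : c.Ranked) (hR : c.Reducible) (hE : c.Env s) {i : ℕ}
    (h39 : s.wreg 39 = i) (hi : i ≤ c.K + 1) (h10 : s.wreg 10 = c.K + 2)
    (hst : ∀ y, s.warr 7 y = 0)
    (hne : (c.cell (row c.d (s.rarr 7) i) (row c.d (s.rarr 8) i)).Nonempty)
    (hT : Tour (c.K + 2) (s.rarr 2) (s.warr 5))
    (hTi : ∀ l < c.K + 2, s.warr 5 (c.K + 2 + l) ≠ i) :
    HT c.β c.w refresh s (fun s' => (∀ y, s'.warr 7 y = 0) ∧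
      (∃ L dim mid, s'.rarr 2 = Function.update (s.rarr 2) i L ∧
        s'.warr 9 = Function.update (s.warr 9) i dim ∧
        s'.rarr 9 = Function.update (s.rarr 9) i mid ∧
        c.Info (row c.d (s.rarr 7) i) (row c.d (s.rarr 8) i) L dim mid) ∧
      Tour (c.K + 2) (s'.rarr 2) (s'.warr 5) ∧
      ∀ l < c.K + 2, s'.warr 5 (c.K + 2 + l) = if l = i then i else s.warr 5 (c.K + 2 + l)) := by
  have hb := hg.cells_lt (a := c.d) hi le_rfl
  refine HT.seq' (loadCell_spec hg hE h39 hi) ?_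
  intro s1 h1 hk1
  have hE1 := hE.keep hk1 rfl
  have a7 : s1.warr 7 = s.warr 7 := hk1 (.wa 7) rfl
  refine HT.seq' (reduce_spec hg hr hR hE1 (by rwa [a7])) ?_
  rintro s2 ⟨h2, h3⟩ hk2
  have hE2 := hE1.keep hk2 rfl
  rw [Reduced, cell_congr (fun a ha => (h1 a ha).1) (fun a ha => (h1 a ha).2)] at h3
  replace h3 : c.Tight (row c.d (s.rarr 7) i) (row c.d (s.rarr 8) i) (s2.rarr 5) (s2.rarr 6) := by
    rcases h3 with ⟨-, -, h3⟩ | ⟨-, h3⟩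
    · unfold Tight at h3 ⊢
      rwa [cell_congr (fun a ha => (h1 a ha).1) (fun a ha => (h1 a ha).2)] at h3
    · rw [h3] at hne
      exact absurd hne Set.not_nonempty_empty
  refine HT.seq' (longest_spec hg hE2) ?_
  rintro s3 ⟨l1, l2, l3⟩ hk3
  have f39 : s3.wreg 39 = i :=
    Eq.trans (hk3 (.w 39) rfl) (Eq.trans (hk2 (.w 39) rfl) (Eq.trans (hk1 (.w 39) rfl) h39))
  have f10 : s3.wreg 10 = c.K + 2 :=
    Eq.trans (hk3 (.w 10) rfl) (Eq.trans (hk2 (.w 10) rfl) (Eq.trans (hk1 (.w 10) rfl) h10))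
  have b2 : s3.rarr 2 = s.rarr 2 :=
    Eq.trans (hk3 (.ra 2) rfl) (Eq.trans (hk2 (.ra 2) rfl) (hk1 (.ra 2) rfl))
  have b9 : s3.rarr 9 = s.rarr 9 :=
    Eq.trans (hk3 (.ra 9) rfl) (Eq.trans (hk2 (.ra 9) rfl) (hk1 (.ra 9) rfl))
  have a9 : s3.warr 9 = s.warr 9 :=
    Eq.trans (hk3 (.wa 9) rfl) (Eq.trans (hk2 (.wa 9) rfl) (hk1 (.wa 9) rfl))
  have a5 : s3.warr 5 = s.warr 5 :=
    Eq.trans (hk3 (.wa 5) rfl) (Eq.trans (hk2 (.wa 5) rfl) (hk1 (.wa 5) rfl))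
  have a7' : s3.warr 7 = s2.warr 7 := hk3 (.wa 7) rfl
  have hinfo : c.Info (row c.d (s.rarr 7) i) (row c.d (s.rarr 8) i) (s3.rreg 0) (s3.wreg 38)
      (s3.rreg 1) := by
    refine ⟨hne, l1, fun x hx y hy a => ?_, fun h0 => ?_⟩
    · have t1 := (h3 a).2.2 ⟨x, hx, rfl⟩
      have t2 := (h3 a).1.2 ⟨y, hy, rfl⟩
      have t3 := l2 a a.2
      simp only at t1 t2
      linarith
    · obtain ⟨hd, e1, e2⟩ := l3 h0
      obtain ⟨⟨x, hx, ex⟩, -⟩ := (h3 ⟨_, hd⟩).1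
      obtain ⟨⟨y, hy, ey⟩, -⟩ := (h3 ⟨_, hd⟩).2
      refine ⟨hd, x, hx, y, hy, ?_, ?_⟩
      · simp only at ex
        rw [ex, e1, e2]
        ring
      · simp only at ey
        rw [ey, e1, e2]
        ring
  refine HT.seq (HT.of_wp ?_)
  simp only [HL.wp, WE.ok_reg, RE.ok_reg, WE.eval_reg, RE.eval_reg, true_and, f39]
  refine HT.seq (HT.of_wp ?_)
  simp only [HL.wp, WE.ok_reg, WE.eval_reg, true_and, f39, State.setRA_wreg]
  refine HT.seq (HT.of_wp ?_)
  simp only [HL.wp, WE.ok_reg, RE.ok_reg, WE.eval_reg, RE.eval_reg, true_and, f39,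
    State.setRA_wreg, State.setWA_wreg, State.setRA_rreg, State.setWA_rreg]
  refine HT.seq (HT.of_wp ?_)
  simp only [HL.wp, WE.ok_reg, WE.eval_reg, true_and, f39, State.setRA_wreg, State.setWA_wreg]
  refine HT.seq (HT.of_wp ?_)
  simp only [HL.wp, WE.ok_reg, WE.eval_reg, true_and]
  set s4 := State.setW _ 42 _ with hs4
  have m41 : s4.wreg 41 = i := by simp [hs4]
  have m10 : s4.wreg 10 = c.K + 2 := by simp [hs4, f10]
  have m42 : s4.wreg 42 = i := by simp [hs4, f39]
  have m2 : s4.rarr 2 = Function.update (s.rarr 2) i (s3.rreg 0) := by simp [hs4, b2]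
  have m5 : s4.warr 5 = s.warr 5 := by simp [hs4, a5]
  have m7 : s4.warr 7 = s2.warr 7 := by simp [hs4, a7']
  have m9 : s4.warr 9 = Function.update (s.warr 9) i (s3.wreg 38) := by simp [hs4, a9]
  have n9 : s4.rarr 9 = Function.update (s.rarr 9) i (s3.rreg 1) := by simp [hs4, b9]
  clear_value s4
  have hT4 : Tour (c.K + 2) (s4.rarr 2) (s4.warr 5) := by
    rw [m2, m5]
    refine hT.update_key fun j hj hj' => ?_
    obtain ⟨l, hl, e⟩ := hT.eq_leaf j hj hj'
    rw [e]
    exact hTi l hl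
  refine (setLeaf_spec m10 m41 m42 (by omega) (by omega) hg.β43.2 hT4).keeps.mono ?_
  rintro s5 ⟨⟨j1, j2, -⟩, hk5⟩
  have o7 : s5.warr 7 = s2.warr 7 := Eq.trans (hk5 (.wa 7) rfl) m7
  refine ⟨by rwa [o7], ⟨_, _, _, Eq.trans (hk5 (.ra 2) rfl) m2, Eq.trans (hk5 (.wa 9) rfl) m9,
    Eq.trans (hk5 (.ra 9) rfl) n9, hinfo⟩, j1, fun l hl => ?_⟩
  rw [j2 l hl, m5]

end Cx

end RealRAM

/-! ### Partitions of the join results into cells, and the splitting of a cell. -/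

namespace RealRAM

namespace Cx

variable {s s' : State} {c : Cx}

/-- The cells `1, …, n` partition the join results; every cell is at least half as wide, in all
directions, as the longest tight side of any cell. -/
structure Part (c : Cx) (n : ℕ) (key G H : ℕ → ℝ) (dim : ℕ → ℕ) (mid : ℕ → ℝ) : Prop where
  info : ∀ i, 1 ≤ i → i ≤ n → c.Info (row c.d G i) (row c.d H i) (key i) (dim i) (mid i)
  cover : ∀ x ∈ c.res, ∃ i, 1 ≤ i ∧ i ≤ n ∧ x ∈ c.cell (row c.d G i) (row c.d H i)
  disj : ∀ i j, 1 ≤ i → i ≤ n → 1 ≤ j → j ≤ n → i ≠ j →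
    ∃ a < c.d, row c.d H i a ≤ row c.d G j a ∨ row c.d H j a ≤ row c.d G i a
  sides : ∀ i j, 1 ≤ i → i ≤ n → 1 ≤ j → j ≤ n → ∀ a < c.d,
    key j ≤ 2 * (row c.d H i a - row c.d G i a)

variable {n : ℕ} {key G H mid key' G' H' mid' : ℕ → ℝ} {dim dim' : ℕ → ℕ} {i : ℕ}

/-- Tables `G'`, `H'` arise from `G`, `H` by splitting cell `i`; the upper part is cell `n + 1`. -/
structure Halved (c : Cx) (n i : ℕ) (δ : ℕ) (μ : ℝ) (G H G' H' : ℕ → ℝ) : Prop where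
  g_new : ∀ a < c.d, row c.d G' (n + 1) a = if a = δ then μ else row c.d G i a
  g_old : ∀ j ≤ n, ∀ a < c.d, row c.d G' j a = row c.d G j a
  h_new : ∀ a < c.d, row c.d H' (n + 1) a = row c.d H i a
  h_low : ∀ a < c.d, row c.d H' i a = if a = δ then μ else row c.d H i a
  h_old : ∀ j ≤ n, j ≠ i → ∀ a < c.d, row c.d H' j a = row c.d H j a

/-- The two results that span the longest side lie on the two sides of its midpoint, at distance
`key i / 2`. So each half keeps a result, and each half is at least `key i / 2` wide across the cut.
-/
theorem Part.split_nonempty (h : c.Part n key G H dim mid) (hi : 1 ≤ i) (hin : i ≤ n)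
    (h0 : 0 < key i) (hH : c.Halved n i (dim i) (mid i) G H G' H') :
    dim i < c.d ∧ (c.cell (row c.d G' i) (row c.d H' i)).Nonempty ∧
      (c.cell (row c.d G' (n + 1)) (row c.d H' (n + 1))).Nonempty ∧
      c.cell (row c.d G' i) (row c.d H' i) ⊆ c.cell (row c.d G i) (row c.d H i) ∧
      c.cell (row c.d G' (n + 1)) (row c.d H' (n + 1)) ⊆ c.cell (row c.d G i) (row c.d H i) ∧
      row c.d G i (dim i) + key i / 2 ≤ mid i ∧ mid i + key i / 2 ≤ row c.d H i (dim i) := by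
  obtain ⟨hd, x, hx, y, hy, e1, e2⟩ := (h.info i hi hin).side h0
  have b1 := (hx.2 ⟨_, hd⟩).1
  have b2 := (hy.2 ⟨_, hd⟩).2
  simp only at b1 b2
  refine ⟨hd, ⟨x, hx.1, fun a => ?_⟩, ⟨y, hy.1, fun a => ?_⟩, ?_, ?_, by linarith, by linarith⟩
  · rw [hH.g_old i hin a a.2, hH.h_low a a.2]
    refine ⟨(hx.2 a).1, ?_⟩
    split_ifs with ha
    · have : a = ⟨dim i, hd⟩ := Fin.ext ha
      rw [this]
      linarith
    · exact (hx.2 a).2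
  · rw [hH.g_new a a.2, hH.h_new a a.2]
    refine ⟨?_, (hy.2 a).2⟩
    split_ifs with ha
    · have : a = ⟨dim i, hd⟩ := Fin.ext ha
      rw [this]
      linarith
    · exact (hy.2 a).1
  · refine cell_subset (fun a ha => (hH.g_old i hin a ha).ge) fun a ha => ?_
    rw [hH.h_low a ha]
    split_ifs with hc
    · rw [hc]
      linarith
    · exact le_rfl
  · refine cell_subset (fun a ha => ?_) fun a ha => (hH.h_new a ha).le
    rw [hH.g_new a ha]
    split_ifs with hc
    · rw [hc]
      linarith
    · exact le_rfl

/-- The invariant `sides` survives because the cell with the largest key is cut: both parts are at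
least `key i / 2` wide in the direction of the cut, all other sides are inherited, and by `Info.le`
no key exceeds `key i` afterwards. -/
theorem Part.split (h : c.Part n key G H dim mid) (hi : 1 ≤ i) (hin : i ≤ n)
    (h0 : 0 < key i) (hmax : ∀ j, 1 ≤ j → j ≤ n → key j ≤ key i)
    (hH : c.Halved n i (dim i) (mid i) G H G' H')
    (hold : ∀ j, j ≤ n → j ≠ i → key' j = key j ∧ dim' j = dim j ∧ mid' j = mid j)
    (hi1 : c.Info (row c.d G' i) (row c.d H' i) (key' i) (dim' i) (mid' i))
    (hi2 : c.Info (row c.d G' (n + 1)) (row c.d H' (n + 1)) (key' (n + 1)) (dim' (n + 1))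
      (mid' (n + 1))) : c.Part (n + 1) key' G' H' dim' mid' := by
  obtain ⟨hd, -, -, s1, s2, b1, b2⟩ := h.split_nonempty hi hin h0 hH
  have same : ∀ j, j ≤ n → j ≠ i →
      c.cell (row c.d G' j) (row c.d H' j) = c.cell (row c.d G j) (row c.d H j) :=
    fun j hj hji => cell_congr (hH.g_old j hj) (hH.h_old j hj hji)
  have hcase : ∀ j, j ≤ n + 1 → j = n + 1 ∨ j = i ∨ (j ≤ n ∧ j ≠ i) := by intro j hj; omega
  have hkey : ∀ j, 1 ≤ j → j ≤ n + 1 → key' j ≤ key i := by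
    intro j hj hj'
    rcases hcase j hj' with rfl | rfl | ⟨h1, h2⟩
    · exact (h.info i hi hin).le hi2 s2
    · exact (h.info j hi hin).le hi1 s1
    · rw [(hold j h1 h2).1]
      exact hmax j hj h1
  have hlow : ∀ j, j ≤ n → ∀ a < c.d, row c.d H' j a ≤ row c.d H j a := by
    intro j hj a ha
    by_cases hji : j = i
    · subst hji
      rw [hH.h_low a ha]
      split_ifs with hc
      · rw [hc]
        linarith
      · exact le_rfl
    · exact (hH.h_old j hj hji a ha).le
  have hnew : ∀ a < c.d, row c.d G i a ≤ row c.d G' (n + 1) a := by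
    intro a ha
    rw [hH.g_new a ha]
    split_ifs with hc
    · rw [hc]
      linarith
    · exact le_rfl
  -- The new cell is separated from cell `i` by the cut, and from any other cell by whatever
  -- separated that cell from `i`.
  have hdn : ∀ j, 1 ≤ j → j ≤ n → ∃ a < c.d, row c.d H' j a ≤ row c.d G' (n + 1) a ∨
      row c.d H' (n + 1) a ≤ row c.d G' j a := by
    intro j hj hjn
    by_cases hji : j = i
    · subst hji
      refine ⟨dim j, hd, Or.inl ?_⟩
      rw [hH.h_low _ hd, hH.g_new _ hd, if_pos rfl, if_pos rfl]
    · obtain ⟨a, ha, hc | hc⟩ := h.disj j i hj hjn hi hin hji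
      · exact ⟨a, ha, Or.inl ((hlow j hjn a ha).trans (hc.trans (hnew a ha)))⟩
      · refine ⟨a, ha, Or.inr ?_⟩
        rw [hH.h_new a ha, hH.g_old j hjn a ha]
        exact hc
  refine ⟨fun j hj hj' => ?_, fun x hx => ?_, fun p q hp hp' hq hq' hpq => ?_,
    fun p q hp hp' hq hq' a ha => ?_⟩
  · rcases hcase j hj' with rfl | rfl | ⟨h1, h2⟩
    · exact hi2
    · exact hi1
    · obtain ⟨e1, e2, e3⟩ := hold j h1 h2
      rw [e1, e2, e3]
      obtain ⟨f1, f2, f3, f4⟩ := h.info j hj h1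
      exact ⟨by rwa [same j h1 h2], f2, by rwa [same j h1 h2], by rwa [same j h1 h2]⟩
  · obtain ⟨j, hj, hjn, hxj⟩ := h.cover x hx
    by_cases hji : j = i
    · subst hji
      by_cases hm : x ⟨dim j, hd⟩ ≤ mid j
      · refine ⟨j, hj, by omega, hx, fun a => ?_⟩
        rw [hH.g_old j hjn a a.2, hH.h_low a a.2]
        refine ⟨(hxj.2 a).1, ?_⟩
        split_ifs with hc
        · rwa [show a = ⟨dim j, hd⟩ from Fin.ext hc]
        · exact (hxj.2 a).2
      · refine ⟨n + 1, by omega, le_rfl, hx, fun a => ?_⟩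
        rw [hH.g_new a a.2, hH.h_new a a.2]
        refine ⟨?_, (hxj.2 a).2⟩
        split_ifs with hc
        · rw [show a = ⟨dim j, hd⟩ from Fin.ext hc]
          exact not_le.1 hm
        · exact (hxj.2 a).1
    · exact ⟨j, hj, by omega, by rwa [same j hjn hji]⟩
  · by_cases hpn : p = n + 1
    · subst hpn
      obtain ⟨a, ha, hc⟩ := hdn q hq (by omega)
      exact ⟨a, ha, hc.symm⟩
    · by_cases hqn : q = n + 1
      · subst hqn
        exact hdn p hp (by omega)
      · obtain ⟨a, ha, hc | hc⟩ := h.disj p q hp (by omega) hq (by omega) hpq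
        · refine ⟨a, ha, Or.inl ((hlow p (by omega) a ha).trans (hc.trans ?_))⟩
          exact (hH.g_old q (by omega) a ha).ge
        · refine ⟨a, ha, Or.inr ((hlow q (by omega) a ha).trans (hc.trans ?_))⟩
          exact (hH.g_old p (by omega) a ha).ge
  · refine (hkey q hq hq').trans ?_
    have hs := fun j hj hj' => h.sides j i hj hj' hi hin a ha
    rcases hcase p hp' with rfl | rfl | ⟨h1, h2⟩
    · rw [hH.h_new a ha, hH.g_new a ha]
      split_ifs with hc
      · rw [hc]
        linarith
      · exact hs i hi hin
    · rw [hH.g_old p hin a ha, hH.h_low a ha]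
      split_ifs with hc
      · rw [hc]
        linarith
      · exact hs p hi hin
    · rw [hH.g_old p h1 a ha, hH.h_old p h1 h2 a ha]
      exact hs p hp h1

/-- The memory of the splitting phase. -/
structure Cells (c : Cx) (n : ℕ) (s : State) : Prop where
  cnt : s.wreg 9 = n
  leaves : s.wreg 10 = c.K + 2
  tour : Tour (c.K + 2) (s.rarr 2) (s.warr 5)
  leaf : ∀ l < c.K + 2, s.warr 5 (c.K + 2 + l) = if 1 ≤ l ∧ l ≤ n then l else 0
  sentinel : s.rarr 2 0 = -1
  stamp : ∀ y, s.warr 7 y = 0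
  part : c.Part n (s.rarr 2) (s.rarr 7) (s.rarr 8) (s.warr 9) (s.rarr 9)

end Cx

/-- Split cell (register 52); its upper part becomes a new cell. -/
def halve : HL :=
  .wset 53 (.reg 9 + .const 1) ⨟
  .loopTo 54 2 (
    .rsto 7 (.reg 53 * .reg 2 + .reg 54) (.load 7 (.reg 52 * .reg 2 + .reg 54)) ⨟
    .rsto 8 (.reg 53 * .reg 2 + .reg 54) (.load 8 (.reg 52 * .reg 2 + .reg 54))) ⨟
  .rsto 8 (.reg 52 * .reg 2 + .load 9 (.reg 52)) (.load 9 (.reg 52)) ⨟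
  .rsto 7 (.reg 53 * .reg 2 + .load 9 (.reg 52)) (.load 9 (.reg 52))

/-- Split cell (register 52) and update the tournament tree. -/
def splitCell : HL :=
  halve ⨟ .wset 41 (.reg 52) ⨟ .wset 42 (.const 0) ⨟ setLeaf ⨟
  .wset 39 (.reg 52) ⨟ refresh ⨟ .wset 39 (.reg 53) ⨟ refresh ⨟ .wset 9 (.reg 53)

/-- Split cells with a longest tight side, as often as register 8 tells, as long as there is one
with two points. -/
def splitLoop : HL :=
  .loopTo 59 8 (.wset 52 (.load 5 (.const 1)) ⨟
    .ite (.rlt (.ofW (.const 0)) (.load 2 (.reg 52))) splitCell .skip)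

namespace Cx

variable {c : Cx} {s s' : State} {n i : ℕ}

theorem row_index_ne {d i j a b : ℕ} (ha : a < d) (hb : b < d) (h : i ≠ j) :
    i * d + a ≠ j * d + b := by
  intro e
  have h1 := congrArg (· / d) e
  have hd : 0 < d := by omega
  simp only [Nat.mul_comm _ d, Nat.mul_add_div hd, Nat.div_eq_of_lt ha, Nat.div_eq_of_lt hb,
    add_zero] at h1
  exact h h1

theorem halve_spec (hg : c.Good) (hE : c.Env s) (h9 : s.wreg 9 = n) (h52 : s.wreg 52 = i)
    (hi : i ≤ n) (hn : n ≤ c.K) (hd : s.warr 9 i < c.d) :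
    HT c.β c.w halve s (fun s' => s'.wreg 53 = n + 1 ∧
      c.Halved n i (s.warr 9 i) (s.rarr 9 i) (s.rarr 7) (s.rarr 8) (s'.rarr 7) (s'.rarr 8)) := by
  have hb := hg.cells_lt (i := i) (a := c.d) (by omega) le_rfl
  have hb' := hg.cells_lt (i := n + 1) (a := c.d) (by omega) le_rfl
  refine HT.seq (HT.of_wp ?_)
  simp only [HL.wp, WE.ok_add, WE.ok_reg, WE.ok_const, WE.eval_add, WE.eval_reg, WE.eval_const,
    true_and, h9]
  refine ⟨by omega, ?_⟩
  set s0 := s.setW 53 _ with hs0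
  have hE0 : c.Env s0 := hE.setW (by decide)
  have e53 : s0.wreg 53 = n + 1 := by simp [hs0]
  have e52 : s0.wreg 52 = i := by simp [hs0, h52]
  have e9 : s0.warr 9 = s.warr 9 := rfl
  have f9 : s0.rarr 9 = s.rarr 9 := rfl
  have f7 : s0.rarr 7 = s.rarr 7 := rfl
  have f8 : s0.rarr 8 = s.rarr 8 := rfl
  clear_value s0
  refine HT.seq' (HT.loopTo (Q := fun s' => ∀ j a, a < c.d →
      s'.rarr 7 (j * c.d + a) = (if j = n + 1 then s.rarr 7 (i * c.d + a)
        else s.rarr 7 (j * c.d + a)) ∧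
      s'.rarr 8 (j * c.d + a) = (if j = n + 1 then s.rarr 8 (i * c.d + a)
        else s.rarr 8 (j * c.d + a)))
    (fun x s' => ∀ j a, a < c.d →
      s'.rarr 7 (j * c.d + a) = (if j = n + 1 ∧ a < x then s.rarr 7 (i * c.d + a)
        else s.rarr 7 (j * c.d + a)) ∧
      s'.rarr 8 (j * c.d + a) = (if j = n + 1 ∧ a < x then s.rarr 8 (i * c.d + a)
        else s.rarr 8 (j * c.d + a))) ⟨rfl, rfl, by decide⟩ (by rw [hE0.r2]; exact hg.β2)
      (by rw [hE0.r2]; omega) (by simp [f7, f8]) ?_ ?_) ?_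
  · intro x s1 hx hx1 hk hI
    rw [hE0.r2] at hx
    have hE1 := hE0.keep hk rfl
    have g53 : s1.wreg 53 = n + 1 := Eq.trans (hk (.w 53) rfl) e53
    have g52 : s1.wreg 52 = i := Eq.trans (hk (.w 52) rfl) e52
    refine HT.of_wp ?_
    simp only [HL.wp, WE.ok_add, WE.ok_mul, WE.ok_reg, WE.eval_add, WE.eval_mul, WE.eval_reg,
      RE.ok_load, RE.eval_load, true_and, hx1, g52, g53, hE1.r2, State.setRA_wreg, State.setRA_rarr,
      State.setW_rarr]
    norm_num [-Order.lt_add_one_iff]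
    refine ⟨by omega, by omega, by omega, by omega, fun j a ha => ?_⟩
    obtain ⟨hI7, hI8⟩ := hI j a ha
    obtain ⟨hx7, hx8⟩ := hI i x hx
    rw [if_neg (by omega)] at hx7 hx8
    by_cases hj : j = n + 1
    · subst hj
      rcases Nat.lt_trichotomy a x with hax | rfl | hax
      · simp [show a < x + 1 by omega, hax, hax.ne] at hI7 hI8 ⊢
        exact ⟨hI7, hI8⟩
      · simp [hx7, hx8]
      · simp [show ¬ a < x + 1 by omega, show ¬ a < x by omega, hax.ne'] at hI7 hI8 ⊢
        exact ⟨hI7, hI8⟩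
    · rw [Function.update_of_ne (row_index_ne ha hx hj), Function.update_of_ne (row_index_ne ha hx hj)]
      simp only [hj, false_and, if_false] at hI7 hI8 ⊢
      exact ⟨hI7, hI8⟩
  · intro s1 _ _ hI j a ha
    rw [hE0.r2] at hI
    simpa [ha] using hI j a ha
  · intro s1 hI hk
    have hE1 := hE0.keep hk rfl
    have g53 : s1.wreg 53 = n + 1 := Eq.trans (hk (.w 53) rfl) e53
    have g52 : s1.wreg 52 = i := Eq.trans (hk (.w 52) rfl) e52
    have g9 : s1.warr 9 = s.warr 9 := Eq.trans (hk (.wa 9) rfl) e9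
    have k9 : s1.rarr 9 = s.rarr 9 := Eq.trans (hk (.ra 9) rfl) f9
    refine HT.of_wp ?_
    simp only [HL.wp, WE.ok_add, WE.ok_mul, WE.ok_reg, WE.ok_load, WE.eval_load, WE.eval_add,
      WE.eval_mul, WE.eval_reg,
      RE.ok_load, RE.eval_load, true_and, g52, g53, hE1.r2, State.setRA_wreg, State.setRA_rarr,
      State.setRA_warr, g9, k9]
    norm_num [-Order.lt_add_one_iff]
    refine ⟨by omega, by omega, ?_⟩
    have hin : i ≠ n + 1 := by omega
    refine ⟨fun a ha => ?_, fun j hj a ha => ?_, fun a ha => ?_, fun a ha => ?_,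
      fun j hj hji a ha => ?_⟩
    · rw [row, Function.update_apply]
      simp [(hI (n + 1) a ha).1, row]
    · rw [row, Function.update_of_ne (row_index_ne ha hd (by omega)), (hI j a ha).1,
        if_neg (by omega), row]
    · rw [row, Function.update_of_ne (row_index_ne ha hd hin.symm), (hI (n + 1) a ha).2, if_pos rfl,
        row]
    · rw [row, Function.update_apply]
      simp [(hI i a ha).2, row, hin]
    · rw [row, Function.update_of_ne (row_index_ne ha hd hji), (hI j a ha).2, if_neg (by omega), row]

/-- The leaf of cell `i` is first given the sentinel, so that no node holds `i` while its key
changes. -/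
theorem splitCell_spec (hg : c.Good) (hr : c.Ranked) (hR : c.Reducible) (hE : c.Env s)
    (hC : c.Cells n s) (h52 : s.wreg 52 = i) (hi : 1 ≤ i) (hin : i ≤ n) (hn : n ≤ c.K)
    (h0 : 0 < s.rarr 2 i) (hmax : ∀ j, 1 ≤ j → j ≤ n → s.rarr 2 j ≤ s.rarr 2 i) :
    HT c.β c.w splitCell s (c.Cells (n + 1)) := by
  have hb := hg.cells_lt (i := n + 1) (a := c.d) (by omega) le_rfl
  obtain ⟨hd, -⟩ := (hC.part.info i hi hin).side h0
  refine HT.seq' (halve_spec hg hE hC.cnt h52 hin hn hd) ?_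
  rintro s1 ⟨h1, h2⟩ hk1
  obtain ⟨-, ne1, ne2, -⟩ := hC.part.split_nonempty hi hin h0 h2
  have f52 : s1.wreg 52 = i := Eq.trans (hk1 (.w 52) rfl) h52
  refine HT.seq (HT.of_wp ?_)
  simp only [HL.wp, WE.ok_reg, WE.eval_reg, true_and, f52]
  refine HT.seq (HT.of_wp ?_)
  simp only [HL.wp, WE.ok_const, WE.eval_const]
  refine ⟨by omega, ?_⟩
  set s2 := State.setW _ 42 0 with hs2
  have hE2 : c.Env s2 := ((hE.keep hk1 rfl).setW (by decide)).setW (by decide)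
  have m41 : s2.wreg 41 = i := by simp [hs2]
  have m42 : s2.wreg 42 = 0 := by simp [hs2]
  have m52 : s2.wreg 52 = i := by simp [hs2, f52]
  have m53 : s2.wreg 53 = n + 1 := by simp [hs2, h1]
  have m10 : s2.wreg 10 = c.K + 2 := by simp [hs2]; exact Eq.trans (hk1 (.w 10) rfl) hC.leaves
  have m2 : s2.rarr 2 = s.rarr 2 := hk1 (.ra 2) rfl
  have m5 : s2.warr 5 = s.warr 5 := hk1 (.wa 5) rfl
  have m7 : s2.warr 7 = s.warr 7 := hk1 (.wa 7) rfl
  have m9 : s2.warr 9 = s.warr 9 := hk1 (.wa 9) rfl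
  have n9 : s2.rarr 9 = s.rarr 9 := hk1 (.ra 9) rfl
  have n7 : s2.rarr 7 = s1.rarr 7 := rfl
  have n8 : s2.rarr 8 = s1.rarr 8 := rfl
  clear_value s2
  refine HT.seq' (setLeaf_spec m10 m41 m42 (by omega) (by omega) hg.β43.2
    (by rw [m2, m5]; exact hC.tour)) ?_
  rintro s3 ⟨t1, t2, -⟩ hk3
  refine HT.seq (HT.of_wp ?_)
  simp only [HL.wp, WE.ok_reg, WE.eval_reg, true_and]
  set s4 := State.setW s3 39 _ with hs4
  have hE4 : c.Env s4 := (hE2.keep hk3 rfl).setW (by decide)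
  have q39 : s4.wreg 39 = i := by simp [hs4]; exact Eq.trans (hk3 (.w 52) rfl) m52
  have q53 : s4.wreg 53 = n + 1 := by simp [hs4]; exact Eq.trans (hk3 (.w 53) rfl) m53
  have q10 : s4.wreg 10 = c.K + 2 := by simp [hs4]; exact Eq.trans (hk3 (.w 10) rfl) m10
  have p2 : s4.rarr 2 = s.rarr 2 := Eq.trans (hk3 (.ra 2) rfl) m2
  have p7 : s4.rarr 7 = s1.rarr 7 := Eq.trans (hk3 (.ra 7) rfl) n7
  have p8 : s4.rarr 8 = s1.rarr 8 := Eq.trans (hk3 (.ra 8) rfl) n8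
  have p9 : s4.rarr 9 = s.rarr 9 := Eq.trans (hk3 (.ra 9) rfl) n9
  have q7 : s4.warr 7 = s.warr 7 := Eq.trans (hk3 (.wa 7) rfl) m7
  have q9 : s4.warr 9 = s.warr 9 := Eq.trans (hk3 (.wa 9) rfl) m9
  have u1 : Tour (c.K + 2) (s4.rarr 2) (s4.warr 5) := t1
  have u2 : ∀ l < c.K + 2, s4.warr 5 (c.K + 2 + l) =
      if 1 ≤ l ∧ l ≤ n ∧ l ≠ i then l else 0 := by
    intro l hl
    have : s4.warr 5 (c.K + 2 + l) = s3.warr 5 (c.K + 2 + l) := rfl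
    rw [this, t2 l hl, m5, hC.leaf l hl]
    split_ifs <;> omega
  clear_value s4
  refine HT.seq' (refresh_spec hg hr hR hE4 q39 (by omega) q10 (by rw [q7]; exact hC.stamp)
    (by rw [p7, p8]; exact ne1) u1 ?_) ?_
  · intro l hl
    rw [u2 l hl]
    split_ifs <;> omega
  rintro s5 ⟨v1, ⟨L1, d1, μ1, v2, v3, v4, v5⟩, v6, v7⟩ hk5
  refine HT.seq (HT.of_wp ?_)
  simp only [HL.wp, WE.ok_reg, WE.eval_reg, true_and]
  set s6 := State.setW s5 39 _ with hs6
  have hE6 : c.Env s6 := (hE4.keep hk5 rfl).setW (by decide)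
  have w39 : s6.wreg 39 = n + 1 := by simp [hs6]; exact Eq.trans (hk5 (.w 53) rfl) q53
  have w53 : s6.wreg 53 = n + 1 := by simp [hs6]; exact Eq.trans (hk5 (.w 53) rfl) q53
  have w10 : s6.wreg 10 = c.K + 2 := by simp [hs6]; exact Eq.trans (hk5 (.w 10) rfl) q10
  have x7 : s6.rarr 7 = s1.rarr 7 := Eq.trans (hk5 (.ra 7) rfl) p7
  have x8 : s6.rarr 8 = s1.rarr 8 := Eq.trans (hk5 (.ra 8) rfl) p8
  have x2 : s6.rarr 2 = Function.update (s.rarr 2) i L1 := by rw [← p2]; exact v2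
  have x9 : s6.rarr 9 = Function.update (s.rarr 9) i μ1 := by rw [← p9]; exact v4
  have w9 : s6.warr 9 = Function.update (s.warr 9) i d1 := by rw [← q9]; exact v3
  have v1' : ∀ y, s6.warr 7 y = 0 := v1
  have v6' : Tour (c.K + 2) (s6.rarr 2) (s6.warr 5) := v6
  have v7' : ∀ l < c.K + 2, s6.warr 5 (c.K + 2 + l) = if 1 ≤ l ∧ l ≤ n then l else 0 := by
    intro l hl
    have : s6.warr 5 (c.K + 2 + l) = s5.warr 5 (c.K + 2 + l) := rfl
    rw [this, v7 l hl, u2 l hl]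
    split_ifs <;> omega
  clear_value s6
  refine HT.seq' (refresh_spec hg hr hR hE6 w39 (by omega) w10 v1' (by rw [x7, x8]; exact ne2)
    v6' ?_) ?_
  · intro l hl
    rw [v7' l hl]
    split_ifs <;> omega
  rintro s7 ⟨y1, ⟨L2, d2, μ2, y2, y3, y4, y5⟩, y6, y7⟩ hk7
  have z53 : s7.wreg 53 = n + 1 := Eq.trans (hk7 (.w 53) rfl) w53
  have z10 : s7.wreg 10 = c.K + 2 := Eq.trans (hk7 (.w 10) rfl) w10
  have z7 : s7.rarr 7 = s1.rarr 7 := Eq.trans (hk7 (.ra 7) rfl) x7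
  have z8 : s7.rarr 8 = s1.rarr 8 := Eq.trans (hk7 (.ra 8) rfl) x8
  refine HT.of_wp ?_
  simp only [HL.wp, WE.ok_reg, WE.eval_reg, true_and, z53]
  have hin' : i ≠ n + 1 := by omega
  rw [p7, p8] at v5
  rw [x7, x8] at y5
  refine ⟨by simp, by simpa using z10, y6, fun l hl => ?_, ?_, y1, ?_⟩
  · refine (y7 l hl).trans ?_
    rw [v7' l hl]
    split_ifs <;> omega
  · simp only [State.setW_rarr]
    rw [y2, x2, Function.update_of_ne (by omega), Function.update_of_ne (by omega)]
    exact hC.sentinel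
  · simp only [State.setW_rarr, State.setW_warr]
    rw [z7, z8, y2, y3, y4, x2, x9, w9]
    refine hC.part.split hi hin h0 hmax h2 (fun j hj hji => ?_) ?_ ?_
    · have : j ≠ n + 1 := by omega
      simp [hji, this]
    · simpa [hin'] using v5
    · simpa using y5

/-- A round adds a cell unless no key is positive, that is, unless every cell holds a single result;
from then on nothing changes. Leaf `0` is the sentinel, so `K + 2` leaves accommodate the at most `K
+ 1` cells. -/
theorem splitLoop_spec (hg : c.Good) (hr : c.Ranked) (hR : c.Reducible) (hE : c.Env s)
    (hC : c.Cells 1 s) :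
    HT c.β c.w splitLoop s (fun s' => ∃ n, 1 ≤ n ∧ n ≤ c.K + 1 ∧ c.Cells n s' ∧
      (n = c.K + 1 ∨ ∀ j, 1 ≤ j → j ≤ n → s'.rarr 2 j ≤ 0)) := by
  have hb := hg.cells_lt (i := 1) (a := c.d) (by omega) le_rfl
  have hsetW : ∀ {n r v : ℕ} {s : State}, c.Cells n s → 10 < r → c.Cells n (s.setW r v) := by
    intro n r v s h hr
    exact ⟨by simpa [show 9 ≠ r by omega] using h.cnt, by simpa [show 10 ≠ r by omega] using h.leaves,
      h.tour, h.leaf, h.sentinel, h.stamp, h.part⟩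
  refine HT.loopTo (fun x s' => ∃ n, 1 ≤ n ∧ n ≤ x + 1 ∧ c.Cells n s' ∧
      (n = x + 1 ∨ ∀ j, 1 ≤ j → j ≤ n → s'.rarr 2 j ≤ 0)) ⟨rfl, rfl, by decide⟩
    (by rw [hE.r8]; exact hg.β8) (by rw [hE.r8]; omega) ?_ ?_ ?_
  · exact ⟨1, le_rfl, le_rfl, hsetW hC (by decide), Or.inl rfl⟩
  · rintro x s1 hx hx1 hk ⟨n, hn1, hn, hC1, hor⟩
    rw [hE.r8] at hx
    have hE1 := hE.keep hk rfl
    refine HT.seq (HT.of_wp ?_)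
    simp only [HL.wp, WE.ok_load, WE.ok_const, WE.eval_load, WE.eval_const]
    refine ⟨by omega, ?_⟩
    have hC2 : c.Cells n (s1.setW 52 (s1.warr 5 1)) := hsetW hC1 (by decide)
    have hmax : ∀ j, 1 ≤ j → j ≤ n → s1.rarr 2 j ≤ s1.rarr 2 (s1.warr 5 1) := by
      intro j hj hjn
      have := hC1.tour.le_root (c.K + 2 + j) (by omega) (by omega)
      rwa [hC1.leaf j (by omega), if_pos ⟨hj, hjn⟩] at this
    refine HT.ite (by simp) (fun h => ?_) (fun h => ?_)
    · simp at h
      obtain ⟨l, hl, e⟩ := hC1.tour.eq_leaf 1 le_rfl (by omega)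
      rw [hC1.leaf l hl] at e
      -- The sentinel has key `-1`, so a positive maximum belongs to a cell.
      have hne : s1.warr 5 1 ≠ 0 := by
        intro e0
        rw [e0, hC1.sentinel] at h
        norm_num at h
      split_ifs at e with hc
      · rw [e] at h hmax
        refine (splitCell_spec hg hr hR (hE1.setW (by decide)) hC2 (i := l) (by simp [e]) hc.1 hc.2
          (by omega) h hmax).mono fun s2 h2 => ?_
        refine ⟨n + 1, by omega, by omega, hsetW h2 (by decide), ?_⟩
        rcases hor with hor | hor
        · left; omega
        · exact absurd (hor l hc.1 hc.2) (not_le.2 h)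
      · exact absurd e hne
    · simp at h
      exact HT.skip ⟨n, hn1, by omega, hsetW hC2 (by decide),
        Or.inr fun j hj hjn => (hmax j hj hjn).trans h⟩
  · rintro s1 _ hk h
    rw [hE.r8] at h
    exact h

end Cx

end RealRAM

/-! ### The root cell, and one join result from every cell. -/

namespace RealRAM

/-- Cell 1 := a cube that contains all entries; reduce it. -/
def openRoot : HL :=
  .loopTo 35 2 (.rsto 7 (.reg 2 + .reg 35) (.reg 2 - .ofW (.const 1)) ⨟
    .rsto 8 (.reg 2 + .reg 35) (.reg 3)) ⨟
  .wset 10 (.reg 8 + .const 2) ⨟ .rsto 2 (.const 0) (.ofW (.const 0) - .ofW (.const 1)) ⨟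
  .wset 9 (.const 1) ⨟ .wset 39 (.const 1) ⨟ loadCell ⨟ reduce

/-- Row `i` of real array 10 := a join result in cell `i + 1`, for all cells. -/
def witnesses : HL :=
  .loopTo 55 9 (.wset 39 (.reg 55 + .const 1) ⨟ loadCell ⨟
    .loopTo 56 2 (reduce ⨟ .rsto 4 (.reg 56) (.load 5 (.reg 56))) ⨟
    .loopTo 35 2 (.rsto 10 (.reg 55 * .reg 2 + .reg 35) (.load 4 (.reg 35))))

namespace Cx

variable {c : Cx} {s s' : State} {n i : ℕ}

/-- The memory after `openRoot`. -/
structure Rooted (c : Cx) (s : State) : Prop where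
  cnt : s.wreg 9 = 1
  leaves : s.wreg 10 = c.K + 2
  cell : s.wreg 39 = 1
  node : ∀ i, s.warr 5 i = 0
  sentinel : s.rarr 2 0 = -1
  stamp : ∀ y, s.warr 7 y = 0
  g : ∀ a < c.d, row c.d (s.rarr 7) 1 a = s.rreg 2 - 1
  h : ∀ a < c.d, row c.d (s.rarr 8) 1 a = s.rreg 3
  bounds : ∀ x ∈ c.res, ∀ a, s.rreg 2 ≤ x a ∧ x a ≤ s.rreg 3

theorem Reducible.mem_entry (hR : c.Reducible) {x : EuclideanSpace ℝ (Fin c.d)} (hx : x ∈ c.res)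
    (a : Fin c.d) : ∃ y < c.nv, x a = c.V y := by
  obtain ⟨l, hl, hla⟩ := hR.cover a a.2
  obtain ⟨i, hi, hf⟩ := hx l hl
  exact ⟨_, entry_lt (tuple_lt hl hi) a.2, hf a hla⟩

/-- Boxes are open below; hence the lower corner `lo - 1`. -/
theorem cell_eq_res {g h : ℕ → ℝ} {lo hi : ℝ} (hb : ∀ x ∈ c.res, ∀ a, lo ≤ x a ∧ x a ≤ hi)
    (hg : ∀ a < c.d, g a = lo - 1) (hh : ∀ a < c.d, h a = hi) : c.cell g h = c.res := by
  refine Set.Subset.antisymm (fun x hx => hx.1) fun x hx => ⟨hx, fun a => ?_⟩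
  rw [hg a a.2, hh a a.2]
  have := hb x hx a
  exact ⟨by linarith, this.2⟩

theorem openRoot_spec (hg : c.Good) (hr : c.Ranked) (hR : c.Reducible) (hE : c.Env s)
    (hV : ∀ x < c.nv, s.rreg 2 ≤ c.V x ∧ c.V x ≤ s.rreg 3) (hst : ∀ y, s.warr 7 y = 0)
    (hnode : ∀ i, s.warr 5 i = 0) :
    HT c.β c.w openRoot s (fun s' => c.Rooted s' ∧
      ((s'.wreg 36 = 1 ∧ c.res.Nonempty) ∨ (s'.wreg 36 = 0 ∧ c.res = ∅))) := by
  have hb := hg.cells_lt (i := 1) (a := c.d) (by omega) le_rfl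
  have hbounds : ∀ x ∈ c.res, ∀ a, s.rreg 2 ≤ x a ∧ x a ≤ s.rreg 3 := by
    intro x hx a
    obtain ⟨y, hy, e⟩ := hR.mem_entry hx a
    rw [e]
    exact hV y hy
  refine HT.seq' (HT.loopTo (Q := fun s' => ∀ a < c.d, row c.d (s'.rarr 7) 1 a = s.rreg 2 - 1 ∧
      row c.d (s'.rarr 8) 1 a = s.rreg 3)
    (fun x s' => ∀ a < x, row c.d (s'.rarr 7) 1 a = s.rreg 2 - 1 ∧
      row c.d (s'.rarr 8) 1 a = s.rreg 3) ⟨rfl, rfl, by decide⟩ (by rw [hE.r2]; exact hg.β2)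
      (by rw [hE.r2]; omega) (by simp) ?_ ?_) ?_
  · intro x s1 hx hx1 hk hI
    rw [hE.r2] at hx
    have hE1 := hE.keep hk rfl
    have f2 : s1.rreg 2 = s.rreg 2 := hk (.r 2) rfl
    have f3 : s1.rreg 3 = s.rreg 3 := hk (.r 3) rfl
    refine HT.of_wp ?_
    simp [HL.wp, hx1, hE1.r2, f2, f3, -Order.lt_add_one_iff]
    refine ⟨by omega, hg.w_ne, by omega, fun a ha => ?_⟩
    rcases Nat.lt_succ_iff_lt_or_eq.1 ha with ha | rfl
    · have := hI a ha
      simp only [row] at this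
      simpa [row, ha.ne] using this
    · simp [row]
  · intro s1 _ _ hI
    rwa [hE.r2] at hI
  intro s1 h1 hk1
  have hE1 := hE.keep hk1 rfl
  refine HT.seq (HT.of_wp ?_)
  simp only [HL.wp, WE.ok_add, WE.ok_reg, WE.ok_const, WE.eval_add, WE.eval_reg, WE.eval_const,
    true_and, hE1.r8]
  refine ⟨by omega, ?_⟩
  refine HT.seq (HT.of_wp ?_)
  simp only [HL.wp, WE.ok_const, RE.ok_sub, RE.ok_ofW, RE.eval_sub, RE.eval_ofW, WE.eval_const]
  refine ⟨by omega, by omega, ?_⟩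
  refine HT.seq (HT.of_wp ?_)
  simp only [HL.wp, WE.ok_const, WE.eval_const]
  refine ⟨by omega, ?_⟩
  refine HT.seq (HT.of_wp ?_)
  simp only [HL.wp, WE.ok_const, WE.eval_const]
  refine ⟨by omega, ?_⟩
  set s2 := State.setW _ 39 1 with hs2
  have hE2 : c.Env s2 :=
    (((hE1.setW (by decide)).setRA (by decide)).setW (by decide)).setW (by decide)
  have m9 : s2.wreg 9 = 1 := by simp [hs2]
  have m10 : s2.wreg 10 = c.K + 2 := by simp [hs2]
  have m39 : s2.wreg 39 = 1 := by simp [hs2]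
  have m5 : s2.warr 5 = s.warr 5 := hk1 (.wa 5) rfl
  have m7 : s2.warr 7 = s.warr 7 := hk1 (.wa 7) rfl
  have n2 : s2.rarr 2 0 = -1 := by simp [hs2]
  have n7 : s2.rarr 7 = s1.rarr 7 := by simp [hs2]
  have n8 : s2.rarr 8 = s1.rarr 8 := by simp [hs2]
  have r2 : s2.rreg 2 = s.rreg 2 := hk1 (.r 2) rfl
  have r3 : s2.rreg 3 = s.rreg 3 := hk1 (.r 3) rfl
  clear_value s2
  refine HT.seq' (loadCell_spec hg hE2 m39 (by omega)) ?_
  intro s3 h3 hk3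
  have hE3 := hE2.keep hk3 rfl
  have p7 : s3.warr 7 = s.warr 7 := Eq.trans (hk3 (.wa 7) rfl) m7
  refine (reduce_spec hg hr hR hE3 (by rwa [p7])).keeps.mono ?_
  rintro s4 ⟨⟨h4, h5⟩, hk4⟩
  have q2 : s4.rreg 2 = s.rreg 2 := Eq.trans (hk4 (.r 2) rfl) (Eq.trans (hk3 (.r 2) rfl) r2)
  have q3 : s4.rreg 3 = s.rreg 3 := Eq.trans (hk4 (.r 3) rfl) (Eq.trans (hk3 (.r 3) rfl) r3)
  have q7 : s4.rarr 7 = s1.rarr 7 := Eq.trans (hk4 (.ra 7) rfl) (Eq.trans (hk3 (.ra 7) rfl) n7)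
  have q8 : s4.rarr 8 = s1.rarr 8 := Eq.trans (hk4 (.ra 8) rfl) (Eq.trans (hk3 (.ra 8) rfl) n8)
  have q5 : s4.warr 5 = s.warr 5 := Eq.trans (hk4 (.wa 5) rfl) (Eq.trans (hk3 (.wa 5) rfl) m5)
  have qr : s4.rarr 2 = s2.rarr 2 := Eq.trans (hk4 (.ra 2) rfl) (hk3 (.ra 2) rfl)
  refine ⟨⟨Eq.trans (hk4 (.w 9) rfl) (Eq.trans (hk3 (.w 9) rfl) m9),
    Eq.trans (hk4 (.w 10) rfl) (Eq.trans (hk3 (.w 10) rfl) m10),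
    Eq.trans (hk4 (.w 39) rfl) (Eq.trans (hk3 (.w 39) rfl) m39), by rwa [q5], by rw [qr, n2], h4,
    fun a ha => by rw [q7, q2, (h1 a ha).1], fun a ha => by rw [q8, q3, (h1 a ha).2],
    by rwa [q2, q3]⟩, ?_⟩
  rw [Reduced, cell_eq_res hbounds (fun a ha => ?_) (fun a ha => ?_)] at h5
  · rcases h5 with h5 | h5
    · exact Or.inl ⟨h5.1, h5.2.1⟩
    · exact Or.inr h5
  · rw [(h3 a ha).1, n7, (h1 a ha).1]
  · rw [(h3 a ha).2, n8, (h1 a ha).2]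

theorem Rooted.refresh (hg : c.Good) (hr : c.Ranked) (hR : c.Reducible) (hE : c.Env s)
    (h : c.Rooted s) (hne : c.res.Nonempty) : HT c.β c.w refresh s (c.Cells 1) := by
  have hcell := cell_eq_res h.bounds h.g h.h
  refine (refresh_spec hg hr hR hE h.cell (by omega) h.leaves h.stamp (by rwa [hcell])
    (Tour.zero _ _ h.node) (by simp [h.node])).keeps.mono ?_
  rintro s1 ⟨⟨h1, ⟨L, δ, μ, h2, h3, h4, h5⟩, h6, h7⟩, hk⟩
  have f7 : s1.rarr 7 = s.rarr 7 := hk (.ra 7) rfl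
  have f8 : s1.rarr 8 = s.rarr 8 := hk (.ra 8) rfl
  refine ⟨Eq.trans (hk (.w 9) rfl) h.cnt, Eq.trans (hk (.w 10) rfl) h.leaves, h6, fun l hl => ?_,
    ?_, h1, ?_⟩
  · rw [h7 l hl, h.node]
    split_ifs <;> omega
  · rw [h2, Function.update_of_ne (by omega), h.sentinel]
  · rw [h2, h3, h4, f7, f8]
    refine ⟨fun i hi hi' => ?_, fun x hx => ⟨1, le_rfl, le_rfl, by rwa [hcell]⟩,
      fun i j hi hi' hj hj' hij => by omega, fun i j hi hi' hj hj' a ha => ?_⟩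
    · obtain rfl : i = 1 := by omega
      simpa using h5
    · obtain rfl : i = 1 := by omega
      obtain rfl : j = 1 := by omega
      -- The root is a cube whose side exceeds the range of the results' coordinates, so the longest
      -- tight side in one direction can be compared with its width in any other.
      rw [Function.update_self, h.g a ha, h.h a ha]
      obtain ⟨x, hx⟩ := hne
      have hx' := h.bounds x hx ⟨a, ha⟩
      rcases h5.nonneg.eq_or_lt with h0 | h0
      · linarith
      · obtain ⟨hd, y, hy, z, hz, e1, e2⟩ := h5.side h0
        have hy' := h.bounds y hy.1 ⟨δ, hd⟩
        have hz' := h.bounds z hz.1 ⟨δ, hd⟩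
        linarith

/-- Lowering the upper corner in one direction to the tight minimum keeps a result in the box and
makes that coordinate constant on it. After all directions the upper corner is itself the only
result left. -/
theorem pinCell_spec (hg : c.Good) (hr : c.Ranked) (hR : c.Reducible) (hE : c.Env s)
    (hst : ∀ y, s.warr 7 y = 0) (hne : (c.cell (s.rarr 3) (s.rarr 4)).Nonempty) :
    HT c.β c.w (.loopTo 56 2 (reduce ⨟ .rsto 4 (.reg 56) (.load 5 (.reg 56)))) s
      (fun s' => (∀ y, s'.warr 7 y = 0) ∧
        ∃ x ∈ c.cell (s.rarr 3) (s.rarr 4), ∀ a : Fin c.d, x a = s'.rarr 4 a) := by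
  have hb := hg.cells_lt (i := 1) (a := c.d) (by omega) le_rfl
  refine HT.loopTo (fun n s' => (∀ y, s'.warr 7 y = 0) ∧
      (c.cell (s.rarr 3) (s'.rarr 4)).Nonempty ∧
      c.cell (s.rarr 3) (s'.rarr 4) ⊆ c.cell (s.rarr 3) (s.rarr 4) ∧
      ∀ x ∈ c.cell (s.rarr 3) (s'.rarr 4), ∀ a : Fin c.d, (a : ℕ) < n → x a = s'.rarr 4 a)
    ⟨rfl, rfl, by decide⟩ (by rw [hE.r2]; exact hg.β2) (by rw [hE.r2]; omega) ?_ ?_ ?_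
  · exact ⟨hst, hne, subset_rfl, by simp⟩
  · rintro n s1 hn hn1 hk ⟨i1, i2, i3, i4⟩
    rw [hE.r2] at hn
    have hE1 := hE.keep hk rfl
    have f3 : s1.rarr 3 = s.rarr 3 := hk (.ra 3) rfl
    refine HT.seq' (reduce_spec hg hr hR hE1 i1) ?_
    rintro s2 ⟨j1, j2⟩ hk2
    have g56 : s2.wreg 56 = n := Eq.trans (hk2 (.w 56) rfl) hn1
    have g4 : s2.rarr 4 = s1.rarr 4 := hk2 (.ra 4) rfl
    rw [f3] at j2
    replace j2 : c.Tight (s.rarr 3) (s1.rarr 4) (s2.rarr 5) (s2.rarr 6) := by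
      rcases j2 with ⟨-, -, j2⟩ | ⟨-, j2⟩
      · exact j2
      · rw [j2] at i2
        exact absurd i2 Set.not_nonempty_empty
    refine HT.of_wp ?_
    simp only [HL.wp, WE.ok_reg, RE.ok_load, WE.eval_reg, RE.eval_load, true_and, g56]
    simp only [State.setW_rarr, State.setW_warr, State.setRA_rarr, State.setRA_warr, if_true, g4]
    obtain ⟨⟨x, hx, ex⟩, hlow⟩ := (j2 ⟨n, hn⟩).1
    simp only at ex
    have hupd : ∀ a < c.d, Function.update (s1.rarr 4) n (s2.rarr 5 n) a ≤ s1.rarr 4 a := by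
      intro a ha
      rw [Function.update_apply]
      split_ifs with hc
      · rw [hc, ← ex]
        exact (hx.2 ⟨n, hn⟩).2
      · exact le_rfl
    have hsub := cell_subset (g := s.rarr 3) (fun a _ => le_rfl) hupd
    refine ⟨j1, ⟨x, hx.1, fun a => ⟨(hx.2 a).1, ?_⟩⟩, hsub.trans i3, fun y hy a ha => ?_⟩
    · rw [Function.update_apply]
      split_ifs with hc
      · rw [show a = ⟨n, hn⟩ from Fin.ext hc, ex]
      · exact (hx.2 a).2
    · have hya := (hy.2 a).2
      rw [Function.update_apply] at hya ⊢
      split_ifs at hya ⊢ with hc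
      · refine le_antisymm hya ?_
        rw [show a = ⟨n, hn⟩ from Fin.ext hc]
        exact hlow ⟨y, hsub hy, rfl⟩
      · exact i4 y (hsub hy) a (by omega)
  · rintro s1 _ hk ⟨i1, ⟨x, hx⟩, i3, i4⟩
    rw [hE.r2] at i4
    exact ⟨i1, x, i3 hx, fun a => i4 x hx a a.2⟩

theorem witnesses_spec (hg : c.Good) (hr : c.Ranked) (hR : c.Reducible) (hE : c.Env s)
    (hst : ∀ y, s.warr 7 y = 0) (h9 : s.wreg 9 = n) (hn : n ≤ c.K + 1)
    (hne : ∀ i < n, (c.cell (row c.d (s.rarr 7) (i + 1)) (row c.d (s.rarr 8) (i + 1))).Nonempty) :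
    HT c.β c.w witnesses s (fun s' => ∀ i < n,
      ∃ x ∈ c.cell (row c.d (s.rarr 7) (i + 1)) (row c.d (s.rarr 8) (i + 1)),
        ∀ a : Fin c.d, x a = row c.d (s'.rarr 10) i a) := by
  have hb := hg.cells_lt hn (a := c.d) le_rfl
  refine HT.loopTo (fun m s' => (∀ y, s'.warr 7 y = 0) ∧ ∀ i < m,
      ∃ x ∈ c.cell (row c.d (s.rarr 7) (i + 1)) (row c.d (s.rarr 8) (i + 1)),
        ∀ a : Fin c.d, x a = row c.d (s'.rarr 10) i a)
    ⟨rfl, rfl, by decide⟩ (by rw [h9]; exact hn.trans hg.β9) (by rw [h9]; omega) ?_ ?_ ?_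
  · exact ⟨hst, by simp⟩
  · rintro i s1 hi hi1 hk ⟨i1, i2⟩
    rw [h9] at hi
    have hE1 := hE.keep hk rfl
    have f7 : s1.rarr 7 = s.rarr 7 := hk (.ra 7) rfl
    have f8 : s1.rarr 8 = s.rarr 8 := hk (.ra 8) rfl
    refine HT.seq (HT.of_wp ?_)
    simp only [HL.wp, WE.ok_add, WE.ok_reg, WE.ok_const, WE.eval_add, WE.eval_reg, WE.eval_const,
      true_and, hi1]
    refine ⟨by omega, ?_⟩
    refine HT.seq' (loadCell_spec hg (hE1.setW (by decide)) (i := i + 1) (by simp) (by omega)) ?_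
    intro s2 h2 hk2
    have hE2 := (hE1.setW (by decide)).keep hk2 rfl
    have g7 : s2.warr 7 = s1.warr 7 := hk2 (.wa 7) rfl
    have g10 : s2.rarr 10 = s1.rarr 10 := hk2 (.ra 10) rfl
    have g55 : s2.wreg 55 = i := Eq.trans (hk2 (.w 55) rfl) (by simp [hi1])
    simp only [State.setW_rarr, f7, f8] at h2
    have hcell := cell_congr (fun a ha => (h2 a ha).1) (fun a ha => (h2 a ha).2)
    refine HT.seq' (pinCell_spec hg hr hR hE2 (by rwa [g7]) (by rw [hcell]; exact hne i hi)) ?_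
    rintro s3 ⟨h3, x, hx, h4⟩ hk3
    rw [hcell] at hx
    have hE3 := hE2.keep hk3 rfl
    have k10 : s3.rarr 10 = s1.rarr 10 := Eq.trans (hk3 (.ra 10) rfl) g10
    have k55 : s3.wreg 55 = i := Eq.trans (hk3 (.w 55) rfl) g55
    have hid : i * c.d + c.d < 2 ^ c.w := by
      have := hg.cells_lt (i := i) (a := c.d) (by omega) le_rfl
      omega
    refine HT.loopTo (fun y s' => (∀ y, s'.warr 7 y = 0) ∧
      (∀ a < y, row c.d (s'.rarr 10) i a = s3.rarr 4 a) ∧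
      ∀ j < i, ∀ a < c.d, row c.d (s'.rarr 10) j a = row c.d (s1.rarr 10) j a)
      ⟨rfl, rfl, by decide⟩ (by rw [hE3.r2]; exact hg.β2) (by rw [hE3.r2]; omega) ?_ ?_ ?_
    · exact ⟨h3, by simp, by simp [k10]⟩
    · rintro a s4 ha ha4 hk4 ⟨l1, l2, l3⟩
      rw [hE3.r2] at ha
      have hE4 := hE3.keep hk4 rfl
      have o55 : s4.wreg 55 = i := Eq.trans (hk4 (.w 55) rfl) k55
      have o4 : s4.rarr 4 = s3.rarr 4 := hk4 (.ra 4) rfl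
      refine HT.of_wp ?_
      simp [HL.wp, ha4, o55, o4, hE4.r2, -Order.lt_add_one_iff]
      refine ⟨by omega, l1, fun b hb => ?_, fun j hj b hb => ?_⟩
      · rcases Nat.lt_succ_iff_lt_or_eq.1 hb with hb | rfl
        · have := l2 b hb
          simp only [row] at this
          simpa [row, hb.ne] using this
        · simp [row]
      · rw [row, Function.update_of_ne (row_index_ne hb ha hj.ne)]
        exact l3 j hj b hb
    · rintro s4 _ hk4 ⟨l1, l2, l3⟩
      rw [hE3.r2] at l2
      refine ⟨l1, fun j hj => ?_⟩
      rcases Nat.lt_succ_iff_lt_or_eq.1 hj with hj | rfl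
      · obtain ⟨y, hy, e⟩ := i2 j hj
        refine ⟨y, hy, fun a => ?_⟩
        rw [e a]
        exact (l3 j hj a a.2).symm
      · refine ⟨x, hx, fun a => ?_⟩
        rw [h4 a]
        exact (l2 a a.2).symm
  · rintro s1 _ hk ⟨-, i2⟩
    rwa [h9] at i2

end Cx

end RealRAM

namespace RealRAM

/-! ### Selecting the output -/

/-- Real array 3 := row (register 63) of real array `src`. -/
def loadRow (src : ℕ) : HL :=
  .loopTo 35 2 (.rsto 3 (.reg 35) (.load src (.reg 63 * .reg 2 + .reg 35)))

/-- Word register 67 := the rank code of the entry that equals cell (register 35) of real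
array 3. -/
def findCode : HL :=
  .wset 67 (.const 0) ⨟ .loopTo 65 5 (
    .ite (.rlt (.load 1 (.reg 65)) (.load 3 (.reg 35))) .skip
      (.ite (.rlt (.load 3 (.reg 35)) (.load 1 (.reg 65))) .skip
        (.wset 67 (.load 4 (.reg 65 + .const 1)))))

/-- Word register 66 := a code of the row in real array 3. -/
def rowCode : HL :=
  .wset 66 (.const 0) ⨟ .loopTo 35 2 (findCode ⨟ .wset 66 (.reg 66 * .reg 6 + .reg 67))

/-- Mark the codes of the first rows (as many as register 12 tells) of real array `src` in word
array 10. -/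
def markRows (src : ℕ) : HL :=
  .loopTo 63 12 (loadRow src ⨟ rowCode ⨟ .wsto 10 (.reg 66) (.const 1))

/-- Append the row in real array 3 to real array 0. -/
def emit : HL :=
  .loopTo 35 2 (.rsto 0 (.reg 14 * .reg 2 + .reg 35) (.load 3 (.reg 35))) ⨟
  .wset 14 (.reg 14 + .const 1)

/-- Real array 0 := the marked rows of real array 10, and further rows until there are as many as
register 15 tells. -/
def selectRows : HL :=
  .wset 13 (.reg 12) ⨟ .wset 14 (.const 0) ⨟
  .loopTo 63 9 (loadRow 10 ⨟ rowCode ⨟ .wset 16 (.load 10 (.reg 66)) ⨟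
    .ite (.weq (.reg 16) (.const 1)) .skip
      (.ite (.wlt (.reg 13) (.reg 15)) (.wset 16 (.const 1) ⨟ .wset 13 (.reg 13 + .const 1)) .skip) ⨟
    .ite (.weq (.reg 16) (.const 1)) emit .skip) ⨟
  .wset 0 (.reg 14)

namespace Cx

variable {c : Cx} {s s' : State} {n i : ℕ}

theorem loadRow_spec (hg : c.Good) (hE : c.Env s) {src : ℕ} (hsrc : src ≠ 3) (h63 : s.wreg 63 = i)
    (hi : i ≤ c.K + 1) :
    HT c.β c.w (loadRow src) s (fun s' => ∀ a < c.d, s'.rarr 3 a = row c.d (s.rarr src) i a) := by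
  have hb := hg.cells_lt (a := c.d) hi le_rfl
  refine HT.loopTo (fun x s' => ∀ a < x, s'.rarr 3 a = row c.d (s.rarr src) i a)
    ⟨rfl, rfl, by decide⟩ (by rw [hE.r2]; exact hg.β2) (by rw [hE.r2]; omega) (by simp) ?_ ?_
  · intro x s1 hx hx1 hk hI
    rw [hE.r2] at hx
    have hE1 := hE.keep hk rfl
    have f63 : s1.wreg 63 = i := Eq.trans (hk (.w 63) rfl) h63
    have fs : s1.rarr src = s.rarr src := hk (.ra src) (by simp [HL.wr, hsrc.symm])
    refine HT.of_wp ?_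
    simp [HL.wp, hx1, f63, fs, hE1.r2, -Order.lt_add_one_iff]
    refine ⟨by omega, fun a ha => ?_⟩
    rcases Nat.lt_succ_iff_lt_or_eq.1 ha with ha | rfl
    · simpa [ha.ne] using hI a ha
    · simp [row]
  · rintro s1 _ hk hI
    rwa [hE.r2] at hI

open Classical in
/-- The rank code of a number. -/
noncomputable def codeOf (c : Cx) (v : ℝ) : ℕ :=
  if h : ∃ x < c.nv, c.V x = v then c.ids (h.choose + 1) else 0

theorem Ranked.codeOf_eq (hr : c.Ranked) {x : ℕ} (hx : x < c.nv) :
    c.codeOf (c.V x) = c.ids (x + 1) := by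
  have h : ∃ y < c.nv, c.V y = c.V x := ⟨x, hx, rfl⟩
  rw [codeOf, dif_pos h]
  exact (hr.eq_iff _ h.choose_spec.1 _ hx).2 h.choose_spec.2

theorem Ranked.codeOf_le (hr : c.Ranked) (v : ℝ) : c.codeOf v ≤ c.nv := by
  by_cases h : ∃ x < c.nv, c.V x = v
  · obtain ⟨x, hx, rfl⟩ := h
    rw [hr.codeOf_eq hx]
    exact hr.le x hx
  · rw [codeOf, dif_neg h]
    omega

theorem Ranked.codeOf_inj (hr : c.Ranked) {v v' : ℝ} (hv : ∃ x < c.nv, c.V x = v)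
    (hv' : ∃ x < c.nv, c.V x = v') (h : c.codeOf v = c.codeOf v') : v = v' := by
  obtain ⟨x, hx, rfl⟩ := hv
  obtain ⟨y, hy, rfl⟩ := hv'
  rw [hr.codeOf_eq hx, hr.codeOf_eq hy] at h
  exact (hr.eq_iff x hx y hy).1 h

/-- The code of a row. -/
noncomputable def code (c : Cx) (y : ℕ → ℝ) : ℕ := horner (c.nv + 1) (fun a => c.codeOf (y a)) c.d

theorem Ranked.code_inj (hr : c.Ranked) {y y' : ℕ → ℝ} (hy : ∀ a < c.d, ∃ x < c.nv, c.V x = y a)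
    (hy' : ∀ a < c.d, ∃ x < c.nv, c.V x = y' a) (h : c.code y = c.code y') :
    ∀ a < c.d, y a = y' a := by
  intro a ha
  refine hr.codeOf_inj (hy a ha) (hy' a ha) (horner_inj (fun a _ => ?_) (fun a _ => ?_) h a ha) <;>
  exact Nat.lt_succ_of_le (hr.codeOf_le _)

/-- Reals are compared by `<` only, so equality is the failure of both comparisons. The linear scan
is affordable: it is made once per coordinate for `O(K)` rows. -/
theorem findCode_spec (hg : c.Good) (hr : c.Ranked) (hE : c.Env s) {v : ℝ}
    (h3 : s.rarr 3 (s.wreg 35) = v) (hv : ∃ x < c.nv, c.V x = v) :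
    HT c.β c.w findCode s (fun s' => s'.wreg 67 = c.codeOf v) := by
  have hnv := hg.nv_lt.1
  refine HT.seq (HT.of_wp ?_)
  simp only [HL.wp, WE.ok_const]
  refine ⟨by omega, ?_⟩
  set s0 := s.setW 67 _ with hs0
  have hE0 : c.Env s0 := hE.setW (by decide)
  have e3 : s0.rarr 3 (s0.wreg 35) = v := by simpa [hs0] using h3
  clear_value s0
  refine HT.loopTo (fun n s' => (∃ x < n, c.V x = v) → s'.wreg 67 = c.codeOf v)
    ⟨rfl, rfl, by decide⟩ (by rw [hE0.r5]; exact hg.β5) (by rw [hE0.r5]; omega) (by simp) ?_ ?_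
  · intro n s1 hn hn1 hk hI
    rw [hE0.r5] at hn
    have hE1 := hE0.keep hk rfl
    have f3 : s1.rarr 3 (s1.wreg 35) = v := by
      rw [show s1.rarr 3 = s0.rarr 3 from hk (.ra 3) rfl,
        show s1.wreg 35 = s0.wreg 35 from hk (.w 35) rfl, e3]
    have hold : c.V n ≠ v → (∃ x < n + 1, c.V x = v) → s1.wreg 67 = c.codeOf v := by
      rintro hne ⟨x, hx, e⟩
      rcases Nat.lt_succ_iff_lt_or_eq.1 hx with hx | rfl
      · exact hI ⟨x, hx, e⟩
      · exact absurd e hne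
    refine HT.of_wp ?_
    simp only [HL.wp, HC.ok_rlt, RE.ok_load, WE.ok_reg, HC.holds_rlt, RE.eval_load, WE.eval_reg,
      WE.ok_load, WE.eval_load, WE.ok_add, WE.eval_add, WE.ok_const, WE.eval_const, true_and,
      hn1, hE1.V, hE1.ids, f3, State.setW_wreg]
    refine ⟨fun h => ?_, fun h => ⟨fun h' => ?_, fun h' => ⟨by omega, fun _ => ?_⟩⟩⟩
    · simpa using hold h.ne
    · simpa using hold h'.ne'
    · have : c.V n = v := le_antisymm (not_lt.1 h') (not_lt.1 h)
      simp [← this, hr.codeOf_eq hn]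
  · intro s1 _ hk hI
    rw [hE0.r5] at hI
    exact hI hv

theorem rowCode_spec (hg : c.Good) (hr : c.Ranked) (hE : c.Env s) {y : ℕ → ℝ}
    (h3 : ∀ a < c.d, s.rarr 3 a = y a) (hy : ∀ a < c.d, ∃ x < c.nv, c.V x = y a) :
    HT c.β c.w rowCode s (fun s' => s'.wreg 66 = c.code y) := by
  have hnv := hg.nv_lt
  have hb := hg.cells_lt (i := 0) (a := 0) (by omega) (by omega)
  refine HT.seq (HT.of_wp ?_)
  simp only [HL.wp, WE.ok_const, WE.eval_const]
  refine ⟨by omega, ?_⟩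
  set s0 := s.setW 66 0 with hs0
  have hE0 : c.Env s0 := hE.setW (by decide)
  have e3 : s0.rarr 3 = s.rarr 3 := rfl
  have e66 : s0.wreg 66 = 0 := by simp [hs0]
  clear_value s0
  refine HT.loopTo (fun x s' => s'.wreg 66 = horner (c.nv + 1) (fun a => c.codeOf (y a)) x)
    ⟨rfl, rfl, by decide⟩ (by rw [hE0.r2]; exact hg.β2) (by rw [hE0.r2]; omega)
    (by simp [e66, horner]) ?_ ?_
  · intro x s1 hx hx1 hk hI
    rw [hE0.r2] at hx
    have hE1 := hE0.keep hk rfl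
    have f3 : s1.rarr 3 = s.rarr 3 := Eq.trans (hk (.ra 3) rfl) e3
    refine HT.seq' (findCode_spec hg hr hE1 (v := y x) (by rw [f3, hx1, h3 x hx]) (hy x hx)) ?_
    intro s2 h2 hk2
    have hE2 := hE1.keep hk2 rfl
    have g66 : s2.wreg 66 = horner (c.nv + 1) (fun a => c.codeOf (y a)) x :=
      Eq.trans (hk2 (.w 66) rfl) hI
    have hlt : horner (c.nv + 1) (fun a => c.codeOf (y a)) (x + 1) < 2 ^ c.w := by
      refine (horner_lt fun a _ => Nat.lt_succ_of_le (hr.codeOf_le _)).trans_le ?_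
      exact (Nat.pow_le_pow_right (by omega) (show x + 1 ≤ c.d + 1 by omega)).trans hnv.2.le
    simp only [horner] at hlt
    refine HT.of_wp ?_
    simp [HL.wp, g66, h2, hE2.r6, horner]
    omega
  · intro s1 _ hk hI
    rw [hE0.r2] at hI
    exact hI

/-- The clustering program returns bare coordinates. Marking the codes of its rows makes it possible
to decide, for each witness, by one array access whether it was chosen. -/
theorem markRows_spec (hg : c.Good) (hr : c.Ranked) (hE : c.Env s) {q src : ℕ} (hsrc : src ≠ 3)
    (h12 : s.wreg 12 = q) (hq : q ≤ c.K + 1) (h10 : ∀ y, s.warr 10 y = 0)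
    (hV : ∀ j < q, ∀ a < c.d, ∃ x < c.nv, c.V x = row c.d (s.rarr src) j a) :
    HT c.β c.w (markRows src) s (fun s' => ∀ y, s'.warr 10 y = 1 ↔
      ∃ j < q, c.code (row c.d (s.rarr src) j) = y) := by
  have hb := hg.cells_lt hq (a := c.d) le_rfl
  refine HT.loopTo (fun n s' => ∀ y, s'.warr 10 y = 1 ↔
      ∃ j < n, c.code (row c.d (s.rarr src) j) = y)
    ⟨rfl, rfl, by decide⟩ (by rw [h12]; exact hq.trans hg.β12) (by rw [h12]; omega)
    (by simp [h10]) ?_ ?_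
  · intro j s1 hj hj1 hk hI
    rw [h12] at hj
    have hE1 := hE.keep hk rfl
    have fs : s1.rarr src = s.rarr src := hk (.ra src) (by
      simp [HL.wr, loadRow, rowCode, findCode, hsrc.symm])
    refine HT.seq' (loadRow_spec hg hE1 hsrc hj1 (by omega)) ?_
    intro s2 h2 hk2
    have hE2 := hE1.keep hk2 rfl
    rw [fs] at h2
    refine HT.seq' (rowCode_spec hg hr hE2 h2 (hV j hj)) ?_
    intro s3 h3 hk3
    have f10 : s3.warr 10 = s1.warr 10 := Eq.trans (hk3 (.wa 10) rfl) (hk2 (.wa 10) rfl)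
    refine HT.of_wp ?_
    simp only [HL.wp, WE.ok_reg, WE.ok_const, WE.eval_reg, WE.eval_const, true_and, h3,
      State.setW_warr, State.setWA_warr, if_true, f10]
    refine ⟨by omega, fun y => ?_⟩
    rw [Function.update_apply]
    split_ifs with hc
    · simpa using ⟨j, by omega, hc.symm⟩
    · rw [hI y]
      constructor
      · rintro ⟨j', hj', e⟩
        exact ⟨j', by omega, e⟩
      · rintro ⟨j', hj', e⟩
        rcases Nat.lt_succ_iff_lt_or_eq.1 hj' with hj' | rfl
        · exact ⟨j', hj', e⟩
        · exact absurd e.symm hc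
  · intro s1 _ hk hI
    rwa [h12] at hI

theorem emit_spec (hg : c.Good) (hE : c.Env s) {e : ℕ} (h14 : s.wreg 14 = e) (he : e ≤ c.K) :
    HT c.β c.w emit s (fun s' => s'.wreg 14 = e + 1 ∧
      (∀ a < c.d, row c.d (s'.rarr 0) e a = s.rarr 3 a) ∧
      ∀ i < e, ∀ a < c.d, row c.d (s'.rarr 0) i a = row c.d (s.rarr 0) i a) := by
  have hb := hg.cells_lt (i := e) (a := c.d) (by omega) le_rfl
  refine HT.seq' (HT.loopTo (Q := fun s' => (∀ a < c.d, row c.d (s'.rarr 0) e a = s.rarr 3 a) ∧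
      ∀ i < e, ∀ a < c.d, row c.d (s'.rarr 0) i a = row c.d (s.rarr 0) i a)
    (fun x s' => (∀ a < x, row c.d (s'.rarr 0) e a = s.rarr 3 a) ∧
      ∀ i < e, ∀ a < c.d, row c.d (s'.rarr 0) i a = row c.d (s.rarr 0) i a)
    ⟨rfl, rfl, by decide⟩ (by rw [hE.r2]; exact hg.β2) (by rw [hE.r2]; omega) (by simp) ?_ ?_) ?_
  · rintro x s1 hx hx1 hk ⟨i1, i2⟩
    rw [hE.r2] at hx
    have hE1 := hE.keep hk rfl
    have f14 : s1.wreg 14 = e := Eq.trans (hk (.w 14) rfl) h14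
    have f3 : s1.rarr 3 = s.rarr 3 := hk (.ra 3) rfl
    refine HT.of_wp ?_
    simp [HL.wp, hx1, f14, f3, hE1.r2, -Order.lt_add_one_iff]
    refine ⟨by omega, fun a ha => ?_, fun i hi a ha => ?_⟩
    · rcases Nat.lt_succ_iff_lt_or_eq.1 ha with ha | rfl
      · have := i1 a ha
        simp only [row] at this
        simpa [row, ha.ne] using this
      · simp [row]
    · rw [row, Function.update_of_ne (row_index_ne ha hx hi.ne)]
      exact i2 i hi a ha
  · rintro s1 _ hk hI
    rwa [hE.r2] at hI
  · rintro s1 ⟨i1, i2⟩ hk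
    have f14 : s1.wreg 14 = e := Eq.trans (hk (.w 14) rfl) h14
    refine HT.of_wp ?_
    simp only [HL.wp, WE.ok_add, WE.ok_reg, WE.ok_const, WE.eval_add, WE.eval_reg, WE.eval_const,
      true_and, f14]
    exact ⟨by omega, by simp, i1, i2⟩

open Classical in
/-- The state of `selectRows` after `x` rows: the rows `σ 0, …, σ (e - 1)` are selected. -/
structure Selected (mk : ℕ → Prop) (q k' x e t : ℕ) (σ : ℕ → ℕ) : Prop where
  lt : ∀ i < e, σ i < x
  inj : ∀ i < e, ∀ j < e, σ i = σ j → i = j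
  marked : ∀ y < x, mk y → ∃ i < e, σ i = y
  count : e + q = t + ((Finset.range x).filter mk).card
  le : q ≤ t ∧ t ≤ k'
  all : t < k' → e = x
  e_le : e ≤ x

theorem Selected.push {mk : ℕ → Prop} {q k' x e t t' : ℕ} {σ : ℕ → ℕ} (h : Selected mk q k' x e t σ)
    (ht : (mk x ∧ t' = t) ∨ (¬ mk x ∧ t < k' ∧ t' = t + 1)) :
    Selected mk q k' (x + 1) (e + 1) t' (Function.update σ e x) := by
  classical
  have hσ : ∀ i < e, Function.update σ e x i = σ i := fun i hi => Function.update_of_ne hi.ne _ _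
  refine ⟨fun i hi => ?_, fun i hi j hj hij => ?_, fun y hy hm => ?_, ?_, ?_, ?_, ?_⟩
  · rcases Nat.lt_succ_iff_lt_or_eq.1 hi with hi | rfl
    · rw [hσ i hi]
      have := h.lt i hi
      omega
    · simp
  · rcases Nat.lt_succ_iff_lt_or_eq.1 hi with hi | rfl <;>
      rcases Nat.lt_succ_iff_lt_or_eq.1 hj with hj | rfl
    · rw [hσ i hi, hσ j hj] at hij
      exact h.inj i hi j hj hij
    · rw [hσ i hi, Function.update_self] at hij
      exact absurd hij (h.lt i hi).ne
    · rw [hσ j hj, Function.update_self] at hij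
      exact absurd hij (h.lt j hj).ne'
    · rfl
  · rcases Nat.lt_succ_iff_lt_or_eq.1 hy with hy | rfl
    · obtain ⟨i, hi, e'⟩ := h.marked y hy hm
      exact ⟨i, by omega, by rw [hσ i hi, e']⟩
    · exact ⟨e, by omega, by simp⟩
  · rw [Finset.range_add_one, Finset.filter_insert]
    have := h.count
    rcases ht with ⟨hm, rfl⟩ | ⟨hm, -, rfl⟩
    · rw [if_pos hm, Finset.card_insert_of_notMem (by simp)]
      omega
    · rw [if_neg hm]
      omega
  · have := h.le
    rcases ht with ⟨-, rfl⟩ | ⟨-, h2, rfl⟩ <;> omega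
  · intro h2
    have := h.all (by rcases ht with ⟨-, rfl⟩ | ⟨-, h3, rfl⟩ <;> omega)
    omega
  · have := h.e_le
    omega

theorem Selected.pass {mk : ℕ → Prop} {q k' x e t : ℕ} {σ : ℕ → ℕ} (h : Selected mk q k' x e t σ)
    (hm : ¬ mk x) (ht : ¬ t < k') : Selected mk q k' (x + 1) e t σ := by
  classical
  refine ⟨fun i hi => (h.lt i hi).trans (by omega), h.inj, fun y hy hy' => ?_, ?_, h.le,
    fun h' => absurd h' ht, h.e_le.trans (by omega)⟩
  · rcases Nat.lt_succ_iff_lt_or_eq.1 hy with hy | rfl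
    · exact h.marked y hy hy'
    · exact absurd hy' hm
  · rw [Finset.range_add_one, Finset.filter_insert, if_neg hm]
    exact h.count

/-- The counter in register 13 starts at `q`, which reserves a place for every marked row; an
unmarked row is taken only while the counter is below `k'`. Since exactly `q` rows are marked, the
counter ends as the number of rows taken, and it reaches `k'`, for otherwise all `n ≥ k'` rows would
have been taken. -/
theorem selectRows_spec (hg : c.Good) (hr : c.Ranked) (hE : c.Env s) {q k' : ℕ} {τ : ℕ → ℕ}
    (h12 : s.wreg 12 = q) (h9 : s.wreg 9 = n) (h15 : s.wreg 15 = k') (hn : n ≤ c.K + 1)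
    (hq : q ≤ k') (hk' : k' ≤ n)
    (hV : ∀ i < n, ∀ a < c.d, ∃ x < c.nv, c.V x = row c.d (s.rarr 10) i a)
    (hτ : ∀ j < q, τ j < n) (hinj : ∀ i < q, ∀ j < q, τ i = τ j → i = j)
    (hmark : ∀ i < n, s.warr 10 (c.code (row c.d (s.rarr 10) i)) = 1 ↔ ∃ j < q, τ j = i) :
    HT c.β c.w selectRows s (fun s' => s'.wreg 0 = k' ∧ ∃ σ : ℕ → ℕ,
      (∀ i < k', σ i < n ∧ ∀ a < c.d, row c.d (s'.rarr 0) i a = row c.d (s.rarr 10) (σ i) a) ∧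
      (∀ i < k', ∀ j < k', σ i = σ j → i = j) ∧ ∀ j < q, ∃ i < k', σ i = τ j) := by
  classical
  have hb := hg.cells_lt hn (a := c.d) le_rfl
  set mk : ℕ → Prop := fun i => ∃ j < q, τ j = i with hmk
  refine HT.seq (HT.of_wp ?_)
  simp only [HL.wp, WE.ok_reg, WE.eval_reg, true_and, h12]
  refine HT.seq (HT.of_wp ?_)
  simp only [HL.wp, WE.ok_const, WE.eval_const]
  refine ⟨by omega, ?_⟩
  set s0 := State.setW _ 14 0 with hs0
  have hE0 : c.Env s0 := (hE.setW (by decide)).setW (by decide)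
  have e13 : s0.wreg 13 = q := by simp [hs0]
  have e14 : s0.wreg 14 = 0 := by simp [hs0]
  have e9 : s0.wreg 9 = n := by simp [hs0, h9]
  have e15 : s0.wreg 15 = k' := by simp [hs0, h15]
  have a10 : s0.warr 10 = s.warr 10 := rfl
  have b10 : s0.rarr 10 = s.rarr 10 := rfl
  clear_value s0
  refine HT.seq' (HT.loopTo (Q := fun s' => ∃ σ : ℕ → ℕ,
      Selected mk q k' n (s'.wreg 14) (s'.wreg 13) σ ∧
      ∀ i < s'.wreg 14, ∀ a < c.d, row c.d (s'.rarr 0) i a = row c.d (s.rarr 10) (σ i) a)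
    (fun x s' => ∃ σ : ℕ → ℕ,
      Selected mk q k' x (s'.wreg 14) (s'.wreg 13) σ ∧
      ∀ i < s'.wreg 14, ∀ a < c.d, row c.d (s'.rarr 0) i a = row c.d (s.rarr 10) (σ i) a)
    ⟨rfl, rfl, by decide⟩ (by rw [e9]; exact hn.trans hg.β9) (by rw [e9]; omega) ?_ ?_ ?_) ?_
  · refine ⟨id, ⟨?_, ?_, ?_, ?_, ?_, ?_, ?_⟩, ?_⟩ <;> simp [e13, e14, hq]
  · rintro x s1 hx hx1 hk ⟨σ, hS, hrows⟩
    rw [e9] at hx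
    have hE1 := hE0.keep hk rfl
    have f15 : s1.wreg 15 = k' := Eq.trans (hk (.w 15) rfl) e15
    have g10 : s1.rarr 10 = s.rarr 10 := Eq.trans (hk (.ra 10) rfl) b10
    have f10 : s1.warr 10 = s.warr 10 := Eq.trans (hk (.wa 10) rfl) a10
    generalize he : s1.wreg 14 = e at *
    generalize ht : s1.wreg 13 = t at *
    have hele := hS.e_le
    refine HT.seq' (loadRow_spec hg hE1 (by decide) hx1 (by omega)) ?_
    intro s2 h2 hk2
    rw [g10] at h2
    have hE2 := hE1.keep hk2 rfl
    refine HT.seq' (rowCode_spec hg hr hE2 h2 (hV x hx)) ?_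
    intro s3 h3 hk3
    have hE3 := hE2.keep hk3 rfl
    have u13 : s3.wreg 13 = t := Eq.trans (hk3 (.w 13) rfl) (Eq.trans (hk2 (.w 13) rfl) ht)
    have u14 : s3.wreg 14 = e := Eq.trans (hk3 (.w 14) rfl) (Eq.trans (hk2 (.w 14) rfl) he)
    have u15 : s3.wreg 15 = k' := Eq.trans (hk3 (.w 15) rfl) (Eq.trans (hk2 (.w 15) rfl) f15)
    have v10 : s3.warr 10 = s.warr 10 :=
      Eq.trans (hk3 (.wa 10) rfl) (Eq.trans (hk2 (.wa 10) rfl) f10)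
    have v0 : s3.rarr 0 = s1.rarr 0 := Eq.trans (hk3 (.ra 0) rfl) (hk2 (.ra 0) rfl)
    have v3 : s3.rarr 3 = s2.rarr 3 := hk3 (.ra 3) rfl
    refine HT.seq (HT.of_wp ?_)
    simp only [HL.wp, WE.ok_load, WE.ok_reg, WE.eval_load, WE.eval_reg, true_and, h3, v10]
    set s4 := s3.setW 16 _ with hs4
    have hE4 : c.Env s4 := hE3.setW (by decide)
    have w13 : s4.wreg 13 = t := by simp [hs4, u13]
    have w14 : s4.wreg 14 = e := by simp [hs4, u14]
    have w15 : s4.wreg 15 = k' := by simp [hs4, u15]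
    have w16 : s4.wreg 16 = 1 ↔ mk x := by
      refine Iff.trans ?_ (hmark x hx)
      simp [hs4]
    have x0 : s4.rarr 0 = s1.rarr 0 := v0
    have x3 : s4.rarr 3 = s2.rarr 3 := v3
    clear_value s4
    have htk := hS.le
    refine HT.seq' (R := fun s' => (s'.wreg 16 = 1 ∧
        ((mk x ∧ s'.wreg 13 = t) ∨ (¬ mk x ∧ t < k' ∧ s'.wreg 13 = t + 1))) ∨
        (s'.wreg 16 ≠ 1 ∧ ¬ mk x ∧ ¬ t < k' ∧ s'.wreg 13 = t)) (HT.of_wp ?_) ?_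
    · simp only [HL.wp, HC.ok_weq, WE.ok_reg, WE.ok_const, HC.holds_weq, WE.eval_reg,
        WE.eval_const, HC.ok_wlt, HC.holds_wlt, w13, w15, true_and, w16, WE.ok_add, WE.eval_add,
        State.setW_wreg]
      norm_num
      exact ⟨hg.w_ne, fun hm => Or.inl hm, fun hm => ⟨fun htk' => ⟨hg.w_ne, ⟨hg.w_ne, by omega⟩, hm, htk'⟩,
        fun htk' => Or.inr ⟨mt w16.1 hm, hm, htk'⟩⟩⟩
    intro s5 h5 hk5
    have hE5 := hE4.keep hk5 rfl
    have y14 : s5.wreg 14 = e := Eq.trans (hk5 (.w 14) rfl) w14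
    have z0 : s5.rarr 0 = s1.rarr 0 := Eq.trans (hk5 (.ra 0) rfl) x0
    have z3 : s5.rarr 3 = s2.rarr 3 := Eq.trans (hk5 (.ra 3) rfl) x3
    refine HT.ite ?_ (fun h => ?_) (fun h => ?_)
    · simp [hg.w_ne]
    · simp at h
      refine (emit_spec hg hE5 y14 (by omega)).keeps.mono ?_
      rintro s6 ⟨⟨l1, l2, l3⟩, hk6⟩
      have q13 : s6.wreg 13 = s5.wreg 13 := hk6 (.w 13) rfl
      refine ⟨Function.update σ e x, ?_, ?_⟩
      · simp only [State.setW_wreg]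
        norm_num
        rw [l1, q13]
        rcases h5 with ⟨-, h5⟩ | ⟨h5, -⟩
        · exact hS.push h5
        · exact absurd h h5
      · simp only [State.setW_wreg, State.setW_rarr]
        norm_num
        rw [l1]
        intro i hi a ha
        rcases Nat.lt_succ_iff_lt_or_eq.1 hi with hi | rfl
        · rw [l3 i hi a ha, z0, hrows i hi a ha, Function.update_of_ne hi.ne]
        · rw [l2 a ha, z3, h2 a ha, Function.update_self]
    · simp at h
      rcases h5 with ⟨h5, -⟩ | ⟨-, j1, j2, j3⟩
      · exact absurd h5 h
      · refine HT.skip ⟨σ, ?_, ?_⟩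
        · simp only [State.setW_wreg]
          norm_num
          rw [y14, j3]
          exact hS.pass j1 j2
        · simp only [State.setW_wreg, State.setW_rarr]
          norm_num
          rwa [y14, z0]
  · rintro s1 _ hk hI
    rwa [e9] at hI
  · rintro s1 ⟨σ, hS, hrows⟩ -
    have hcard : ((Finset.range n).filter mk).card = q := by
      have : (Finset.range n).filter mk = (Finset.range q).image τ := by
        ext i
        simp only [Finset.mem_filter, Finset.mem_range, Finset.mem_image, hmk]
        constructor
        · rintro ⟨-, j, hj, e⟩
          exact ⟨j, hj, e⟩
        · rintro ⟨j, hj, rfl⟩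
          exact ⟨hτ j hj, j, hj, rfl⟩
      rw [this, Finset.card_image_of_injOn, Finset.card_range]
      intro i hi j hj e
      exact hinj i (by simpa using hi) j (by simpa using hj) e
    -- The reserved places have all been used, so the number of emitted rows equals the counter.
    have hcount : s1.wreg 14 + q = s1.wreg 13 + q := by
      convert hS.count using 2
      convert hcard.symm
    have hle := hS.le
    have he : s1.wreg 14 = k' := by
      by_contra hne
      have := hS.all (by omega)
      omega
    refine HT.of_wp ?_
    simp only [HL.wp, WE.ok_reg, WE.eval_reg, true_and, State.setW_wreg, if_true, State.setW_rarr]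
    rw [he] at hS hrows
    exact ⟨he, σ, fun i hi => ⟨hS.lt i hi, hrows i hi⟩, hS.inj,
      fun j hj => hS.marked _ (hτ j hj) ⟨j, hj, rfl⟩⟩

end Cx

end RealRAM

namespace RealRAM

/-! ### Packing -/

/-- The window `(u, u + s]` with `u = max g (p - s)` lies inside `(g, h]` and within distance `s` of
`p`, and a half-open interval of length `s` contains a multiple of `s`. -/
theorem exists_lattice_point {g h p s : ℝ} (hs : 0 < s) (hg : g < p) (hp : p ≤ h)
    (hw : s ≤ h - g) : ∃ z : ℤ, g < s * z ∧ s * z ≤ h ∧ |s * z - p| ≤ s := by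
  set u := max g (p - s) with hu
  have h1 : g ≤ u := le_max_left _ _
  have h2 : p - s ≤ u := le_max_right _ _
  have h3 : u + s ≤ h := by
    rcases max_choice g (p - s) with h | h <;> rw [hu, h] <;> linarith
  have h4 : u ≤ p := max_le hg.le (by linarith)
  have h5 : s * ((⌊(u + s) / s⌋ : ℤ) : ℝ) ≤ u + s := by
    have := Int.floor_le ((u + s) / s)
    rwa [le_div_iff₀ hs, mul_comm] at this
  have h6 : u < s * ((⌊(u + s) / s⌋ : ℤ) : ℝ) := by
    have := Int.lt_floor_add_one ((u + s) / s)
    rw [div_lt_iff₀ hs] at this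
    linarith
  refine ⟨⌊(u + s) / s⌋, by linarith, by linarith, abs_le.2 ⟨by linarith, by linarith⟩⟩

theorem card_near_le {s r p : ℝ} (hs : 0 < s) {B : ℕ} (hB : 2 * r / s + 3 ≤ B) :
    (Finset.Icc ⌈(p - r - s) / s⌉ ⌊(p + r + s) / s⌋).card ≤ B := by
  rw [Int.card_Icc]
  refine Int.toNat_le.2 ?_
  have h1 := Int.floor_le ((p + r + s) / s)
  have h2 := Int.le_ceil ((p - r - s) / s)
  have h3 : (p + r + s) / s - (p - r - s) / s = 2 * r / s + 2 := by
    field_simp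
    ring
  have : ((⌊(p + r + s) / s⌋ + 1 - ⌈(p - r - s) / s⌉ : ℤ) : ℝ) ≤ (B : ℝ) := by
    push_cast
    linarith
  exact_mod_cast this

namespace Cx

variable {c : Cx} {n : ℕ} {key G H mid : ℕ → ℝ} {dim : ℕ → ℕ}

/-- Each cell is assigned a lattice point `s * z i` inside it and a point `y i` of `S`, the lattice
point being within `r + s` of `y i` in every coordinate. Cells are disjoint, so `z` is injective;
for a fixed value of `y i` each coordinate of `z i` has at most `B` possible values. -/
theorem Part.card_le (h : c.Part n key G H dim mid) {S : Finset (EuclideanSpace ℝ (Fin c.d))}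
    {r s : ℝ} (hs : 0 < s) (hS : ∀ x ∈ c.res, ∃ y ∈ S, dist x y ≤ r)
    (hside : ∀ i, 1 ≤ i → i ≤ n → ∀ a < c.d, s ≤ row c.d H i a - row c.d G i a) {B : ℕ}
    (hB : 2 * r / s + 3 ≤ B) : n ≤ S.card * B ^ c.d := by
  classical
  have hpick : ∀ i, ∃ (y : EuclideanSpace ℝ (Fin c.d)) (z : Fin c.d → ℤ), 1 ≤ i → i ≤ n →
      y ∈ S ∧ ∀ a : Fin c.d, row c.d G i a < s * z a ∧ s * z a ≤ row c.d H i a ∧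
        |s * z a - y a| ≤ r + s := by
    intro i
    by_cases hi : 1 ≤ i ∧ i ≤ n
    · obtain ⟨x, hx⟩ := (h.info i hi.1 hi.2).ne
      obtain ⟨y, hy, hxy⟩ := hS x hx.1
      have : ∀ a : Fin c.d, ∃ z : ℤ, row c.d G i a < s * z ∧ s * z ≤ row c.d H i a ∧
          |s * z - x a| ≤ s :=
        fun a => exists_lattice_point hs (hx.2 a).1 (hx.2 a).2 (hside i hi.1 hi.2 a a.2)
      choose z hz using this
      refine ⟨y, z, fun _ _ => ⟨hy, fun a => ⟨(hz a).1, (hz a).2.1, ?_⟩⟩⟩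
      have h1 : |x a - y a| ≤ r := (Real.norm_eq_abs _ ▸ PiLp.norm_apply_le (x - y) a).trans
        (by rwa [← dist_eq_norm])
      calc |s * z a - y a| = |(s * z a - x a) + (x a - y a)| := by ring_nf
        _ ≤ |s * z a - x a| + |x a - y a| := abs_add_le _ _
        _ ≤ r + s := by linarith [(hz a).2.2]
    · exact ⟨0, 0, fun h1 h2 => absurd ⟨h1, h2⟩ hi⟩
  choose y z hyz using hpick
  have hmem : ∀ i ∈ Finset.Icc 1 n, y i ∈ S := by
    intro i hi
    rw [Finset.mem_Icc] at hi
    exact (hyz i hi.1 hi.2).1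
  have key : (Finset.Icc 1 n).card ≤ B ^ c.d * S.card := by
    refine Finset.card_le_mul_card_image_of_maps_to hmem _ fun p hp => ?_
    have hcard : (Fintype.piFinset fun a : Fin c.d =>
        Finset.Icc ⌈(p a - r - s) / s⌉ ⌊(p a + r + s) / s⌋).card ≤ B ^ c.d := by
      rw [Fintype.card_piFinset]
      refine (Finset.prod_le_pow_card _ _ B fun a _ => card_near_le hs hB).trans (by simp)
    refine le_trans (Finset.card_le_card_of_injOn z ?_ ?_) hcard
    · intro i hi
      simp only [Finset.coe_filter, Finset.mem_Icc, Set.mem_ofPred_eq] at hi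
      obtain ⟨⟨h1, h2⟩, rfl⟩ := hi
      rw [Finset.mem_coe, Fintype.mem_piFinset]
      intro a
      have := abs_le.1 ((hyz i h1 h2).2 a).2.2
      rw [Finset.mem_Icc, Int.ceil_le, Int.le_floor, div_le_iff₀ hs, le_div_iff₀ hs]
      constructor <;> linarith
    · intro i hi j hj hij
      simp only [Finset.coe_filter, Finset.mem_Icc, Set.mem_ofPred_eq] at hi hj
      by_contra hne
      obtain ⟨a, ha, hd | hd⟩ := h.disj i j hi.1.1 hi.1.2 hj.1.1 hj.1.2 hne
      · have h1 := ((hyz i hi.1.1 hi.1.2).2 ⟨a, ha⟩).2.1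
        have h2 := ((hyz j hj.1.1 hj.1.2).2 ⟨a, ha⟩).1
        rw [← hij] at h2
        simp only at h1 h2
        linarith
      · have h1 := ((hyz j hj.1.1 hj.1.2).2 ⟨a, ha⟩).2.1
        have h2 := ((hyz i hi.1.1 hi.1.2).2 ⟨a, ha⟩).1
        rw [hij] at h2
        simp only at h1 h2
        linarith
  rw [Nat.card_Icc] at key
  rw [Nat.mul_comm]
  omega

/-- Otherwise `key j` is positive and all cells have width at least `s = key j / 2`, with `2 * r / s
≤ 4 * d / η`; then `Part.card_le` gives `n ≤ S.card * B ^ d`, against `hn`. -/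
theorem Part.key_le (h : c.Part n key G H dim mid) {S : Finset (EuclideanSpace ℝ (Fin c.d))}
    {r η : ℝ} (hη : 0 < η) (hr : 0 ≤ r) (hS : ∀ x ∈ c.res, ∃ y ∈ S, dist x y ≤ r) {B : ℕ}
    (hB : 4 * c.d / η + 3 ≤ B) (hn : S.card * B ^ c.d < n) {j : ℕ} (hj : 1 ≤ j) (hjn : j ≤ n) :
    c.d * key j ≤ η * r := by
  by_contra! hlt
  have h0 : 0 < key j := by
    rcases (h.info j hj hjn).nonneg.eq_or_lt with h0 | h0
    · rw [← h0, mul_zero] at hlt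
      nlinarith
    · exact h0
  have := h.card_le (s := key j / 2) (by positivity) hS
    (fun i hi hi' a ha => by linarith [h.sides i j hi hi' hj hjn a ha]) (B := B) ?_
  · omega
  · refine le_trans ?_ hB
    have : r / key j ≤ c.d / η := by
      rw [div_le_div_iff₀ h0 hη]
      linarith
    have e : 2 * r / (key j / 2) = 4 * (r / key j) := by
      field_simp
      ring
    rw [e, mul_div_assoc]
    linarith

end Cx

end RealRAM

/-! ### Approximation -/

section Approximation

variable {d : ℕ}

/-- The factor `d` in place of `√d` affects only the number of cells, by a constant factor. -/
theorem edist_le_of_coord {x y : EuclideanSpace ℝ (Fin d)} {L : ℝ} (hL : 0 ≤ L)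
    (h : ∀ a, |x a - y a| ≤ L) : edist x y ≤ ENNReal.ofReal (d * L) := by
  rw [edist_dist]
  refine ENNReal.ofReal_le_ofReal ?_
  rw [EuclideanSpace.dist_eq]
  refine Real.sqrt_le_iff.2 ⟨by positivity, ?_⟩
  calc ∑ a, dist (x a) (y a) ^ 2 ≤ ∑ _a : Fin d, L ^ 2 := by
        refine Finset.sum_le_sum fun a _ => ?_
        rw [Real.dist_eq]
        exact pow_le_pow_left₀ (abs_nonneg _) (h a) 2
    _ = d * L ^ 2 := by simp
    _ ≤ (d * L) ^ 2 := by
        have : (d : ℝ) ≤ (d : ℝ) ^ 2 := by exact_mod_cast Nat.le_self_pow (by norm_num) d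
        rw [mul_pow]
        exact mul_le_mul_of_nonneg_right this (sq_nonneg _)

theorem centerCost_anti {C C' P : Set (EuclideanSpace ℝ (Fin d))} (h : C ⊆ C') :
    centerCost C' P ≤ centerCost C P :=
  iSup₂_mono fun _ _ => iInf_le_iInf_of_subset h

theorem iInf_edist_le_centerCost (C : Set (EuclideanSpace ℝ (Fin d)))
    {P : Set (EuclideanSpace ℝ (Fin d))} {p : EuclideanSpace ℝ (Fin d)} (hp : p ∈ P) :
    ⨅ c ∈ C, edist p c ≤ centerCost C P := by
  unfold centerCost
  exact le_iSup₂_of_le p hp le_rfl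

theorem centerCost_le_add {C P R : Set (EuclideanSpace ℝ (Fin d))} {δ : ℝ≥0∞}
    (h : ∀ x ∈ R, ∃ p ∈ P, edist x p ≤ δ) : centerCost C R ≤ δ + centerCost C P := by
  refine iSup₂_le fun x hx => ?_
  obtain ⟨p, hp, hxp⟩ := h x hx
  refine le_trans ?_ (add_le_add hxp (iInf_edist_le_centerCost C hp))
  rw [ENNReal.add_iInf₂]
  exact iInf₂_mono fun c _ => edist_triangle _ _ _

/-- A finite nonempty `S` attains its infimum; an empty `S` has infinite cost once there is a point
to serve. -/
theorem exists_dist_le {R : Set (EuclideanSpace ℝ (Fin d))} {S : Finset (EuclideanSpace ℝ (Fin d))}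
    (h : centerCost (S : Set _) R ≠ ⊤) {x : EuclideanSpace ℝ (Fin d)} (hx : x ∈ R) :
    ∃ y ∈ S, dist x y ≤ (centerCost (S : Set _) R).toReal := by
  have hle : ⨅ c ∈ (S : Set (EuclideanSpace ℝ (Fin d))), edist x c ≤ centerCost (S : Set _) R :=
    iInf_edist_le_centerCost _ hx
  rcases S.eq_empty_or_nonempty with rfl | hne
  · rw [Finset.coe_empty] at hle h
    exact absurd (top_le_iff.1 (by simpa using hle)) h
  · obtain ⟨y, hy, hmin⟩ := S.exists_min_image (fun y => edist x y) hne
    refine ⟨y, hy, ?_⟩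
    rw [dist_edist]
    refine ENNReal.toReal_mono h (le_trans ?_ hle)
    exact le_iInf₂ fun c hc => hmin c hc

theorem optCenterCost_le {k : ℕ} {P : Set (EuclideanSpace ℝ (Fin d))}
    {S : Finset (EuclideanSpace ℝ (Fin d))} (hS : (S : Set _) ⊆ P) (hk : S.card ≤ k) :
    optCenterCost k P ≤ centerCost (S : Set _) P := by
  unfold optCenterCost
  exact iInf_le_of_le S (iInf_le_of_le hS (iInf_le_of_le hk le_rfl))

theorem centerCost_image_le {P R : Set (EuclideanSpace ℝ (Fin d))} {δ : ℝ≥0∞} (hPR : P ⊆ R)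
    {f : EuclideanSpace ℝ (Fin d) → EuclideanSpace ℝ (Fin d)}
    {S : Set (EuclideanSpace ℝ (Fin d))} (hf : ∀ x ∈ S, edist x (f x) ≤ δ) :
    centerCost (f '' S) P ≤ centerCost S R + δ := by
  refine iSup₂_le fun p hp => ?_
  refine le_trans ?_ (add_le_add (iInf_edist_le_centerCost S (hPR hp)) le_rfl)
  rw [ENNReal.iInf₂_add]
  refine le_iInf₂ fun y hy => ?_
  exact (iInf₂_le (f y) (Set.mem_image_of_mem f hy)).trans
    ((edist_triangle p y (f y)).trans (add_le_add le_rfl (hf y hy)))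

/-- Centers are moved from `R` to points of the net at distance at most `δ`. Moving them adds `δ` to
the cost once, so no constant factor is lost although centers must belong to `P`. -/
theorem optCenterCost_le_add {k k' : ℕ} {P R : Set (EuclideanSpace ℝ (Fin d))} {δ : ℝ≥0∞}
    (hPR : P ⊆ R) (h : ∀ x ∈ R, ∃ p ∈ P, edist x p ≤ δ) {S : Finset (EuclideanSpace ℝ (Fin d))}
    (hSR : (S : Set _) ⊆ R) (hS : S.card ≤ k)
    (hk' : ∀ S' : Finset (EuclideanSpace ℝ (Fin d)), (S' : Set _) ⊆ P → S'.card ≤ k →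
      S'.card ≤ k') : optCenterCost k' P ≤ centerCost (S : Set _) R + δ := by
  classical
  have hex : ∃ f : EuclideanSpace ℝ (Fin d) → EuclideanSpace ℝ (Fin d),
      ∀ x ∈ R, f x ∈ P ∧ edist x (f x) ≤ δ := by
    choose! f hf hfδ using h
    exact ⟨f, fun x hx => ⟨hf x hx, hfδ x hx⟩⟩
  obtain ⟨f, hf⟩ := hex
  have h1 : ((S.image f : Finset _) : Set (EuclideanSpace ℝ (Fin d))) ⊆ P := by
    rw [Finset.coe_image]
    exact Set.image_subset_iff.2 fun x hx => (hf x (hSR hx)).1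
  refine (optCenterCost_le h1 (hk' _ h1 (Finset.card_image_le.trans hS))).trans ?_
  rw [Finset.coe_image]
  exact centerCost_image_le hPR fun x hx => (hf x (hSR hx)).2

theorem le_mul_optCenterCost {k : ℕ} {R : Set (EuclideanSpace ℝ (Fin d))} {α : ℝ} (hα : 0 < α)
    {X : ℝ≥0∞} (h : ∀ S : Finset (EuclideanSpace ℝ (Fin d)), (S : Set _) ⊆ R → S.card ≤ k →
      X ≤ ENNReal.ofReal α * centerCost (S : Set _) R) :
    X ≤ ENNReal.ofReal α * optCenterCost k R := by
  have h0 : ENNReal.ofReal α ≠ 0 := by simpa using hα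
  rw [mul_comm, ← ENNReal.div_le_iff h0 ENNReal.ofReal_ne_top]
  refine le_iInf₂ fun S hS => le_iInf fun hk => ?_
  rw [ENNReal.div_le_iff h0 ENNReal.ofReal_ne_top, mul_comm]
  exact h S hS hk

/-- The net error enters twice: when the centers of `S` are moved into `P`, where it is multiplied
by `γ`, and when cost on `P` is turned into cost on `R`. With `d * L ≤ (ε / 2) r` and `γ ≥ 1` both
together are at most `ε γ r`. -/
theorem approx_of_net {k k' : ℕ} {P R C : Set (EuclideanSpace ℝ (Fin d))} {L γ ε : ℝ}
    (hγ : 1 ≤ γ) (hε : 0 < ε) (hPR : P ⊆ R)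
    (hnet : ∀ x ∈ R, ∃ p ∈ P, edist x p ≤ ENNReal.ofReal (d * L))
    (hk' : ∀ S' : Finset (EuclideanSpace ℝ (Fin d)), (S' : Set _) ⊆ P → S'.card ≤ k →
      S'.card ≤ k')
    (hC : centerCost C P ≤ ENNReal.ofReal γ * optCenterCost k' P)
    (hL : ∀ S : Finset (EuclideanSpace ℝ (Fin d)), (S : Set _) ⊆ R → S.card ≤ k → ∀ r, 0 ≤ r →
      (∀ x ∈ R, ∃ y ∈ S, dist x y ≤ r) → d * L ≤ ε / 2 * r) :
    centerCost C R ≤ ENNReal.ofReal ((1 + ε) * γ) * optCenterCost k R := by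
  refine le_mul_optCenterCost (by positivity) fun S hSR hS => ?_
  -- An infinite cost, as for an empty set of centers, makes the bound trivial; otherwise the cost
  -- is a real radius `r`.
  by_cases htop : centerCost (S : Set _) R = ⊤
  · rw [htop, ENNReal.mul_top]
    · exact le_top
    · simp
      positivity
  set r := (centerCost (S : Set _) R).toReal with hr
  have hr0 : 0 ≤ r := ENNReal.toReal_nonneg
  have hX : centerCost (S : Set _) R = ENNReal.ofReal r := (ENNReal.ofReal_toReal htop).symm
  have hδ := ENNReal.ofReal_le_ofReal (hL S hSR hS r hr0 fun x hx => exists_dist_le htop hx)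
  calc centerCost C R ≤ ENNReal.ofReal (d * L) + centerCost C P := centerCost_le_add hnet
    _ ≤ ENNReal.ofReal (d * L) + ENNReal.ofReal γ * (ENNReal.ofReal r + ENNReal.ofReal (d * L)) := by
        rw [← hX]
        gcongr
        exact hC.trans (mul_le_mul_right (optCenterCost_le_add hPR hnet hSR hS hk') _)
    _ ≤ ENNReal.ofReal (ε / 2 * r) +
          ENNReal.ofReal γ * (ENNReal.ofReal r + ENNReal.ofReal (ε / 2 * r)) := by gcongr
    _ = ENNReal.ofReal (ε / 2 * r + γ * (r + ε / 2 * r)) := by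
        rw [← ENNReal.ofReal_add hr0 (by positivity), ← ENNReal.ofReal_mul (by positivity),
          ← ENNReal.ofReal_add (by positivity) (by positivity)]
    _ ≤ ENNReal.ofReal ((1 + ε) * γ * r) := by
        refine ENNReal.ofReal_le_ofReal ?_
        have : ε / 2 * r ≤ γ * (ε / 2 * r) := le_mul_of_one_le_left (by positivity) hγ
        linarith
    _ = _ := by rw [hX, ← ENNReal.ofReal_mul (by positivity)]

end Approximation

/-! ### Schedules from join trees -/

namespace JoinQuery

variable {d m : ℕ}

/-- The set of relations `S` can be fully reduced by a schedule. -/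
def Scheduled (q : JoinQuery d m) (S : Finset (Fin m)) : Prop :=
  ∃ l : List (ℕ × ℕ), ∀ c : RealRAM.Cx, c.d = d →
    (∀ (j : Fin m) (a : Fin d), c.Has j a ↔ a ∈ q.attrs j) → c.Built (S.image Fin.val) l

/-- The list of semijoins is chosen before the context `c`: it becomes part of the program, which
may depend on the query only. -/
theorem Scheduled.insert {q : JoinQuery d m} {S : Finset (Fin m)} (h : q.Scheduled S) {v p : Fin m}
    (hv : v ∉ S) (hp : p ∈ S)
    (hrip : ∀ a ∈ q.attrs v, ∀ r ∈ S, a ∈ q.attrs r → a ∈ q.attrs p) :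
    q.Scheduled (insert v S) := by
  obtain ⟨l, hl⟩ := h
  refine ⟨((v : ℕ), (p : ℕ)) :: l ++ [((p : ℕ), (v : ℕ))], fun c hd hc => ?_⟩
  rw [Finset.image_insert]
  refine (hl c hd hc).attach ?_ (Finset.mem_image_of_mem _ hp) ?_
  · simpa [Fin.val_inj] using hv
  · intro a ha hva r hr hra
    obtain ⟨r, hr', rfl⟩ := Finset.mem_image.1 hr
    rw [hd] at ha
    exact (hc p ⟨a, ha⟩).2 (hrip _ ((hc v ⟨a, ha⟩).1 hva) r hr' ((hc r ⟨a, ha⟩).1 hra))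

/-- Relations are added one at a time along edges of the join tree, starting at a root. If the next
edge `p v` leaves `S`, then every attribute of `v` that occurs in `S` occurs in `p`; otherwise the
relations with this attribute would connect `v` to `S` around the bridge `p v`. -/
theorem Acyclic.scheduled {q : JoinQuery d m} (hq : q.Acyclic) : q.Scheduled Finset.univ := by
  classical
  obtain ⟨G, hG, hconn⟩ := hq
  obtain ⟨root⟩ := hG.connected.nonempty
  -- The last clause expresses that `S` is a subtree: deleting a pair with an end outside `S`
  -- disconnects no member of `S` from the root.
  let good : Finset (Fin m) → Prop := fun S => root ∈ S ∧ q.Scheduled S ∧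
    ∀ u v, v ∉ S → ∀ s ∈ S, (G.deleteEdges {s(u, v)}).Reachable root s
  have h0 : good {root} := by
    refine ⟨by simp, ⟨[], fun c _ _ => ?_⟩, fun u v _ s hs => ?_⟩
    · simpa using RealRAM.Cx.Built.root (c := c) (root : ℕ)
    · rw [Finset.mem_singleton.1 hs]
  obtain ⟨S, hS, hmax⟩ := (Finset.univ.filter good).exists_max_image Finset.card
    ⟨{root}, by simpa using h0⟩
  obtain ⟨hr, hsch, hreach⟩ : good S := by simpa using hS
  by_cases hu : S = Finset.univ
  · rwa [← hu]
  exfalso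
  obtain ⟨z, hz⟩ : ∃ z, z ∉ S := by
    by_contra! hcon
    exact hu (Finset.eq_univ_iff_forall.2 hcon)
  obtain ⟨W⟩ := hG.connected.preconnected root z
  obtain ⟨e, -, he1, he2⟩ := W.exists_boundary_dart (S : Set (Fin m)) (by simpa using hr)
    (by simpa using hz)
  obtain ⟨⟨p, v⟩, hadj⟩ := e
  simp only [Finset.mem_coe] at he1 he2
  have hbridge := SimpleGraph.isAcyclic_iff_forall_adj_isBridge.1 hG.isAcyclic hadj
  have hgood : good (insert v S) := by
    refine ⟨Finset.mem_insert_of_mem hr, hsch.insert he2 he1 ?_, ?_⟩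
    · intro a hav r hrS har
      by_contra hap
      obtain ⟨W'⟩ := (hconn a).preconnected ⟨v, hav⟩ ⟨r, har⟩
      -- A walk among relations with attribute `a` avoids `p`, hence survives the deletion of the
      -- edge `p v`.
      let f : G.induce {j | a ∈ q.attrs j} →g G.deleteEdges {s(p, v)} :=
        { toFun := Subtype.val
          map_rel' := by
            rintro ⟨x, hx⟩ ⟨y, hy⟩ hxy
            rw [SimpleGraph.deleteEdges_adj]
            refine ⟨hxy, fun hmem => ?_⟩
            have : p = x ∨ p = y := by
              have := Set.mem_singleton_iff.1 hmem
              rw [Sym2.eq_iff] at this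
              rcases this with h | h
              · exact Or.inl h.1.symm
              · exact Or.inr h.2.symm
            rcases this with rfl | rfl
            · exact hap hx
            · exact hap hy }
      have h1 : (G.deleteEdges {s(p, v)}).Reachable v r := ⟨W'.map f⟩
      have h2 := hreach p v he2 r hrS
      have h3 := hreach p v he2 p he1
      exact (SimpleGraph.isBridge_iff.1 hbridge) (h3.symm.trans (h2.trans h1.symm))
    · intro u x hx s hs
      rw [Finset.mem_insert, not_or] at hx
      rcases Finset.mem_insert.1 hs with rfl | hs
      · refine (hreach u x hx.2 p he1).trans (SimpleGraph.Adj.reachable ?_)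
        rw [SimpleGraph.deleteEdges_adj]
        refine ⟨hadj, fun hmem => ?_⟩
        have := Set.mem_singleton_iff.1 hmem
        rw [Sym2.eq_iff] at this
        rcases this with h | h
        · exact hx.1 h.2.symm
        · exact hx.2 (h.1 ▸ he1)
      · exact hreach u x hx.2 s hs
  have := hmax (insert v S) (by simpa using hgood)
  rw [Finset.card_insert_of_notMem he2] at this
  omega

end JoinQuery

namespace RealRAM.Cx

variable {c : Cx}

theorem Built.mem {S : Finset ℕ} {l : List (ℕ × ℕ)} (h : c.Built S l) {e : ℕ × ℕ} (he : e ∈ l) :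
    e.1 ∈ S ∧ e.2 ∈ S := by
  induction h with
  | root => simp at he
  | attach h hv hp hrip ih =>
    simp only [List.cons_append, List.mem_cons, List.mem_append, List.not_mem_nil, or_false] at he
    rcases he with rfl | he | rfl
    · exact ⟨Finset.mem_insert_self _ _, Finset.mem_insert_of_mem hp⟩
    · exact ⟨Finset.mem_insert_of_mem (ih he).1, Finset.mem_insert_of_mem (ih he).2⟩
    · exact ⟨Finset.mem_insert_of_mem hp, Finset.mem_insert_self _ _⟩

end RealRAM.Cx

/-! ### Join results -/

namespace Database

variable {d m N : ℕ} {q : JoinQuery d m}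

/-- A result is determined by the tuples it projects to, because every attribute is covered. -/
theorem card_results_le (D : Database q N) :
    D.results.Finite ∧ D.results.encard ≤ (N ^ m : ℕ) := by
  classical
  have hex : ∀ x : D.results, ∃ f : Fin m → Fin N, ∀ j, D.tup j (f j) = fun a : q.attrs j => x.1 a :=
    fun x => ⟨fun j => (x.2 j).choose, fun j => (x.2 j).choose_spec⟩
  choose f hf using hex
  have hinj : Function.Injective f := by
    intro x y h
    refine Subtype.ext (PiLp.ext fun a => ?_)
    obtain ⟨j, hj⟩ := q.cover a
    have := (hf x j).symm.trans ((congrArg (fun g => D.tup j (g j)) h).trans (hf y j))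
    exact congrFun this ⟨a, hj⟩
  have hfin : Finite D.results := Finite.of_injective f hinj
  refine ⟨D.results.toFinite, ?_⟩
  rw [← D.results.toFinite.cast_ncard_eq]
  have := Nat.card_le_card_of_injective f hinj
  simp only [Nat.card_eq_fintype_card, Fintype.card_pi, Fintype.card_fin, Finset.prod_const,
    Finset.card_univ] at this
  rw [Nat.card_coe_set_eq] at this
  exact_mod_cast this

end Database

namespace RealRAM

/-! ### Reading the input -/

/-- Word register 60 := the `m`-th power of register 0. -/
def power : ℕ → HL
  | 0 => .wset 60 (.const 1)
  | m + 1 => power m ⨟ .wset 60 (.reg 60 * .reg 0)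

/-- Store `f 0, …, f (n - 1)` in word array `arr`. -/
def storeTable (arr : ℕ) (f : ℕ → ℕ) : ℕ → HL
  | 0 => .skip
  | n + 1 => storeTable arr f n ⨟ .wsto arr (.const n) (.const (f n))

/-- Copy the relations, which have as many entries as register 11 tells, to real array 0. -/
def gather : ℕ → HL
  | 0 => .skip
  | j + 1 => gather j ⨟
    .loopTo 50 11 (.rsto 0 (.const j * .reg 11 + .reg 50) (.load (j + 1) (.reg 50)))

/-- Set up the memory for a query with `d` attributes, `m` relations, attribute table `mask` and
semijoin schedule `sched`, for `M` splits per center. -/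
def setup (d m M : ℕ) (mask : ℕ → ℕ) (sched : List (ℕ × ℕ)) : HL :=
  power m ⨟ .ite (.wlt (.reg 60) (.reg 1)) (.wset 1 (.reg 60)) .skip ⨟
  (.wset 2 (.const d) ⨟ .wset 3 (.const m) ⨟ .wset 4 (.reg 3 * .reg 0) ⨟
    .wset 5 (.reg 4 * .reg 2) ⨟ .wset 6 (.reg 5 + .const 1) ⨟ .wset 7 (.const sched.length) ⨟
    .wset 8 (.const M * .reg 1) ⨟ .wset 11 (.reg 0 * .reg 2)) ⨟
  storeTable 1 mask (m * d) ⨟ storeTable 2 (fun e => (sched.getD e (0, 0)).1) sched.length ⨟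
  storeTable 3 (fun e => (sched.getD e (0, 0)).2) sched.length ⨟
  gather m ⨟ .loopTo 50 5 (.rsto 1 (.reg 50) (.load 0 (.reg 50)))

theorem power_wr (m : ℕ) {l : Loc} (h : l ≠ .w 60) : (power m).wr l = false := by
  have hset : ∀ e, (HL.wset 60 e).wr l = false := by
    intro e
    cases l with
    | w r =>
      have : 60 ≠ r := by rintro rfl; exact h rfl
      simpa [HL.wr] using this
    | _ => rfl
  induction m with
  | zero => exact hset _
  | succ m ih => rw [power, HL.wr, ih, hset, Bool.or_false]

theorem storeTable_wr (arr : ℕ) (f : ℕ → ℕ) (n : ℕ) {l : Loc} (h : l ≠ .wa arr) :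
    (storeTable arr f n).wr l = false := by
  have hset : ∀ e v, (HL.wsto arr e v).wr l = false := by
    intro e v
    cases l with
    | wa r =>
      have : arr ≠ r := by rintro rfl; exact h rfl
      simpa [HL.wr] using this
    | _ => rfl
  induction n with
  | zero => cases l <;> rfl
  | succ n ih => rw [storeTable, HL.wr, ih, hset, Bool.or_false]

theorem gather_wr (m : ℕ) {l : Loc} (h : l ≠ .ra 0) (h' : l ≠ .w 50) : (gather m).wr l = false := by
  have hset : ∀ e v, (HL.loopTo 50 11 (.rsto 0 e v)).wr l = false := by
    intro e v
    cases l with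
    | ra r =>
      have : 0 ≠ r := by rintro rfl; exact h rfl
      simpa [HL.wr] using this
    | w r =>
      have : 50 ≠ r := by rintro rfl; exact h' rfl
      simpa [HL.wr] using this
    | _ => rfl
  induction m with
  | zero => cases l <;> rfl
  | succ m ih => rw [gather, HL.wr, ih, hset, Bool.or_false]

variable {β : ℕ → ℕ} {w : ℕ} {s : State}

theorem power_spec {m : ℕ} (hw : w ≠ 0) (h : ∀ i ≤ m, s.wreg 0 ^ i < 2 ^ w) :
    HT β w (power m) s (fun s' => s'.wreg 60 = s.wreg 0 ^ m) := by
  induction m with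
  | zero => exact HT.of_wp (by simp [power, HL.wp, hw])
  | succ m ih =>
    refine HT.seq' (ih fun i hi => h i (by omega)) fun s1 h1 hk => ?_
    have f0 : s1.wreg 0 = s.wreg 0 := hk (.w 0) (power_wr m (by simp))
    have := h (m + 1) le_rfl
    rw [pow_succ] at this
    refine HT.of_wp ?_
    simp [HL.wp, h1, f0, this, pow_succ]

theorem storeTable_spec {arr n : ℕ} {f : ℕ → ℕ} (h : ∀ i < n, i < 2 ^ w ∧ f i < 2 ^ w) :
    HT β w (storeTable arr f n) s (fun s' => ∀ x, s'.warr arr x =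
      if x < n then f x else s.warr arr x) := by
  induction n with
  | zero => exact HT.skip (by simp)
  | succ n ih =>
    refine HT.seq' (ih fun i hi => h i (by omega)) fun s1 h1 hk => ?_
    have := h n (by omega)
    refine HT.of_wp ?_
    simp only [HL.wp, WE.ok_const, WE.eval_const, State.setWA_warr, if_true]
    refine ⟨this.1, this.2, fun x => ?_⟩
    rw [Function.update_apply, h1 x]
    rcases Nat.lt_trichotomy x n with hx | rfl | hx
    · simp [hx, hx.ne, show x < n + 1 by omega]
    · simp
    · simp [hx.ne', show ¬ x < n by omega, show ¬ x < n + 1 by omega]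

/-- The table is assembled in real array 0, because array 1, its final place, initially holds the
first relation. -/
theorem gather_spec {m e : ℕ} (h11 : s.wreg 11 = e) (he : m * e < 2 ^ w) (hmw : m < 2 ^ w) (hew : e < 2 ^ w)
    (hβ : e ≤ β 11) :
    HT β w (gather m) s (fun s' => ∀ j < m, ∀ x < e, s'.rarr 0 (j * e + x) = s.rarr (j + 1) x) := by
  induction m with
  | zero => exact HT.skip (by simp)
  | succ m ih =>
    have he' : (m + 1) * e = m * e + e := by ring
    refine HT.seq' (ih (by omega) (by omega)) fun s1 h1 hk => ?_
    have f11 : s1.wreg 11 = e := Eq.trans (hk (.w 11) (gather_wr m (by simp) (by simp))) h11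
    have fr : s1.rarr (m + 1) = s.rarr (m + 1) := hk (.ra (m + 1)) (gather_wr m (by simp) (by simp))
    refine HT.loopTo (fun y s' => (∀ j < m, ∀ x < e, s'.rarr 0 (j * e + x) = s.rarr (j + 1) x) ∧
      ∀ x < y, s'.rarr 0 (m * e + x) = s.rarr (m + 1) x) ⟨rfl, rfl, by decide⟩
      (by rwa [f11]) (by rwa [f11]) ⟨h1, by simp⟩ ?_ ?_
    · rintro y s2 hy hy2 hk2 ⟨i1, i2⟩
      rw [f11] at hy
      have g11 : s2.wreg 11 = e := Eq.trans (hk2 (.w 11) rfl) f11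
      have gr : s2.rarr (m + 1) = s.rarr (m + 1) :=
        Eq.trans (hk2 (.ra (m + 1)) (by simp [HL.wr])) fr
      refine HT.of_wp ?_
      simp [HL.wp, hy2, g11, gr, -Order.lt_add_one_iff]
      refine ⟨by omega, fun j hj x hx => ?_, fun x hx => ?_⟩
      · rw [Function.update_of_ne]
        · exact i1 j hj x hx
        · have : (j + 1) * e ≤ m * e := Nat.mul_le_mul_right _ hj
          rw [add_mul] at this
          omega
      · rcases Nat.lt_succ_iff_lt_or_eq.1 hx with hx | rfl
        · rw [Function.update_of_ne (by omega), i2 x hx]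
        · simp
    · rintro s2 _ _ ⟨i1, i2⟩ j hj x hx
      rw [f11] at i2
      rcases Nat.lt_succ_iff_lt_or_eq.1 hj with hj | rfl
      · exact i1 j hj x hx
      · exact i2 x hx

end RealRAM

open Classical in
/-- The attribute table of a query. -/
noncomputable def JoinQuery.maskOf {d m : ℕ} (q : JoinQuery d m) (x : ℕ) : ℕ :=
  if ∃ (j : Fin m) (a : Fin d), x = j * d + a ∧ a ∈ q.attrs j then 1 else 0

theorem JoinQuery.maskOf_eq_one {d m : ℕ} (q : JoinQuery d m) (j : Fin m) (a : Fin d) :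
    q.maskOf (j * d + a) = 1 ↔ a ∈ q.attrs j := by
  unfold maskOf
  constructor
  · intro h
    split_ifs at h with hc
    obtain ⟨j', a', e, ha⟩ := hc
    have hj : j = j' := by
      by_contra hne
      exact RealRAM.Cx.row_index_ne a.2 a'.2 (fun h => hne (Fin.ext h)) e
    subst hj
    have : a = a' := Fin.ext (by omega)
    rwa [this]
  · intro h
    rw [if_pos ⟨j, a, rfl, h⟩]

theorem JoinQuery.maskOf_le {d m : ℕ} (q : JoinQuery d m) (x : ℕ) :
    q.maskOf x ≤ 1 ∧ (m * d ≤ x → q.maskOf x = 0) := by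
  unfold maskOf
  refine ⟨by split_ifs <;> omega, fun hx => if_neg ?_⟩
  rintro ⟨j, a, rfl, -⟩
  have : (j + 1 : ℕ) * d ≤ m * d := Nat.mul_le_mul_right _ j.2
  rw [add_mul] at this
  have := a.2
  omega

/-! ### The context attached to a query and a database instance. -/

namespace RealRAM

/-- The bounds for the loops. -/
def loopBound (d m N K l Λ r : ℕ) : ℕ :=
  if r = 0 then N else if r = 2 then d else if r = 4 then m * N else if r = 5 then m * N * d else
  if r = 7 then l else if r = 8 then K else if r = 9 then K + 1 else if r = 11 then N * d else
  if r = 12 then K + 1 else if r = 43 then Λ else if r = 57 then (K + 1) * d else 0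

/-- The data for a query `q` with schedule `sched`, for entries `V`. -/
noncomputable def ctx {d m : ℕ} (q : JoinQuery d m) (sched : List (ℕ × ℕ)) (M N k w Λ : ℕ)
    (V : ℕ → ℝ) (ids : ℕ → ℕ) : Cx where
  d := d
  m := m
  N := N
  w := w
  k := min k (N ^ m)
  K := M * min k (N ^ m)
  V := V
  mask := q.maskOf
  ids := ids
  sched := sched
  β := loopBound d m N (M * min k (N ^ m)) sched.length Λ

variable {d m M N k w Λ : ℕ} {q : JoinQuery d m} {sched : List (ℕ × ℕ)}

theorem ctx_has (V : ℕ → ℝ) (ids : ℕ → ℕ) (j : Fin m) (a : Fin d) :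
    (ctx q sched M N k w Λ V ids).Has j a ↔ a ∈ q.attrs j := q.maskOf_eq_one j a

/-- The table `V` lists the entries of the database. -/
def Lists (D : Database q N) (V : ℕ → ℝ) : Prop :=
  ∀ (j : Fin m) (i : Fin N) (a : Fin d) (h : a ∈ q.attrs j), V ((j * N + i) * d + a) = D.tup j i ⟨a, h⟩

theorem ctx_res {D : Database q N} {V : ℕ → ℝ} (hV : Lists D V) (ids : ℕ → ℕ) :
    (ctx q sched M N k w Λ V ids).res = D.results := by
  ext x
  constructor
  · intro hx j
    obtain ⟨i, hi, h⟩ := hx j j.2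
    refine ⟨⟨i, hi⟩, funext fun a => ?_⟩
    exact (hV j ⟨i, hi⟩ a.1 a.2).symm.trans (h a.1 ((ctx_has V ids j a.1).2 a.2)).symm
  · intro hx l hl
    obtain ⟨i, h⟩ := hx ⟨l, hl⟩
    refine ⟨i, i.2, fun a ha => ?_⟩
    have ha' := (ctx_has V ids ⟨l, hl⟩ a).1 ha
    exact (congrFun h ⟨a, ha'⟩).symm.trans (hV ⟨l, hl⟩ i a ha').symm

theorem setup_spec (D : Database q N) (hg : ∀ V ids, (ctx q sched M N k w Λ V ids).Good)
    (hm : 1 ≤ m) (hk : 1 ≤ k) (hpow : N ^ m < 2 ^ w) :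
    HT (loopBound d m N (M * min k (N ^ m)) sched.length Λ) w (setup d m M q.maskOf sched)
      (D.input k) (fun s' => Lists D (s'.rarr 1) ∧
        ∀ ids, (ctx q sched M N k w Λ (s'.rarr 1) ids).Base s') := by
  have hg0 := hg 0 0
  have hN : 1 ≤ N := hg0.N_pos
  have hnv : m * N * d + 2 ≤ 2 ^ w := hg0.nv_lt.1
  have htup : m * N + m + N + 1 ≤ 2 ^ w := hg0.tuples_lt
  have hmask : m * d + m + d + 1 ≤ 2 ^ w := hg0.mask_lt
  have hsl : sched.length < 2 ^ w := hg0.big_sched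
  have hK := (hg0.cells_lt (i := 0) (a := 0) (by omega) (by omega)).2.2.1
  change 2 * (M * min k (N ^ m) + 2) + 2 ≤ 2 ^ w at hK
  have hw : w ≠ 0 := hg0.w_ne
  have hNd : N * d ≤ m * N * d := by
    rw [Nat.mul_assoc]
    exact Nat.le_mul_of_pos_left _ hm
  have hkc : 1 ≤ min k (N ^ m) := le_min hk (Nat.one_le_pow _ _ hN)
  have hM : M ≤ M * min k (N ^ m) := Nat.le_mul_of_pos_right _ hkc
  have i0 : (D.input k).wreg 0 = N := rfl
  have i1 : (D.input k).wreg 1 = k := rfl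
  refine HT.seq' (power_spec hw fun i hi => ?_) ?_
  · rw [i0]
    exact (Nat.pow_le_pow_right hN hi).trans_lt hpow
  intro s1 h1 hk1
  rw [i0] at h1
  have f0 : s1.wreg 0 = N := hk1 (.w 0) (power_wr m (by simp))
  have f1 : s1.wreg 1 = k := hk1 (.w 1) (power_wr m (by simp))
  -- Capping `k` at `N ^ m ≥ |q(D)|` does not change the problem and makes the number of cells
  -- polynomial in `N`, so that the rounds of the tournament are `O(log N)` whatever `k` is.
  refine HT.seq' (R := fun s' => s'.wreg 1 = min k (N ^ m)) (HT.of_wp ?_) ?_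
  · simp [HL.wp, h1, f1]
    omega
  intro s2 h2 hk2
  have g0 : s2.wreg 0 = N := Eq.trans (hk2 (.w 0) rfl) f0
  refine HT.seq' (R := fun s' => s'.wreg 0 = N ∧ s'.wreg 1 = min k (N ^ m) ∧ s'.wreg 2 = d ∧
    s'.wreg 3 = m ∧ s'.wreg 4 = m * N ∧ s'.wreg 5 = m * N * d ∧ s'.wreg 6 = m * N * d + 1 ∧
    s'.wreg 7 = sched.length ∧ s'.wreg 8 = M * min k (N ^ m) ∧ s'.wreg 11 = N * d) (HT.of_wp ?_) ?_
  · simp [HL.wp, g0, h2]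
    omega
  rintro s3 ⟨r0, r1, r2, r3, r4, r5, r6, r7, r8, r11⟩ hk3
  have w3 : ∀ arr x, s3.warr arr x = 0 := by
    intro arr x
    have e3 : s3.warr arr = s2.warr arr := hk3 (.wa arr) rfl
    have e2 : s2.warr arr = s1.warr arr := hk2 (.wa arr) rfl
    have e1 : s1.warr arr = (D.input k).warr arr := hk1 (.wa arr) (power_wr m (by simp))
    rw [e3, e2, e1]
    rfl
  have v3 : ∀ arr, s3.rarr arr = (D.input k).rarr arr := by
    intro arr
    have e3 : s3.rarr arr = s2.rarr arr := hk3 (.ra arr) rfl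
    have e2 : s2.rarr arr = s1.rarr arr := hk2 (.ra arr) rfl
    have e1 : s1.rarr arr = (D.input k).rarr arr := hk1 (.ra arr) (power_wr m (by simp))
    rw [e3, e2, e1]
  refine HT.seq' (storeTable_spec fun i hi => ⟨by omega, ?_⟩) ?_
  · have := (q.maskOf_le i).1
    have := Nat.one_lt_two_pow hw
    omega
  intro s4 h4 hk4
  refine HT.seq' (storeTable_spec fun i hi => ⟨by omega, ?_⟩) ?_
  · have := (hg0.sched_lt (sched.getD i (0, 0)) (by
      rw [List.getD_eq_getElem _ _ hi]; exact List.getElem_mem hi)).1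
    change _ < m at this
    omega
  intro s5 h5 hk5
  refine HT.seq' (storeTable_spec fun i hi => ⟨by omega, ?_⟩) ?_
  · have := (hg0.sched_lt (sched.getD i (0, 0)) (by
      rw [List.getD_eq_getElem _ _ hi]; exact List.getElem_mem hi)).2
    change _ < m at this
    omega
  intro s6 h6 hk6
  have keep6 : ∀ r, s6.wreg r = s3.wreg r := fun r =>
    Eq.trans (hk6 (.w r) (storeTable_wr _ _ _ (by simp)))
      (Eq.trans (hk5 (.w r) (storeTable_wr _ _ _ (by simp)))
        (hk4 (.w r) (storeTable_wr _ _ _ (by simp))))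
  have v6 : ∀ arr, s6.rarr arr = (D.input k).rarr arr := fun arr =>
    Eq.trans (hk6 (.ra arr) (storeTable_wr _ _ _ (by simp)))
      (Eq.trans (hk5 (.ra arr) (storeTable_wr _ _ _ (by simp)))
        (Eq.trans (hk4 (.ra arr) (storeTable_wr _ _ _ (by simp))) (v3 arr)))
  refine HT.seq' (gather_spec (e := N * d) (by rw [keep6, r11])
    (by rw [← Nat.mul_assoc]; omega) (by omega) (by omega) (by simp [loopBound])) ?_
  intro s7 h7 hk7
  have keep7 : ∀ r, r ≠ 50 → s7.wreg r = s3.wreg r := fun r hr =>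
    Eq.trans (hk7 (.w r) (gather_wr _ (by simp) (by simpa using hr))) (keep6 r)
  have keepA : ∀ arr, s7.warr arr = s6.warr arr := fun arr =>
    hk7 (.wa arr) (gather_wr _ (by simp) (by simp))
  have e5 : s7.wreg 5 = m * N * d := (keep7 5 (by decide)).trans r5
  refine HT.loopTo (fun n s' => ∀ x < n, s'.rarr 1 x = s7.rarr 0 x) ⟨rfl, rfl, by decide⟩
    (by rw [e5]; simp [loopBound]) (by rw [e5]; omega) (by simp) ?_ ?_
  · intro n s8 hn hn8 hk8 hI
    have u0 : s8.rarr 0 = s7.rarr 0 := hk8 (.ra 0) rfl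
    refine HT.of_wp ?_
    simp [HL.wp, hn8, u0, -Order.lt_add_one_iff]
    intro x hx
    rcases Nat.lt_succ_iff_lt_or_eq.1 hx with hx | rfl
    · rw [Function.update_of_ne hx.ne, hI x hx]
    · simp
  · intro s8 _ hk8 hI
    rw [e5] at hI
    have keep8 : ∀ r, r ≠ 50 → s8.wreg r = s3.wreg r := fun r hr =>
      Eq.trans (hk8 (.w r) (by simpa [HL.wr] using hr.symm)) (keep7 r hr)
    have A1 : s8.warr 1 = s4.warr 1 := Eq.trans (hk8 (.wa 1) rfl) (Eq.trans (keepA 1)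
      (Eq.trans (hk6 (.wa 1) (storeTable_wr _ _ _ (by simp)))
        (hk5 (.wa 1) (storeTable_wr _ _ _ (by simp)))))
    have A2 : s8.warr 2 = s5.warr 2 := Eq.trans (hk8 (.wa 2) rfl) (Eq.trans (keepA 2)
      (hk6 (.wa 2) (storeTable_wr _ _ _ (by simp))))
    have A3 : s8.warr 3 = s6.warr 3 := Eq.trans (hk8 (.wa 3) rfl) (keepA 3)
    refine ⟨fun j i a ha => ?_, fun ids => ⟨?_, ?_, ?_, ?_, ?_, ?_, ?_, ?_, ?_, ?_, ?_, ?_, rfl⟩⟩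
    · have hia : (i : ℕ) * d + a < N * d := by
        have : ((i : ℕ) + 1) * d ≤ N * d := Nat.mul_le_mul_right _ i.2
        rw [add_mul] at this
        have := a.2
        omega
      have hlt : ((j : ℕ) * N + i) * d + a < m * N * d := by
        have : ((j : ℕ) + 1) * (N * d) ≤ m * (N * d) := Nat.mul_le_mul_right _ j.2
        calc ((j : ℕ) * N + i) * d + a = j * (N * d) + (i * d + a) := by ring
          _ < j * (N * d) + N * d := by omega
          _ = ((j : ℕ) + 1) * (N * d) := by ring
          _ ≤ m * (N * d) := this
          _ = m * N * d := by ring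
      rw [hI _ hlt, show ((j : ℕ) * N + i) * d + a = j * (N * d) + (i * d + a) by ring,
        h7 j j.2 _ hia, v6]
      have hdiv : Fin.divNat ⟨(i : ℕ) * d + a, hia⟩ = i := by
        refine Fin.ext ?_
        simp only [Fin.coe_divNat]
        rw [Nat.mul_comm, Nat.mul_add_div (by have := a.2; omega), Nat.div_eq_of_lt a.2, add_zero]
      have hmod : Fin.modNat ⟨(i : ℕ) * d + a, hia⟩ = a := by
        refine Fin.ext ?_
        simp only [Fin.coe_modNat]
        exact Nat.mul_add_mod_of_lt a.2
      simp only [Database.input]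
      rw [dif_pos ⟨by omega, by simp⟩, dif_pos hia]
      simp only [hdiv, hmod, Nat.add_sub_cancel, Fin.eta]
      rw [dif_pos ha]
      rfl
    · exact (keep8 0 (by decide)).trans r0
    · exact (keep8 1 (by decide)).trans r1
    · exact (keep8 2 (by decide)).trans r2
    · exact (keep8 3 (by decide)).trans r3
    · exact (keep8 4 (by decide)).trans r4
    · exact (keep8 5 (by decide)).trans r5
    · exact (keep8 6 (by decide)).trans r6
    · exact (keep8 7 (by decide)).trans r7
    · exact (keep8 8 (by decide)).trans r8
    · funext x
      rw [A1, h4 x, w3]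
      change _ = q.maskOf x
      split_ifs with hx
      · rfl
      · exact ((q.maskOf_le x).2 (by omega)).symm
    · intro e he
      change e < sched.length at he
      rw [A2, h5 e, if_pos he, List.getD_eq_getElem _ _ he]
      rfl
    · intro e he
      change e < sched.length at he
      rw [A3, h6 e, if_pos he, List.getD_eq_getElem _ _ he]
      rfl

end RealRAM

/-! ### The net formed by the witnesses. -/

namespace RealRAM

namespace Cx

variable {c : Cx} {s : State} {n : ℕ} {key G H mid : ℕ → ℝ} {dim : ℕ → ℕ}

/-- What the splitting phase achieves: `n` witnesses, one in each cell. -/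
structure Net (c : Cx) (n : ℕ) (P : Fin n → EuclideanSpace ℝ (Fin c.d)) : Prop where
  pos : 1 ≤ n
  le : n ≤ c.K + 1
  part : ∃ key G H dim mid, c.Part n key G H dim mid ∧
    (n = c.K + 1 ∨ ∀ j, 1 ≤ j → j ≤ n → key j ≤ 0) ∧
    ∀ i : Fin n, P i ∈ c.cell (row c.d G (i + 1)) (row c.d H (i + 1))

variable {P : Fin n → EuclideanSpace ℝ (Fin c.d)}

theorem Net.mem_res (h : c.Net n P) (i : Fin n) : P i ∈ c.res := by
  obtain ⟨key, G, H, dim, mid, -, -, hP⟩ := h.part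
  exact (hP i).1

theorem Net.injective (h : c.Net n P) : Function.Injective P := by
  obtain ⟨key, G, H, dim, mid, hpart, -, hP⟩ := h.part
  intro i j hij
  by_contra hne
  have hne' : (i : ℕ) + 1 ≠ j + 1 := fun e => hne (Fin.ext (by omega))
  obtain ⟨a, ha, hd⟩ := hpart.disj (i + 1) (j + 1) (by omega) i.2 (by omega) j.2 hne'
  have hi := (hP i).2 ⟨a, ha⟩
  have hj := (hP j).2 ⟨a, ha⟩
  rw [hij] at hi
  simp only at hi hj
  rcases hd with hd | hd <;> linarith

/-- `L` is the largest key: a result and the witness of its cell differ by at most `L` in each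
coordinate. If all cuts were made, the number of cells is `K + 1 > S.card * B ^ d`, which is the
hypothesis of `Part.key_le`; otherwise `L ≤ 0`. -/
theorem Net.exists_net (h : c.Net n P) {W M B k : ℕ} {ε : ℝ} (hε : 0 < ε)
    (hW : c.res.encard ≤ W) (hk : c.k = min k W) (hK : c.K = M * c.k) (hB : B ^ c.d ≤ M)
    (hB' : 4 * c.d / (ε / 2) + 3 ≤ B) :
    ∃ L : ℝ, (∀ x ∈ c.res, ∃ p ∈ Set.range P, edist x p ≤ ENNReal.ofReal (c.d * L)) ∧
      ∀ S : Finset (EuclideanSpace ℝ (Fin c.d)), (S : Set _) ⊆ c.res → S.card ≤ k → ∀ r, 0 ≤ r →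
        (∀ x ∈ c.res, ∃ y ∈ S, dist x y ≤ r) → c.d * L ≤ ε / 2 * r := by
  obtain ⟨key, G, H, dim, mid, hpart, hor, hP⟩ := h.part
  obtain ⟨j, hj, hmax⟩ := (Finset.Icc 1 n).exists_max_image key ⟨1, by simpa using h.pos⟩
  rw [Finset.mem_Icc] at hj
  refine ⟨key j, fun x hx => ?_, fun S hSr hS r hr hcov => ?_⟩
  · obtain ⟨i, hi, hin, hxi⟩ := hpart.cover x hx
    have hPi := hP ⟨i - 1, by omega⟩
    simp only [show i - 1 + 1 = i by omega] at hPi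
    refine ⟨_, ⟨⟨i - 1, by omega⟩, rfl⟩, ?_⟩
    have hinfo := hpart.info i hi hin
    have hle := hmax i (Finset.mem_Icc.2 ⟨hi, hin⟩)
    refine edist_le_of_coord (hinfo.nonneg.trans hle) fun a => abs_le.2 ⟨?_, ?_⟩
    · have := hinfo.diam _ hPi x hxi a
      linarith
    · have := hinfo.diam x hxi _ hPi a
      linarith
  · rcases hor with hor | hor
    · refine hpart.key_le (by positivity) hr hcov hB' ?_ hj.1 hj.2
      have hSW : S.card ≤ W := by
        have := (Set.encard_le_encard hSr).trans hW
        rw [Set.encard_coe_eq_coe_finsetCard] at this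
        exact_mod_cast this
      have h1 : S.card ≤ c.k := by rw [hk]; exact le_min hS hSW
      calc S.card * B ^ c.d ≤ c.k * M := Nat.mul_le_mul h1 hB
        _ = c.K := by rw [hK, Nat.mul_comm]
        _ < n := by omega
    · have h1 := hor j hj.1 hj.2
      have h2 : (c.d : ℝ) * key j ≤ 0 := mul_nonpos_of_nonneg_of_nonpos (by positivity) h1
      have h3 : 0 ≤ ε / 2 * r := by positivity
      linarith

theorem Net.encard_range (h : c.Net n P) : (Set.range P).encard = n := by
  rw [← Set.image_univ, h.injective.encard_image, Set.encard_univ, ENat.card_eq_coe_fintype_card,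
    Fintype.card_fin]

/-- If the cuts ended early, every cell holds one result and the witnesses are all of `q(D)`.
Otherwise `n = K + 1 > c.k`, so the cap is decided by `k` and not by the number of results. -/
theorem Net.card_eq (h : c.Net n P) {W M k : ℕ} (hW : c.res.encard ≤ W) (hk : c.k = min k W)
    (hK : c.K = M * c.k) (hM : 1 ≤ M) :
    ((min n c.k : ℕ) : ℕ∞) = min (k : ℕ∞) c.res.encard := by
  have hsub : Set.range P ⊆ c.res := Set.range_subset_iff.2 h.mem_res
  have hle := Set.encard_le_encard hsub
  have hfin : c.res.Finite := Set.finite_of_encard_le_coe hW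
  rw [h.encard_range] at hle
  rw [← hfin.cast_ncard_eq] at hW hle ⊢
  have e : min (k : ℕ∞) (c.res.ncard : ℕ∞) = ((min k c.res.ncard : ℕ) : ℕ∞) :=
    (Nat.mono_cast.map_min).symm
  rw [e, Nat.cast_inj, hk]
  norm_cast at hW hle
  obtain ⟨key, G, H, dim, mid, hpart, hor, hP⟩ := h.part
  rcases hor with hor | hor
  · have : c.k ≤ c.K := by
      rw [hK]
      exact Nat.le_mul_of_pos_left _ hM
    omega
  · have heq : c.res ⊆ Set.range P := by
      intro x hx
      obtain ⟨i, hi, hin, hxi⟩ := hpart.cover x hx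
      have hPi := hP ⟨i - 1, by omega⟩
      simp only [show i - 1 + 1 = i by omega] at hPi
      refine ⟨⟨i - 1, by omega⟩, PiLp.ext fun a => ?_⟩
      have h1 := (hpart.info i hi hin).diam _ hPi x hxi a
      have h2 := (hpart.info i hi hin).diam x hxi _ hPi a
      have h3 := hor i hi hin
      linarith
    have := Set.encard_le_encard heq
    rw [h.encard_range, ← hfin.cast_ncard_eq] at this
    norm_cast at this
    omega

/-- The points in the first `n` rows of real array 10. -/
noncomputable def points (d n : ℕ) (A : ℕ → ℝ) (i : Fin n) : EuclideanSpace ℝ (Fin d) :=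
  WithLp.toLp 2 fun a => row d A i a

/-- Split the root cell and choose witnesses. -/
def _root_.RealRAM.cover : HL := refresh ⨟ splitLoop ⨟ witnesses

theorem Rooted.cover (hg : c.Good) (hr : c.Ranked) (hR : c.Reducible) (hE : c.Env s)
    (h : c.Rooted s) (hne : c.res.Nonempty) :
    HT c.β c.w RealRAM.cover s (fun s' => ∃ n, s'.wreg 9 = n ∧
      c.Net n (points c.d n (s'.rarr 10))) := by
  refine HT.seq' (h.refresh hg hr hR hE hne) ?_
  intro s1 h1 hk1
  have hE1 := hE.keep hk1 rfl
  refine HT.seq' (splitLoop_spec hg hr hR hE1 h1) ?_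
  rintro s2 ⟨n, hn, hnK, hC, hor⟩ hk2
  have hE2 := hE1.keep hk2 rfl
  refine (witnesses_spec hg hr hR hE2 hC.stamp hC.cnt hnK fun i hi =>
    (hC.part.info (i + 1) (by omega) (by omega)).ne).keeps.mono ?_
  rintro s3 ⟨h3, hk3⟩
  refine ⟨n, Eq.trans (hk3 (.w 9) rfl) hC.cnt, hn, hnK, _, _, _, _, _, hC.part, hor, fun i => ?_⟩
  obtain ⟨x, hx, e⟩ := h3 i i.2
  have : points c.d n (s3.rarr 10) i = x := PiLp.ext fun a => (e a).symm
  rwa [this]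

end Cx

/-! ### Calling the clustering algorithm -/

/-- Copy the witnesses to real array `o + 1`, and their number and the number of centers to word
registers 100 and 101. -/
def sendPoints (o : ℕ) : HL :=
  .wset 57 (.reg 9 * .reg 2) ⨟
  .loopTo 58 57 (.rsto (o + 1) (.reg 58) (.load 10 (.reg 58))) ⨟
  .wset 15 (.reg 1) ⨟ .ite (.wlt (.reg 9) (.reg 1)) (.wset 15 (.reg 9)) .skip ⨟
  .wset 100 (.reg 9) ⨟ .wset 101 (.reg 15)

/-- Choose the output from the witnesses and the centers in real array `o`. -/
def receive (o : ℕ) : HL := .wset 12 (.reg 100) ⨟ markRows o ⨟ selectRows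

namespace Cx

variable {c : Cx} {s : State} {n : ℕ}

theorem sendPoints_spec (hg : c.Good) (hE : c.Env s) {o : ℕ} (ho : 100 ≤ o) (h9 : s.wreg 9 = n)
    (hn : n ≤ c.K + 1) (hz : ∀ x, s.rarr (o + 1) x = 0) :
    HT c.β c.w (sendPoints o) s (fun s' => s'.wreg 15 = min n c.k ∧ s'.wreg 100 = n ∧
      s'.wreg 101 = min n c.k ∧
      ∀ x, s'.rarr (o + 1) x = if x < n * c.d then s.rarr 10 x else 0) := by
  have hb := hg.cells_lt (i := n) (a := c.d) hn le_rfl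
  refine HT.seq (HT.of_wp ?_)
  simp only [HL.wp, WE.ok_mul, WE.ok_reg, WE.eval_mul, WE.eval_reg, true_and, h9, hE.r2]
  refine ⟨by omega, ?_⟩
  set s0 := s.setW 57 _ with hs0
  have hE0 : c.Env s0 := hE.setW (by decide)
  have e57 : s0.wreg 57 = n * c.d := by simp [hs0]
  have e9 : s0.wreg 9 = n := by simp [hs0, h9]
  have eo : s0.rarr (o + 1) = s.rarr (o + 1) := rfl
  have e10 : s0.rarr 10 = s.rarr 10 := rfl
  clear_value s0
  refine HT.seq' (HT.loopTo (Q := fun s' =>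
      ∀ x, s'.rarr (o + 1) x = if x < n * c.d then s.rarr 10 x else 0)
    (fun y s' => ∀ x, s'.rarr (o + 1) x = if x < y then s.rarr 10 x else 0)
    ⟨rfl, rfl, by decide⟩ ?_ (by rw [e57]; omega) (by simp [eo, hz]) ?_ ?_) ?_
  · rw [e57]
    exact (Nat.mul_le_mul_right _ hn).trans hg.β57
  · intro y s1 hy hy1 hk hI
    have f10 : s1.rarr 10 = s.rarr 10 :=
      Eq.trans (hk (.ra 10) (by simp [HL.wr]; omega)) e10
    refine HT.of_wp ?_
    simp [HL.wp, hy1, f10, -Order.lt_add_one_iff]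
    intro x
    rcases Nat.lt_trichotomy x y with hx | rfl | hx
    · rw [Function.update_of_ne hx.ne, hI x]
      simp [hx, show x < y + 1 by omega]
    · simp
    · rw [Function.update_of_ne hx.ne', hI x]
      simp [show ¬ x < y by omega, show ¬ x < y + 1 by omega]
  · intro s1 _ _ hI
    rwa [e57] at hI
  · intro s1 h1 hk
    have f9 : s1.wreg 9 = n := Eq.trans (hk (.w 9) rfl) e9
    have f1 : s1.wreg 1 = c.k := Eq.trans (hk (.w 1) rfl) hE0.r1
    refine HT.of_wp ?_
    simp [HL.wp, f9, f1]
    refine ⟨fun h => ⟨h.le, h1⟩, fun h => ⟨h, h1⟩⟩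

theorem _root_.RealRAM.State.eq_of_fields {s t : State} (h1 : s.wreg = t.wreg)
    (h2 : s.rreg = t.rreg) (h3 : s.warr = t.warr) (h4 : s.rarr = t.rarr) : s = t := by
  cases s
  cases t
  simp_all

/-- The guarantee for the clustering program concerns a memory that equals `pointInput`, zeros
included; therefore its part of the memory must be untouched before the call, apart from the two
numbers and the table. -/
theorem pull_eq_pointInput {o k' : ℕ} (hr : ∀ r, s.rreg (r + 100) = 0)
    (hw : ∀ r, 2 ≤ r → s.wreg (r + 100) = 0) (h100 : s.wreg 100 = n) (h101 : s.wreg 101 = k')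
    (ha : ∀ a x, s.warr (a + 100) x = 0) (ho : ∀ a x, a ≠ 1 → s.rarr (a + o) x = 0)
    {d : ℕ} {A : ℕ → ℝ} (h1 : ∀ x, s.rarr (o + 1) x = if x < n * d then A x else 0) :
    s.pull (· + 100) (· + o) = pointInput (points d n A) k' := by
  have e1 : (s.pull (· + 100) (· + o)).wreg = (pointInput (points d n A) k').wreg := by
    funext r
    simp only [State.pull, pointInput]
    split_ifs with h0 h1
    · rw [h0]
      exact h100
    · rw [h1]
      exact h101
    · exact hw r (by omega)
  have e2 : (s.pull (· + 100) (· + o)).rarr = (pointInput (points d n A) k').rarr := by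
    funext a x
    simp only [State.pull, pointInput]
    by_cases hab : a = 1
    · rw [if_pos hab, hab, Nat.add_comm 1 o, h1]
      split_ifs with hx
      · simp only [points, row, Fin.coe_divNat, Fin.coe_modNat]
        rw [Nat.mul_comm, Nat.div_add_mod]
      · rfl
    · rw [if_neg hab]
      exact ho a x hab
  have e3 : (s.pull (· + 100) (· + o)).rreg = (pointInput (points d n A) k').rreg :=
    funext fun r => hr r
  have e4 : (s.pull (· + 100) (· + o)).warr = (pointInput (points d n A) k').warr :=
    funext fun a => funext fun x => ha a x
  exact State.eq_of_fields e1 e3 e4 e2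

/-- The returned centers are witnesses, so their coordinates are entries of the database and have
rank codes; equal codes then identify each center with a unique row `τ j` of the witness table. -/
theorem receive_spec (hg : c.Good) (hr : c.Ranked) (hR : c.Reducible) (hE : c.Env s) {o k' : ℕ}
    (ho : o ≠ 3) (h9 : s.wreg 9 = n) (hP : c.Net n (points c.d n (s.rarr 10)))
    (h15 : s.wreg 15 = k') (hk' : k' ≤ n) (h10 : ∀ y, s.warr 10 y = 0)
    {C : Finset (EuclideanSpace ℝ (Fin c.d))} (hC : C.card = s.wreg 100)
    (hCmem : ∀ x, x ∈ C ↔ ∃ i < s.wreg 100, ∀ a : Fin c.d, x a = s.rarr o (i * c.d + a))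
    (hsub : (C : Set _) ⊆ Set.range (points c.d n (s.rarr 10))) (hcard : C.card ≤ k') :
    HT c.β c.w (receive o) s (fun s' => ∃ S : Finset (EuclideanSpace ℝ (Fin c.d)),
      Outputs s' S ∧ C ⊆ S ∧ (S : Set _) ⊆ c.res ∧ S.card = k') := by
  classical
  rw [← hC] at hCmem
  set P := points c.d n (s.rarr 10) with hPdef
  have hrowP : ∀ (i : Fin n) (a : Fin c.d), P i a = row c.d (s.rarr 10) i a := fun i a => rfl
  set y : ℕ → EuclideanSpace ℝ (Fin c.d) := fun j => WithLp.toLp 2 fun a => row c.d (s.rarr o) j a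
    with hy
  have hyC : ∀ j < C.card, y j ∈ C := fun j hj => (hCmem _).2 ⟨j, hj, fun a => rfl⟩
  have hyim : (Finset.range C.card).image y = C := by
    ext x
    rw [Finset.mem_image, hCmem]
    constructor
    · rintro ⟨j, hj, rfl⟩
      exact ⟨j, by simpa using hj, fun a => rfl⟩
    · rintro ⟨j, hj, h⟩
      exact ⟨j, by simpa using hj, PiLp.ext fun a => (h a).symm⟩
  -- The rows are pairwise distinct because their number equals the number of points they represent.
  have hyinj : Set.InjOn y (Finset.range C.card) := by
    rw [← Finset.card_image_iff, hyim, Finset.card_range]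
  have hτ : ∀ j, ∃ i : ℕ, j < C.card → ∃ h : i < n, P ⟨i, h⟩ = y j := by
    intro j
    by_cases hj : j < C.card
    · obtain ⟨i, hi⟩ := hsub (hyC j hj)
      exact ⟨i, fun _ => ⟨i.2, hi⟩⟩
    · exact ⟨0, fun h => absurd h hj⟩
  choose τ hτ using hτ
  have hentry : ∀ i < n, ∀ a < c.d, ∃ x < c.nv, c.V x = row c.d (s.rarr 10) i a := by
    intro i hi a ha
    obtain ⟨x, hx, e⟩ := hR.mem_entry (hP.mem_res ⟨i, hi⟩) ⟨a, ha⟩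
    exact ⟨x, hx, e.symm⟩
  have hrow : ∀ j < C.card, ∀ a < c.d, row c.d (s.rarr 10) (τ j) a = row c.d (s.rarr o) j a := by
    intro j hj a ha
    obtain ⟨h, e⟩ := hτ j hj
    have := congrArg (fun x : EuclideanSpace ℝ (Fin c.d) => x ⟨a, ha⟩) e
    exact this
  have hq : C.card ≤ c.K + 1 := (hcard.trans hk').trans hP.le
  refine HT.seq (HT.of_wp ?_)
  simp only [HL.wp, WE.ok_reg, WE.eval_reg, true_and, ← hC]
  set s0 := s.setW 12 C.card with hs0
  have hE0 : c.Env s0 := hE.setW (by decide)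
  have e12 : s0.wreg 12 = C.card := by simp [hs0]
  have e9 : s0.wreg 9 = n := by simp [hs0, h9]
  have e15 : s0.wreg 15 = k' := by simp [hs0, h15]
  have a10 : ∀ y, s0.warr 10 y = 0 := h10
  have b10 : s0.rarr 10 = s.rarr 10 := rfl
  have bo : s0.rarr o = s.rarr o := rfl
  clear_value s0
  refine HT.seq' (markRows_spec hg hr hE0 ho e12 hq a10 ?_) ?_
  · intro j hj a ha
    rw [bo, ← hrow j hj a ha]
    exact hentry _ (hτ j hj).1 a ha
  intro s1 h1 hk1
  have hE1 := hE0.keep hk1 rfl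
  have f10 : s1.rarr 10 = s.rarr 10 := Eq.trans (hk1 (.ra 10) rfl) b10
  have code_eq : ∀ j < C.card, c.code (row c.d (s.rarr o) j) = c.code (row c.d (s.rarr 10) (τ j)) :=
    fun j hj => horner_congr fun a ha => by simp only [hrow j hj a ha]
  refine (selectRows_spec hg hr hE1 (τ := τ) (Eq.trans (hk1 (.w 12) rfl) e12)
    (Eq.trans (hk1 (.w 9) rfl) e9) (Eq.trans (hk1 (.w 15) rfl) e15) hP.le hcard hk'
    (by rw [f10]; exact hentry) (fun j hj => (hτ j hj).1) ?_ ?_).mono ?_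
  · intro i hi j hj hij
    refine hyinj (by simpa using hi) (by simpa using hj) ?_
    obtain ⟨h, e⟩ := hτ i hi
    obtain ⟨h', e'⟩ := hτ j hj
    rw [← e, ← e']
    simp only [hij]
  · intro i hi
    rw [f10, h1, bo]
    constructor
    · rintro ⟨j, hj, e⟩
      refine ⟨j, hj, ?_⟩
      rw [code_eq j hj] at e
      have := hr.code_inj (hentry _ (hτ j hj).1) (hentry i hi) e
      have : P ⟨τ j, (hτ j hj).1⟩ = P ⟨i, hi⟩ := PiLp.ext fun a => this a a.2
      exact congrArg Fin.val (hP.injective this)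
    · rintro ⟨j, hj, rfl⟩
      exact ⟨j, hj, code_eq j hj⟩
  · rintro s2 ⟨h0, σ, hσ, hσinj, hσC⟩
    rw [f10] at hσ
    set z : ℕ → EuclideanSpace ℝ (Fin c.d) := fun i => WithLp.toLp 2 fun a => row c.d (s2.rarr 0) i a
      with hz
    have hzP : ∀ i (hi : i < k'), z i = P ⟨σ i, (hσ i hi).1⟩ := fun i hi =>
      PiLp.ext fun a => (hσ i hi).2 a a.2
    have hcardS : ((Finset.range k').image z).card = k' := by
      rw [Finset.card_image_of_injOn, Finset.card_range]
      intro i hi j hj hij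
      have hi' : i < k' := by simpa using hi
      have hj' : j < k' := by simpa using hj
      rw [hzP i hi', hzP j hj'] at hij
      exact hσinj i hi' j hj' (congrArg Fin.val (hP.injective hij))
    refine ⟨(Finset.range k').image z, ⟨by rw [hcardS, h0], fun x => ?_⟩, fun x hx => ?_,
      fun x hx => ?_, hcardS⟩
    · rw [Finset.mem_image, h0]
      constructor
      · rintro ⟨i, hi, rfl⟩
        exact ⟨i, by simpa using hi, fun a => rfl⟩
      · rintro ⟨i, hi, h⟩
        exact ⟨i, by simpa using hi, PiLp.ext fun a => (h a).symm⟩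
    · rw [← hyim] at hx
      obtain ⟨j, hj, rfl⟩ := Finset.mem_image.1 hx
      rw [Finset.mem_range] at hj
      obtain ⟨i, hi, e⟩ := hσC j hj
      obtain ⟨h, e'⟩ := hτ j hj
      refine Finset.mem_image.2 ⟨i, by simpa using hi, ?_⟩
      rw [hzP i hi, ← e']
      simp only [e]
    · obtain ⟨i, hi, rfl⟩ := Finset.mem_image.1 (Finset.mem_coe.1 hx)
      rw [hzP i (by simpa using hi)]
      exact hP.mem_res _

end Cx

end RealRAM

namespace RealRAM

/-! ### The join algorithm -/

def Loc.index : Loc → ℕ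
  | .w x | .r x | .wa x | .ra x => x

/-- The program writes only locations with index below `b`. -/
def HL.within (b : ℕ) : HL → Bool
  | skip => true
  | wset r _ => decide (r < b)
  | wsto arr _ _ => decide (arr < b)
  | rset r _ => decide (r < b)
  | rsto arr _ _ => decide (arr < b)
  | seq p q => p.within b && q.within b
  | ite _ p q => p.within b && q.within b
  | loopTo i _ p => decide (i < b) && p.within b
  | loopWhile _ _ p => p.within b

theorem HL.wr_of_within {b : ℕ} {p : HL} {l : Loc} (h : p.within b = true) (hl : b ≤ l.index) :
    p.wr l = false := by
  induction p <;> cases l <;> simp_all [within, wr, Loc.index] <;> omega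

theorem power_within (m : ℕ) : (power m).within 100 = true := by
  induction m with
  | zero => rfl
  | succ m ih => simp [power, HL.within, ih]

theorem storeTable_within {arr : ℕ} (h : arr < 100) (f : ℕ → ℕ) (n : ℕ) :
    (storeTable arr f n).within 100 = true := by
  induction n with
  | zero => rfl
  | succ n ih => simp [storeTable, HL.within, ih, h]

theorem gather_within (m : ℕ) : (gather m).within 100 = true := by
  induction m with
  | zero => rfl
  | succ m ih => simp [gather, HL.within, ih]

theorem setup_within (d m M : ℕ) (mask : ℕ → ℕ) (sched : List (ℕ × ℕ)) :
    (setup d m M mask sched).within 100 = true := by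
  simp [setup, HL.within, power_within, storeTable_within, gather_within]

/-- Read the input, compute rank codes, and make the root cell. -/
def prepare (d m M : ℕ) (mask : ℕ → ℕ) (sched : List (ℕ × ℕ)) : HL :=
  setup d m M mask sched ⨟ rankAll ⨟ openRoot ⨟ .wset 62 (.const 0)

theorem prepare_within (d m M : ℕ) (mask : ℕ → ℕ) (sched : List (ℕ × ℕ)) :
    (prepare d m M mask sched).within 100 = true := by
  have h1 : rankAll.within 100 = true := by rfl
  have h2 : openRoot.within 100 = true := by rfl
  simp [prepare, HL.within, setup_within, h1, h2]

theorem setup_wr (d m M : ℕ) (mask : ℕ → ℕ) (sched : List (ℕ × ℕ)) {a : ℕ} (ha : 3 < a) :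
    (setup d m M mask sched).wr (.wa a) = false := by
  simp [setup, HL.wr, power_wr, gather_wr, storeTable_wr, show a ≠ 1 by omega,
    show a ≠ 2 by omega, show a ≠ 3 by omega]

theorem prepare_wr (d m M : ℕ) (mask : ℕ → ℕ) (sched : List (ℕ × ℕ)) :
    (prepare d m M mask sched).wr (.wa 10) = false := by
  have h1 : rankAll.wr (.wa 10) = false := by rfl
  have h2 : openRoot.wr (.wa 10) = false := by rfl
  simp only [prepare, HL.wr, h1, h2, setup_wr d m M mask sched (show 3 < 10 by decide),
    Bool.or_false]

variable {d m M N k w Λ : ℕ} {q : JoinQuery d m} {sched : List (ℕ × ℕ)}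

theorem prepare_spec (D : Database q N) (hg : ∀ V ids, (ctx q sched M N k w Λ V ids).Good)
    (hR : ∀ V ids, (ctx q sched M N k w Λ V ids).Reducible) (hm : 1 ≤ m) (hk : 1 ≤ k)
    (hpow : N ^ m < 2 ^ w) :
    HT (loopBound d m N (M * min k (N ^ m)) sched.length Λ) w (prepare d m M q.maskOf sched)
      (D.input k) (fun s' => s'.wreg 62 = 0 ∧ ∃ V ids, Lists D V ∧
        (ctx q sched M N k w Λ V ids).Env s' ∧ (ctx q sched M N k w Λ V ids).Ranked ∧
        (ctx q sched M N k w Λ V ids).Rooted s' ∧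
        ((s'.wreg 36 = 1 ∧ D.results.Nonempty) ∨ (s'.wreg 36 = 0 ∧ D.results = ∅))) := by
  refine HT.seq' (setup_spec D hg hm hk hpow) ?_
  rintro s1 ⟨hV, hB⟩ hk1
  have e1 : ∀ a, 3 < a → s1.warr a = (D.input k).warr a := fun a ha =>
    hk1 (.wa a) (setup_wr d m M _ _ ha)
  refine HT.seq' (Cx.rankAll_spec (hg _ 0) (hB 0) (fun i => by rw [e1 5 (by omega)]; rfl)) ?_
  rintro s2 ⟨h5, hr, hVb⟩ hk2
  have hB2 := (hB (s2.warr 4)).keep hk2 rfl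
  have e7 : s2.warr 7 = s1.warr 7 := hk2 (.wa 7) rfl
  refine HT.seq' (Cx.openRoot_spec (c := ctx q sched M N k w Λ (s1.rarr 1) (s2.warr 4)) (hg _ _) hr
    (hR _ _) ⟨hB2, rfl⟩ hVb (fun i => by rw [e7, e1 7 (by omega)]; rfl) h5) ?_
  rintro s3 ⟨hroot, hres⟩ hk3
  have hE3 := Cx.Env.keep (c := ctx q sched M N k w Λ (s1.rarr 1) (s2.warr 4)) ⟨hB2, rfl⟩ hk3 rfl
  rw [ctx_res hV] at hres
  refine HT.of_wp ?_
  simp only [HL.wp, WE.ok_const, WE.eval_const]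
  refine ⟨Nat.two_pow_pos w, by simp, s1.rarr 1, s2.warr 4, hV, hE3.setW (by decide), hr, ?_, ?_⟩
  · exact ⟨hroot.cnt, hroot.leaves, hroot.cell, hroot.node, hroot.sentinel, hroot.stamp, hroot.g,
      hroot.h, hroot.bounds⟩
  · exact hres

/-- Cover the join results by cells and hand the witnesses over. -/
def offer (o : ℕ) : HL := cover ⨟ sendPoints o

variable {c : Cx} {s : State}

theorem offer_spec (hg : c.Good) (hr : c.Ranked) (hR : c.Reducible) (hE : c.Env s)
    (h : c.Rooted s) (hne : c.res.Nonempty) {o : ℕ} (ho : 100 ≤ o)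
    (hrz : ∀ r, s.rreg (r + 100) = 0) (hwz : ∀ r, s.wreg (r + 100) = 0)
    (haz : ∀ a x, s.warr (a + 100) x = 0) (hoz : ∀ a x, s.rarr (a + o) x = 0)
    (h10 : ∀ y, s.warr 10 y = 0) :
    HT c.β c.w (offer o) s (fun s' => c.Env s' ∧ ∃ n, s'.wreg 9 = n ∧ s'.wreg 15 = min n c.k ∧
      c.Net n (Cx.points c.d n (s'.rarr 10)) ∧ (∀ y, s'.warr 10 y = 0) ∧
      s'.pull (· + 100) (· + o) = pointInput (Cx.points c.d n (s'.rarr 10)) (min n c.k)) := by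
  refine HT.seq' (h.cover hg hr hR hE hne) ?_
  rintro s1 ⟨n, h9, hnet⟩ hk1
  have hE1 := hE.keep hk1 rfl
  have hcb : cover.within 100 = true := rfl
  have oz1 : ∀ a x, s1.rarr (a + o) x = 0 := fun a x =>
    (congrFun (hk1 (.ra (a + o)) (HL.wr_of_within hcb (by simp [Loc.index]; omega))) x).trans (hoz a x)
  have wz1 : ∀ r, s1.wreg (r + 100) = 0 := fun r =>
    Eq.trans (hk1 (.w (r + 100)) (HL.wr_of_within hcb (by simp [Loc.index]))) (hwz r)
  have rz1 : ∀ r, s1.rreg (r + 100) = 0 := fun r =>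
    Eq.trans (hk1 (.r (r + 100)) (HL.wr_of_within hcb (by simp [Loc.index]))) (hrz r)
  have az1 : ∀ a x, s1.warr (a + 100) x = 0 := fun a x =>
    (congrFun (hk1 (.wa (a + 100)) (HL.wr_of_within hcb (by simp [Loc.index]))) x).trans (haz a x)
  have a1 : s1.warr 10 = s.warr 10 := hk1 (.wa 10) rfl
  refine (Cx.sendPoints_spec hg hE1 ho h9 hnet.le fun x => ?_).keeps.mono ?_
  · rw [Nat.add_comm]
    exact oz1 1 x
  rintro s2 ⟨⟨h15, h100, h101, hpts⟩, hk2⟩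
  have b10 : s2.rarr 10 = s1.rarr 10 := hk2 (.ra 10) (by simp [sendPoints, HL.wr]; omega)
  have a10 : s2.warr 10 = s1.warr 10 := hk2 (.wa 10) (by simp [sendPoints, HL.wr])
  refine ⟨hE1.keep hk2 ?_, n, Eq.trans (hk2 (.w 9) rfl) h9, h15, by rwa [b10],
    fun y => by rw [a10, a1, h10], ?_⟩
  · simp [Cx.baseLocs, HL.wr, sendPoints]
    omega
  · rw [b10]
    refine Cx.pull_eq_pointInput (fun r => ?_) (fun r hr => ?_) h100 h101 (fun a x => ?_)
      (fun a x ha => ?_) hpts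
    · exact Eq.trans (hk2 (.r (r + 100)) rfl) (rz1 r)
    · refine Eq.trans (hk2 (.w (r + 100)) ?_) (wz1 r)
      simp [sendPoints, HL.wr]
      omega
    · exact (congrFun (hk2 (.wa (a + 100)) rfl) x).trans (az1 a x)
    · refine (congrFun (hk2 (.ra (a + o)) ?_) x).trans (oz1 a x)
      simp [sendPoints, HL.wr]
      omega

/-- Everything the join algorithm relies on has index below `100`, so it can resume after a program
that leaves these locations alone. -/
theorem Cx.Env.of_sameAt {s' : State} (h : c.Env s) (hs : ∀ l : Loc, l.index < 100 → SameAt s s' l) :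
    c.Env s' := by
  have hw : ∀ r < 100, s'.wreg r = s.wreg r := fun r hr => hs (.w r) hr
  have ha : ∀ r < 100, s'.warr r = s.warr r := fun r hr => hs (.wa r) hr
  have hra : ∀ r < 100, s'.rarr r = s.rarr r := fun r hr => hs (.ra r) hr
  refine ⟨⟨?_, ?_, ?_, ?_, ?_, ?_, ?_, ?_, ?_, ?_, fun e he => ?_, fun e he => ?_, ?_⟩, ?_⟩
  · rw [hw 0 (by decide), h.r0]
  · rw [hw 1 (by decide), h.r1]
  · rw [hw 2 (by decide), h.r2]
  · rw [hw 3 (by decide), h.r3]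
  · rw [hw 4 (by decide), h.r4]
  · rw [hw 5 (by decide), h.r5]
  · rw [hw 6 (by decide), h.r6]
  · rw [hw 7 (by decide), h.r7]
  · rw [hw 8 (by decide), h.r8]
  · rw [ha 1 (by decide), h.mask]
  · rw [ha 2 (by decide), h.src e he]
  · rw [ha 3 (by decide), h.dst e he]
  · rw [hra 1 (by decide), h.V]
  · rw [ha 4 (by decide), h.ids]

/-- A program for `k`-center, moved to the memory where it does not disturb the join algorithm. -/
def embed (o : ℕ) (B : Prog) : Prog := B.rename (fun r => phys (r + 100)) (· + o)

/-- Two renamings are composed: the shift by `100` (by `o` for real arrays) and `phys`, which makes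
room for the temporaries of compiled code. The written locations are then seen with index at least
`100`. -/
theorem embed_runs {o t : ℕ} {B : Prog} {Q : State → Prop} (ho : 100 ≤ o)
    (h : Runs w B ((view s).pull (· + 100) (· + o)) t Q) :
    Runs w (embed o B) s t (fun s' => Q ((view s').pull (· + 100) (· + o)) ∧
      ∀ l : Loc, l.index < 100 → SameAt (view s) (view s') l) := by
  refine (Runs.rename (f := fun r => phys (r + 100)) (g := (· + o)) (s := s)
    (fun a b hab => by have := phys_injective hab; omega) (fun a b hab => by simpa using hab)
    h).frame.mono le_rfl ?_
  rintro s' ⟨hQ, hs⟩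
  refine ⟨hQ, fun l hl => sameAt_view (hs _ fun hw => ?_)⟩
  obtain ⟨r, hr⟩ := Prog.writes_rename hw
  cases l <;> simp [Loc.phys, phys_injective.eq_iff, Loc.index] at hr hl <;> omega

/-- The algorithm for relational `k`-center. -/
def algorithm (d m M : ℕ) (mask : ℕ → ℕ) (sched : List (ℕ × ℕ)) (o : ℕ) (B : Prog) : Prog :=
  .seq (prepare d m M mask sched).toProg (.ite (.wlt (phys 62) (phys 36))
    (.seq (offer o).toProg (.seq (embed o B) (receive o).toProg)) (HL.wset 0 (.const 0)).toProg)

/-- The steps of the algorithm outside the `k`-center program. -/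
def overhead (d m M : ℕ) (mask : ℕ → ℕ) (sched : List (ℕ × ℕ)) (o : ℕ) (β : ℕ → ℕ) : ℕ :=
  (prepare d m M mask sched).cost β + (offer o).cost β + (receive o).cost β + 20

theorem view_input (D : Database q N) : view (D.input k) = D.input k := by
  refine State.eq_of_fields (funext fun r => ?_) rfl rfl rfl
  simp only [view, State.pull, Database.input, phys]
  split_ifs <;> omega

theorem algorithm_runs (D : Database q N) (hg : ∀ V ids, (ctx q sched M N k w Λ V ids).Good)
    (hR : ∀ V ids, (ctx q sched M N k w Λ V ids).Reducible) (hm : 1 ≤ m) (hk : 1 ≤ k)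
    (hpow : N ^ m < 2 ^ w) (hM : 1 ≤ M) {B : Prog} {T : ℕ → ℕ} (hT : Monotone T) {γ ε : ℝ}
    (hγ : 1 ≤ γ) (hε : 0 < ε) {b o : ℕ} (hb : b ^ d ≤ M) (hb' : 4 * d / (ε / 2) + 3 ≤ b)
    (ho : 100 ≤ o) (hom : m < o)
    (hB : ∀ (n k' : ℕ) (P : Fin n → EuclideanSpace ℝ (Fin d)), Function.Injective P → 1 ≤ k' →
      k' ≤ n → n ≤ M * min k (N ^ m) + 1 → HaltsWithin w B (pointInput P k') (T n) ∧
      Yields w B (pointInput P k') fun s =>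
        ∃ C : Finset (EuclideanSpace ℝ (Fin d)), Outputs s C ∧
          (C : Set _) ⊆ Set.range P ∧ C.card ≤ k' ∧
          centerCost (C : Set _) (Set.range P) ≤
            ENNReal.ofReal γ * optCenterCost k' (Set.range P)) :
    Runs w (algorithm d m M q.maskOf sched o B) (D.input k)
      (overhead d m M q.maskOf sched o (loopBound d m N (M * min k (N ^ m)) sched.length Λ) +
        T (M * min k (N ^ m) + 1)) fun s =>
      ∃ S : Finset (EuclideanSpace ℝ (Fin d)), Outputs s S ∧
        (S : Set _) ⊆ D.results ∧ (S.card : ℕ∞) = min (k : ℕ∞) D.results.encard ∧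
        centerCost (S : Set _) D.results ≤
          ENNReal.ofReal ((1 + ε) * γ) * optCenterCost k D.results := by
  set β := loopBound d m N (M * min k (N ^ m)) sched.length Λ with hβ
  set rest := (offer o).cost β + (T (M * min k (N ^ m) + 1) + (receive o).cost β + 1) + 1 + 7 + 1
  refine Runs.mono (t := (prepare d m M q.maskOf sched).cost β + rest + 1) ?_
    (by simp only [overhead, rest]; omega) (fun _ h => h)
  refine Runs.seq (((prepare_spec D hg hR hm hk hpow).keeps (D.input k) (view_input D)).mono
    le_rfl ?_)
  rintro s1 ⟨⟨h62, V, ids, hV, hE, hr, hroot, hres⟩, hk1⟩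
  have hwi := prepare_within d m M q.maskOf sched
  set c := ctx q sched M N k w Λ V ids with hc
  have hcres : c.res = D.results := ctx_res hV ids
  have hgood : c.Good := hg V ids
  have hW : c.res.encard ≤ (N ^ m : ℕ) := by rw [hcres]; exact D.card_results_le.2
  refine Runs.ite (fun hlt => ?_) (fun hlt => ?_)
  · have hne : c.res.Nonempty := by
      rw [hcres]
      rcases hres with h | h
      · exact h.2
      · change (view s1).wreg 62 < (view s1).wreg 36 at hlt
        omega
    refine Runs.mono (t := (offer o).cost β + (T (M * min k (N ^ m) + 1) + (receive o).cost β + 1) + 1)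
      ?_ (by omega) (fun _ h => h)
    refine Runs.seq ((offer_spec hgood hr (hR V ids) hE hroot hne ho ?_ ?_ ?_ ?_ ?_ s1 rfl).mono
      le_rfl ?_)
    · exact fun r => hk1 (.r (r + 100)) (HL.wr_of_within hwi (by simp [Loc.index]))
    · exact fun r => hk1 (.w (r + 100)) (HL.wr_of_within hwi (by simp [Loc.index]))
    · exact fun a x => congrFun
        (hk1 (.wa (a + 100)) (HL.wr_of_within hwi (by simp [Loc.index]))) x
    · intro a x
      refine (congrFun (hk1 (.ra (a + o))
        (HL.wr_of_within hwi (by simp only [Loc.index]; omega))) x).trans ?_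
      simp only [Database.input]
      rw [dif_neg (by omega)]
    · exact fun y => congrFun (hk1 (.wa 10) (prepare_wr d m M _ _)) y
    rintro s2 ⟨hE2, n, h9, h15, hnet, h10, hpull⟩
    set P := Cx.points c.d n ((view s2).rarr 10) with hP
    have hkc : 1 ≤ min k (N ^ m) := le_min hk (Nat.one_le_pow _ _ hgood.N_pos)
    have hck : c.k = min k (N ^ m) := rfl
    have hk'1 : 1 ≤ min n c.k := le_min hnet.pos hkc
    obtain ⟨hB1, hB2⟩ := hB n (min n c.k) P hnet.injective hk'1 (min_le_left _ _) hnet.le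
    have hruns := hB1.ends hB2
    refine Runs.seq ((embed_runs ho (by rw [hpull]; exact hruns)).mono (hT hnet.le) ?_)
    rintro s3 ⟨⟨C, hCout, hCP, hCk, hCcost⟩, hs3⟩
    have hCmem := hCout.2
    simp only [State.pull, Nat.zero_add] at hCmem
    have hrecv := Cx.receive_spec (o := o) (k' := min n c.k) (n := n) (C := C) hgood hr (hR V ids)
      (hE2.of_sameAt hs3) (by omega)
      (Eq.trans (hs3 (.w 9) (by decide)) h9)
      (by rw [show (view s3).rarr 10 = (view s2).rarr 10 from hs3 (.ra 10) (by decide)]; exact hnet)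
      (Eq.trans (hs3 (.w 15) (by decide)) h15) (min_le_left _ _)
      (fun y => (congrFun (hs3 (.wa 10) (by decide)) y).trans (h10 y))
      hCout.1 hCmem
      (by rw [show (view s3).rarr 10 = (view s2).rarr 10 from hs3 (.ra 10) (by decide)]; exact hCP)
      hCk
    refine (hrecv s3 rfl).mono le_rfl ?_
    rintro s4 ⟨S, hSout, hCS, hSres, hScard⟩
    refine ⟨S, hSout, by rw [← hcres]; exact hSres, ?_, ?_⟩
    · refine (congrArg Nat.cast hScard).trans ((hnet.card_eq hW hck rfl hM).trans ?_)
      rw [hcres]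
      rfl
    · obtain ⟨L, hL1, hL2⟩ := hnet.exists_net hε hW hck rfl hb hb'
      rw [hcres] at hL1 hL2
      have hsub : Set.range P ⊆ D.results := by
        rw [← hcres]
        exact Set.range_subset_iff.2 hnet.mem_res
      -- Adding points to the returned centers can only lower the cost. The call with `min n c.k`
      -- centers is no restriction, as a set of at most `k` witnesses has at most `n` and at most `N
      -- ^ m` elements.
      refine (centerCost_anti (Finset.coe_subset.2 hCS)).trans
        (approx_of_net hγ hε hsub hL1 (fun S' hS' hS'k => ?_) hCcost hL2)
      have h1 := (Set.encard_le_encard hS').trans hnet.encard_range.le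
      have h2 := (Set.encard_le_encard (hS'.trans hsub)).trans (hcres ▸ hW)
      rw [Set.encard_coe_eq_coe_finsetCard] at h1 h2
      norm_cast at h1 h2
      rw [hck]
      omega
  · have hemp : D.results = ∅ := by
      rcases hres with h | h
      · change ¬ (view s1).wreg 62 < (view s1).wreg 36 at hlt
        omega
      · exact h.2
    have hset := HT.of_wp (β := β) (w := w) (p := .wset 0 (.const 0)) (s := view s1)
      (Q := fun s' => s'.wreg 0 = 0) (by simp [HL.wp])
    refine (hset s1 rfl).mono (by simp only [HL.cost, WE.cost]; omega) ?_
    intro s2 h0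
    change s2.wreg 0 = 0 at h0
    refine ⟨∅, ⟨by simp [h0], by simp [h0]⟩, by simp, by simp [hemp], ?_⟩
    rw [hemp]
    simp [centerCost]

end RealRAM

namespace RealRAM

/-! ### The running time -/

/-- The degrees in `N`, `K` and `Λ` of the loop bounds. -/
def loopDegree (r : ℕ) : ℕ × ℕ × ℕ :=
  if r = 0 ∨ r = 4 ∨ r = 5 ∨ r = 11 then (1, 0, 0) else
  if r = 8 ∨ r = 9 ∨ r = 12 ∨ r = 57 then (0, 1, 0) else
  if r = 43 then (0, 0, 1) else (0, 0, 0)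

/-- The degrees in `N`, `K` and `Λ` of the running time. -/
def HL.degree : HL → ℕ × ℕ × ℕ
  | skip | wset _ _ | wsto _ _ _ | rset _ _ | rsto _ _ _ => (0, 0, 0)
  | seq p q | ite _ p q => p.degree ⊔ q.degree
  | loopTo _ n p => loopDegree n + p.degree
  | loopWhile _ i p => loopDegree i + p.degree

def monomial (N K Λ : ℕ) (e : ℕ × ℕ × ℕ) : ℕ := N ^ e.1 * K ^ e.2.1 * Λ ^ e.2.2

variable {N K Λ : ℕ}

theorem monomial_mono (hN : 1 ≤ N) (hK : 1 ≤ K) (hΛ : 1 ≤ Λ) {e e' : ℕ × ℕ × ℕ} (h : e ≤ e') :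
    monomial N K Λ e ≤ monomial N K Λ e' :=
  Nat.mul_le_mul (Nat.mul_le_mul (Nat.pow_le_pow_right hN h.1) (Nat.pow_le_pow_right hK h.2.1))
    (Nat.pow_le_pow_right hΛ h.2.2)

theorem one_le_monomial (hN : 1 ≤ N) (hK : 1 ≤ K) (hΛ : 1 ≤ Λ) (e : ℕ × ℕ × ℕ) :
    1 ≤ monomial N K Λ e := by
  have := monomial_mono hN hK hΛ (show (0, 0, 0) ≤ e from ⟨Nat.zero_le _, Nat.zero_le _, Nat.zero_le _⟩)
  simpa [monomial] using this

theorem monomial_add (e e' : ℕ × ℕ × ℕ) :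
    monomial N K Λ (e + e') = monomial N K Λ e * monomial N K Λ e' := by
  simp only [monomial, Prod.fst_add, Prod.snd_add, pow_add]
  ring

theorem loopBound_le (d m l : ℕ) : ∃ a, ∀ N K Λ, 1 ≤ N → 1 ≤ K → 1 ≤ Λ → ∀ r,
    loopBound d m N K l Λ r ≤ a * monomial N K Λ (loopDegree r) := by
  -- A single constant that dominates all coefficients in the loop bounds: `2`, `m`, `d`, `2 * d`,
  -- `m * d` and `l`.
  refine ⟨2 * ((m + 1) * (d + 1)) + l, fun N K Λ hN hK hΛ r => ?_⟩
  have hA : 2 * ((m + 1) * (d + 1)) = 2 * (m * d) + 2 * m + 2 * d + 2 := by ring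
  have hA2 : 2 ≤ 2 * ((m + 1) * (d + 1)) + l := by omega
  have hAm : m ≤ 2 * ((m + 1) * (d + 1)) + l := by omega
  have hAd : 2 * d ≤ 2 * ((m + 1) * (d + 1)) + l := by omega
  have hAmd : m * d ≤ 2 * ((m + 1) * (d + 1)) + l := by omega
  have hAl : l ≤ 2 * ((m + 1) * (d + 1)) + l := by omega
  clear hA
  generalize 2 * ((m + 1) * (d + 1)) + l = A at *
  have key : ∀ b x : ℕ, b ≤ A → b * x ≤ A * x := fun b x h => Nat.mul_le_mul_right x h
  have hN' : monomial N K Λ (1, 0, 0) = N := by simp [monomial]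
  have hK' : monomial N K Λ (0, 1, 0) = K := by simp [monomial]
  have hΛ' : monomial N K Λ (0, 0, 1) = Λ := by simp [monomial]
  have h1 : monomial N K Λ (0, 0, 0) = 1 := by simp [monomial]
  by_cases h : r = 0
  · subst h
    rw [show loopDegree 0 = (1, 0, 0) from rfl, hN', show loopBound d m N K l Λ 0 = N from rfl]
    exact (key (1) N (by omega)).trans' (by omega)
  by_cases h : r = 2
  · subst h
    rw [show loopDegree 2 = (0, 0, 0) from rfl, h1, show loopBound d m N K l Λ 2 = d from rfl]
    exact (key (d) 1 (by omega)).trans' (by omega)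
  by_cases h : r = 4
  · subst h
    rw [show loopDegree 4 = (1, 0, 0) from rfl, hN', show loopBound d m N K l Λ 4 = m * N from rfl]
    exact (key (m) N (by omega)).trans' (by omega)
  by_cases h : r = 5
  · subst h
    rw [show loopDegree 5 = (1, 0, 0) from rfl, hN', show loopBound d m N K l Λ 5 = m * N * d from rfl]
    exact (key (m * d) N (by omega)).trans' (by rw [Nat.mul_right_comm])
  by_cases h : r = 7
  · subst h
    rw [show loopDegree 7 = (0, 0, 0) from rfl, h1, show loopBound d m N K l Λ 7 = l from rfl]
    exact (key (l) 1 (by omega)).trans' (by omega)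
  by_cases h : r = 8
  · subst h
    rw [show loopDegree 8 = (0, 1, 0) from rfl, hK', show loopBound d m N K l Λ 8 = K from rfl]
    exact (key (1) K (by omega)).trans' (by omega)
  by_cases h : r = 9
  · subst h
    rw [show loopDegree 9 = (0, 1, 0) from rfl, hK', show loopBound d m N K l Λ 9 = K + 1 from rfl]
    exact (key (2) K (by omega)).trans' (by omega)
  by_cases h : r = 11
  · subst h
    rw [show loopDegree 11 = (1, 0, 0) from rfl, hN', show loopBound d m N K l Λ 11 = N * d from rfl]
    exact (key (d) N (by omega)).trans' (by rw [Nat.mul_comm])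
  by_cases h : r = 12
  · subst h
    rw [show loopDegree 12 = (0, 1, 0) from rfl, hK', show loopBound d m N K l Λ 12 = K + 1 from rfl]
    exact (key (2) K (by omega)).trans' (by omega)
  by_cases h : r = 43
  · subst h
    rw [show loopDegree 43 = (0, 0, 1) from rfl, hΛ', show loopBound d m N K l Λ 43 = Λ from rfl]
    exact (key (1) Λ (by omega)).trans' (by omega)
  by_cases h : r = 57
  · subst h
    rw [show loopDegree 57 = (0, 1, 0) from rfl, hK', show loopBound d m N K l Λ 57 = (K + 1) * d from rfl]
    exact (key (2 * d) K (by omega)).trans' (by nlinarith)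
  rw [show loopBound d m N K l Λ r = 0 by simp [loopBound, *]]
  exact Nat.zero_le _

/-- For a fixed program the cost is, up to a constant factor, a monomial whose exponents are read
off the syntax: nesting in a loop adds degrees, sequencing and branching take the maximum. For the
concrete programs the degrees are then simply evaluated. -/
theorem HL.cost_le (d m l : ℕ) (p : HL) : ∃ a, ∀ N K Λ, 1 ≤ N → 1 ≤ K → 1 ≤ Λ →
    p.cost (loopBound d m N K l Λ) ≤ a * monomial N K Λ p.degree := by
  have hconst : ∀ b : ℕ, ∃ a, ∀ N K Λ, 1 ≤ N → 1 ≤ K → 1 ≤ Λ → ∀ e,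
      b ≤ a * monomial N K Λ e := fun b => ⟨b, fun N K Λ hN hK hΛ e =>
    Nat.le_mul_of_pos_right _ (one_le_monomial hN hK hΛ e)⟩
  have hloop : ∀ (r c₁ c₂ : ℕ) (p : HL), (∃ a, ∀ N K Λ, 1 ≤ N → 1 ≤ K → 1 ≤ Λ →
      p.cost (loopBound d m N K l Λ) ≤ a * monomial N K Λ p.degree) →
      ∃ a, ∀ N K Λ, 1 ≤ N → 1 ≤ K → 1 ≤ Λ → loopBound d m N K l Λ r *
        (p.cost (loopBound d m N K l Λ) + c₁) + c₂ ≤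
        a * monomial N K Λ (loopDegree r + p.degree) := by
    rintro r c₁ c₂ p ⟨a, ha⟩
    obtain ⟨b, hb⟩ := loopBound_le d m l
    refine ⟨b * (a + c₁) + c₂, fun N K Λ hN hK hΛ => ?_⟩
    have h1 := ha N K Λ hN hK hΛ
    have h2 := hb N K Λ hN hK hΛ r
    have h3 : c₁ ≤ c₁ * monomial N K Λ p.degree :=
      Nat.le_mul_of_pos_right _ (one_le_monomial hN hK hΛ _)
    have h4 : c₂ ≤ c₂ * monomial N K Λ (loopDegree r + p.degree) :=
      Nat.le_mul_of_pos_right _ (one_le_monomial hN hK hΛ _)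
    calc _ ≤ b * monomial N K Λ (loopDegree r) * (a * monomial N K Λ p.degree +
          c₁ * monomial N K Λ p.degree) + c₂ * monomial N K Λ (loopDegree r + p.degree) :=
          Nat.add_le_add (Nat.mul_le_mul h2 (Nat.add_le_add h1 h3)) h4
      _ = _ := by rw [monomial_add]; ring
  have hsup : ∀ (c₁ : ℕ) (p q : HL), (∃ a, ∀ N K Λ, 1 ≤ N → 1 ≤ K → 1 ≤ Λ →
      p.cost (loopBound d m N K l Λ) ≤ a * monomial N K Λ p.degree) →
      (∃ a, ∀ N K Λ, 1 ≤ N → 1 ≤ K → 1 ≤ Λ →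
      q.cost (loopBound d m N K l Λ) ≤ a * monomial N K Λ q.degree) →
      ∃ a, ∀ N K Λ, 1 ≤ N → 1 ≤ K → 1 ≤ Λ → p.cost (loopBound d m N K l Λ) +
        q.cost (loopBound d m N K l Λ) + c₁ ≤ a * monomial N K Λ (p.degree ⊔ q.degree) := by
    rintro c₁ p q ⟨a, ha⟩ ⟨b, hb⟩
    refine ⟨a + b + c₁, fun N K Λ hN hK hΛ => ?_⟩
    have h1 := (ha N K Λ hN hK hΛ).trans
      (Nat.mul_le_mul_left a (monomial_mono hN hK hΛ (le_sup_left (b := q.degree))))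
    have h2 := (hb N K Λ hN hK hΛ).trans
      (Nat.mul_le_mul_left b (monomial_mono hN hK hΛ (le_sup_right (a := p.degree))))
    have h3 : c₁ ≤ c₁ * monomial N K Λ (p.degree ⊔ q.degree) :=
      Nat.le_mul_of_pos_right _ (one_le_monomial hN hK hΛ _)
    rw [Nat.add_mul, Nat.add_mul]
    exact Nat.add_le_add (Nat.add_le_add h1 h2) h3
  induction p with
  | skip => exact (hconst 1).imp fun a h N K Λ hN hK hΛ => h N K Λ hN hK hΛ _
  | wset r e => exact (hconst _).imp fun a h N K Λ hN hK hΛ => h N K Λ hN hK hΛ _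
  | wsto arr e v => exact (hconst _).imp fun a h N K Λ hN hK hΛ => h N K Λ hN hK hΛ _
  | rset r e => exact (hconst _).imp fun a h N K Λ hN hK hΛ => h N K Λ hN hK hΛ _
  | rsto arr e v => exact (hconst _).imp fun a h N K Λ hN hK hΛ => h N K Λ hN hK hΛ _
  | seq p q hp hq => exact hsup 1 p q hp hq
  | ite c p q hp hq =>
    refine (hsup c.cost p q hp hq).imp fun a h N K Λ hN hK hΛ => ?_
    simp only [HL.cost, HL.degree]
    rw [Nat.add_comm]
    exact h N K Λ hN hK hΛ
  | loopTo i n p hp => exact hloop n 17 9 p hp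
  | loopWhile z i p hp => exact hloop i 1 1 p hp

theorem power_degree (m : ℕ) : (power m).degree = 0 := by
  induction m with
  | zero => rfl
  | succ m ih => rw [power, HL.degree, ih]; rfl

theorem storeTable_degree (arr : ℕ) (f : ℕ → ℕ) (n : ℕ) : (storeTable arr f n).degree = 0 := by
  induction n with
  | zero => rfl
  | succ n ih => rw [storeTable, HL.degree, ih]; rfl

theorem gather_degree (m : ℕ) : (gather m).degree ≤ (1, 1, 1) := by
  induction m with
  | zero => decide
  | succ m ih =>
    rw [gather, HL.degree]
    exact sup_le ih (show loopDegree 11 + (0, 0, 0) ≤ (1, 1, 1) by decide)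

theorem prepare_degree (d m M : ℕ) (mask : ℕ → ℕ) (sched : List (ℕ × ℕ)) :
    (prepare d m M mask sched).degree ≤ (1, 1, 1) := by
  have h1 : rankAll.degree ≤ (1, 1, 1) := by decide
  have h2 : openRoot.degree ≤ (1, 1, 1) := by decide
  simp only [prepare, setup, HL.degree, power_degree, storeTable_degree, sup_le_iff, gather_degree,
    h1, h2]
  decide

theorem offer_degree (o : ℕ) : (offer o).degree ≤ (1, 1, 1) := by
  have h1 : cover.degree ≤ (1, 1, 1) := by decide
  simp only [offer, sendPoints, HL.degree, sup_le_iff, h1]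
  decide

theorem receive_degree (o : ℕ) : (receive o).degree ≤ (1, 1, 1) := by
  have h : (receive o).degree = (receive 0).degree := rfl
  rw [h]
  decide

/-- No loop nest ranges more than once over each of the tuples (`N`), the cells (`K`) and the rounds
of the tournament (`Λ`); loops over attributes and over the schedule cost only constants. -/
theorem overhead_le (d m M : ℕ) (mask : ℕ → ℕ) (sched : List (ℕ × ℕ)) (o : ℕ) :
    ∃ a, ∀ N K Λ, 1 ≤ N → 1 ≤ K → 1 ≤ Λ →
      overhead d m M mask sched o (loopBound d m N K sched.length Λ) ≤ a * (N * K * Λ) := by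
  obtain ⟨a, ha⟩ := HL.cost_le d m sched.length (prepare d m M mask sched)
  obtain ⟨b, hb⟩ := HL.cost_le d m sched.length (offer o)
  obtain ⟨e, he⟩ := HL.cost_le d m sched.length (receive o)
  refine ⟨a + b + e + 20, fun N K Λ hN hK hΛ => ?_⟩
  have h0 : monomial N K Λ (1, 1, 1) = N * K * Λ := by simp [monomial]
  have h1 := (ha N K Λ hN hK hΛ).trans
    (Nat.mul_le_mul_left a (monomial_mono hN hK hΛ (prepare_degree d m M mask sched)))
  have h2 := (hb N K Λ hN hK hΛ).trans
    (Nat.mul_le_mul_left b (monomial_mono hN hK hΛ (offer_degree o)))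
  have h3 := (he N K Λ hN hK hΛ).trans
    (Nat.mul_le_mul_left e (monomial_mono hN hK hΛ (receive_degree o)))
  have h4 := one_le_monomial hN hK hΛ (1, 1, 1)
  rw [h0] at h1 h2 h3 h4
  rw [Nat.add_mul, Nat.add_mul, Nat.add_mul]
  unfold overhead
  omega

end RealRAM

namespace RealRAM

/-! ### The parameters -/

/-- The number of rounds of the tournament. -/
def rounds (d m N K : ℕ) : ℕ := Nat.log 2 (2 * (m * N * d + 1) + 2 * (K + 2)) + 1

/-- Constant factors are absorbed into the exponent, so each size condition follows from one bound
`x ^ c ≤ 2 ^ w`. -/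
theorem mul_le_pow_succ {x : ℕ} (hx : 2 ≤ x) (a : ℕ) : a * x ≤ x ^ (a + 1) := by
  rw [pow_succ]
  exact Nat.mul_le_mul_right x (Nat.lt_two_pow_self.le.trans (Nat.pow_le_pow_left hx a))

/-- An exponent such that words of `wordExponent * log₂ (N + k + 2)` bits suffice. -/
def wordExponent (d m M l c : ℕ) : ℕ :=
  (m * d + 3) * (d + 2) + (2 * (M + 3) * (d + 2) + 1) + (m + 2) + ((m + 1) * (d + 1) + 1) +
    (l + 1) + (M + 4) * c

variable {d m M N k w c : ℕ} {q : JoinQuery d m} {sched : List (ℕ × ℕ)}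

theorem ctx_reducible {Λ : ℕ} (hs : ∀ c : Cx, c.d = d →
      (∀ (j : Fin m) (a : Fin d), c.Has j a ↔ a ∈ q.attrs j) →
        c.Built (Finset.univ.image (Fin.val : Fin m → ℕ)) sched) (V : ℕ → ℝ) (ids : ℕ → ℕ) :
    (ctx q sched M N k w Λ V ids).Reducible := by
  have hb := hs (ctx q sched M N k w Λ V ids) rfl (ctx_has V ids)
  refine ⟨?_, fun a ha => ?_⟩
  · have himage : Finset.univ.image (Fin.val : Fin m → ℕ) = Finset.range m := by
      ext x
      simp only [Finset.mem_range, Finset.mem_image, Finset.mem_univ, true_and]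
      exact ⟨fun ⟨y, hy⟩ => hy ▸ y.2, fun hx => ⟨⟨x, hx⟩, rfl⟩⟩
    rw [himage] at hb
    exact hb
  · obtain ⟨j, hj⟩ := q.cover ⟨a, ha⟩
    exact ⟨j, j.2, (ctx_has V ids j ⟨a, ha⟩).2 hj⟩

theorem le_two_pow_of_le {x y e : ℕ} (hx : 1 ≤ x) (hw : x ^ c ≤ 2 ^ w) (h : y ≤ x ^ e)
    (he : e ≤ c) : y ≤ 2 ^ w :=
  h.trans ((Nat.pow_le_pow_right hx he).trans hw)

theorem ctx_good (hR : ∀ V ids, (ctx q sched M N k w (rounds d m N (M * min k (N ^ m))) V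
      ids).Reducible) (hN : 1 ≤ N)
    (hw : (N + k + 2) ^ wordExponent d m M sched.length c ≤ 2 ^ w) (V : ℕ → ℝ) (ids : ℕ → ℕ) :
    (ctx q sched M N k w (rounds d m N (M * min k (N ^ m))) V ids).Good := by
  have hx : 1 ≤ N + k + 2 := by omega
  have hx2 : 2 ≤ N + k + 2 := by omega
  have hk : min k (N ^ m) ≤ k := min_le_left _ _
  set x := N + k + 2 with hxdef
  have hlog := Nat.lt_pow_succ_log_self (b := 2) (by decide)
    (2 * (m * N * d + 1) + 2 * (M * min k (N ^ m) + 2))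
  have hMk : M * min k (N ^ m) + 3 ≤ (M + 3) * x := by
    calc M * min k (N ^ m) + 3 ≤ M * x + 3 * x :=
          Nat.add_le_add (Nat.mul_le_mul_left _ (by omega)) (by omega)
      _ = (M + 3) * x := by ring
  have hcv := (hR V ids).built
  refine ⟨hN, le_rfl, le_rfl, le_rfl, le_rfl, le_rfl, le_rfl, le_rfl, le_rfl, le_rfl,
    ⟨hlog.le.trans' (Nat.le_add_right _ _), hlog.le.trans' (Nat.le_add_left _ _)⟩, le_rfl,
    ?_, ?_, ?_, ?_, ?_, fun y => (q.maskOf_le y).1, fun e he => ?_⟩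
  · refine le_two_pow_of_le (e := (m * d + 3) * (d + 2)) hx hw ?_
      (by unfold wordExponent; omega)
    rw [pow_mul]
    refine Nat.pow_le_pow_left ?_ _
    calc m * N * d + 2 = (m * d) * N + 2 := by ring
      _ ≤ (m * d) * x + 2 * x := Nat.add_le_add (Nat.mul_le_mul_left _ (by omega)) (by omega)
      _ = (m * d + 2) * x := by ring
      _ ≤ x ^ (m * d + 3) := mul_le_pow_succ hx2 _
  · refine le_two_pow_of_le (e := 2 * (M + 3) * (d + 2) + 1) hx hw ?_
      (by unfold wordExponent; omega)
    calc 2 * (M * min k (N ^ m) + 3) * (d + 2) ≤ 2 * ((M + 3) * x) * (d + 2) :=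
          Nat.mul_le_mul_right _ (Nat.mul_le_mul_left _ hMk)
      _ = 2 * (M + 3) * (d + 2) * x := by ring
      _ ≤ _ := mul_le_pow_succ hx2 _
  · refine le_two_pow_of_le (e := m + 2) hx hw ?_ (by unfold wordExponent; omega)
    exact (Nat.mul_le_mul_left (m + 1) (by omega : N + 1 ≤ x)).trans (mul_le_pow_succ hx2 _)
  · refine le_two_pow_of_le (e := (m + 1) * (d + 1) + 1) hx hw ?_ (by unfold wordExponent; omega)
    exact (Nat.le_mul_of_pos_right _ (by omega)).trans (mul_le_pow_succ hx2 _)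
  · refine le_two_pow_of_le (e := sched.length + 1) hx hw ?_ (by unfold wordExponent; omega)
    change sched.length + 1 ≤ _
    exact (Nat.lt_two_pow_self.le.trans (Nat.pow_le_pow_left hx2 _))
  · have := hcv.mem he
    simpa using this

/-! ### Logarithms -/

/-- This turns one factor `log N` into `2 log² N`. -/
theorem half_le_log {N : ℕ} (hN : 2 ≤ N) : 1 / 2 ≤ Real.log N := by
  have h1 : Real.log 2 ≤ Real.log N := Real.log_le_log (by norm_num) (by exact_mod_cast hN)
  have := Real.log_two_gt_d9
  linarith

/-- By the cap on `k`, the argument of the logarithm is at most `2 ^ s * N ^ (m + 1)`. The factor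
`2` in front compensates for the base of the logarithm, as `log 2 ≥ 1 / 2`. -/
theorem rounds_le (hN : 2 ≤ N) {K : ℕ} (hK : K ≤ M * N ^ m) :
    (rounds d m N K : ℝ) ≤ 2 * (2 * m * d + 2 * M + m + 8 : ℕ) * Real.log N := by
  set s := 2 * m * d + 2 * M + 6 with hs
  have hpow : 1 ≤ N ^ m := Nat.one_le_pow _ _ (by omega)
  have hX : 2 * (m * N * d + 1) + 2 * (K + 2) ≤ 2 ^ s * N ^ (m + 1) := by
    have h1 : N ≤ N ^ (m + 1) := Nat.le_self_pow (by omega) N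
    have h2 : N ^ m ≤ N ^ (m + 1) := Nat.pow_le_pow_right (by omega) (by omega)
    calc 2 * (m * N * d + 1) + 2 * (K + 2) = 2 * m * d * N + 2 * K + 6 * 1 := by ring
      _ ≤ 2 * m * d * N ^ (m + 1) + 2 * (M * N ^ (m + 1)) + 6 * N ^ (m + 1) := by
        refine Nat.add_le_add (Nat.add_le_add (Nat.mul_le_mul_left _ h1) (Nat.mul_le_mul_left _
          (hK.trans (Nat.mul_le_mul_left _ h2)))) (Nat.mul_le_mul_left _ (by omega))
      _ = s * N ^ (m + 1) := by rw [hs]; ring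
      _ ≤ _ := Nat.mul_le_mul_right _ Nat.lt_two_pow_self.le
  have hlog : (Nat.log 2 (2 * (m * N * d + 1) + 2 * (K + 2)) : ℝ) * Real.log 2 ≤
      s * Real.log 2 + (m + 1) * Real.log N := by
    have h1 : 2 ^ Nat.log 2 (2 * (m * N * d + 1) + 2 * (K + 2)) ≤ 2 ^ s * N ^ (m + 1) :=
      (Nat.pow_log_le_self 2 (by omega)).trans hX
    have h2 : (2 : ℝ) ^ Nat.log 2 (2 * (m * N * d + 1) + 2 * (K + 2)) ≤
        2 ^ s * (N : ℝ) ^ (m + 1) := by exact_mod_cast h1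
    have h3 := Real.log_le_log (by positivity) h2
    have hN0 : (N : ℝ) ≠ 0 := by positivity
    rw [Real.log_mul (by positivity) (by positivity), Real.log_pow, Real.log_pow, Real.log_pow] at h3
    exact_mod_cast h3
  have hl2 : Real.log 2 ≤ Real.log N := Real.log_le_log (by norm_num) (by exact_mod_cast hN)
  have hl := Real.log_two_gt_d9
  have hmain : (rounds d m N K : ℝ) * Real.log 2 ≤ (s + m + 2) * Real.log N := by
    unfold rounds
    push_cast
    have h1 : (s : ℝ) * Real.log 2 ≤ s * Real.log N := by gcongr
    nlinarith
  have h0 : (0 : ℝ) ≤ rounds d m N K := by positivity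
  have e : ((2 * m * d + 2 * M + m + 8 : ℕ) : ℝ) = s + m + 2 := by
    rw [hs]
    push_cast
    ring
  rw [e]
  nlinarith

end RealRAM

/-! ### The main theorem. -/

open RealRAM

theorem mainTheorem2 {d m : ℕ} (q : JoinQuery d m) (hq : q.Acyclic)
    (ε : ℝ) (hε0 : 0 < ε) (hε1 : ε < 1) :
    ∃ C : ℕ, ∀ (γ : ℝ) (T : ℕ → ℕ) (B : RealRAM.Prog),
      1 ≤ γ → Monotone T → IsKCenterAlg d γ T B →
      ∃ (A : RealRAM.Prog) (c : ℕ),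
        SolvesRelKCenter q A c ((1 + ε) * γ) ∧
        RunsInTimeWHP q A c (fun N k =>
          C * (k * N * Real.log N ^ 2 + k * Real.log N ^ 4 + T (C * k))) ∧
        ((∃ L : ℕ, ∀ n, 1 ≤ n → T (2 * n) ≤ L * T n) →
          ∃ K : ℕ, RunsInTimeWHP q A c (fun N k =>
            K * (k * N * Real.log N ^ 2 + k * Real.log N ^ 4 + T k))) := by
  obtain ⟨sched, hs⟩ := hq.scheduled
  have hm : 1 ≤ m := by
    obtain ⟨G, hG, -⟩ := hq
    obtain ⟨r⟩ := hG.connected.nonempty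
    have := r.2
    omega
  -- `b` bounds the lattice points per coordinate near a center, in `Part.key_le` with `η = ε / 2`;
  -- hence `M = b ^ d` cuts per center.
  obtain ⟨b, hb⟩ := exists_nat_ge (4 * d / (ε / 2) + 3)
  have hb1 : 1 ≤ b := by
    have : (0 : ℝ) ≤ 4 * d / (ε / 2) := by positivity
    have : (1 : ℝ) ≤ b := by linarith
    exact_mod_cast this
  set M := b ^ d with hMdef
  have hM : 1 ≤ M := Nat.one_le_pow _ _ hb1
  -- The input fills real arrays `1, …, m` and the join algorithm works in arrays below `100`; from
  -- `o` on the real arrays are free for `B`.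
  set o := m + 101 with ho
  obtain ⟨a, ha⟩ := overhead_le d m M q.maskOf sched o
  set F := 2 * m * d + 2 * M + m + 8 with hF
  -- The product pays for the overhead with `log N ≤ 2 log² N`; the summand `M + 1` bounds the
  -- number of witnesses by `C * k`.
  set C := a * M * (4 * F) + M + 1 with hC
  refine ⟨C, fun γ T B hγ hT ⟨cB, hB⟩ => ?_⟩
  have hruns : ∀ (N k w : ℕ) (D : Database q N), 1 ≤ N → 1 ≤ k →
      (N + k + 2) ^ wordExponent d m M sched.length cB ≤ 2 ^ w → Runs w
        (algorithm d m M q.maskOf sched o B) (D.input k)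
        (overhead d m M q.maskOf sched o (loopBound d m N (M * min k (N ^ m)) sched.length
          (rounds d m N (M * min k (N ^ m)))) + T (M * min k (N ^ m) + 1)) fun s =>
        ∃ S : Finset (EuclideanSpace ℝ (Fin d)), Outputs s S ∧
          (S : Set _) ⊆ D.results ∧ (S.card : ℕ∞) = min (k : ℕ∞) D.results.encard ∧
          centerCost (S : Set _) D.results ≤
            ENNReal.ofReal ((1 + ε) * γ) * optCenterCost k D.results := by
    intro N k w D hN hk hw
    have hx2 : 2 ≤ N + k + 2 := by omega
    refine algorithm_runs D (ctx_good (ctx_reducible hs) hN hw) (ctx_reducible hs) hm hk ?_ hM hT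
      hγ hε0 le_rfl hb (by omega) (by omega) fun n k' P hP hk' hk'n hn => hB n k' w P hP hk' hk'n ?_
    · refine lt_of_lt_of_le (Nat.pow_lt_pow_left (by omega : N < N + k + 2) (by omega))
        (le_two_pow_of_le (by omega) hw le_rfl ?_)
      unfold wordExponent
      omega
    · refine le_two_pow_of_le (e := (M + 4) * cB) (by omega) hw ?_ (by unfold wordExponent; omega)
      rw [pow_mul]
      refine Nat.pow_le_pow_left ?_ _
      have : M * min k (N ^ m) ≤ M * (N + k + 2) :=
        Nat.mul_le_mul_left _ ((min_le_left _ _).trans (by omega))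
      calc n + 2 ≤ M * (N + k + 2) + 3 * (N + k + 2) := by omega
        _ = (M + 3) * (N + k + 2) := by ring
        _ ≤ _ := mul_le_pow_succ hx2 _
  have hover : ∀ N k, 2 ≤ N → 1 ≤ k → ((overhead d m M q.maskOf sched o (loopBound d m N
      (M * min k (N ^ m)) sched.length (rounds d m N (M * min k (N ^ m)))) : ℕ) : ℝ) ≤
      C * (k * N * Real.log N ^ 2) := by
    intro N k hN hk
    have hkc : 1 ≤ min k (N ^ m) := le_min hk (Nat.one_le_pow _ _ (by omega))
    have h1 := ha N (M * min k (N ^ m)) (rounds d m N (M * min k (N ^ m))) (by omega)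
      (Nat.mul_pos hM hkc) (Nat.succ_pos _)
    have h2 := rounds_le (d := d) hN (Nat.mul_le_mul_left M (min_le_right k (N ^ m)))
    rw [← hF] at h2
    have h3 := half_le_log hN
    have h4 : ((M * min k (N ^ m) : ℕ) : ℝ) ≤ M * k := by
      exact_mod_cast Nat.mul_le_mul_left M (min_le_left k (N ^ m))
    have h5 : 2 * (F : ℝ) * Real.log N ≤ 4 * F * Real.log N ^ 2 := by
      have : (0 : ℝ) ≤ F * Real.log N := by positivity
      nlinarith
    calc _ ≤ ((a * (N * (M * min k (N ^ m)) * rounds d m N (M * min k (N ^ m))) : ℕ) : ℝ) := by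
          exact_mod_cast h1
      _ = a * (N * ((M * min k (N ^ m) : ℕ) : ℝ) * (rounds d m N (M * min k (N ^ m)) : ℕ)) := by
          push_cast
          ring
      _ ≤ a * (N * (M * k) * (4 * F * Real.log N ^ 2)) := by
          gcongr
          exact h2.trans h5
      _ = ((a * M * (4 * F) : ℕ) : ℝ) * (k * N * Real.log N ^ 2) := by
          push_cast
          ring
      _ ≤ _ := by
          gcongr
          omega
  have htime : ∀ f : ℕ → ℕ → ℝ, (∀ N k : ℕ, 2 ≤ N → 1 ≤ k →
      C * (k * N * Real.log N ^ 2 + k * Real.log N ^ 4 + T (C * k)) ≤ f N k) →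
      RunsInTimeWHP q (algorithm d m M q.maskOf sched o B)
        (wordExponent d m M sched.length cB) f := by
    intro f hf N k w D hN hk hw
    rcases Nat.lt_or_ge N 2 with h | h
    -- For `N = 1` the required probability is `0`.
    · obtain rfl : N = 1 := by omega
      simp
    · refine ((Ends.haltsWithin (hruns N k w D hN hk hw) (Nat.le_floor ?_)).haltProb_eq_one).ge.trans'
        ?_
      · refine le_trans ?_ (hf N k h hk)
        have hTC : (T (M * min k (N ^ m) + 1) : ℝ) ≤ C * T (C * k) := by
          have h1 : T (M * min k (N ^ m) + 1) ≤ T (C * k) := by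
            refine hT ?_
            calc M * min k (N ^ m) + 1 ≤ M * k + k :=
                  Nat.add_le_add (Nat.mul_le_mul_left _ (min_le_left _ _)) hk
              _ = (M + 1) * k := by ring
              _ ≤ C * k := Nat.mul_le_mul_right _ (by omega)
          exact_mod_cast h1.trans (Nat.le_mul_of_pos_left _ (by omega))
        have h2 := hover N k h hk
        have h3 : (0 : ℝ) ≤ C * (k * Real.log N ^ 4) := by positivity
        push_cast
        linarith
      · rw [← ENNReal.ofReal_one]
        refine ENNReal.ofReal_le_ofReal ?_
        have : (0 : ℝ) ≤ 1 / N := by positivity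
        linarith
  refine ⟨_, _, fun N k w D hN hk hw => ⟨⟨_, (hruns N k w D hN hk hw).haltsWithin le_rfl⟩,
    (hruns N k w D hN hk hw).yields⟩, htime _ fun N k _ _ => le_rfl, ?_⟩
  rintro ⟨L, hL⟩
  refine ⟨C * (L ^ C + 1), htime _ fun N k hN hk => ?_⟩
  -- The doubling hypothesis is used `C` times, since `C ≤ 2 ^ C`.
  have hTL : ∀ i, T (2 ^ i * k) ≤ L ^ i * T k := by
    intro i
    induction i with
    | zero => simp
    | succ i ih =>
      calc T (2 ^ (i + 1) * k) = T (2 * (2 ^ i * k)) := by congr 1; ring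
        _ ≤ L * T (2 ^ i * k) := hL _ (Nat.mul_pos (Nat.two_pow_pos i) hk)
        _ ≤ L * (L ^ i * T k) := Nat.mul_le_mul_left _ ih
        _ = L ^ (i + 1) * T k := by ring
  have h1 : (T (C * k) : ℝ) ≤ L ^ C * T k := by
    exact_mod_cast (hT (Nat.mul_le_mul_right k Nat.lt_two_pow_self.le)).trans (hTL C)
  have h2 : (0 : ℝ) ≤ k * N * Real.log N ^ 2 + k * Real.log N ^ 4 := by positivity
  have h3 : (0 : ℝ) ≤ (L : ℝ) ^ C * (k * N * Real.log N ^ 2 + k * Real.log N ^ 4) := by positivity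
  have h4 : (0 : ℝ) ≤ T k := by positivity
  push_cast
  rw [mul_assoc (C : ℝ)]
  refine mul_le_mul_of_nonneg_left ?_ (Nat.cast_nonneg C)
  linarith
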